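/- Let $H$ and $\mathscr Y$ be (real or complex) Hilbert spaces, let $(\Omega,\mathcal F,\mathbb P)$ be a probability space with a filtration $\mathbb F=(\mathcal F_t)_{t\ge 0}$, and let $W$ be a standard one-dimensional Brownian motion relative to $\mathbb F$: it is $\mathbb F$-adapted and $W(t)-W(s)$ is independent of $\mathcal F_s$ for $s\le t$ (for instance, $\mathbb F$ is the filtration generated by $W$). Let $A:D(A)\subset H\to H$ be the generator of a $C_0$-semigroup $(T(t))_{t\ge 0}$ on $H$, let $C\in\mathcal L(D(A),\mathscr Y)$ (with $D(A)$ carrying the graph norm), and assume that $C$ is an admissible observation operator for $A$: for some $\alpha_0>0$ there is $\gamma>0$ with $\int_0^{\alpha_0}\|CT(t)x\|^2\,dt\le\gamma^2\|x\|^2$ for all $x\in D(A)$. Let $C_\Lambda$ be the Yosida extension of $C$ for $A$, that is, $$D(C_\Lambda)=\Big\{x\in H:\ \lim_{\lambda\to+\infty}C\lambda R(\lambda,A)x\ \text{exists in}\ \mathscr Y\Big\},\qquad C_\Lambda x=\lim_{\lambda\to+\infty}C\lambda R(\lambda,A)x ,$$ where $R(\lambda,A)=(\lambda-A)^{-1}$.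 Let $G,F:H\to H$ satisfy $\|G(x)-G(y)\|+\|F(x)-F(y)\|\le L\|x-y\|$ for all $x,y\in H$, with a constant $L$. Write $L^2_{\mathcal F_0}(\Omega,H)$ for the space of $\mathcal F_0$-measurable square integrable $H$-valued random variables. For $\xi\in L^2_{\mathcal F_0}(\Omega,H)$, a mild solution $X(\cdot,\xi)$ of the semilinear stochastic system $$dX(t)=(AX(t)+G(X(t)))\,dt+F(X(t))\,dW(t),\quad X(0)=\xi,\qquad Y(t)=CX(t)$$ is a (progressively measurable) $\mathbb F$-adapted $H$-valued process with $\mathbb E\|X(t)\|^2<\infty$ for all $t\ge0$ and $t\mapsto(\mathbb E\|X(t)\|^2)^{1/2}$ continuous, such that for every $t\ge 0$, $\mathbb P$-a.s., $$X(t)=T(t)\xi+\int_0^tT(t-s)G(X(s))\,ds+\int_0^tT(t-s)F(X(s))\,dW(s).$$ For every $\xi\in L^2_{\mathcal F_0}(\Omega,H)$ such a mild solution exists, and it is unique up to modification. Moreover: (i) for every $\xi\in L^2_{\mathcal F_0}(\Omega,H)$, the mild solution satisfies $X(t,\xi)\in D(C_\Lambda)$ for a.e. $t>0$, $\mathbb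 P$-a.s.; (ii) for every $\alpha>0$ there is a constant $\delta=\delta(\alpha)>0$ such that for all $\xi_1,\xi_2\in L^2_{\mathcal F_0}(\Omega,H)$ the process $C_\Lambda X(\cdot,\xi_1)-C_\Lambda X(\cdot,\xi_2)$ (set equal to $0$ in place of $C_\Lambda X(t,\xi_i)$ on the null set where $X(t,\xi_i)\notin D(C_\Lambda)$) is in $L^2_{\mathbb F}(0,\alpha;\mathscr Y)$, i.e. it is progressively measurable and square integrable on $[0,\alpha]\times\Omega$, and $$\Big(\int_0^\alpha\mathbb E\|C_\Lambda X(t,\xi_1)-C_\Lambda X(t,\xi_2)\|_{\mathscr Y}^2\,dt\Big)^{1/2}\le\delta\,\big(\mathbb E\|\xi_1-\xi_2\|_H^2\big)^{1/2}.$$ In particular, the system is well-posed: there is a linear extension $\tilde C:D(\tilde C)\subset H\to\mathscr Y$ of $C$ such that $X(t,\xi)\in D(\tilde C)$ for a.e. $t>0$, $\mathbb P$-a.s., for all $\xi\in L^2_{\mathcal F_0}(\Omega,H)$, and for every $\alpha>0$ there is a constant $c=c_\alpha$ such that $\tilde C(X(\cdot,\xi_1)-X(\cdot,\xi_2))\in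 L^2_{\mathbb F}(0,\alpha;\mathscr Y)$ and $\mathbb E\int_0^\alpha\|\tilde C(X(t,\xi_1)-X(t,\xi_2))\|_{\mathscr Y}^2\,dt\le c^2\,\mathbb E\|\xi_1-\xi_2\|_H^2$ for all $\xi_1,\xi_2\in L^2_{\mathcal F_0}(\Omega,H)$. -/

import Mathlib

open MeasureTheory ProbabilityTheory Filter Topology
open scoped NNReal ENNReal

namespace StochSys

/-! ### Time: Lebesgue measure on `[0, ∞)` -/

/-- Lebesgue measure on the time axis `[0, ∞)`. -/
noncomputable def timeMeasure : Measure ℝ≥0 :=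
  Measure.comap ((↑) : ℝ≥0 → ℝ) volume

theorem measurableEmbedding_coe : MeasurableEmbedding ((↑) : ℝ≥0 → ℝ) :=
  MeasurableEmbedding.subtype_coe measurableSet_Ici

theorem timeMeasure_Icc (a b : ℝ≥0) :
    timeMeasure (Set.Icc a b) = ENNReal.ofReal ((b : ℝ) - a) := by
  have h : ((↑) : ℝ≥0 → ℝ) '' Set.Icc a b = Set.Icc (a : ℝ) b := by
    ext x
    constructor
    · rintro ⟨y, hy, rfl⟩
      exact ⟨NNReal.coe_le_coe.2 hy.1, NNReal.coe_le_coe.2 hy.2⟩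
    · intro hx
      exact ⟨⟨x, a.2.trans hx.1⟩, ⟨hx.1, hx.2⟩, rfl⟩
  rw [timeMeasure, measurableEmbedding_coe.comap_apply, h, Real.volume_Icc]

instance : SigmaFinite timeMeasure where
  out' := ⟨{
    set := fun n => Set.Icc 0 (n : ℝ≥0)
    set_mem := fun _ => trivial
    finite := fun n => by rw [timeMeasure_Icc]; exact ENNReal.ofReal_lt_top
    spanning := Set.eq_univ_of_forall fun x => by
      obtain ⟨n, hn⟩ := exists_nat_ge x
      exact Set.mem_iUnion.2 ⟨n, zero_le, hn⟩ }⟩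

section Deterministic

variable {𝕜 : Type*} [RCLike 𝕜]
variable {H : Type*} [NormedAddCommGroup H] [NormedSpace 𝕜 H]
variable {Y : Type*} [NormedAddCommGroup Y] [NormedSpace 𝕜 Y]

/-! ### Semigroups, generators, resolvents -/

/-- `T` is a `C₀`-semigroup of bounded operators on `H`. -/
structure IsC0Semigroup (T : ℝ≥0 → H →L[𝕜] H) : Prop where
  map_zero : T 0 = ContinuousLinearMap.id 𝕜 H
  map_add : ∀ s t, T (s + t) = (T s).comp (T t)
  tendsto_zero : ∀ x, Tendsto (fun t => T t x) (𝓝 0) (𝓝 x)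

/-- `A` is the (infinitesimal) generator of `T`: `x ∈ D(A)` with `A x = y` if and only if
`(T(t) x - x) / t → y` as `t → 0+`. -/
def IsGenerator (T : ℝ≥0 → H →L[𝕜] H) (A : H →ₗ.[𝕜] H) : Prop :=
  ∀ x y : H, (x, y) ∈ A.graph ↔
    Tendsto (fun t : ℝ≥0 => ((t : ℝ) : 𝕜)⁻¹ • (T t x - x)) (𝓝[>] 0) (𝓝 y)

/-- `C : D(A) → Y` is bounded for the graph norm of `A`, that is, `C ∈ L(D(A), Y)`. -/
def IsGraphBounded (A : H →ₗ.[𝕜] H) (C : A.domain →ₗ[𝕜] Y) : Prop :=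
  ∃ K : ℝ, ∀ x : A.domain, ‖C x‖ ≤ K * (‖(x : H)‖ + ‖A x‖)

open scoped Classical in
/-- The resolvent `R(μ, A) = (μ - A)⁻¹ : H → D(A)`. It is the genuine inverse whenever `μ - A` is
bijective from `D(A)` onto `H`, which for a closed operator (in particular a generator) means
exactly `μ ∈ ρ(A)`. The value `0` is a placeholder for the other `μ`; a generator has none of these
among the large real numbers. -/
noncomputable def resolventMap (A : H →ₗ.[𝕜] H) (μ : 𝕜) : H →ₗ[𝕜] A.domain :=
  if h : Function.Bijective (μ • A.domain.subtype - A.toFun) then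
    ((LinearEquiv.ofBijective _ h).symm : H →ₗ[𝕜] A.domain)
  else 0

/-! ### The Yosida extension -/

/-- The approximations `C λ R(λ, A) x`, for real `λ`, that define the Yosida extension. -/
noncomputable def yosidaApprox (A : H →ₗ.[𝕜] H) (C : A.domain →ₗ[𝕜] Y) (r : ℝ) (x : H) : Y :=
  C ((r : 𝕜) • resolventMap A (r : 𝕜) x)

theorem yosidaApprox_add {A : H →ₗ.[𝕜] H} {C : A.domain →ₗ[𝕜] Y} {x x' : H} {y y' : Y}
    (h : Tendsto (fun r : ℝ => yosidaApprox A C r x) atTop (𝓝 y))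
    (h' : Tendsto (fun r : ℝ => yosidaApprox A C r x') atTop (𝓝 y')) :
    Tendsto (fun r : ℝ => yosidaApprox A C r (x + x')) atTop (𝓝 (y + y')) := by
  refine (h.add h').congr fun r => ?_
  simp only [yosidaApprox, map_add, smul_add]

theorem yosidaApprox_smul {A : H →ₗ.[𝕜] H} {C : A.domain →ₗ[𝕜] Y} {x : H} {y : Y} (c : 𝕜)
    (h : Tendsto (fun r : ℝ => yosidaApprox A C r x) atTop (𝓝 y)) :
    Tendsto (fun r : ℝ => yosidaApprox A C r (c • x)) atTop (𝓝 (c • y)) := by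
  refine (h.const_smul c).congr fun r => ?_
  simp only [yosidaApprox, map_smul]
  rw [smul_comm]

/-- The Yosida extension `C_Λ` of `C` for `A`: its domain is the set of `x ∈ H` for which
`lim_{λ → +∞} C λ R(λ, A) x` exists in `Y`, and `C_Λ x` is this limit. -/
noncomputable def yosidaExtension (A : H →ₗ.[𝕜] H) (C : A.domain →ₗ[𝕜] Y) : H →ₗ.[𝕜] Y where
  domain :=
    { carrier := {x | ∃ y, Tendsto (fun r : ℝ => yosidaApprox A C r x) atTop (𝓝 y)}
      add_mem' := fun ⟨_, h⟩ ⟨_, h'⟩ => ⟨_, yosidaApprox_add h h'⟩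
      zero_mem' := ⟨0, by simp [yosidaApprox]⟩
      smul_mem' := fun c _ ⟨_, h⟩ => ⟨_, yosidaApprox_smul c h⟩ }
  toFun :=
    { toFun := fun x => x.2.choose
      map_add' := fun x x' => tendsto_nhds_unique (x + x').2.choose_spec
        (yosidaApprox_add x.2.choose_spec x'.2.choose_spec)
      map_smul' := fun c x => tendsto_nhds_unique (c • x).2.choose_spec
        (yosidaApprox_smul c x.2.choose_spec) }

open scoped Classical in
/-- The value `M x` of an unbounded operator `M`, with the placeholder `0` for `x ∉ D(M)`. -/
noncomputable def valueAt (M : H →ₗ.[𝕜] Y) (x : H) : Y :=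
  if h : x ∈ M.domain then M ⟨x, h⟩ else 0

/-- `C` is an admissible observation operator for the generator `A` of `T`: for some `α > 0` there
is `γ > 0` with `∫₀^α ‖C T(t) x‖² dt ≤ γ² ‖x‖²` for all `x ∈ D(A)`. -/
def IsAdmissible (T : ℝ≥0 → H →L[𝕜] H) (A : H →ₗ.[𝕜] H) (C : A.domain →ₗ[𝕜] Y) : Prop :=
  ∃ α : ℝ≥0, 0 < α ∧ ∃ γ : ℝ≥0, 0 < γ ∧ ∀ x ∈ A.domain,
    ∫⁻ t in Set.Icc 0 α, ‖valueAt (LinearPMap.mk A.domain C) (T t x)‖ₑ ^ 2 ∂timeMeasure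
      ≤ (γ : ℝ≥0∞) ^ 2 * ‖x‖ₑ ^ 2

end Deterministic

/-! ### Stochastic processes and the Itô integral -/

section Stochastic

variable {Ω : Type*} {mΩ : MeasurableSpace Ω}

/-- `W` is a standard one-dimensional Brownian motion relative to the filtration `𝓕`. (This holds
for the filtration generated by `W`, and for its augmentation.) -/
structure IsFBrownianMotion (𝓕 : Filtration ℝ≥0 mΩ) (P : Measure Ω) (W : ℝ≥0 → Ω → ℝ) : Prop where
  isBrownian : IsBrownianReal W P
  adapted : StronglyAdapted 𝓕 W
  indep : ∀ s t : ℝ≥0, s ≤ t →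
    Indep (MeasurableSpace.comap (fun ω => W t ω - W s ω) inferInstance) (𝓕 s) P

variable {E : Type*} [NormedAddCommGroup E]

/-- `ξ ∈ L²_{𝓕₀}(Ω, E)`. -/
def MemL2Init (𝓕 : Filtration ℝ≥0 mΩ) (P : Measure Ω) (ξ : Ω → E) : Prop :=
  StronglyMeasurable[𝓕 0] ξ ∧ MemLp ξ 2 P

/-- The measure `dt ⊗ P` on `[0, α] × Ω`. The `L²` norm of a (jointly measurable) process `ζ` for
this measure is `(∫₀^α 𝔼 ‖ζ(t)‖² dt)^{1/2}`. -/
noncomputable def timeProd (P : Measure Ω) (α : ℝ≥0) : Measure (ℝ≥0 × Ω) :=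
  (timeMeasure.restrict (Set.Icc 0 α)).prod P

/-- `ζ ∈ L²_𝓕(0, α; E)`: the process is adapted (in the progressive sense, so that it is also
jointly measurable) and `∫₀^α 𝔼 ‖ζ(t)‖² dt < ∞`. -/
def MemL2F (𝓕 : Filtration ℝ≥0 mΩ) (P : Measure Ω) (α : ℝ≥0) (ζ : ℝ≥0 → Ω → E) : Prop :=
  IsStronglyProgressive 𝓕 ζ ∧ MemLp (fun p : ℝ≥0 × Ω => ζ p.1 p.2) 2 (timeProd P α)

/-- The norm `‖ζ‖ = (∫₀^α 𝔼 ‖ζ(t)‖² dt)^{1/2}` of `L²_𝓕(0, α; E)`. -/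
noncomputable def normL2F (P : Measure Ω) (α : ℝ≥0) (ζ : ℝ≥0 → Ω → E) : ℝ≥0∞ :=
  eLpNorm (fun p : ℝ≥0 × Ω => ζ p.1 p.2) 2 (timeProd P α)

/-- `ζ ∈ 𝒞_𝓕(0, ∞; L²(Ω, E))`: the process is adapted (in the progressive sense), square
integrable at each time, and `t ↦ (𝔼 ‖ζ(t)‖²)^{1/2}` is continuous. -/
structure MemCF (𝓕 : Filtration ℝ≥0 mΩ) (P : Measure Ω) (ζ : ℝ≥0 → Ω → E) : Prop where
  progressive : IsStronglyProgressive 𝓕 ζ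
  memLp : ∀ t, MemLp (ζ t) 2 P
  continuous_norm : Continuous fun t => eLpNorm (ζ t) 2 P

/-- A simple process `∑ᵢ 1_{(aᵢ, bᵢ]} ηᵢ` with `ηᵢ` square integrable and `𝓕_{aᵢ}`-measurable. -/
structure SimpleProcess (𝓕 : Filtration ℝ≥0 mΩ) (P : Measure Ω) (E : Type*)
    [NormedAddCommGroup E] where
  n : ℕ
  a : Fin n → ℝ≥0
  b : Fin n → ℝ≥0
  η : Fin n → Ω → E
  a_le_b : ∀ i, a i ≤ b i
  measurable : ∀ i, StronglyMeasurable[𝓕 (a i)] (η i)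
  memLp : ∀ i, MemLp (η i) 2 P

/-- The value at time `s` of a simple process. -/
noncomputable def SimpleProcess.value {𝓕 : Filtration ℝ≥0 mΩ} {P : Measure Ω}
    (φ : SimpleProcess 𝓕 P E) (s : ℝ≥0) (ω : Ω) : E :=
  ∑ i, (Set.Ioc (φ.a i) (φ.b i)).indicator (fun _ => φ.η i ω) s

variable [NormedSpace ℝ E]

/-- The Itô integral `∫₀^t φ dW = ∑ᵢ (W(bᵢ ∧ t) - W(aᵢ ∧ t)) ηᵢ` of a simple process. -/
noncomputable def SimpleProcess.integral {𝓕 : Filtration ℝ≥0 mΩ} {P : Measure Ω}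
    (φ : SimpleProcess 𝓕 P E) (W : ℝ≥0 → Ω → ℝ) (t : ℝ≥0) (ω : Ω) : E :=
  ∑ i, (W (min (φ.b i) t) ω - W (min (φ.a i) t) ω) • φ.η i ω

/-- `I` is (a version of) the Itô integral `∫₀^t ζ(s) dW(s)`: the process `ζ` is square integrable
on `[0, t] × Ω`, and there are simple processes that converge to `ζ` in `L²([0, t] × Ω)` and whose
Itô integrals converge to `I` in `L²(Ω)`. By Itô's isometry `I` is unique up to equality
almost surely, and does not depend on the approximation. -/
def IsItoIntegral (𝓕 : Filtration ℝ≥0 mΩ) (P : Measure Ω) (W : ℝ≥0 → Ω → ℝ) (t : ℝ≥0)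
    (ζ : ℝ≥0 → Ω → E) (I : Ω → E) : Prop :=
  MemLp (fun p : ℝ≥0 × Ω => ζ p.1 p.2) 2 (timeProd P t) ∧ MemLp I 2 P ∧
  ∃ φ : ℕ → SimpleProcess 𝓕 P E,
    Tendsto (fun k => normL2F P t (fun s ω => (φ k).value s ω - ζ s ω)) atTop (𝓝 0) ∧
    Tendsto (fun k => eLpNorm (fun ω => (φ k).integral W t ω - I ω) 2 P) atTop (𝓝 0)

end Stochastic

/-! ### The semilinear system -/

section System

variable {Ω : Type*} {mΩ : MeasurableSpace Ω}
variable {𝕜 : Type*} [RCLike 𝕜]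
variable {H : Type*} [NormedAddCommGroup H] [NormedSpace 𝕜 H] [NormedSpace ℝ H]
variable {Y : Type*} [NormedAddCommGroup Y] [NormedSpace 𝕜 Y]

/-- `X` is a mild solution of `dX = (A X + G(X)) dt + F(X) dW`, `X(0) = ξ`, where `A` generates
`T`: `X ∈ 𝒞_𝓕(0, ∞; L²(Ω, H))` and, for each `t ≥ 0`, almost surely
`X(t) = T(t) ξ + ∫₀^t T(t - s) G(X(s)) ds + ∫₀^t T(t - s) F(X(s)) dW(s)`. -/
structure IsMildSolution (𝓕 : Filtration ℝ≥0 mΩ) (P : Measure Ω) (W : ℝ≥0 → Ω → ℝ)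
    (T : ℝ≥0 → H →L[𝕜] H) (G F : H → H) (ξ : Ω → H) (X : ℝ≥0 → Ω → H) : Prop where
  memCF : MemCF 𝓕 P X
  eq : ∀ t : ℝ≥0, ∃ I : Ω → H,
    IsItoIntegral 𝓕 P W t (fun s ω => T (t - s) (F (X s ω))) I ∧
    ∀ᵐ ω ∂P, X t ω =
      T t (ξ ω) + (∫ s in Set.Icc 0 t, T (t - s) (G (X s ω)) ∂timeMeasure) + I ω

/-- The semilinear system `dX = (A X + G(X)) dt + F(X) dW`, `Y = C X` is well-posed: there is an
extension `C'` of `C` such that mild solutions with initial value in `L²_{𝓕₀}(Ω, H)` are in `D(C')`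
for a.e. `t > 0`, almost surely, and such that for each `α > 0` there is a constant `c` with
`𝔼 ∫₀^α ‖C' (X(t; ξ₁) - X(t; ξ₂))‖² dt ≤ c² 𝔼 ‖ξ₁ - ξ₂‖²` for all `ξ₁, ξ₂ ∈ L²_{𝓕₀}(Ω, H)`. -/
def IsWellPosed (𝓕 : Filtration ℝ≥0 mΩ) (P : Measure Ω) (W : ℝ≥0 → Ω → ℝ)
    (T : ℝ≥0 → H →L[𝕜] H) (A : H →ₗ.[𝕜] H) (C : A.domain →ₗ[𝕜] Y) (G F : H → H) : Prop :=
  ∃ C' : H →ₗ.[𝕜] Y, LinearPMap.mk A.domain C ≤ C' ∧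
    (∀ ξ : Ω → H, MemL2Init 𝓕 P ξ → ∀ X, IsMildSolution 𝓕 P W T G F ξ X →
      ∀ᵐ t ∂timeMeasure, ∀ᵐ ω ∂P, X t ω ∈ C'.domain) ∧
    ∀ α : ℝ≥0, 0 < α → ∃ c : ℝ≥0, 0 < c ∧
      ∀ ξ₁ ξ₂ : Ω → H, MemL2Init 𝓕 P ξ₁ → MemL2Init 𝓕 P ξ₂ →
      ∀ X₁ X₂, IsMildSolution 𝓕 P W T G F ξ₁ X₁ → IsMildSolution 𝓕 P W T G F ξ₂ X₂ →
        MemL2F 𝓕 P α (fun t ω => valueAt C' (X₁ t ω - X₂ t ω)) ∧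
        normL2F P α (fun t ω => valueAt C' (X₁ t ω - X₂ t ω)) ^ 2
          ≤ (c : ℝ≥0∞) ^ 2 * eLpNorm (fun ω => ξ₁ ω - ξ₂ ω) 2 P ^ 2

end System

end StochSys

set_option linter.unusedSectionVars false

namespace StochSys

/-! ### Increments of Brownian motion -/

section Increments

variable {Ω : Type*} {mΩ : MeasurableSpace Ω} {P : Measure Ω} [IsProbabilityMeasure P]
  {𝓕 : Filtration ℝ≥0 mΩ} {W : ℝ≥0 → Ω → ℝ}
  {H : Type*} [NormedAddCommGroup H] [InnerProductSpace ℝ H]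

namespace IsFBrownianMotion

/-! Existence, uniqueness and mean square Lipschitz dependence of mild solutions come from Picard
iteration and a Gronwall estimate in `Lp H 2 P`, both resting on Itô's isometry. The real difficulty
is the output. `C` is unbounded and `X(t)` need not lie in `D(A)`, so the limit of `C r R(r, A)
X(t)` as `r → ∞` has to be produced at almost every time, path by path, and not merely along a
subsequence.

The stochastic integral on `[0, t]` is treated as a closed linear relation `itoGraph` between
integrands, seen as curves in `L²(Ω, H)`, and their integrals. It is isometric
(`norm_eq_of_mem_itoGraph`), compatible with bounded operators (`map_mem_itoGraph`) and, being
closed and linear, stable under Bochner averages. These three facts also do the work of a stochastic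
Fubini theorem.

The bounded operators `K n = C r R(r, A)` with `r = l + n` approximate `C`. Admissibility bounds `K
n - K m` along free orbits by `J n - J m`, where `J n = r R(r, A) → 1` strongly. Itô's isometry and
Tonelli's theorem carry this over to `X` (`IsLinearMild.lintegral_observe_sq_le`), so `K n X` is
Cauchy in `L²([0, u] × Ω)`. Its limit `y` is the candidate for the output.

To identify `y(t)` with a limit at time `t`, compare `X(t + τ)` with the free evolution `T(τ) X(t)`:
only drift and noise after `t` remain. Average the observation of this difference over `τ ∈ [0, h]`,
take mean squares, integrate over `t`, weight by `h⁻³` and integrate over `h ∈ [0, 1]`. Integration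
over `t` gains a factor `h`, Hardy's inequality absorbs the remaining `h⁻²`, and admissibility gives
a bound independent of `n` (`IsLinearMild.lintegral_average_increment_le`). By Fatou's lemma, for
almost every path and almost every `t`, the integral over `h` of `h⁻³ ‖∫₀^h y(t + τ) dτ - Ψ h
X(t)‖²` is finite. Here `Ψ h x` extends `∫₀^h C T(τ) x dτ` to all `x ∈ H`.

By Lebesgue's differentiation theorem `h ↦ ∫₀^h y(t + τ) dτ` is differentiable at `0` for almost
every `t`, so its averages against the kernel `r² e^{-rh}` converge. The finite square function and
the Cauchy–Schwarz inequality show that the averages of `Ψ h X(t)` have the same limit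
(`tendsto_laplace`). Up to exponentially small terms the latter are `C r R(r, A) X(t)`
(`IsResolventFamily.tendsto_observer_sub`). Hence `X(t) ∈ D(C_Λ)`.

The Lipschitz estimate for the output is the estimate for `K n`, uniform in `n`, followed by Fatou's
lemma. Well-posedness holds with the Yosida extension itself as the extension of `C`. -/

theorem hasLaw_sub (hW : IsFBrownianMotion 𝓕 P W) {s t : ℝ≥0} (hst : s ≤ t) :
    HasLaw (fun ω => W t ω - W s ω) (gaussianReal 0 (t - s)) P := by
  have h := hW.isBrownian.toIsPreBrownianReal.hasLaw_sub t s
  have e : nndist (t : ℝ) s = t - s := by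
    apply NNReal.coe_injective
    rw [coe_nndist, Real.dist_eq, NNReal.coe_sub hst, abs_of_nonneg]
    exact sub_nonneg.2 (NNReal.coe_le_coe.2 hst)
  exact e ▸ h

theorem memLp_sub (hW : IsFBrownianMotion 𝓕 P W) {s t : ℝ≥0} (hst : s ≤ t) :
    MemLp (fun ω => W t ω - W s ω) 2 P := by
  have h := hW.hasLaw_sub hst
  have h2 : MemLp id 2 (gaussianReal 0 (t - s)) := memLp_id_gaussianReal' 2 (by simp)
  rw [← h.map_eq] at h2
  exact h2.comp_of_map h.aemeasurable

theorem integral_sub (hW : IsFBrownianMotion 𝓕 P W) {s t : ℝ≥0} (hst : s ≤ t) :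
    ∫ ω, (W t ω - W s ω) ∂P = 0 := by
  rw [(hW.hasLaw_sub hst).integral_eq, integral_id_gaussianReal]

theorem integral_sub_sq (hW : IsFBrownianMotion 𝓕 P W) {s t : ℝ≥0} (hst : s ≤ t) :
    ∫ ω, (W t ω - W s ω) ^ 2 ∂P = t - s := by
  have h := (hW.hasLaw_sub hst).variance_eq
  rw [variance_id_gaussianReal, variance_of_integral_eq_zero
    (hW.hasLaw_sub hst).aemeasurable (hW.integral_sub hst), NNReal.coe_sub hst] at h
  exact h

theorem stronglyMeasurable_sub (hW : IsFBrownianMotion 𝓕 P W) {s t u : ℝ≥0} (hs : s ≤ u)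
    (ht : t ≤ u) : StronglyMeasurable[𝓕 u] (fun ω => W t ω - W s ω) :=
  ((hW.adapted t).mono (𝓕.mono ht)).sub ((hW.adapted s).mono (𝓕.mono hs))

theorem indepFun_sub (hW : IsFBrownianMotion 𝓕 P W) {s t : ℝ≥0} (hst : s ≤ t) {q : Ω → ℝ}
    (hq : StronglyMeasurable[𝓕 s] q) : IndepFun (fun ω => W t ω - W s ω) q P :=
  indep_of_indep_of_le_right (hW.indep s t hst) hq.measurable.comap_le

theorem integral_sub_mul (hW : IsFBrownianMotion 𝓕 P W) {s t : ℝ≥0} (hst : s ≤ t) {q : Ω → ℝ}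
    (hq : StronglyMeasurable[𝓕 s] q) : ∫ ω, (W t ω - W s ω) * q ω ∂P = 0 := by
  rw [(hW.indepFun_sub hst hq).integral_fun_mul_eq_mul_integral
    (hW.memLp_sub hst).aestronglyMeasurable (hq.mono (𝓕.le s)).aestronglyMeasurable,
    hW.integral_sub hst, zero_mul]

theorem integral_sub_sq_mul (hW : IsFBrownianMotion 𝓕 P W) {s t : ℝ≥0} (hst : s ≤ t) {q : Ω → ℝ}
    (hq : StronglyMeasurable[𝓕 s] q) :
    ∫ ω, (W t ω - W s ω) ^ 2 * q ω ∂P = (t - s) * ∫ ω, q ω ∂P := by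
  have hi : IndepFun (fun ω => (W t ω - W s ω) ^ 2) q P :=
    (hW.indepFun_sub hst hq).comp (φ := fun x : ℝ => x ^ 2) (ψ := id) (by fun_prop) measurable_id
  rw [hi.integral_fun_mul_eq_mul_integral
    ((hW.memLp_sub hst).aestronglyMeasurable.pow 2) (hq.mono (𝓕.le s)).aestronglyMeasurable,
    hW.integral_sub_sq hst]

/-- A product of two square integrable factors need not be square integrable. Here independence
helps: the squares of the increment and of `‖η‖` are independent and integrable, hence so is their
product. -/
theorem memLp_sub_smul (hW : IsFBrownianMotion 𝓕 P W) {s t : ℝ≥0} (hst : s ≤ t) {η : Ω → H}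
    (hη : StronglyMeasurable[𝓕 s] η) (hη2 : MemLp η 2 P) :
    MemLp (fun ω => (W t ω - W s ω) • η ω) 2 P := by
  have hm : AEStronglyMeasurable (fun ω => (W t ω - W s ω) • η ω) P :=
    (hW.memLp_sub hst).aestronglyMeasurable.smul hη2.aestronglyMeasurable
  rw [memLp_two_iff_integrable_sq_norm hm]
  have hi : IndepFun (fun ω => (W t ω - W s ω) ^ 2) (fun ω => ‖η ω‖ ^ 2) P :=
    (hW.indepFun_sub hst hη.norm).comp (φ := fun x : ℝ => x ^ 2) (ψ := fun x : ℝ => x ^ 2)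
      (by fun_prop) (by fun_prop)
  have := hi.integrable_mul (hW.memLp_sub hst).integrable_sq
    ((memLp_two_iff_integrable_sq_norm hη2.aestronglyMeasurable).1 hη2)
  refine this.congr (ae_of_all _ fun ω => ?_)
  simp [norm_smul, mul_pow]

theorem stronglyMeasurable_sub_smul (hW : IsFBrownianMotion 𝓕 P W) {s t : ℝ≥0} (hst : s ≤ t)
    {η : Ω → H} (hη : StronglyMeasurable[𝓕 s] η) :
    StronglyMeasurable[𝓕 t] (fun ω => (W t ω - W s ω) • η ω) :=
  (hW.stronglyMeasurable_sub hst le_rfl).smul (hη.mono (𝓕.mono hst))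

theorem integral_inner_of_measurable_left (hW : IsFBrownianMotion 𝓕 P W) {s t : ℝ≥0}
    (hst : s ≤ t) {ζ η : Ω → H} (hζ : StronglyMeasurable[𝓕 s] ζ)
    (hη : StronglyMeasurable[𝓕 s] η) :
    ∫ ω, inner ℝ (ζ ω) ((W t ω - W s ω) • η ω) ∂P = 0 := by
  simp_rw [inner_smul_right]
  exact hW.integral_sub_mul hst (hζ.inner hη)

theorem integral_inner_same (hW : IsFBrownianMotion 𝓕 P W) {s t : ℝ≥0}
    (hst : s ≤ t) {ζ η : Ω → H} (hζ : StronglyMeasurable[𝓕 s] ζ)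
    (hη : StronglyMeasurable[𝓕 s] η) :
    ∫ ω, inner ℝ ((W t ω - W s ω) • ζ ω) ((W t ω - W s ω) • η ω) ∂P
      = (t - s) * ∫ ω, inner ℝ (ζ ω) (η ω) ∂P := by
  simp_rw [inner_smul_right, inner_smul_left]
  rw [← hW.integral_sub_sq_mul hst (hζ.inner hη)]
  refine integral_congr_ae (ae_of_all _ fun ω => ?_)
  simp; ring

theorem integrable_inner_of_memLp {f g : Ω → H} (hf : MemLp f 2 P) (hg : MemLp g 2 P) :
    Integrable (fun ω => inner ℝ (f ω) (g ω)) P := by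
  refine ((hf.norm.integrable_mul hg.norm)).mono'
    (hf.aestronglyMeasurable.inner hg.aestronglyMeasurable) (ae_of_all _ fun ω => ?_)
  exact norm_inner_le_norm _ _

theorem integral_add₃ {f g h : Ω → ℝ} (hf : Integrable f P) (hg : Integrable g P)
    (hh : Integrable h P) :
    ∫ ω, f ω + g ω + h ω ∂P = ∫ ω, f ω ∂P + ∫ ω, g ω ∂P + ∫ ω, h ω ∂P := by
  rw [integral_add (f := fun ω => f ω + g ω) (hf.add hg) hh, integral_add hf hg]

theorem _root_.StochSys.toReal_overlap (a b c d : ℝ≥0) :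
    (timeMeasure (Set.Ioc a b ∩ Set.Ioc c d)).toReal = max 0 (min (b : ℝ) d - max (a : ℝ) c) := by
  have h : timeMeasure (Set.Ioc a b ∩ Set.Ioc c d)
      = ENNReal.ofReal (min (b : ℝ) d - max (a : ℝ) c) := by
    have himg : ((↑) : ℝ≥0 → ℝ) '' (Set.Ioc a b ∩ Set.Ioc c d)
        = Set.Ioc (max (a : ℝ) c) (min (b : ℝ) d) := by
      ext x
      constructor
      · rintro ⟨y, ⟨⟨h1, h2⟩, h3, h4⟩, rfl⟩
        exact ⟨max_lt (NNReal.coe_lt_coe.2 h1) (NNReal.coe_lt_coe.2 h3),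
          le_min (NNReal.coe_le_coe.2 h2) (NNReal.coe_le_coe.2 h4)⟩
      · rintro ⟨h1, h2⟩
        rw [max_lt_iff] at h1
        rw [le_min_iff] at h2
        exact ⟨⟨x, a.2.trans h1.1.le⟩, ⟨⟨h1.1, h2.1⟩, h1.2, h2.2⟩, rfl⟩
    rw [timeMeasure, measurableEmbedding_coe.comap_apply, himg, Real.volume_Ioc]
  rw [h, ENNReal.toReal_ofReal', max_comm]

/-- Cut both intervals at their endpoints beyond `c`. Over the overlap the two increments coincide
and their variance produces the length. In every other term one increment lies after everything it
is paired with, so by independence its zero mean kills the term. -/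
theorem integral_inner_increments_of_le (hW : IsFBrownianMotion 𝓕 P W) {a b c d : ℝ≥0}
    (hab : a ≤ b) (hcd : c ≤ d) (hac : a ≤ c) {ζ η : Ω → H}
    (hζ : StronglyMeasurable[𝓕 a] ζ) (hζ2 : MemLp ζ 2 P)
    (hη : StronglyMeasurable[𝓕 c] η) (hη2 : MemLp η 2 P) :
    ∫ ω, inner ℝ ((W b ω - W a ω) • ζ ω) ((W d ω - W c ω) • η ω) ∂P
      = max 0 (min (b : ℝ) d - max (a : ℝ) c) * ∫ ω, inner ℝ (ζ ω) (η ω) ∂P := by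
  have hac' : (a : ℝ) ≤ c := NNReal.coe_le_coe.2 hac
  rw [max_eq_right hac']
  rcases le_total b c with hbc | hcb
  · have hbc' : (b : ℝ) ≤ c := NNReal.coe_le_coe.2 hbc
    rw [max_eq_left (by linarith [min_le_left (b : ℝ) d]), zero_mul]
    exact hW.integral_inner_of_measurable_left hcd
      ((hW.stronglyMeasurable_sub_smul hab hζ).mono (𝓕.mono hbc)) hη
  have hζc : StronglyMeasurable[𝓕 c] ζ := hζ.mono (𝓕.mono hac)
  have i1 := hW.memLp_sub_smul hac hζ hζ2
  have m1 := hW.stronglyMeasurable_sub_smul hac hζ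
  rcases le_total b d with hbd | hdb
  · have i2 := hW.memLp_sub_smul hcb hζc hζ2
    have i3 := hW.memLp_sub_smul hcb hη hη2
    have i4 := hW.memLp_sub_smul hbd (hη.mono (𝓕.mono hcb)) hη2
    have e : ∀ ω, inner ℝ ((W b ω - W a ω) • ζ ω) ((W d ω - W c ω) • η ω)
        = inner ℝ ((W c ω - W a ω) • ζ ω) ((W b ω - W c ω) • η ω)
          + inner ℝ ((W b ω - W c ω) • ζ ω) ((W b ω - W c ω) • η ω)
          + inner ℝ ((W b ω - W a ω) • ζ ω) ((W d ω - W b ω) • η ω) := by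
      intro ω; simp only [inner_smul_left, inner_smul_right, RCLike.conj_to_real]; ring
    simp_rw [e]
    rw [integral_add₃ (integrable_inner_of_memLp i1 i3) (integrable_inner_of_memLp i2 i3)
      (integrable_inner_of_memLp (hW.memLp_sub_smul hab hζ hζ2) i4),
      hW.integral_inner_of_measurable_left hcb m1 hη, hW.integral_inner_same hcb hζc hη,
      hW.integral_inner_of_measurable_left hbd (hW.stronglyMeasurable_sub_smul hab hζ)
        (hη.mono (𝓕.mono hcb)), min_eq_left (NNReal.coe_le_coe.2 hbd),
      max_eq_right (sub_nonneg.2 (NNReal.coe_le_coe.2 hcb))]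
    ring
  · have i2 := hW.memLp_sub_smul hcd hζc hζ2
    have i3 := hW.memLp_sub_smul hcd hη hη2
    have i4 := hW.memLp_sub_smul hdb (hζ.mono (𝓕.mono (hac.trans hcd))) hζ2
    have e : ∀ ω, inner ℝ ((W b ω - W a ω) • ζ ω) ((W d ω - W c ω) • η ω)
        = inner ℝ ((W c ω - W a ω) • ζ ω) ((W d ω - W c ω) • η ω)
          + inner ℝ ((W d ω - W c ω) • ζ ω) ((W d ω - W c ω) • η ω)
          + inner ℝ ((W b ω - W d ω) • ζ ω) ((W d ω - W c ω) • η ω) := by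
      intro ω; simp only [inner_smul_left, inner_smul_right, RCLike.conj_to_real]; ring
    simp_rw [e]
    have h0 : ∫ ω, inner ℝ ((W b ω - W d ω) • ζ ω) ((W d ω - W c ω) • η ω) ∂P = 0 := by
      refine (integral_congr_ae (ae_of_all _ fun ω => real_inner_comm _ _)).trans ?_
      exact hW.integral_inner_of_measurable_left hdb (hW.stronglyMeasurable_sub_smul hcd hη)
        (hζ.mono (𝓕.mono (hac.trans hcd)))
    rw [integral_add₃ (integrable_inner_of_memLp i1 i3) (integrable_inner_of_memLp i2 i3)
      (integrable_inner_of_memLp i4 i3),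
      hW.integral_inner_of_measurable_left hcd m1 hη, hW.integral_inner_same hcd hζc hη, h0,
      min_eq_right (NNReal.coe_le_coe.2 hdb),
      max_eq_right (sub_nonneg.2 (NNReal.coe_le_coe.2 hcd))]
    ring

theorem integral_inner_increments (hW : IsFBrownianMotion 𝓕 P W) {a b c d : ℝ≥0}
    (hab : a ≤ b) (hcd : c ≤ d) {ζ η : Ω → H}
    (hζ : StronglyMeasurable[𝓕 a] ζ) (hζ2 : MemLp ζ 2 P)
    (hη : StronglyMeasurable[𝓕 c] η) (hη2 : MemLp η 2 P) :
    ∫ ω, inner ℝ ((W b ω - W a ω) • ζ ω) ((W d ω - W c ω) • η ω) ∂P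
      = (timeMeasure (Set.Ioc a b ∩ Set.Ioc c d)).toReal * ∫ ω, inner ℝ (ζ ω) (η ω) ∂P := by
  rw [toReal_overlap]
  rcases le_total a c with h | h
  · exact hW.integral_inner_increments_of_le hab hcd h hζ hζ2 hη hη2
  · have := hW.integral_inner_increments_of_le hcd hab h hη hη2 hζ hζ2
    rw [min_comm, max_comm (c : ℝ)] at this
    rw [integral_congr_ae (ae_of_all _ fun ω => real_inner_comm _ _),
      integral_congr_ae (ae_of_all P fun ω => real_inner_comm (η ω) (ζ ω))]
    exact this

end IsFBrownianMotion

end Increments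

/-! ### The Itô integral as an isometric graph -/

section ItoGraph

variable {Ω : Type*} {mΩ : MeasurableSpace Ω} {P : Measure Ω}
  {𝓕 : Filtration ℝ≥0 mΩ} {W : ℝ≥0 → Ω → ℝ}
  {H : Type*} [NormedAddCommGroup H] [InnerProductSpace ℝ H]
  {H' : Type*} [NormedAddCommGroup H'] [InnerProductSpace ℝ H']

theorem timeMeasure_Ioc_ne_top (a b : ℝ≥0) : timeMeasure (Set.Ioc a b) ≠ ∞ := by
  refine ((measure_mono Set.Ioc_subset_Icc_self).trans_lt ?_).ne
  rw [timeMeasure_Icc]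
  exact ENNReal.ofReal_lt_top

theorem timeMeasure_Icc_ne_top (a b : ℝ≥0) : timeMeasure (Set.Icc a b) ≠ ∞ := by
  rw [timeMeasure_Icc]
  exact ENNReal.ofReal_ne_top

instance : NullSingletonClass timeMeasure where
  measure_singleton x := by
    rw [← Set.Icc_self, timeMeasure_Icc]
    simp

instance : IsLocallyFiniteMeasure timeMeasure where
  finiteAtNhds x := ⟨Set.Icc 0 (x + 1), Icc_mem_nhds_of x,
    by rw [timeMeasure_Icc]; exact ENNReal.ofReal_lt_top⟩
where
  Icc_mem_nhds_of (x : ℝ≥0) : Set.Icc 0 (x + 1) ∈ 𝓝 x := by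
    have : Set.Iio (x + 1) ∈ 𝓝 x := Iio_mem_nhds (by simp)
    exact mem_of_superset this fun y hy => ⟨zero_le, le_of_lt hy⟩

/-- Pairs of an elementary integrand `1_{(a, b]} η` with `b ≤ t` and its stochastic integral. -/
def itoGenerators (𝓕 : Filtration ℝ≥0 mΩ) (P : Measure Ω) (W : ℝ≥0 → Ω → ℝ) (t : ℝ≥0) :
    Set (Lp (Lp H 2 P) 2 timeMeasure × Lp H 2 P) :=
  {p | ∃ a b : ℝ≥0, a ≤ b ∧ b ≤ t ∧ ∃ (η : Ω → H) (hη : MemLp η 2 P),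
    StronglyMeasurable[𝓕 a] η ∧
    p.1 = indicatorConstLp 2 measurableSet_Ioc (timeMeasure_Ioc_ne_top a b) (hη.toLp η) ∧
    p.2 =ᵐ[P] fun ω => (W b ω - W a ω) • η ω}

/-- The graph of the Itô integral on `[0, t]`, for integrands seen as curves in `L²(Ω, H)`. -/
noncomputable def itoGraph (𝓕 : Filtration ℝ≥0 mΩ) (P : Measure Ω) (W : ℝ≥0 → Ω → ℝ) (t : ℝ≥0) :
    Submodule ℝ (Lp (Lp H 2 P) 2 timeMeasure × Lp H 2 P) :=
  (Submodule.span ℝ (itoGenerators 𝓕 P W t)).topologicalClosure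

theorem itoGraph_mono {s t : ℝ≥0} (hst : s ≤ t) :
    (itoGraph 𝓕 P W s : Submodule ℝ (Lp (Lp H 2 P) 2 timeMeasure × Lp H 2 P))
      ≤ itoGraph 𝓕 P W t := by
  refine Submodule.topologicalClosure_mono (Submodule.span_mono ?_)
  rintro p ⟨a, b, hab, hb, h⟩
  exact ⟨a, b, hab, hb.trans hst, h⟩

theorem isClosed_itoGraph (t : ℝ≥0) :
    IsClosed ((itoGraph 𝓕 P W t :
      Submodule ℝ (Lp (Lp H 2 P) 2 timeMeasure × Lp H 2 P)) :
        Set (Lp (Lp H 2 P) 2 timeMeasure × Lp H 2 P)) :=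
  Submodule.isClosed_topologicalClosure _

theorem span_le_itoGraph (t : ℝ≥0) :
    Submodule.span ℝ (itoGenerators 𝓕 P W t)
      ≤ (itoGraph 𝓕 P W t : Submodule ℝ (Lp (Lp H 2 P) 2 timeMeasure × Lp H 2 P)) :=
  Submodule.le_topologicalClosure _

variable [IsProbabilityMeasure P] [CompleteSpace H] [CompleteSpace H']

/-- Measurability with respect to `𝓕 t` cuts out a closed subspace of `L²`, so it suffices to check
it on the generators, whose increments end before `t`. -/
theorem aestronglyMeasurable_of_mem_itoGraph {t : ℝ≥0} {p : Lp (Lp H 2 P) 2 timeMeasure × Lp H 2 P}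
    (hp : p ∈ itoGraph 𝓕 P W t) (hW : IsFBrownianMotion 𝓕 P W) :
    AEStronglyMeasurable[𝓕 t] p.2 P := by
  have : Fact (𝓕 t ≤ mΩ) := ⟨𝓕.le t⟩
  have hcl : IsClosed {f : Lp H 2 P | AEStronglyMeasurable[𝓕 t] f P} :=
    isClosed_aestronglyMeasurable (𝓕.le t)
  let S : Submodule ℝ (Lp (Lp H 2 P) 2 timeMeasure × Lp H 2 P) :=
    (lpMeas H ℝ (𝓕 t) 2 P).comap (LinearMap.snd ℝ _ _)
  have hS : IsClosed (S : Set (Lp (Lp H 2 P) 2 timeMeasure × Lp H 2 P)) := by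
    have e : (S : Set (Lp (Lp H 2 P) 2 timeMeasure × Lp H 2 P))
        = Prod.snd ⁻¹' {f : Lp H 2 P | AEStronglyMeasurable[𝓕 t] f P} := by
      ext p
      exact mem_lpMeas_iff_aestronglyMeasurable (𝕜 := ℝ)
    rw [e]
    exact hcl.preimage continuous_snd
  have hle : itoGraph 𝓕 P W t ≤ S := by
    refine Submodule.topologicalClosure_minimal _ (Submodule.span_le.2 ?_) hS
    rintro p ⟨a, b, hab, hb, η, hη, hηm, -, h2⟩
    exact (mem_lpMeas_iff_aestronglyMeasurable (𝕜 := ℝ)).2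
      ⟨_, (hW.stronglyMeasurable_sub_smul hab hηm).mono (𝓕.mono hb), h2⟩
  exact (mem_lpMeas_iff_aestronglyMeasurable (𝕜 := ℝ)).1 (hle hp)

/-- Itô's isometry in polarised form. Both sides are the length of the overlap of the two intervals
times the inner product of the coefficients. -/
theorem inner_eq_of_generators (hW : IsFBrownianMotion 𝓕 P W) {t : ℝ≥0}
    {p q : Lp (Lp H 2 P) 2 timeMeasure × Lp H 2 P}
    (hp : p ∈ itoGenerators 𝓕 P W t) (hq : q ∈ itoGenerators 𝓕 P W t) :
    inner ℝ p.1 q.1 = inner ℝ p.2 q.2 := by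
  obtain ⟨a, b, hab, -, ζ, hζ, hζm, hp1, hp2⟩ := hp
  obtain ⟨c, d, hcd, -, η, hη, hηm, hq1, hq2⟩ := hq
  rw [hp1, hq1, L2.inner_indicatorConstLp_indicatorConstLp _ _ (timeMeasure_Ioc_ne_top a b)
    (timeMeasure_Ioc_ne_top c d), L2.inner_def, L2.inner_def]
  have e1 : ∫ ω, inner ℝ (p.2 ω) (q.2 ω) ∂P
      = ∫ ω, inner ℝ ((W b ω - W a ω) • ζ ω) ((W d ω - W c ω) • η ω) ∂P := by
    refine integral_congr_ae ?_
    filter_upwards [hp2, hq2] with ω h1 h2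
    rw [h1, h2]
  have e2 : ∫ ω, inner ℝ (hζ.toLp ζ ω) (hη.toLp η ω) ∂P = ∫ ω, inner ℝ (ζ ω) (η ω) ∂P := by
    refine integral_congr_ae ?_
    filter_upwards [hζ.coeFn_toLp, hη.coeFn_toLp] with ω h1 h2
    rw [h1, h2]
  rw [e1, e2, hW.integral_inner_increments hab hcd hζm hζ hηm hη]
  rfl

/-- The polarised isometry is bilinear, so it passes from generators to their span; equality of
norms is a closed condition, so it survives the closure. Since the relation is linear, this makes it
the graph of an isometry, in particular single-valued. -/
theorem norm_eq_of_mem_itoGraph (hW : IsFBrownianMotion 𝓕 P W) {t : ℝ≥0}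
    {p : Lp (Lp H 2 P) 2 timeMeasure × Lp H 2 P} (hp : p ∈ itoGraph 𝓕 P W t) :
    ‖p.1‖ = ‖p.2‖ := by
  have hspan : ∀ x ∈ Submodule.span ℝ (itoGenerators 𝓕 P W t),
      ∀ y ∈ Submodule.span ℝ (itoGenerators 𝓕 P W t),
      inner ℝ (x : Lp (Lp H 2 P) 2 timeMeasure × Lp H 2 P).1 y.1 = inner ℝ x.2 y.2 := by
    intro x hx y hy
    induction hx, hy using Submodule.span_induction₂ with
    | mem_mem x y hx hy => exact inner_eq_of_generators hW hx hy
    | zero_left y hy => simp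
    | zero_right x hx => simp
    | add_left x y z _ _ _ h1 h2 => simp [inner_add_left, h1, h2]
    | add_right x y z _ _ _ h1 h2 => simp [inner_add_right, h1, h2]
    | smul_left r x y _ _ h => simp [inner_smul_left, h]
    | smul_right r x y _ _ h => simp [inner_smul_right, h]
  have hcl : IsClosed {p : Lp (Lp H 2 P) 2 timeMeasure × Lp H 2 P | ‖p.1‖ = ‖p.2‖} :=
    isClosed_eq (by fun_prop) (by fun_prop)
  refine closure_minimal (fun x hx => ?_) hcl hp
  have := hspan x hx x hx
  rw [real_inner_self_eq_norm_sq, real_inner_self_eq_norm_sq] at this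
  exact (sq_eq_sq₀ (norm_nonneg _) (norm_nonneg _)).1 this

/-- The domain of the integral is closed: by the isometry the integrals are Cauchy as soon as the
integrands are. -/
theorem exists_itoGraph_of_tendsto (hW : IsFBrownianMotion 𝓕 P W) {t : ℝ≥0}
    {p : ℕ → Lp (Lp H 2 P) 2 timeMeasure × Lp H 2 P} (hp : ∀ n, p n ∈ itoGraph 𝓕 P W t)
    {v : Lp (Lp H 2 P) 2 timeMeasure} (hv : Tendsto (fun n => (p n).1) atTop (𝓝 v)) :
    ∃ I, (v, I) ∈ itoGraph 𝓕 P W t := by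
  have hc : CauchySeq fun n => (p n).2 := by
    have hc1 := hv.cauchySeq
    rw [Metric.cauchySeq_iff] at hc1 ⊢
    intro ε hε
    obtain ⟨N, hN⟩ := hc1 ε hε
    refine ⟨N, fun m hm n hn => ?_⟩
    have h := norm_eq_of_mem_itoGraph hW (sub_mem (hp m) (hp n))
    have := hN m hm n hn
    rw [dist_eq_norm] at this ⊢
    exact h ▸ this
  obtain ⟨I, hI⟩ := cauchySeq_tendsto_of_complete hc
  exact ⟨I, (isClosed_itoGraph t).mem_of_tendsto (hv.prodMk_nhds hI) (Eventually.of_forall hp)⟩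

/-- Bounded operators commute with the stochastic integral. On generators this is the linearity of
`K` applied to the coefficient, and the preimage of a closed relation under a continuous map is
closed. It is used for the observations as well as for the semigroup. -/
theorem map_mem_itoGraph (K : H →L[ℝ] H') {t : ℝ≥0}
    {p : Lp (Lp H 2 P) 2 timeMeasure × Lp H 2 P} (hp : p ∈ itoGraph 𝓕 P W t) :
    ((K.compLpL 2 P).compLpL 2 timeMeasure p.1, K.compLpL 2 P p.2) ∈ itoGraph 𝓕 P W t := by
  let Φ : Lp (Lp H 2 P) 2 timeMeasure × Lp H 2 P →L[ℝ]
      Lp (Lp H' 2 P) 2 timeMeasure × Lp H' 2 P :=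
    ((K.compLpL 2 P).compLpL 2 timeMeasure).prodMap (K.compLpL 2 P)
  have hle : itoGraph 𝓕 P W t ≤ (itoGraph 𝓕 P W t).comap Φ.toLinearMap := by
    refine Submodule.topologicalClosure_minimal _ (Submodule.span_le.2 ?_)
      ((isClosed_itoGraph t).preimage Φ.continuous)
    rintro q ⟨a, b, hab, hb, η, hη, hηm, h1, h2⟩
    refine span_le_itoGraph t (Submodule.subset_span ⟨a, b, hab, hb, fun ω => K (η ω),
      K.comp_memLp' hη, K.continuous.comp_stronglyMeasurable hηm, ?_, ?_⟩)
    · change (K.compLpL 2 P).compLpL 2 timeMeasure q.1 = _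
      rw [h1]
      apply Lp.ext
      have e : K.compLpL 2 P (hη.toLp η) = (K.comp_memLp' hη).toLp _ := by
        apply Lp.ext
        filter_upwards [K.coeFn_compLpL (hη.toLp η), hη.coeFn_toLp,
          (K.comp_memLp' hη).coeFn_toLp] with ω h3 h4 h5
        rw [h3, h4, h5]; rfl
      refine ((K.compLpL 2 P).coeFn_compLpL _).trans ?_
      filter_upwards [indicatorConstLp_coeFn (p := 2)
        (hs := measurableSet_Ioc) (hμs := timeMeasure_Ioc_ne_top a b) (c := hη.toLp η),
        indicatorConstLp_coeFn (p := 2)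
        (hs := measurableSet_Ioc) (hμs := timeMeasure_Ioc_ne_top a b)
          (c := (K.comp_memLp' hη).toLp (fun ω => K (η ω)))] with s h3 h4
      rw [h3, h4]
      by_cases hs : s ∈ Set.Ioc a b
      · simp only [Set.indicator_of_mem hs]
        exact e
      · simp only [Set.indicator_of_notMem hs, map_zero]
    · change K.compLpL 2 P q.2 =ᵐ[P] _
      filter_upwards [K.coeFn_compLpL q.2, h2] with ω h3 h4
      rw [h3, h4, map_smul]
  exact hle hp

end ItoGraph

/-! ### Square norms as integrals -/

theorem eLpNorm_two_sq {α F : Type*} {mα : MeasurableSpace α} [NormedAddCommGroup F]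
    (f : α → F) (μ : Measure α) : eLpNorm f 2 μ ^ 2 = ∫⁻ x, ‖f x‖ₑ ^ 2 ∂μ := by
  have := eLpNorm_nnreal_pow_eq_lintegral (f := f) (μ := μ) (p := 2) (by norm_num)
  simpa using this

theorem Lp_enorm_sq {α F : Type*} {mα : MeasurableSpace α} [NormedAddCommGroup F]
    {μ : Measure α} (f : Lp F 2 μ) : ‖f‖ₑ ^ 2 = ∫⁻ x, ‖f x‖ₑ ^ 2 ∂μ := by
  rw [Lp.enorm_def, eLpNorm_two_sq]

theorem sq_le_sq_ennreal {a b : ℝ≥0∞} : a ^ 2 ≤ b ^ 2 ↔ a ≤ b :=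
  (ENNReal.pow_right_strictMono two_ne_zero).le_iff_le

theorem sq_eq_sq_ennreal {a b : ℝ≥0∞} : a ^ 2 = b ^ 2 ↔ a = b :=
  ⟨fun h => le_antisymm (sq_le_sq_ennreal.1 h.le) (sq_le_sq_ennreal.1 h.ge), fun h => h ▸ rfl⟩

/-! ### Integrands of the Itô graph: from processes and continuous curves -/

section Link

variable {Ω : Type*} {mΩ : MeasurableSpace Ω} {P : Measure Ω} [IsProbabilityMeasure P]
  {𝓕 : Filtration ℝ≥0 mΩ} {W : ℝ≥0 → Ω → ℝ}
  {H : Type*} [NormedAddCommGroup H]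

theorem normL2F_sq {t : ℝ≥0} {ζ : ℝ≥0 → Ω → H}
    (hζ : AEStronglyMeasurable (fun p : ℝ≥0 × Ω => ζ p.1 p.2) (timeProd P t)) :
    normL2F P t ζ ^ 2 = ∫⁻ s in Set.Icc 0 t, eLpNorm (ζ s) 2 P ^ 2 ∂timeMeasure := by
  rw [normL2F, eLpNorm_two_sq, timeProd, lintegral_prod _ (hζ.enorm.pow_const 2)]
  simp_rw [eLpNorm_two_sq]

theorem enorm_eq_normL2F {t : ℝ≥0} {ζ : ℝ≥0 → Ω → H}
    (hζ : AEStronglyMeasurable (fun p : ℝ≥0 × Ω => ζ p.1 p.2) (timeProd P t))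
    {v : Lp (Lp H 2 P) 2 timeMeasure}
    (hv : ∀ᵐ s ∂timeMeasure, v s =ᵐ[P] fun ω => (Set.Icc 0 t).indicator (fun s => ζ s ω) s) :
    ‖v‖ₑ = normL2F P t ζ := by
  rw [← sq_eq_sq_ennreal, normL2F_sq hζ, Lp_enorm_sq, ← lintegral_indicator measurableSet_Icc]
  refine lintegral_congr_ae (hv.mono fun s hs => ?_)
  simp only
  rw [Lp.enorm_def, eLpNorm_congr_ae hs]
  by_cases h : s ∈ Set.Icc 0 t <;> simp [h]

variable [InnerProductSpace ℝ H] [CompleteSpace H]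

theorem exists_elementary_mem_itoGraph (hW : IsFBrownianMotion 𝓕 P W) {a b t : ℝ≥0} (hab : a ≤ b)
    (hbt : b ≤ t) (x : Lp H 2 P) (hx : AEStronglyMeasurable[𝓕 a] x P) :
    ∃ I, (indicatorConstLp 2 measurableSet_Ioc (timeMeasure_Ioc_ne_top a b) x, I)
      ∈ itoGraph 𝓕 P W t := by
  obtain ⟨η, hηm, hη⟩ := hx
  have hη2 : MemLp η 2 P := (Lp.memLp x).ae_eq hη
  have e : hη2.toLp η = x := by
    apply Lp.ext
    exact hη2.coeFn_toLp.trans hη.symm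
  exact ⟨(hW.memLp_sub_smul hab hηm hη2).toLp _, span_le_itoGraph t (Submodule.subset_span
    ⟨a, b, hab, hbt, η, hη2, hηm, by rw [e], (hW.memLp_sub_smul hab hηm hη2).coeFn_toLp⟩)⟩

theorem memLp_indicator_of_continuous {F : Type*} [NormedAddCommGroup F] {h : ℝ≥0 → F}
    (hc : Continuous h) (a b : ℝ≥0) : MemLp ((Set.Icc a b).indicator h) 2 timeMeasure := by
  obtain ⟨B, hB⟩ := (isCompact_Icc (a := a) (b := b)).exists_bound_of_continuousOn hc.continuousOn
  rw [memLp_indicator_iff_restrict measurableSet_Icc]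
  have : IsFiniteMeasure (timeMeasure.restrict (Set.Icc a b)) :=
    ⟨by rw [Measure.restrict_apply_univ]; exact (timeMeasure_Icc_ne_top a b).lt_top⟩
  exact MemLp.of_bound hc.aestronglyMeasurable B
    ((ae_restrict_mem measurableSet_Icc).mono hB)

/-- The cells are open on the left and pairwise disjoint, so the index of the cell of `s` is `⌈s /
δ⌉₊ - 1`. -/
theorem sum_indicator_Ioc_eq {F : Type*} [AddCommMonoid F] (δ : ℝ≥0) (hδ : 0 < δ) (n : ℕ)
    (g : ℕ → F) {s : ℝ≥0} (hs : s ∈ Set.Ioc 0 (n * δ)) :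
    ∃ i < n, s ∈ Set.Ioc (i * δ) ((i + 1 : ℕ) * δ) ∧
      ∑ i ∈ Finset.range n, (Set.Ioc (i * δ) ((i + 1 : ℕ) * δ)).indicator (fun _ => g i) s
        = g i := by
  have hmono : Monotone fun i : ℕ => (i : ℝ≥0) * δ := fun i j hij => by
    have : (i : ℝ≥0) ≤ j := by exact_mod_cast hij
    exact mul_le_mul_left this δ
  have hpos : 0 < ⌈s / δ⌉₊ := Nat.ceil_pos.2 (div_pos hs.1 hδ)
  obtain ⟨i, hi⟩ : ∃ i, ⌈s / δ⌉₊ = i + 1 := ⟨_, (Nat.succ_pred_eq_of_pos hpos).symm⟩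
  have h1 : (i : ℝ≥0) < s / δ := Nat.lt_ceil.1 (by omega)
  have h2 : s / δ ≤ (i + 1 : ℕ) := hi ▸ Nat.le_ceil _
  have hin : i < n := by
    have : s / δ ≤ n := (div_le_iff₀ hδ).2 hs.2
    have := Nat.ceil_le.2 this
    omega
  have hmem : s ∈ Set.Ioc ((i : ℝ≥0) * δ) ((i + 1 : ℕ) * δ) :=
    ⟨(lt_div_iff₀ hδ).1 h1, (div_le_iff₀ hδ).1 h2⟩
  refine ⟨i, hin, hmem, ?_⟩
  rw [Finset.sum_eq_single i, Set.indicator_of_mem hmem]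
  · intro j _ hji
    refine Set.indicator_of_notMem (fun hj => ?_) _
    exact (Set.disjoint_left.1 (hmono.pairwise_disjoint_on_Ioc_succ hji) hj) hmem
  · intro h
    exact absurd (Finset.mem_range.2 hin) h

/-- Left-endpoint Riemann sums of an adapted continuous curve are elementary integrands, because the
value on a cell is known at its left end. Uniform continuity on `[0, t]` makes them converge to the
curve in `L²`. -/
theorem exists_mem_itoGraph (hW : IsFBrownianMotion 𝓕 P W) {t : ℝ≥0} {h : ℝ≥0 → Lp H 2 P}
    (hc : Continuous h) (ha : ∀ s ≤ t, AEStronglyMeasurable[𝓕 s] (h s) P) :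
    ∃ I, ((memLp_indicator_of_continuous hc 0 t).toLp _, I) ∈ itoGraph 𝓕 P W t := by
  set v := (memLp_indicator_of_continuous hc 0 t).toLp _ with hv
  suffices hs : ∀ ε > 0, ∃ p ∈ itoGraph 𝓕 P W t, ‖p.1 - v‖ ≤ ε by
    choose! p hp hpv using fun n : ℕ => hs (1 / ((n : ℝ) + 1)) (by positivity)
    refine exists_itoGraph_of_tendsto hW hp ?_
    rw [tendsto_iff_norm_sub_tendsto_zero]
    exact squeeze_zero (fun _ => norm_nonneg _) hpv tendsto_one_div_add_atTop_nhds_zero_nat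
  intro ε hε
  -- For `t = 0` the mesh `t / n` below would vanish; the integrand is then supported on a null set.
  rcases eq_or_lt_of_le (zero_le : 0 ≤ t) with ht | ht
  · refine ⟨0, zero_mem _, ?_⟩
    have : v = 0 := by
      rw [Lp.eq_zero_iff_ae_eq_zero]
      refine (MemLp.coeFn_toLp _).trans ?_
      have h0 : ∀ᵐ s ∂timeMeasure, s ≠ 0 := by
        simp [ae_iff, measure_singleton]
      filter_upwards [h0] with s hs
      subst ht
      simp [hs]
    simp [this, hε.le]
  -- An error of at most `ε / (1 + t)` on `[0, t]` has `L²` norm at most `ε √t / (1 + t) ≤ ε`.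
  obtain ⟨δ, hδ, hδε⟩ := Metric.uniformContinuousOn_iff_le.1
    ((isCompact_Icc (a := 0) (b := t)).uniformContinuousOn_of_continuous hc.continuousOn)
    (ε / (1 + t)) (by positivity)
  obtain ⟨n, hn⟩ := exists_nat_gt ((t : ℝ) / δ)
  have hn0 : 0 < n := by
    have : (0 : ℝ) < n := lt_of_le_of_lt (by positivity) hn
    exact_mod_cast this
  set d : ℝ≥0 := t / n with hd
  have hd0 : 0 < d := by positivity
  have hnd : n * d = t := by rw [hd]; field_simp
  have hdδ : (d : ℝ) ≤ δ := by
    rw [hd, NNReal.coe_div, NNReal.coe_natCast, div_le_iff₀ (by positivity)]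
    rw [div_lt_iff₀ hδ] at hn
    linarith
  have hle : ∀ i < n, ((i + 1 : ℕ) : ℝ≥0) * d ≤ t := fun i hi => by
    rw [← hnd]
    have : ((i + 1 : ℕ) : ℝ≥0) ≤ n := by exact_mod_cast hi
    gcongr
  have hle' : ∀ i : ℕ, (i : ℝ≥0) * d ≤ ((i + 1 : ℕ) : ℝ≥0) * d := fun i => by
    gcongr; simp
  choose! I hI using fun i (hi : i < n) => exists_elementary_mem_itoGraph hW (hle' i) (hle i hi)
    (h (i * d)) (ha _ ((hle' i).trans (hle i hi)))
  refine ⟨∑ i ∈ Finset.range n, (indicatorConstLp 2 measurableSet_Ioc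
    (timeMeasure_Ioc_ne_top (i * d) ((i + 1 : ℕ) * d)) (h (i * d)), I i),
    sum_mem fun i hi => hI i (Finset.mem_range.1 hi), ?_⟩
  rw [Prod.fst_sum]
  have hbound : ∀ᵐ s ∂timeMeasure, ‖(∑ i ∈ Finset.range n, indicatorConstLp 2 measurableSet_Ioc
      (timeMeasure_Ioc_ne_top (i * d) ((i + 1 : ℕ) * d)) (h (i * d)) - v) s‖
      ≤ ‖indicatorConstLp (μ := timeMeasure) 2 measurableSet_Icc (timeMeasure_Icc_ne_top 0 t)
          (ε / (1 + t)) s‖ := by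
    have hall : ∀ᵐ s ∂timeMeasure, ∀ i : ℕ, (indicatorConstLp 2 measurableSet_Ioc
      (timeMeasure_Ioc_ne_top (i * d) ((i + 1 : ℕ) * d)) (h (i * d)) :
        Lp (Lp H 2 P) 2 timeMeasure) s
        = (Set.Ioc (i * d) ((i + 1 : ℕ) * d)).indicator (fun _ => h (i * d)) s :=
      ae_all_iff.2 fun i => indicatorConstLp_coeFn
    have h0 : ∀ᵐ s ∂timeMeasure, s ≠ 0 := by
      simp [ae_iff, measure_singleton]
    filter_upwards [Lp.coeFn_sub (∑ i ∈ Finset.range n, indicatorConstLp 2 measurableSet_Ioc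
      (timeMeasure_Ioc_ne_top (i * d) ((i + 1 : ℕ) * d)) (h (i * d))) v,
      Lp.coeFn_finsetSum (Finset.range n) fun i : ℕ => (indicatorConstLp 2 measurableSet_Ioc
      (timeMeasure_Ioc_ne_top (i * d) ((i + 1 : ℕ) * d)) (h (i * d)) :
        Lp (Lp H 2 P) 2 timeMeasure), hall, h0,
      (memLp_indicator_of_continuous hc 0 t).coeFn_toLp,
      indicatorConstLp_coeFn (p := 2) (μ := timeMeasure) (hs := measurableSet_Icc)
        (hμs := timeMeasure_Icc_ne_top 0 t) (c := ε / (1 + (t : ℝ)))] with s h1 h2 h3 h4 h5 h6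
    rw [h1, Pi.sub_apply, h2, Finset.sum_apply, h5, h6]
    simp_rw [h3]
    by_cases hs : s ∈ Set.Icc 0 t
    · have hs' : s ∈ Set.Ioc 0 (n * d) := ⟨pos_iff_ne_zero.2 h4, hnd ▸ hs.2⟩
      obtain ⟨i, hin, hi, he⟩ := sum_indicator_Ioc_eq d hd0 n (fun i => h (i * d)) hs'
      rw [he, Set.indicator_of_mem hs, Set.indicator_of_mem hs, ← dist_eq_norm,
        Real.norm_of_nonneg (by positivity)]
      refine hδε _ ⟨zero_le, (hle' i).trans (hle i hin)⟩ _ hs ?_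
      rw [dist_comm, NNReal.dist_eq, abs_of_nonneg (sub_nonneg.2 (NNReal.coe_le_coe.2 hi.1.le))]
      have := NNReal.coe_le_coe.2 hi.2
      push_cast at this ⊢
      linarith
    · rw [Set.indicator_of_notMem hs, Set.indicator_of_notMem hs, Finset.sum_eq_zero]
      · simp
      intro i hi
      refine Set.indicator_of_notMem (fun h' => hs ⟨zero_le, h'.2.trans ?_⟩) _
      exact hle i (Finset.mem_range.1 hi)
  refine (Lp.norm_le_norm_of_ae_le hbound).trans ?_
  refine norm_indicatorConstLp_le.trans ?_
  rw [Real.norm_of_nonneg (by positivity), measureReal_def, timeMeasure_Icc]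
  have h1 : (ENNReal.ofReal ((t : ℝ) - (0 : ℝ≥0))).toReal = t := by
    rw [ENNReal.toReal_ofReal (by simp)]; simp
  rw [h1]
  have h2 : (t : ℝ) ^ (1 / (2 : ℝ≥0∞).toReal) ≤ 1 + t := by
    have : (1 / (2 : ℝ≥0∞).toReal) = (1 / 2 : ℝ) := by norm_num
    rw [this, ← Real.sqrt_eq_rpow]
    have ht0 : (0 : ℝ) ≤ t := t.2
    rw [Real.sqrt_le_left (by positivity)]
    nlinarith
  calc ε / (1 + (t : ℝ)) * (t : ℝ) ^ (1 / (2 : ℝ≥0∞).toReal) ≤ ε / (1 + t) * (1 + t) := by gcongr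
    _ = ε := by field_simp

end Link

/-! ### Simple processes and the Itô graph -/

section SimpleLink

variable {Ω : Type*} {mΩ : MeasurableSpace Ω} {P : Measure Ω} [IsProbabilityMeasure P]
  {𝓕 : Filtration ℝ≥0 mΩ} {W : ℝ≥0 → Ω → ℝ}
  {H : Type*} [NormedAddCommGroup H] [InnerProductSpace ℝ H] [CompleteSpace H]

/-- An elementary integrand in the graph, with its values. -/
theorem exists_generator (hW : IsFBrownianMotion 𝓕 P W) {a b t : ℝ≥0} (hab : a ≤ b) {η : Ω → H}
    (hη : StronglyMeasurable[𝓕 a] η) (hη2 : MemLp η 2 P) :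
    ∃ p ∈ Submodule.span ℝ (itoGenerators 𝓕 P W t),
      (∀ᵐ s ∂timeMeasure, p.1 s =ᵐ[P] fun ω => (Set.Icc 0 t).indicator
        (fun s => (Set.Ioc a b).indicator (fun _ => η ω) s) s) ∧
      p.2 =ᵐ[P] fun ω => (W (min b t) ω - W (min a t) ω) • η ω := by
  rcases le_total a t with hat | hta
  · have hab' : a ≤ min b t := le_min hab hat
    refine ⟨(indicatorConstLp 2 measurableSet_Ioc (timeMeasure_Ioc_ne_top a (min b t))
      (hη2.toLp η), (hW.memLp_sub_smul hab' hη hη2).toLp _),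
      Submodule.subset_span ⟨a, min b t, hab', min_le_right _ _, η, hη2, hη, rfl,
        (hW.memLp_sub_smul hab' hη hη2).coeFn_toLp⟩, ?_, ?_⟩
    · filter_upwards [indicatorConstLp_coeFn (p := 2) (μ := timeMeasure) (hs := measurableSet_Ioc)
        (hμs := timeMeasure_Ioc_ne_top a (min b t)) (c := hη2.toLp η)] with s hs
      simp only [hs]
      by_cases h : s ∈ Set.Ioc a (min b t)
      · have h1 : s ∈ Set.Icc 0 t := ⟨zero_le, h.2.trans (min_le_right _ _)⟩
        have h2 : s ∈ Set.Ioc a b := ⟨h.1, h.2.trans (min_le_left _ _)⟩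
        simp only [Set.indicator_of_mem h, Set.indicator_of_mem h1, Set.indicator_of_mem h2]
        exact hη2.coeFn_toLp
      · simp only [Set.indicator_of_notMem h]
        filter_upwards [Lp.coeFn_zero H 2 P] with ω hω
        rw [hω]
        by_cases h1 : s ∈ Set.Icc 0 t
        · have h2 : s ∉ Set.Ioc a b := fun h2 => h ⟨h2.1, le_min h2.2 h1.2⟩
          simp [h1, h2]
        · simp [h1]
    · rw [min_eq_left hat]
      exact (hW.memLp_sub_smul hab' hη hη2).coeFn_toLp
  · refine ⟨0, zero_mem _, ?_, ?_⟩
    · filter_upwards [Lp.coeFn_zero (Lp H 2 P) 2 timeMeasure] with s hs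
      simp only [Prod.fst_zero, hs, Pi.zero_apply]
      filter_upwards [Lp.coeFn_zero H 2 P] with ω hω
      rw [hω]
      by_cases h1 : s ∈ Set.Icc 0 t
      · have h2 : s ∉ Set.Ioc a b := fun h2 => absurd (h1.2.trans hta) (not_le.2 h2.1)
        simp [h1, h2]
      · simp [h1]
    · rw [min_eq_right hta, min_eq_right (hta.trans hab)]
      simp only [Prod.snd_zero, sub_self, zero_smul]
      exact Lp.coeFn_zero H 2 P

theorem SimpleProcess.exists_mem_span (hW : IsFBrownianMotion 𝓕 P W) (t : ℝ≥0)
    (φ : SimpleProcess 𝓕 P H) :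
    ∃ p ∈ Submodule.span ℝ (itoGenerators 𝓕 P W t),
      (∀ᵐ s ∂timeMeasure, p.1 s =ᵐ[P] fun ω => (Set.Icc 0 t).indicator
        (fun s => φ.value s ω) s) ∧ p.2 =ᵐ[P] φ.integral W t := by
  choose p hp hp1 hp2 using fun i => exists_generator hW (t := t) (φ.a_le_b i)
    (φ.measurable i) (φ.memLp i)
  refine ⟨∑ i, p i, sum_mem fun i _ => hp i, ?_, ?_⟩
  · rw [Prod.fst_sum]
    filter_upwards [Lp.coeFn_finsetSum Finset.univ fun i => (p i).1, ae_all_iff.2 hp1] with s h1 h2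
    rw [h1, Finset.sum_apply]
    filter_upwards [Lp.coeFn_finsetSum Finset.univ fun i => (p i).1 s, ae_all_iff.2 h2]
      with ω h3 h4
    rw [h3, Finset.sum_apply, Finset.sum_congr rfl fun i _ => h4 i]
    by_cases h : s ∈ Set.Icc 0 t <;> simp [h, SimpleProcess.value]
  · rw [Prod.snd_sum]
    filter_upwards [Lp.coeFn_finsetSum Finset.univ fun i => (p i).2, ae_all_iff.2 hp2] with ω h1 h2
    rw [h1, Finset.sum_apply, Finset.sum_congr rfl fun i _ => h2 i]
    rfl

/-- The linear operations are realised on simple processes: a sum concatenates the lists of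
intervals and a scalar multiplies the coefficients. This allows points of the closed graph to be
approximated by simple processes, as `IsItoIntegral` demands. -/
theorem exists_simpleProcess {t : ℝ≥0} {p : Lp (Lp H 2 P) 2 timeMeasure × Lp H 2 P}
    (hp : p ∈ Submodule.span ℝ (itoGenerators 𝓕 P W t)) :
    ∃ φ : SimpleProcess 𝓕 P H, (∀ᵐ s ∂timeMeasure, p.1 s =ᵐ[P] φ.value s) ∧
      p.2 =ᵐ[P] φ.integral W t := by
  induction hp using Submodule.span_induction with
  | mem p hp =>
    obtain ⟨a, b, hab, hbt, η, hη, hηm, h1, h2⟩ := hp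
    refine ⟨⟨1, fun _ => a, fun _ => b, fun _ => η, fun _ => hab, fun _ => hηm, fun _ => hη⟩,
      ?_, ?_⟩
    · rw [h1]
      filter_upwards [indicatorConstLp_coeFn (p := 2) (μ := timeMeasure) (hs := measurableSet_Ioc)
        (hμs := timeMeasure_Ioc_ne_top a b) (c := hη.toLp η)] with s hs
      rw [hs]
      by_cases h : s ∈ Set.Ioc a b
      · filter_upwards [hη.coeFn_toLp] with ω hω
        simp [SimpleProcess.value, h, hω]
      · filter_upwards [Lp.coeFn_zero H 2 P] with ω hω
        simp [SimpleProcess.value, h]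
    · filter_upwards [h2] with ω hω
      simp [SimpleProcess.integral, hω, min_eq_left hbt, min_eq_left (hab.trans hbt)]
  | zero =>
    refine ⟨⟨0, Fin.elim0, Fin.elim0, fun _ _ => 0, fun i => i.elim0, fun i => i.elim0,
      fun i => i.elim0⟩, ?_, ?_⟩
    · filter_upwards [Lp.coeFn_zero (Lp H 2 P) 2 timeMeasure] with s hs
      simp only [Prod.fst_zero, hs, Pi.zero_apply]
      filter_upwards [Lp.coeFn_zero H 2 P] with ω hω
      simp [SimpleProcess.value]
    · filter_upwards [Lp.coeFn_zero H 2 P] with ω hω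
      simp [SimpleProcess.integral]
  | add p q _ _ hp hq =>
    obtain ⟨φ, h1, h2⟩ := hp
    obtain ⟨ψ, h3, h4⟩ := hq
    refine ⟨⟨φ.n + ψ.n, Fin.append φ.a ψ.a, Fin.append φ.b ψ.b, Fin.append φ.η ψ.η, fun i => ?_,
      fun i => ?_, fun i => ?_⟩, ?_, ?_⟩
    · induction i using Fin.addCases <;> simp [φ.a_le_b, ψ.a_le_b]
    · induction i using Fin.addCases with
      | left i =>
        rw [Fin.append_left, Fin.append_left]
        exact φ.measurable i
      | right i =>
        rw [Fin.append_right, Fin.append_right]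
        exact ψ.measurable i
    · induction i using Fin.addCases <;> simp [φ.memLp, ψ.memLp]
    · filter_upwards [h1, h3, Lp.coeFn_add p.1 q.1] with s h1 h3 h5
      rw [Prod.fst_add, h5, Pi.add_apply]
      filter_upwards [h1, h3, Lp.coeFn_add (p.1 s) (q.1 s)] with ω h1 h3 h5
      rw [h5, Pi.add_apply, h1, h3]
      simp [SimpleProcess.value, Fin.sum_univ_add]
    · filter_upwards [h2, h4, Lp.coeFn_add p.2 q.2] with ω h2 h4 h5
      rw [Prod.snd_add, h5, Pi.add_apply, h2, h4]
      simp [SimpleProcess.integral, Fin.sum_univ_add]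
  | smul c p _ hp =>
    obtain ⟨φ, h1, h2⟩ := hp
    refine ⟨⟨φ.n, φ.a, φ.b, fun i ω => c • φ.η i ω, φ.a_le_b, fun i => (φ.measurable i).const_smul c,
      fun i => (φ.memLp i).const_smul c⟩, ?_, ?_⟩
    · filter_upwards [h1, Lp.coeFn_smul c p.1] with s h1 h5
      rw [Prod.smul_fst, h5, Pi.smul_apply]
      filter_upwards [h1, Lp.coeFn_smul c (p.1 s)] with ω h1 h5
      rw [h5, Pi.smul_apply, h1]
      simp only [SimpleProcess.value, Finset.smul_sum]
      refine Finset.sum_congr rfl fun i _ => ?_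
      by_cases h : s ∈ Set.Ioc (φ.a i) (φ.b i)
      · simp only [Set.indicator_of_mem h]
      · simp only [Set.indicator_of_notMem h, smul_zero]
    · filter_upwards [h2, Lp.coeFn_smul c p.2] with ω h2 h5
      rw [Prod.smul_snd, h5, Pi.smul_apply, h2]
      simp only [SimpleProcess.integral, Finset.smul_sum]
      exact Finset.sum_congr rfl fun i _ => smul_comm _ _ _

theorem SimpleProcess.stronglyMeasurable_value (φ : SimpleProcess 𝓕 P H) :
    StronglyMeasurable (fun p : ℝ≥0 × Ω => φ.value p.1 p.2) := by
  simp only [SimpleProcess.value]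
  refine Finset.stronglyMeasurable_fun_sum _ fun i _ => ?_
  have e : (fun p : ℝ≥0 × Ω => (Set.Ioc (φ.a i) (φ.b i)).indicator (fun _ => φ.η i p.2) p.1)
      = (Prod.fst ⁻¹' Set.Ioc (φ.a i) (φ.b i)).indicator (fun p : ℝ≥0 × Ω => φ.η i p.2) := by
    ext p
    by_cases h : p.1 ∈ Set.Ioc (φ.a i) (φ.b i) <;> simp [h, Set.indicator]
  rw [e]
  exact (((φ.measurable i).mono (𝓕.le _)).comp_measurable measurable_snd).indicator
    (measurable_fst measurableSet_Ioc)

/-- **Itô's isometry** for the difference of two simple processes. -/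
theorem SimpleProcess.eLpNorm_integral_sub (hW : IsFBrownianMotion 𝓕 P W) (t : ℝ≥0)
    (φ ψ : SimpleProcess 𝓕 P H) :
    eLpNorm (fun ω => φ.integral W t ω - ψ.integral W t ω) 2 P
      = normL2F P t (fun s ω => φ.value s ω - ψ.value s ω) := by
  obtain ⟨p, hp, hp1, hp2⟩ := φ.exists_mem_span hW t
  obtain ⟨q, hq, hq1, hq2⟩ := ψ.exists_mem_span hW t
  have h := norm_eq_of_mem_itoGraph hW (span_le_itoGraph t (sub_mem hp hq))
  have h1 : ‖(p - q).1‖ₑ = normL2F P t (fun s ω => φ.value s ω - ψ.value s ω) := by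
    refine enorm_eq_normL2F (φ.stronglyMeasurable_value.sub
      ψ.stronglyMeasurable_value).aestronglyMeasurable ?_
    filter_upwards [hp1, hq1, Lp.coeFn_sub p.1 q.1] with s h1 h2 h3
    rw [Prod.fst_sub, h3, Pi.sub_apply]
    filter_upwards [h1, h2, Lp.coeFn_sub (p.1 s) (q.1 s)] with ω h1 h2 h3
    rw [h3, Pi.sub_apply, h1, h2]
    by_cases h : s ∈ Set.Icc 0 t <;> simp [h]
  rw [← h1, ← ofReal_norm, h, ofReal_norm, Lp.enorm_def]
  refine eLpNorm_congr_ae ?_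
  filter_upwards [hp2, hq2, Lp.coeFn_sub p.2 q.2] with ω h1 h2 h3
  rw [Prod.snd_sub, h3, Pi.sub_apply, h1, h2]

theorem eLpNorm_sub_comm' {α : Type*} {mα : MeasurableSpace α} {μ : Measure α} (f g : α → H) :
    eLpNorm (fun x => f x - g x) 2 μ = eLpNorm (fun x => g x - f x) 2 μ :=
  eLpNorm_sub_comm f g 2 μ

theorem eLpNorm_sub_le_of_approx {α : Type*} {mα : MeasurableSpace α} {μ : Measure α}
    {f f' g g' : α → H} (hf : AEStronglyMeasurable f μ) (hf' : AEStronglyMeasurable f' μ)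
    (hg : AEStronglyMeasurable g μ) (hg' : AEStronglyMeasurable g' μ) :
    eLpNorm (fun x => g x - g' x) 2 μ ≤ eLpNorm (fun x => f x - f' x) 2 μ
      + eLpNorm (fun x => f x - g x) 2 μ + eLpNorm (fun x => f' x - g' x) 2 μ := by
  have e : (fun x => g x - g' x) = (f - f') - (f - g) + (f' - g') := by
    ext x; simp only [Pi.sub_apply, Pi.add_apply]; abel
  rw [e]
  refine (eLpNorm_add_le ((hf.sub hf').sub (hf.sub hg)) (hf'.sub hg') (by norm_num)).trans ?_
  exact add_le_add_left (eLpNorm_sub_le (hf.sub hf') (hf.sub hg) (by norm_num)) _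

/-- Itô's isometry for the approximating simple processes and the triangle inequality on both sides;
all errors vanish in the limit. The inequality suffices for uniqueness of the integral and for
Gronwall's argument. -/
theorem eLpNorm_sub_of_isItoIntegral (hW : IsFBrownianMotion 𝓕 P W) {t : ℝ≥0}
    {ζ ζ' : ℝ≥0 → Ω → H} {I I' : Ω → H} (h : IsItoIntegral 𝓕 P W t ζ I)
    (h' : IsItoIntegral 𝓕 P W t ζ' I') :
    eLpNorm (fun ω => I ω - I' ω) 2 P ≤ normL2F P t (fun s ω => ζ s ω - ζ' s ω) := by
  obtain ⟨hζ, hI, φ, h1, h2⟩ := h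
  obtain ⟨hζ', hI', φ', h1', h2'⟩ := h'
  have mI : ∀ ψ : SimpleProcess 𝓕 P H, AEStronglyMeasurable (ψ.integral W t) P := fun ψ => by
    obtain ⟨p, -, -, hp⟩ := ψ.exists_mem_span hW t
    exact (Lp.aestronglyMeasurable p.2).congr hp
  have mV : ∀ ψ : SimpleProcess 𝓕 P H, AEStronglyMeasurable
      (fun p : ℝ≥0 × Ω => ψ.value p.1 p.2) (timeProd P t) := fun ψ =>
    ψ.stronglyMeasurable_value.aestronglyMeasurable
  have key : ∀ k, eLpNorm (fun ω => I ω - I' ω) 2 P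
      ≤ normL2F P t (fun s ω => ζ s ω - ζ' s ω)
        + normL2F P t (fun s ω => (φ k).value s ω - ζ s ω)
        + normL2F P t (fun s ω => (φ' k).value s ω - ζ' s ω)
        + eLpNorm (fun ω => (φ k).integral W t ω - I ω) 2 P
        + eLpNorm (fun ω => (φ' k).integral W t ω - I' ω) 2 P := by
    intro k
    have a1 := eLpNorm_sub_le_of_approx (mI (φ k)) (mI (φ' k)) hI.1 hI'.1
    rw [(φ k).eLpNorm_integral_sub hW t (φ' k)] at a1
    refine a1.trans (add_le_add_left (add_le_add_left ?_ _) _)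
    have a2 := eLpNorm_sub_le_of_approx hζ.1 hζ'.1 (mV (φ k)) (mV (φ' k))
    rw [eLpNorm_sub_comm' (fun p : ℝ≥0 × Ω => ζ p.1 p.2)
      (fun p : ℝ≥0 × Ω => (φ k).value p.1 p.2), eLpNorm_sub_comm' (fun p : ℝ≥0 × Ω => ζ' p.1 p.2)
      (fun p : ℝ≥0 × Ω => (φ' k).value p.1 p.2)] at a2
    exact a2
  have hlim := ((((tendsto_const_nhds (x := normL2F P t (fun s ω => ζ s ω - ζ' s ω))
    (f := atTop)).add h1).add h1').add h2).add h2'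
  simp only [add_zero] at hlim
  exact ge_of_tendsto' hlim key

/-- A point of the closure is the limit of a sequence in the span, and each member of the span comes
from a simple process. The approximants may not vanish beyond `t`, but only their part on `[0, t]`
enters the norm to be estimated. -/
theorem isItoIntegral_of_mem_itoGraph {t : ℝ≥0}
    {ζ : ℝ≥0 → Ω → H}
    (hζ : AEStronglyMeasurable (fun p : ℝ≥0 × Ω => ζ p.1 p.2) (timeProd P t))
    {v : Lp (Lp H 2 P) 2 timeMeasure} {I : Lp H 2 P} (hvI : (v, I) ∈ itoGraph 𝓕 P W t)
    (hv : ∀ᵐ s ∂timeMeasure, v s =ᵐ[P] fun ω => (Set.Icc 0 t).indicator (fun s => ζ s ω) s)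
    {J : Ω → H} (hJ : I =ᵐ[P] J) :
    IsItoIntegral 𝓕 P W t ζ J := by
  refine ⟨⟨hζ, ?_⟩, (Lp.memLp I).ae_eq hJ, ?_⟩
  · have := enorm_eq_normL2F hζ hv
    rw [normL2F] at this
    rw [← this]
    exact enorm_lt_top
  obtain ⟨p, hp, hpt⟩ := mem_closure_iff_seq_limit.1 hvI
  choose φ hφ1 hφ2 using fun k => exists_simpleProcess (hp k)
  rw [nhds_prod_eq, tendsto_prod_iff'] at hpt
  have g1 : Tendsto (fun k => ‖(p k).1 - v‖ₑ) atTop (𝓝 0) := by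
    have := hpt.1.sub_const v
    rw [sub_self] at this
    simpa using this.enorm
  have g2 : Tendsto (fun k => ‖(p k).2 - I‖ₑ) atTop (𝓝 0) := by
    have := hpt.2.sub_const I
    rw [sub_self] at this
    simpa using this.enorm
  refine ⟨φ, ?_, ?_⟩
  · refine tendsto_of_tendsto_of_tendsto_of_le_of_le tendsto_const_nhds g1 (fun _ => zero_le)
      fun k => ?_
    have hm : AEStronglyMeasurable (fun p : ℝ≥0 × Ω => (φ k).value p.1 p.2 - ζ p.1 p.2)
        (timeProd P t) := (φ k).stronglyMeasurable_value.aestronglyMeasurable.sub hζ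
    rw [← sq_le_sq_ennreal, normL2F_sq hm, Lp_enorm_sq, ← lintegral_indicator measurableSet_Icc]
    refine lintegral_mono_ae ?_
    filter_upwards [hφ1 k, hv, Lp.coeFn_sub (p k).1 v] with s h1 h2 h3
    by_cases h : s ∈ Set.Icc 0 t
    · rw [Set.indicator_of_mem h, h3, Pi.sub_apply, Lp.enorm_def]
      refine le_of_eq (congrArg (· ^ 2) (eLpNorm_congr_ae ?_))
      filter_upwards [h1, h2, Lp.coeFn_sub ((p k).1 s) (v s)] with ω h1 h2 h3
      rw [h3, Pi.sub_apply, h1, h2, Set.indicator_of_mem h]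
    · rw [Set.indicator_of_notMem h]
      exact zero_le
  · refine g2.congr fun k => ?_
    rw [Lp.enorm_def]
    refine eLpNorm_congr_ae ?_
    filter_upwards [hφ2 k, hJ, Lp.coeFn_sub (p k).2 I] with ω h1 h2 h3
    rw [h3, Pi.sub_apply, h1, h2]

end SimpleLink

/-! ### Integrals over the time axis -/

/-- The bridge to Lebesgue measure on `ℝ`: explicit integrals and the fundamental theorem of
calculus are taken there. -/
theorem map_coe_timeMeasure_restrict (a b : ℝ≥0) :
    (timeMeasure.restrict (Set.Icc a b)).map ((↑) : ℝ≥0 → ℝ)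
      = volume.restrict (Set.Icc (a : ℝ) b) := by
  have h : Set.Icc a b = ((↑) : ℝ≥0 → ℝ) ⁻¹' Set.Icc (a : ℝ) b := by
    ext x; simp
  rw [h, ← measurableEmbedding_coe.restrict_map, timeMeasure, measurableEmbedding_coe.map_comap,
    Measure.restrict_restrict measurableSet_Icc, Set.inter_eq_left.2]
  intro x hx
  exact ⟨⟨x, a.2.trans hx.1⟩, rfl⟩

theorem setLIntegral_timeMeasure (a b : ℝ≥0) (f : ℝ → ℝ≥0∞) :
    ∫⁻ s in Set.Icc a b, f s ∂timeMeasure = ∫⁻ x in Set.Icc (a : ℝ) b, f x := by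
  rw [← map_coe_timeMeasure_restrict, measurableEmbedding_coe.lintegral_map]

theorem setIntegral_timeMeasure {F : Type*} [NormedAddCommGroup F] [NormedSpace ℝ F]
    (a b : ℝ≥0) (f : ℝ → F) :
    ∫ s in Set.Icc a b, f s ∂timeMeasure = ∫ x in Set.Icc (a : ℝ) b, f x := by
  rw [← map_coe_timeMeasure_restrict, measurableEmbedding_coe.integral_map]

theorem setLIntegral_exp_le {β : ℝ} (hβ : 0 < β) (t : ℝ≥0) :
    ∫⁻ s in Set.Icc 0 t, ENNReal.ofReal (Real.exp (β * s)) ∂timeMeasure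
      ≤ ENNReal.ofReal (Real.exp (β * t) / β) := by
  rw [setLIntegral_timeMeasure 0 t fun x => ENNReal.ofReal (Real.exp (β * x)),
    ← ofReal_integral_eq_lintegral_ofReal]
  · refine ENNReal.ofReal_le_ofReal ?_
    rw [NNReal.coe_zero, integral_Icc_eq_integral_Ioc, ← intervalIntegral.integral_of_le t.coe_nonneg,
      intervalIntegral.integral_comp_mul_left (fun x => Real.exp x) hβ.ne', integral_exp,
      smul_eq_mul, inv_mul_eq_div]
    gcongr
    have := Real.exp_pos (β * 0)
    linarith
  · exact (by fun_prop : Continuous fun x : ℝ => Real.exp (β * x)).integrableOn_Icc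
  · exact ae_of_all _ fun x => (Real.exp_pos _).le

theorem sq_lintegral_mul_le {α : Type*} {mα : MeasurableSpace α} {μ : Measure α}
    {f g : α → ℝ≥0∞} (hf : AEMeasurable f μ) (hg : AEMeasurable g μ) :
    (∫⁻ x, f x * g x ∂μ) ^ 2 ≤ (∫⁻ x, f x ^ 2 ∂μ) * ∫⁻ x, g x ^ 2 ∂μ := by
  have h := ENNReal.lintegral_mul_le_Lp_mul_Lq μ Real.HolderConjugate.two_two hf hg
  have e : ∀ a : ℝ≥0∞, (a ^ (1 / (2 : ℝ))) ^ 2 = a := fun a => by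
    rw [← ENNReal.rpow_natCast, ← ENNReal.rpow_mul]
    norm_num
  calc _ ≤ ((∫⁻ x, f x ^ (2 : ℝ) ∂μ) ^ (1 / (2 : ℝ)) * (∫⁻ x, g x ^ (2 : ℝ) ∂μ) ^ (1 / (2 : ℝ))) ^ 2 :=
        pow_le_pow_left' h 2
    _ = _ := by
        rw [mul_pow, e, e]
        simp

theorem sq_setLIntegral_le {f : ℝ≥0 → ℝ≥0∞} (t : ℝ≥0)
    (hf : AEMeasurable f (timeMeasure.restrict (Set.Icc 0 t))) :
    (∫⁻ s in Set.Icc 0 t, f s ∂timeMeasure) ^ 2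
      ≤ t * ∫⁻ s in Set.Icc 0 t, f s ^ 2 ∂timeMeasure := by
  have h := sq_lintegral_mul_le (f := fun _ => 1) aemeasurable_const hf
  simpa [timeMeasure_Icc] using h

theorem add_sq_le_two_mul (a b : ℝ≥0∞) : (a + b) ^ 2 ≤ 2 * (a ^ 2 + b ^ 2) := by
  have := ENNReal.rpow_add_le_mul_rpow_add_rpow a b (p := 2) (by norm_num)
  norm_num at this
  exact this

/-! ### Strongly continuous semigroups -/

namespace IsC0Semigroup

variable {𝕜 : Type*} [RCLike 𝕜] {H : Type*} [NormedAddCommGroup H] [NormedSpace 𝕜 H]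
  {T : ℝ≥0 → H →L[𝕜] H}

theorem add_apply (hT : IsC0Semigroup T) (s t : ℝ≥0) (x : H) : T (s + t) x = T s (T t x) := by
  rw [hT.map_add]; rfl

theorem zero_apply (hT : IsC0Semigroup T) (x : H) : T 0 x = x := by
  rw [hT.map_zero]; rfl

theorem comm_apply (hT : IsC0Semigroup T) (s t : ℝ≥0) (x : H) : T s (T t x) = T t (T s x) := by
  rw [← hT.add_apply, ← hT.add_apply, add_comm]

/-- Uniform boundedness gives a bound `M` on some interval `[0, δ]`, and the semigroup law turns it
into `M ^ k` on `[0, k δ]`. -/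
theorem exists_bound [CompleteSpace H] (hT : IsC0Semigroup T) (N : ℝ≥0) :
    ∃ M : ℝ≥0, 1 ≤ M ∧ ∀ t ≤ N, ‖T t‖ ≤ M := by
  obtain ⟨δ, hδ, M, hM1, hM⟩ : ∃ δ > 0, ∃ M : ℝ≥0, 1 ≤ M ∧ ∀ t ≤ δ, ‖T t‖ ≤ M := by
    -- Otherwise there are times `t n → 0` with `‖T (t n)‖ > n + 1`. All orbits converge along this
    -- sequence, so the Banach–Steinhaus theorem bounds the norms, a contradiction.
    by_contra! hcon
    choose! t ht htn using fun n : ℕ => hcon (1 / ((n : ℝ≥0) + 1)) (by positivity)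
      ((n : ℝ≥0) + 1) (by simp)
    have ht0 : Tendsto t atTop (𝓝 0) := by
      refine tendsto_of_tendsto_of_tendsto_of_le_of_le tendsto_const_nhds
        (tendsto_one_div_add_atTop_nhds_zero_nat (𝕜 := ℝ≥0)) (fun _ => zero_le) ht
    obtain ⟨C, hC⟩ := banach_steinhaus (g := fun n => T (t n)) fun x => by
      obtain ⟨B, hB⟩ := ((hT.tendsto_zero x).comp ht0).norm.bddAbove_range
      exact ⟨B, fun n => hB ⟨n, rfl⟩⟩
    obtain ⟨n, hn⟩ := exists_nat_gt C
    have h1 := htn n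
    have h2 := hC n
    push_cast at h1
    linarith
  have hk : ∀ k : ℕ, ∀ t ≤ k * δ, ‖T t‖ ≤ (M : ℝ) ^ k := by
    have hM1' : (1 : ℝ) ≤ M := by exact_mod_cast hM1
    intro k
    induction k with
    | zero =>
      intro t ht
      have : t = 0 := by simpa using ht
      rw [this, hT.map_zero, pow_zero]
      exact ContinuousLinearMap.norm_id_le
    | succ k ih =>
      intro t ht
      rcases le_total t δ with h | h
      · exact (hM t h).trans (le_self_pow₀ hM1' (by omega))
      · have e : t = δ + (t - δ) := (add_tsub_cancel_of_le h).symm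
        rw [e, hT.map_add, pow_succ']
        refine (ContinuousLinearMap.opNorm_comp_le _ _).trans ?_
        refine mul_le_mul (hM δ le_rfl) (ih _ ?_) (norm_nonneg _) (by positivity)
        rw [tsub_le_iff_right]
        refine ht.trans (le_of_eq ?_)
        push_cast; ring
  obtain ⟨k, hk'⟩ := exists_nat_ge (N / δ)
  refine ⟨M ^ k, one_le_pow₀ hM1, fun t ht => ?_⟩
  push_cast
  exact hk k t (ht.trans ((div_le_iff₀ hδ).1 hk'))

theorem continuous_uncurry [CompleteSpace H] (hT : IsC0Semigroup T) :
    Continuous fun p : ℝ≥0 × H => T p.1 p.2 := by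
  rw [continuous_iff_continuousAt]
  rintro ⟨t₀, x₀⟩
  obtain ⟨M, hM1, hM⟩ := hT.exists_bound (t₀ + 1)
  -- With truncated subtraction one of the two summands is zero, so the sum is `|t - t₀|`. This
  -- treats both sides of `t₀` at once.
  have hd : Tendsto (fun t : ℝ≥0 => (t - t₀) + (t₀ - t)) (𝓝 t₀) (𝓝 0) := by
    have : Continuous fun t : ℝ≥0 => (t - t₀) + (t₀ - t) := by fun_prop
    simpa using this.tendsto t₀
  have h0 : Tendsto (fun t : ℝ≥0 => M * ‖T ((t - t₀) + (t₀ - t)) x₀ - x₀‖) (𝓝 t₀) (𝓝 0) := by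
    have := (((hT.tendsto_zero x₀).comp hd).sub_const x₀).norm.const_mul (M : ℝ)
    simpa using this
  have hev : ∀ᶠ t in 𝓝 t₀, t ≤ t₀ + 1 := by
    filter_upwards [Iio_mem_nhds (lt_add_one t₀)] with t ht using le_of_lt ht
  have hx : Tendsto (fun x : H => (M : ℝ) * ‖x - x₀‖) (𝓝 x₀) (𝓝 0) := by
    have : Continuous fun x : H => (M : ℝ) * ‖x - x₀‖ := by fun_prop
    simpa using this.tendsto x₀
  rw [ContinuousAt, tendsto_iff_norm_sub_tendsto_zero, nhds_prod_eq]
  have hsum := (hx.comp (tendsto_snd (f := 𝓝 t₀))).add (h0.comp (tendsto_fst (g := 𝓝 x₀)))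
  rw [add_zero] at hsum
  refine squeeze_zero' (Eventually.of_forall fun _ => norm_nonneg _) ?_ hsum
  filter_upwards [tendsto_fst.eventually hev] with p hp
  simp only [Function.comp_apply]
  have h1 : T p.1 p.2 - T t₀ x₀ = T p.1 (p.2 - x₀) + (T p.1 x₀ - T t₀ x₀) := by
    rw [map_sub]; abel
  rw [h1]
  refine (norm_add_le _ _).trans (add_le_add ?_ ?_)
  · exact (T p.1).le_of_opNorm_le (hM _ hp) _
  · rcases le_total p.1 t₀ with h | h
    · have e : T t₀ x₀ = T p.1 (T (t₀ - p.1) x₀) := by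
        rw [← hT.add_apply, add_tsub_cancel_of_le h]
      rw [tsub_eq_zero_of_le h, zero_add, e, ← map_sub, ← norm_neg, ← map_neg, neg_sub]
      exact (T p.1).le_of_opNorm_le (hM _ hp) _
    · have e : T p.1 x₀ = T t₀ (T (p.1 - t₀) x₀) := by
        rw [← hT.add_apply, add_tsub_cancel_of_le h]
      rw [tsub_eq_zero_of_le h, add_zero, e, ← map_sub]
      exact (T t₀).le_of_opNorm_le (hM _ (by simp)) _

theorem continuous_apply [CompleteSpace H] (hT : IsC0Semigroup T) (x : H) :
    Continuous fun t => T t x :=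
  hT.continuous_uncurry.comp (by fun_prop : Continuous fun t : ℝ≥0 => (t, x))

end IsC0Semigroup

/-! ### Lifting operators to `L²(Ω, H)` -/

section Lift

variable {Ω : Type*} {mΩ : MeasurableSpace Ω} {P : Measure Ω} 
  {H : Type*} [NormedAddCommGroup H] [NormedSpace ℝ H]
  {H' : Type*} [NormedAddCommGroup H'] [NormedSpace ℝ H']
  {H'' : Type*} [NormedAddCommGroup H''] [NormedSpace ℝ H'']

theorem compLpL_comp (K : H' →L[ℝ] H'') (K' : H →L[ℝ] H') (x : Lp H 2 P) :
    (K.comp K').compLpL 2 P x = K.compLpL 2 P (K'.compLpL 2 P x) := by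
  apply Lp.ext
  filter_upwards [(K.comp K').coeFn_compLpL x, K.coeFn_compLpL (K'.compLpL 2 P x),
    K'.coeFn_compLpL x] with ω h1 h2 h3
  rw [h1, h2, h3]; rfl

theorem compLpL_sub (K K' : H →L[ℝ] H') (x : Lp H 2 P) :
    (K - K').compLpL 2 P x = K.compLpL 2 P x - K'.compLpL 2 P x := by
  apply Lp.ext
  filter_upwards [(K - K').coeFn_compLpL x, K.coeFn_compLpL x, K'.coeFn_compLpL x,
    Lp.coeFn_sub (K.compLpL 2 P x) (K'.compLpL 2 P x)] with ω h1 h2 h3 h4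
  rw [h1, h4, Pi.sub_apply, h2, h3]; rfl

theorem norm_compLpL_le' (K : H →L[ℝ] H') {M : ℝ} (hM : ‖K‖ ≤ M) (x : Lp H 2 P) :
    ‖K.compLpL 2 P x‖ ≤ M * ‖x‖ :=
  (K.norm_compLp_le x).trans (by gcongr)

/-- Strong convergence of uniformly bounded operators lifts to `L²(Ω, H)` by dominated convergence.
It gives the strong continuity of the lifted semigroup and the convergence of the lifted smoothing
operators. -/
theorem tendsto_compLpL {ι : Type*} {l : Filter ι} [l.IsCountablyGenerated]
    {K : ι → H →L[ℝ] H'} {K₀ : H →L[ℝ] H'} {M : ℝ≥0} (hM : ∀ᶠ i in l, ‖K i‖ ≤ M)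
    (hK : ∀ x, Tendsto (fun i => K i x) l (𝓝 (K₀ x))) (x : Lp H 2 P) :
    Tendsto (fun i => (K i).compLpL 2 P x) l (𝓝 (K₀.compLpL 2 P x)) := by
  rw [tendsto_iff_norm_sub_tendsto_zero]
  have hsq : Tendsto (fun i => ‖(K i).compLpL 2 P x - K₀.compLpL 2 P x‖ₑ ^ 2) l (𝓝 0) := by
    have e : ∀ i, ‖(K i).compLpL 2 P x - K₀.compLpL 2 P x‖ₑ ^ 2
        = ∫⁻ ω, ‖K i (x ω) - K₀ (x ω)‖ₑ ^ 2 ∂P := fun i => by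
      rw [← compLpL_sub, Lp_enorm_sq]
      refine lintegral_congr_ae ?_
      filter_upwards [(K i - K₀).coeFn_compLpL x] with ω h1
      rw [h1]; rfl
    simp_rw [e]
    have h0 : (0 : ℝ≥0∞) = ∫⁻ _ : Ω, 0 ∂P := by simp
    rw [h0]
    refine tendsto_lintegral_filter_of_dominated_convergence
      (fun ω => ((M + ‖K₀‖₊ : ℝ≥0) * ‖x ω‖ₑ) ^ 2) ?_ ?_ ?_ ?_
    · exact Eventually.of_forall fun i =>
        ((((K i).continuous.comp_stronglyMeasurable (Lp.stronglyMeasurable x)).sub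
        (K₀.continuous.comp_stronglyMeasurable (Lp.stronglyMeasurable x))).enorm.pow_const 2)
    · filter_upwards [hM] with i hi
      refine ae_of_all _ fun ω => pow_le_pow_left' ?_ 2
      rw [← sub_apply, ← ofReal_norm, ← ofReal_norm,
        ← ENNReal.ofReal_coe_nnreal, ← ENNReal.ofReal_mul (by positivity)]
      refine ENNReal.ofReal_le_ofReal ((K i - K₀).le_of_opNorm_le ?_ _)
      refine (norm_sub_le _ _).trans ?_
      push_cast
      gcongr
    · simp_rw [mul_pow]
      rw [lintegral_const_mul' _ _ (by simp), ← Lp_enorm_sq]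
      exact ENNReal.mul_ne_top (by simp) (by simp)
    · refine ae_of_all _ fun ω => ?_
      have := ((hK (x ω)).sub_const (K₀ (x ω))).enorm
      rw [sub_self, enorm_zero] at this
      have := (ENNReal.continuous_pow 2).tendsto _ |>.comp this
      simpa [Function.comp_def] using this
  have h2 : Tendsto (fun i => (‖(K i).compLpL 2 P x - K₀.compLpL 2 P x‖ ^ 2)) l (𝓝 0) := by
    have := (ENNReal.tendsto_toReal (by simp)).comp hsq
    simpa [Function.comp_def] using this
  have h3 := h2.sqrt
  simpa using h3

theorem IsC0Semigroup.compLpL [CompleteSpace H] {T : ℝ≥0 → H →L[ℝ] H} (hT : IsC0Semigroup T) :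
    IsC0Semigroup fun t => (T t).compLpL 2 P where
  map_zero := by
    ext1 x
    apply Lp.ext
    filter_upwards [(T 0).coeFn_compLpL x] with ω h
    rw [h, hT.zero_apply]; rfl
  map_add s t := by
    ext1 x
    rw [hT.map_add, compLpL_comp]; rfl
  tendsto_zero x := by
    obtain ⟨M, -, hM⟩ := hT.exists_bound 1
    have h : (ContinuousLinearMap.id ℝ H).compLpL 2 P x = x := by
      apply Lp.ext
      filter_upwards [(ContinuousLinearMap.id ℝ H).coeFn_compLpL x] with ω h
      rw [h]; rfl
    have hev : ∀ᶠ t in 𝓝 (0 : ℝ≥0), ‖T t‖ ≤ M := by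
      filter_upwards [Iio_mem_nhds zero_lt_one] with t ht using hM t (le_of_lt ht)
    have := tendsto_compLpL (K := T) (K₀ := ContinuousLinearMap.id ℝ H) hev hT.tendsto_zero x
    rwa [h] at this

/-- The superposition operator `x ↦ G ∘ x` on `L²(Ω, H)` of a Lipschitz map `G`. -/
noncomputable def superposition [IsFiniteMeasure P] {L : ℝ≥0} {G : H → H'}
    (hG : LipschitzWith L G) (x : Lp H 2 P) : Lp H' 2 P :=
  MemLp.toLp (fun ω => G (x ω)) (by
    have h0 : LipschitzWith L fun x => G x - G 0 := by
      intro x y; simpa using hG x y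
    have h1 := h0.comp_memLp (by simp) (Lp.memLp x)
    have h2 := h1.add (memLp_const (G 0))
    refine h2.ae_eq (ae_of_all _ fun ω => ?_)
    simp)

theorem coeFn_superposition [IsFiniteMeasure P] {L : ℝ≥0} {G : H → H'}
    (hG : LipschitzWith L G) (x : Lp H 2 P) : superposition hG x =ᵐ[P] fun ω => G (x ω) :=
  MemLp.coeFn_toLp _

theorem lipschitzWith_superposition [IsFiniteMeasure P] {L : ℝ≥0} {G : H → H'}
    (hG : LipschitzWith L G) : LipschitzWith L (superposition (P := P) hG) := by
  refine LipschitzWith.of_dist_le_mul fun x y => ?_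
  rw [dist_eq_norm, dist_eq_norm]
  apply Lp.norm_le_mul_norm_of_ae_le_mul
  filter_upwards [coeFn_superposition hG x, coeFn_superposition hG y, Lp.coeFn_sub x y,
    Lp.coeFn_sub (superposition hG x) (superposition hG y)] with ω h1 h2 h3 h4
  rw [h4, h3, Pi.sub_apply, Pi.sub_apply, h1, h2, ← dist_eq_norm, ← dist_eq_norm]
  exact hG.dist_le_mul _ _

end Lift

/-! ### Gronwall's lemma -/

/-- Integrating the weight `e^{(4c+1)t}` costs a division by `4c + 1`, so one application of `c ∫`
contracts by the factor `1/4` in the weighted supremum norm. The same inequality drives Gronwall's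
lemma and the Picard iteration. -/
theorem le_exp_of_le_lintegral {N c : ℝ≥0} {φ ψ : ℝ≥0 → ℝ≥0∞} {a S : ℝ≥0∞}
    (h : ∀ t ≤ N, ψ t ≤ a + c * ∫⁻ s in Set.Icc 0 t, φ s ∂timeMeasure)
    (hφ : ∀ t ≤ N, φ t ≤ S * ENNReal.ofReal (Real.exp ((4 * c + 1) * t))) :
    ∀ t ≤ N, ψ t ≤ (a + S / 4) * ENNReal.ofReal (Real.exp ((4 * c + 1) * t)) := by
  intro t ht
  have hc : (0 : ℝ) < 4 * c + 1 := by positivity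
  have h1 : ∫⁻ s in Set.Icc 0 t, φ s ∂timeMeasure
      ≤ S * ENNReal.ofReal (Real.exp ((4 * c + 1) * t) / (4 * c + 1)) := by
    calc ∫⁻ s in Set.Icc 0 t, φ s ∂timeMeasure
        ≤ ∫⁻ s in Set.Icc 0 t, S * ENNReal.ofReal (Real.exp ((4 * c + 1) * s)) ∂timeMeasure :=
          setLIntegral_mono' measurableSet_Icc fun s hs => hφ s (hs.2.trans ht)
      _ = S * ∫⁻ s in Set.Icc 0 t, ENNReal.ofReal (Real.exp ((4 * c + 1) * s)) ∂timeMeasure :=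
          lintegral_const_mul _ (by fun_prop)
      _ ≤ _ := by gcongr; exact setLIntegral_exp_le hc t
  have h2 : (c : ℝ≥0∞) * ENNReal.ofReal (Real.exp ((4 * c + 1) * t) / (4 * c + 1))
      ≤ ENNReal.ofReal (Real.exp ((4 * c + 1) * t)) / 4 := by
    rw [← ENNReal.ofReal_coe_nnreal, ← ENNReal.ofReal_mul (by positivity),
      show (4 : ℝ≥0∞) = ENNReal.ofReal 4 by norm_num, ← ENNReal.ofReal_div_of_pos (by norm_num)]
    refine ENNReal.ofReal_le_ofReal ?_
    rw [← mul_div_assoc, div_le_div_iff₀ hc (by norm_num)]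
    have := Real.exp_pos ((4 * (c : ℝ) + 1) * t)
    nlinarith
  refine (h t ht).trans ?_
  rw [add_mul]
  refine add_le_add ?_ ?_
  · refine le_mul_of_one_le_right zero_le ?_
    rw [ENNReal.one_le_ofReal]
    exact Real.one_le_exp (by positivity)
  · calc (c : ℝ≥0∞) * ∫⁻ s in Set.Icc 0 t, φ s ∂timeMeasure
        ≤ c * (S * ENNReal.ofReal (Real.exp ((4 * c + 1) * t) / (4 * c + 1))) := by gcongr
      _ = S * (c * ENNReal.ofReal (Real.exp ((4 * c + 1) * t) / (4 * c + 1))) := by ring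
      _ ≤ S * (ENNReal.ofReal (Real.exp ((4 * c + 1) * t)) / 4) := by gcongr
      _ = _ := by rw [div_eq_mul_inv, div_eq_mul_inv]; ring

/-- Start from the crude bound `B` and iterate the contraction. After `n` steps the weighted bound
is `2a + B / 4^n`, since `a + 2a/4 ≤ 2a`; the finiteness of `B` lets the second term vanish. -/
theorem gronwall_lintegral {N c : ℝ≥0} {φ : ℝ≥0 → ℝ≥0∞} {a B : ℝ≥0∞} (hB : B ≠ ∞)
    (h : ∀ t ≤ N, φ t ≤ a + c * ∫⁻ s in Set.Icc 0 t, φ s ∂timeMeasure)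
    (hφ : ∀ t ≤ N, φ t ≤ B) :
    ∀ t ≤ N, φ t ≤ 2 * a * ENNReal.ofReal (Real.exp ((4 * c + 1) * t)) := by
  have hn : ∀ n : ℕ, ∀ t ≤ N,
      φ t ≤ (2 * a + B / 4 ^ n) * ENNReal.ofReal (Real.exp ((4 * c + 1) * t)) := by
    intro n
    induction n with
    | zero =>
      intro t ht
      refine (hφ t ht).trans ?_
      rw [pow_zero, div_one]
      refine le_add_self.trans (le_mul_of_one_le_right zero_le ?_)
      rw [ENNReal.one_le_ofReal]
      exact Real.one_le_exp (by positivity)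
    | succ n ih =>
      intro t ht
      refine (le_exp_of_le_lintegral h ih t ht).trans ?_
      refine mul_le_mul_left ?_ _
      have e : (B / 4 ^ n) / 4 = B / 4 ^ (n + 1) := by
        rw [pow_succ, div_eq_mul_inv, div_eq_mul_inv, div_eq_mul_inv, ENNReal.mul_inv (by simp)
          (by simp), mul_assoc]
      rw [ENNReal.add_div, e, ← add_assoc]
      refine add_le_add_left ?_ _
      have : 2 * a / 4 ≤ a := by
        refine ENNReal.div_le_of_le_mul ?_
        rw [mul_comm]
        gcongr
        norm_num
      calc a + 2 * a / 4 ≤ a + a := by gcongr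
        _ = 2 * a := (two_mul a).symm
  intro t ht
  have hlim : Tendsto (fun n : ℕ => (2 * a + B / 4 ^ n)
      * ENNReal.ofReal (Real.exp ((4 * c + 1) * t))) atTop
      (𝓝 ((2 * a + 0) * ENNReal.ofReal (Real.exp ((4 * c + 1) * t)))) := by
    refine ENNReal.Tendsto.mul_const (tendsto_const_nhds.add ?_) (Or.inr (by simp))
    have h4 : Tendsto (fun n : ℕ => B * ((4 : ℝ≥0∞)⁻¹) ^ n) atTop (𝓝 (B * 0)) :=
      ENNReal.Tendsto.const_mul (ENNReal.tendsto_pow_atTop_nhds_zero_of_lt_one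
        (by rw [ENNReal.inv_lt_one]; norm_num)) (Or.inr hB)
    rw [mul_zero] at h4
    refine h4.congr fun n => ?_
    rw [div_eq_mul_inv, ENNReal.inv_pow]
  rw [add_zero] at hlim
  exact ge_of_tendsto' hlim fun n => hn n t ht

/-! ### Volterra-type integrals depending on the upper limit -/

/-- Kernel and domain of integration both move with `t`. Away from the single point `s = t₀` the
integrand converges, and a bound on a compact square dominates it. The exponent 1 serves the drift,
the exponent 2 the stochastic integral. -/
theorem tendsto_lintegral_indicator_sub {F : Type*} [NormedAddCommGroup F] {h : ℝ≥0 → ℝ≥0 → F}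
    (hc : Continuous fun p : ℝ≥0 × ℝ≥0 => h p.1 p.2) (t₀ : ℝ≥0) {k : ℕ} (hk : k ≠ 0) :
    Tendsto (fun t => ∫⁻ s, ‖(Set.Icc 0 t).indicator (h t) s
      - (Set.Icc 0 t₀).indicator (h t₀) s‖ₑ ^ k ∂timeMeasure) (𝓝 t₀) (𝓝 0) := by
  have hK : IsCompact (Set.Icc 0 (t₀ + 1) ×ˢ Set.Icc 0 (t₀ + 1)) :=
    (isCompact_Icc (a := (0 : ℝ≥0))).prod isCompact_Icc
  obtain ⟨B, hB⟩ := hK.exists_bound_of_continuousOn hc.continuousOn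
  have hB0 : 0 ≤ B := (norm_nonneg _).trans (hB (0, 0) (by simp))
  have h0 : (0 : ℝ≥0∞) = ∫⁻ _ : ℝ≥0, 0 ∂timeMeasure := by simp
  have hev : ∀ᶠ t in 𝓝 t₀, t ≤ t₀ + 1 := by
    filter_upwards [Iio_mem_nhds (lt_add_one t₀)] with t ht using le_of_lt ht
  have hm : ∀ t, StronglyMeasurable (h t) := fun t =>
    (hc.comp (by fun_prop : Continuous fun s : ℝ≥0 => (t, s))).stronglyMeasurable
  have hbd : ∀ t ≤ t₀ + 1, ∀ s, ‖(Set.Icc 0 t).indicator (h t) s‖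
      ≤ (Set.Icc 0 (t₀ + 1)).indicator (fun _ => B) s := by
    intro t ht s
    by_cases hs : s ∈ Set.Icc 0 t
    · rw [Set.indicator_of_mem hs, Set.indicator_of_mem (Set.mem_Icc.2 ⟨hs.1, hs.2.trans ht⟩)]
      exact hB (t, s) ⟨⟨zero_le, ht⟩, ⟨zero_le, hs.2.trans ht⟩⟩
    · rw [Set.indicator_of_notMem hs, norm_zero]
      exact Set.indicator_nonneg (fun _ _ => hB0) s
  rw [h0]
  refine tendsto_lintegral_filter_of_dominated_convergence
    (fun s => (ENNReal.ofReal ((Set.Icc 0 (t₀ + 1)).indicator (fun _ => 2 * B) s)) ^ k) ?_ ?_ ?_ ?_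
  · exact Eventually.of_forall fun t => (((hm t).indicator measurableSet_Icc).sub
      ((hm t₀).indicator measurableSet_Icc)).enorm.pow_const k
  · filter_upwards [hev] with t ht
    refine ae_of_all _ fun s => pow_le_pow_left' ?_ k
    rw [← ofReal_norm]
    refine ENNReal.ofReal_le_ofReal ((norm_sub_le _ _).trans ?_)
    refine (add_le_add (hbd t ht s) (hbd t₀ (by simp) s)).trans (le_of_eq ?_)
    by_cases hs : s ∈ Set.Icc 0 (t₀ + 1)
    · simp only [Set.indicator_of_mem hs]; ring
    · simp only [Set.indicator_of_notMem hs]; ring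
  · have e : (fun s => (ENNReal.ofReal ((Set.Icc 0 (t₀ + 1)).indicator (fun _ => 2 * B) s)) ^ k)
        = (Set.Icc 0 (t₀ + 1)).indicator fun _ => ENNReal.ofReal (2 * B) ^ k := by
      ext s
      by_cases hs : s ∈ Set.Icc 0 (t₀ + 1)
      · simp only [Set.indicator_of_mem hs]
      · simp only [Set.indicator_of_notMem hs, ENNReal.ofReal_zero]
        exact zero_pow hk
    rw [e, lintegral_indicator measurableSet_Icc, setLIntegral_const]
    exact ENNReal.mul_ne_top (ENNReal.pow_ne_top ENNReal.ofReal_ne_top)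
      (timeMeasure_Icc_ne_top _ _)
  · have hne : ∀ᵐ s ∂timeMeasure, s ≠ t₀ := by
      simp [ae_iff, measure_singleton]
    filter_upwards [hne] with s hs
    have hlim : Tendsto (fun t => (Set.Icc 0 t).indicator (h t) s) (𝓝 t₀)
        (𝓝 ((Set.Icc 0 t₀).indicator (h t₀) s)) := by
      have hcs : Tendsto (fun t => h t s) (𝓝 t₀) (𝓝 (h t₀ s)) :=
        (hc.comp (by fun_prop : Continuous fun t : ℝ≥0 => (t, s))).tendsto t₀
      rcases lt_or_gt_of_ne hs with hlt | hgt
      · have h2 : ∀ᶠ t in 𝓝 t₀, (Set.Icc 0 t).indicator (h t) s = h t s := by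
          filter_upwards [Ioi_mem_nhds hlt] with t ht
          exact Set.indicator_of_mem (Set.mem_Icc.2 ⟨zero_le, le_of_lt ht⟩) _
        rw [Set.indicator_of_mem (Set.mem_Icc.2 ⟨zero_le, hlt.le⟩)]
        exact hcs.congr' (h2.mono fun t ht => ht.symm)
      · have h2 : ∀ᶠ t in 𝓝 t₀, (Set.Icc 0 t).indicator (h t) s = 0 := by
          filter_upwards [Iio_mem_nhds hgt] with t ht
          exact Set.indicator_of_notMem (fun hh => absurd (Set.mem_Icc.1 hh).2 (not_le.2 ht)) _
        rw [Set.indicator_of_notMem (fun hh => absurd (Set.mem_Icc.1 hh).2 (not_le.2 hgt))]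
        exact tendsto_const_nhds.congr' (h2.mono fun t ht => ht.symm)
    have := (hlim.sub_const ((Set.Icc 0 t₀).indicator (h t₀) s)).enorm
    rw [sub_self, enorm_zero] at this
    have := ((ENNReal.continuous_pow k).tendsto _).comp this
    simpa [Function.comp_def, hk] using this

theorem continuous_setIntegral_volterra {F : Type*} [NormedAddCommGroup F] [NormedSpace ℝ F]
    {h : ℝ≥0 → ℝ≥0 → F} (hc : Continuous fun p : ℝ≥0 × ℝ≥0 => h p.1 p.2) :
    Continuous fun t => ∫ s in Set.Icc 0 t, h t s ∂timeMeasure := by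
  have hi : ∀ t, Integrable ((Set.Icc 0 t).indicator (h t)) timeMeasure := fun t => by
    rw [integrable_indicator_iff measurableSet_Icc]
    exact ((hc.comp (by fun_prop : Continuous fun s : ℝ≥0 => (t, s))).continuousOn
      ).integrableOn_compact isCompact_Icc
  rw [continuous_iff_continuousAt]
  intro t₀
  simp_rw [← integral_indicator measurableSet_Icc]
  refine tendsto_integral_of_L1 _ (hi t₀).1 (Eventually.of_forall hi) ?_
  simpa using tendsto_lintegral_indicator_sub hc t₀ one_ne_zero

/-! ### Existence of mild solutions as curves in `L²(Ω, H)` -/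

section Picard

variable {Ω : Type*} {mΩ : MeasurableSpace Ω} {P : Measure Ω} [IsProbabilityMeasure P]
  {𝓕 : Filtration ℝ≥0 mΩ} {W : ℝ≥0 → Ω → ℝ}
  {H : Type*} [NormedAddCommGroup H] [InnerProductSpace ℝ H] [CompleteSpace H]
  {H' : Type*} [NormedAddCommGroup H'] [InnerProductSpace ℝ H']
  {T : ℝ≥0 → H →L[ℝ] H} {G F : H → H} {L : ℝ≥0}

/-- A continuous curve in `L²(Ω, H)` that is adapted to the filtration. -/
structure IsAdaptedCurve (𝓕 : Filtration ℝ≥0 mΩ) (X : ℝ≥0 → Lp H 2 P) : Prop where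
  continuous : Continuous X
  adapted : ∀ t, AEStronglyMeasurable[𝓕 t] (X t) P

theorem aestronglyMeasurable_compLpL {m : MeasurableSpace Ω} (K : H →L[ℝ] H') {x : Lp H 2 P}
    (hx : AEStronglyMeasurable[m] x P) : AEStronglyMeasurable[m] (K.compLpL 2 P x) P :=
  (K.continuous.comp_aestronglyMeasurable hx).congr (K.coeFn_compLpL x).symm

theorem aestronglyMeasurable_superposition {m : MeasurableSpace Ω} (hG : LipschitzWith L G)
    {x : Lp H 2 P} (hx : AEStronglyMeasurable[m] x P) :
    AEStronglyMeasurable[m] (superposition hG x) P :=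
  (hG.continuous.comp_aestronglyMeasurable hx).congr (coeFn_superposition hG x).symm

theorem aestronglyMeasurable_add {m : MeasurableSpace Ω} {x y : Lp H 2 P}
    (hx : AEStronglyMeasurable[m] x P) (hy : AEStronglyMeasurable[m] y P) :
    AEStronglyMeasurable[m] (x + y : Lp H 2 P) P :=
  (AEStronglyMeasurable.add hx hy).congr (Lp.coeFn_add x y).symm

/-- The `𝓕 t`-measurable classes form a closed subspace, hence a closed convex set, which contains
the average of the curve. -/
theorem aestronglyMeasurable_setIntegral {t : ℝ≥0} {h : ℝ≥0 → Lp H 2 P} (hc : Continuous h)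
    (ha : ∀ s ≤ t, AEStronglyMeasurable[𝓕 t] (h s) P) :
    AEStronglyMeasurable[𝓕 t] (∫ s in Set.Icc 0 t, h s ∂timeMeasure : Lp H 2 P) P := by
  let S : Submodule ℝ (Lp H 2 P) := lpMeas H ℝ (𝓕 t) 2 P
  have hS : IsClosed (S : Set (Lp H 2 P)) := by
    have e : (S : Set (Lp H 2 P)) = {f : Lp H 2 P | AEStronglyMeasurable[𝓕 t] f P} := by
      ext p
      exact mem_lpMeas_iff_aestronglyMeasurable (𝕜 := ℝ)
    rw [e]
    exact isClosed_aestronglyMeasurable (𝓕.le t)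
  rw [← mem_lpMeas_iff_aestronglyMeasurable (𝕜 := ℝ)]
  change _ ∈ S
  by_cases h0 : timeMeasure (Set.Icc 0 t) = 0
  · rw [setIntegral_measure_zero _ h0]
    exact zero_mem _
  · have h1 := S.convex.set_average_mem hS h0 (timeMeasure_Icc_ne_top 0 t)
      ((ae_restrict_mem measurableSet_Icc).mono fun s hs =>
        (mem_lpMeas_iff_aestronglyMeasurable (𝕜 := ℝ)).2 (ha s (Set.mem_Icc.1 hs).2))
      (hc.continuousOn.integrableOn_compact isCompact_Icc)
    rw [setAverage_eq] at h1
    have h2 : timeMeasure.real (Set.Icc 0 t) ≠ 0 := by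
      rw [measureReal_def, ENNReal.toReal_ne_zero]
      exact ⟨h0, timeMeasure_Icc_ne_top 0 t⟩
    have h3 := S.smul_mem (timeMeasure.real (Set.Icc 0 t)) h1
    rwa [smul_inv_smul₀ h2] at h3

/-- `X'` arises from `X` by one step of the Picard iteration for the mild solution. -/
def IsPicardStep (𝓕 : Filtration ℝ≥0 mΩ) (P : Measure Ω) [IsProbabilityMeasure P]
    (W : ℝ≥0 → Ω → ℝ) (T : ℝ≥0 → H →L[ℝ] H) (hG : LipschitzWith L G) (hF : LipschitzWith L F)
    (ξ : Lp H 2 P) (X X' : ℝ≥0 → Lp H 2 P) : Prop :=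
  ∀ t, ∃ (v : Lp (Lp H 2 P) 2 timeMeasure) (I : Lp H 2 P), (v, I) ∈ itoGraph 𝓕 P W t ∧
    v =ᵐ[timeMeasure] (Set.Icc 0 t).indicator
      (fun s => (T (t - s)).compLpL 2 P (superposition hF (X s))) ∧
    X' t = (T t).compLpL 2 P ξ
      + ∫ s in Set.Icc 0 t, (T (t - s)).compLpL 2 P (superposition hG (X s)) ∂timeMeasure + I

theorem continuous_volterra_kernel (hT : IsC0Semigroup T) (hG : LipschitzWith L G)
    {X : ℝ≥0 → Lp H 2 P} (hX : Continuous X) :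
    Continuous fun p : ℝ≥0 × ℝ≥0 => (T (p.1 - p.2)).compLpL 2 P (superposition hG (X p.2)) := by
  have h1 : Continuous fun p : ℝ≥0 × ℝ≥0 => (p.1 - p.2, superposition hG (X p.2)) :=
    (continuous_fst.sub continuous_snd).prodMk
      ((lipschitzWith_superposition hG).continuous.comp (hX.comp continuous_snd))
  exact hT.compLpL.continuous_uncurry.comp h1

theorem continuous_volterra_kernel_right (hT : IsC0Semigroup T) (hG : LipschitzWith L G)
    {X : ℝ≥0 → Lp H 2 P} (hX : Continuous X) (t : ℝ≥0) :
    Continuous fun s : ℝ≥0 => (T (t - s)).compLpL 2 P (superposition hG (X s)) :=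
  (continuous_volterra_kernel hT hG hX).comp (by fun_prop : Continuous fun s : ℝ≥0 => (t, s))

theorem exists_picardStep (hW : IsFBrownianMotion 𝓕 P W) (hT : IsC0Semigroup T)
    (hG : LipschitzWith L G) (hF : LipschitzWith L F) {ξ : Lp H 2 P}
    (hξ : AEStronglyMeasurable[𝓕 0] ξ P) {X : ℝ≥0 → Lp H 2 P} (hX : IsAdaptedCurve 𝓕 X) :
    ∃ X', IsAdaptedCurve 𝓕 X' ∧ IsPicardStep 𝓕 P W T hG hF ξ X X' := by
  have hkF := continuous_volterra_kernel hT hF hX.continuous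
  have hkG := continuous_volterra_kernel hT hG hX.continuous
  have had : ∀ {K : H → H} (hK : LipschitzWith L K) (t s : ℝ≥0), AEStronglyMeasurable[𝓕 s]
      ((T (t - s)).compLpL 2 P (superposition hK (X s))) P := fun hK t s =>
    aestronglyMeasurable_compLpL _ (aestronglyMeasurable_superposition hK (hX.adapted s))
  choose I hI using fun t => exists_mem_itoGraph hW
    (continuous_volterra_kernel_right hT hF hX.continuous t) fun s (_ : s ≤ t) => had hF t s
  refine ⟨fun t => (T t).compLpL 2 P ξ
      + ∫ s in Set.Icc 0 t, (T (t - s)).compLpL 2 P (superposition hG (X s)) ∂timeMeasure + I t,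
    ⟨?_, ?_⟩, ?_⟩
  · refine ((hT.compLpL.continuous_apply ξ).add (continuous_setIntegral_volterra hkG)).add ?_
    rw [continuous_iff_continuousAt]
    intro t₀
    rw [ContinuousAt, tendsto_iff_edist_tendsto_0]
    have h := tendsto_lintegral_indicator_sub
      (h := fun t s => (T (t - s)).compLpL 2 P (superposition hF (X s))) hkF t₀ two_ne_zero
    -- Seen in the graph over the later of the two times, the difference of the integrals has the
    -- norm of the difference of the integrands. Continuity of the stochastic integral is thereby
    -- reduced to that of its truncated kernel.
    have e : ∀ t, ∫⁻ s, ‖(Set.Icc 0 t).indicator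
        (fun s => (T (t - s)).compLpL 2 P (superposition hF (X s))) s
        - (Set.Icc 0 t₀).indicator
          (fun s => (T (t₀ - s)).compLpL 2 P (superposition hF (X s))) s‖ₑ ^ 2 ∂timeMeasure
        = edist (I t) (I t₀) ^ 2 := by
      intro t
      have hm := sub_mem (itoGraph_mono (le_max_left t t₀) (hI t))
        (itoGraph_mono (le_max_right t t₀) (hI t₀))
      have hn := norm_eq_of_mem_itoGraph hW hm
      simp only [Prod.fst_sub, Prod.snd_sub] at hn
      rw [edist_eq_enorm_sub, ← ofReal_norm, ← hn, ofReal_norm,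
        Lp_enorm_sq]
      refine lintegral_congr_ae ?_
      have m1 := (memLp_indicator_of_continuous
        (continuous_volterra_kernel_right hT hF hX.continuous t) 0 t).coeFn_toLp
      have m2 := (memLp_indicator_of_continuous
        (continuous_volterra_kernel_right hT hF hX.continuous t₀) 0 t₀).coeFn_toLp
      filter_upwards [m1, m2, Lp.coeFn_sub
        ((memLp_indicator_of_continuous
          (continuous_volterra_kernel_right hT hF hX.continuous t) 0 t).toLp _)
        ((memLp_indicator_of_continuous
          (continuous_volterra_kernel_right hT hF hX.continuous t₀) 0 t₀).toLp _)]
        with s h1 h2 h3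
      rw [h3, Pi.sub_apply, h1, h2]
    have h' := h.congr e
    have h2 := (ENNReal.continuous_rpow_const (y := 1 / 2)).tendsto 0 |>.comp h'
    simp only [Function.comp_def, ← ENNReal.rpow_natCast, ← ENNReal.rpow_mul] at h2
    simpa using h2
  · intro t
    refine aestronglyMeasurable_add (aestronglyMeasurable_add ?_ ?_) ?_
    · exact aestronglyMeasurable_compLpL _ (hξ.mono (𝓕.mono zero_le))
    · exact aestronglyMeasurable_setIntegral
        (continuous_volterra_kernel_right hT hG hX.continuous t)
        fun s hs => (had hG t s).mono (𝓕.mono hs)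
    · exact aestronglyMeasurable_of_mem_itoGraph (hI t) hW
  · exact fun t => ⟨_, I t, hI t, MemLp.coeFn_toLp _, rfl⟩

theorem enorm_compLpL_superposition_sub_le (hG : LipschitzWith L G) {K : H →L[ℝ] H} {M : ℝ≥0}
    (hK : ‖K‖ ≤ M) (x y : Lp H 2 P) :
    ‖K.compLpL 2 P (superposition hG x) - K.compLpL 2 P (superposition hG y)‖ₑ
      ≤ (M * L : ℝ≥0) * ‖x - y‖ₑ := by
  rw [← map_sub]
  have h1 : ‖K.compLpL 2 P (superposition hG x - superposition hG y)‖
      ≤ (M * L : ℝ≥0) * ‖x - y‖ := by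
    refine (norm_compLpL_le' K hK _).trans ?_
    push_cast
    rw [mul_assoc]
    refine mul_le_mul_of_nonneg_left ?_ M.2
    have := (lipschitzWith_superposition (P := P) hG).dist_le_mul x y
    rwa [dist_eq_norm, dist_eq_norm] at this
  rw [← ofReal_norm, ← ofReal_norm, ← ENNReal.ofReal_coe_nnreal, ← ENNReal.ofReal_mul (NNReal.coe_nonneg _)]
  exact ENNReal.ofReal_le_ofReal h1

/-- One Picard step is Lipschitz in mean square, uniformly on bounded time intervals. -/
theorem exists_picardStep_bound (hW : IsFBrownianMotion 𝓕 P W) (hT : IsC0Semigroup T)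
    (hG : LipschitzWith L G) (hF : LipschitzWith L F) (N : ℝ≥0) :
    ∃ c : ℝ≥0, ∀ (ξ η : Lp H 2 P) (X Y X' Y' : ℝ≥0 → Lp H 2 P), Continuous X → Continuous Y →
      IsPicardStep 𝓕 P W T hG hF ξ X X' → IsPicardStep 𝓕 P W T hG hF η Y Y' → ∀ t ≤ N,
      ‖X' t - Y' t‖ₑ ^ 2 ≤ c * ‖ξ - η‖ₑ ^ 2
        + c * ∫⁻ s in Set.Icc 0 t, ‖X s - Y s‖ₑ ^ 2 ∂timeMeasure := by
  obtain ⟨M, hM1, hM⟩ := hT.exists_bound N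
  -- The terms needed are `2 M²` for the initial value and `4 (N + 1) (M L)²` for drift and noise.
  -- Their coefficients are merged into one constant, so that it serves both terms.
  refine ⟨4 * M ^ 2 + 4 * (N + 1) * (M * L) ^ 2, fun ξ η X Y X' Y' hX hY hX' hY' t ht => ?_⟩
  obtain ⟨v, I, hvI, hv, hXt⟩ := hX' t
  obtain ⟨w, J, hwJ, hw, hYt⟩ := hY' t
  set Q := ∫⁻ s in Set.Icc 0 t, ‖X s - Y s‖ₑ ^ 2 ∂timeMeasure with hQ
  have hbd : ∀ {K : H → H} (hK : LipschitzWith L K) (s : ℝ≥0),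
      ‖(T (t - s)).compLpL 2 P (superposition hK (X s))
        - (T (t - s)).compLpL 2 P (superposition hK (Y s))‖ₑ ^ 2
      ≤ ((M * L : ℝ≥0) : ℝ≥0∞) ^ 2 * ‖X s - Y s‖ₑ ^ 2 := fun hK s => by
    rw [← mul_pow]
    exact pow_le_pow_left' (enorm_compLpL_superposition_sub_le hK
      (hM _ (tsub_le_self.trans ht)) _ _) 2
  have hint : ∀ {K : H → H} (hK : LipschitzWith L K),
      ∫⁻ s in Set.Icc 0 t, ‖(T (t - s)).compLpL 2 P (superposition hK (X s))
        - (T (t - s)).compLpL 2 P (superposition hK (Y s))‖ₑ ^ 2 ∂timeMeasure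
      ≤ ((M * L : ℝ≥0) : ℝ≥0∞) ^ 2 * Q := fun hK => by
    rw [hQ, ← lintegral_const_mul' _ _ (ENNReal.pow_ne_top ENNReal.coe_ne_top)]
    exact lintegral_mono fun s => hbd hK s
  have h1 : ‖(T t).compLpL 2 P ξ - (T t).compLpL 2 P η‖ₑ ≤ M * ‖ξ - η‖ₑ := by
    rw [← map_sub, ← ofReal_norm, ← ofReal_norm, ← ENNReal.ofReal_coe_nnreal,
      ← ENNReal.ofReal_mul (NNReal.coe_nonneg _)]
    exact ENNReal.ofReal_le_ofReal (norm_compLpL_le' _ (hM t ht) _)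
  have h2 : ‖(∫ s in Set.Icc 0 t, (T (t - s)).compLpL 2 P (superposition hG (X s)) ∂timeMeasure)
      - ∫ s in Set.Icc 0 t, (T (t - s)).compLpL 2 P (superposition hG (Y s)) ∂timeMeasure‖ₑ ^ 2
      ≤ N * (((M * L : ℝ≥0) : ℝ≥0∞) ^ 2 * Q) := by
    have c1 := continuous_volterra_kernel_right hT hG hX t
    have c2 := continuous_volterra_kernel_right hT hG hY t
    rw [← integral_sub (c1.continuousOn.integrableOn_compact isCompact_Icc)
      (c2.continuousOn.integrableOn_compact isCompact_Icc)]
    refine (pow_le_pow_left' (enorm_integral_le_lintegral_enorm _) 2).trans ?_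
    refine (sq_setLIntegral_le t (c1.sub c2).enorm.measurable.aemeasurable).trans ?_
    exact mul_le_mul' (by exact_mod_cast ht) (hint hG)
  have h3 : ‖I - J‖ₑ ^ 2 ≤ ((M * L : ℝ≥0) : ℝ≥0∞) ^ 2 * Q := by
    have hn := norm_eq_of_mem_itoGraph hW (sub_mem hvI hwJ)
    simp only [Prod.fst_sub, Prod.snd_sub] at hn
    rw [← ofReal_norm, ← hn, ofReal_norm, Lp_enorm_sq]
    refine le_trans (le_of_eq ?_) (hint hF)
    rw [← lintegral_indicator measurableSet_Icc]
    refine lintegral_congr_ae ?_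
    filter_upwards [hv, hw, Lp.coeFn_sub v w] with s h1 h2 h3
    rw [h3, Pi.sub_apply, h1, h2]
    by_cases hs : s ∈ Set.Icc 0 t
    · simp only [Set.indicator_of_mem hs]
    · simp only [Set.indicator_of_notMem hs]
      simp
  have e : X' t - Y' t = ((T t).compLpL 2 P ξ - (T t).compLpL 2 P η)
      + (((∫ s in Set.Icc 0 t, (T (t - s)).compLpL 2 P (superposition hG (X s)) ∂timeMeasure)
      - ∫ s in Set.Icc 0 t, (T (t - s)).compLpL 2 P (superposition hG (Y s)) ∂timeMeasure)
      + (I - J)) := by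
    rw [hXt, hYt]; abel
  rw [e]
  refine (pow_le_pow_left' (enorm_add_le _ _) 2).trans ((add_sq_le_two_mul _ _).trans ?_)
  refine (mul_le_mul_right (add_le_add_right ((pow_le_pow_left' (enorm_add_le _ _) 2).trans
    (add_sq_le_two_mul _ _)) _) _).trans ?_
  refine (mul_le_mul_right (add_le_add (pow_le_pow_left' h1 2)
    (mul_le_mul_right (add_le_add h2 h3) _)) _).trans ?_
  push_cast
  set m : ℝ≥0∞ := (M : ℝ≥0∞)
  set l : ℝ≥0∞ := (L : ℝ≥0∞)
  set x := ‖ξ - η‖ₑ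
  set n : ℝ≥0∞ := (N : ℝ≥0∞)
  calc 2 * ((m * x) ^ 2 + 2 * (n * ((m * l) ^ 2 * Q) + (m * l) ^ 2 * Q))
      = 2 * m ^ 2 * x ^ 2 + 4 * (n + 1) * (m * l) ^ 2 * Q := by ring
    _ ≤ (2 * m ^ 2 * x ^ 2 + 4 * (n + 1) * (m * l) ^ 2 * Q)
        + (2 * m ^ 2 * x ^ 2 + 4 * m ^ 2 * Q + 4 * (n + 1) * (m * l) ^ 2 * x ^ 2) := le_self_add
    _ = _ := by ring

/-- In the weighted supremum norm of `le_exp_of_le_lintegral` squared distances of successive Picard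
iterates shrink by `1/4`, hence distances by `1/2`. The iterates converge locally uniformly, and the
limit stays continuous and adapted. -/
theorem exists_curve_fixedPoint (hW : IsFBrownianMotion 𝓕 P W) (hT : IsC0Semigroup T)
    (hG : LipschitzWith L G) (hF : LipschitzWith L F) {ξ : Lp H 2 P}
    (hξ : AEStronglyMeasurable[𝓕 0] ξ P) :
    ∃ X, IsAdaptedCurve 𝓕 X ∧ IsPicardStep 𝓕 P W T hG hF ξ X X := by
  choose! step hstep1 hstep2 using fun (X : ℝ≥0 → Lp H 2 P) (hX : IsAdaptedCurve 𝓕 X) =>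
    exists_picardStep hW hT hG hF hξ hX
  let X : ℕ → ℝ≥0 → Lp H 2 P := fun n => step^[n] (fun _ => 0)
  have hX0 : IsAdaptedCurve 𝓕 (X 0) := ⟨continuous_const, fun t =>
    (@stronglyMeasurable_zero _ _ (𝓕 t) _ _).aestronglyMeasurable.congr (Lp.coeFn_zero H 2 P).symm⟩
  have hXs : ∀ n, X (n + 1) = step (X n) := fun n => Function.iterate_succ_apply' _ _ _
  have hX : ∀ n, IsAdaptedCurve 𝓕 (X n) := by
    intro n
    induction n with
    | zero => exact hX0
    | succ n ih => rw [hXs]; exact hstep1 _ ih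
  have hXstep : ∀ n, IsPicardStep 𝓕 P W T hG hF ξ (X n) (X (n + 1)) := fun n => by
    rw [hXs]; exact hstep2 _ (hX n)
  have hgeo : ∀ N : ℝ≥0, ∃ C : ℝ, ∀ t ≤ N, ∀ n, dist (X n t) (X (n + 1) t) ≤ C / 2 / 2 ^ n := by
    intro N
    obtain ⟨c, hc⟩ := exists_picardStep_bound (P := P) (𝓕 := 𝓕) hW hT hG hF N
    obtain ⟨B, hB⟩ := (isCompact_Icc (a := (0 : ℝ≥0)) (b := N)).exists_bound_of_continuousOn
      ((hX 1).continuous.sub (hX 0).continuous).continuousOn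
    have hB0 : 0 ≤ B := (norm_nonneg _).trans (hB 0 (by simp))
    have key : ∀ n, ∀ t ≤ N, ‖X (n + 1) t - X n t‖ₑ ^ 2
        ≤ ENNReal.ofReal B ^ 2 / 4 ^ n * ENNReal.ofReal (Real.exp ((4 * c + 1) * t)) := by
      intro n
      induction n with
      | zero =>
        intro t ht
        rw [pow_zero, div_one]
        refine le_trans (pow_le_pow_left' ?_ 2) (le_mul_of_one_le_right zero_le ?_)
        · rw [← ofReal_norm]
          exact ENNReal.ofReal_le_ofReal (hB t (Set.mem_Icc.2 ⟨zero_le, ht⟩))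
        · rw [ENNReal.one_le_ofReal]
          exact Real.one_le_exp (by positivity)
      | succ n ih =>
        intro t ht
        refine (le_exp_of_le_lintegral (a := 0)
          (φ := fun t => ‖X (n + 1) t - X n t‖ₑ ^ 2)
          (ψ := fun t => ‖X (n + 1 + 1) t - X (n + 1) t‖ₑ ^ 2) (fun t ht => ?_) ih t ht).trans (le_of_eq ?_)
        · have := hc ξ ξ (X (n + 1)) (X n) (X (n + 2)) (X (n + 1)) (hX _).continuous
            (hX _).continuous (hXstep _) (hXstep _) t ht
          simpa using this
        · rw [zero_add, pow_succ (4 : ℝ≥0∞) n, div_eq_mul_inv, div_eq_mul_inv, div_eq_mul_inv,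
            ENNReal.mul_inv (by simp) (by simp), mul_assoc _ (4 ^ n)⁻¹]
    refine ⟨2 * (B * Real.exp ((4 * c + 1) * N)), fun t ht n => ?_⟩
    have h := key n t ht
    have h1 : ‖X (n + 1) t - X n t‖ ^ 2 ≤ (B * Real.exp ((4 * c + 1) * N) / 2 ^ n) ^ 2 := by
      have e4 : (4 : ℝ≥0∞) ^ n = ENNReal.ofReal (4 ^ n) := by
        rw [ENNReal.ofReal_pow (by norm_num)]; norm_num
      rw [← ofReal_norm, ← ENNReal.ofReal_pow (norm_nonneg _), ← ENNReal.ofReal_pow hB0, e4,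
        ← ENNReal.ofReal_div_of_pos (by positivity), ← ENNReal.ofReal_mul (by positivity),
        ENNReal.ofReal_le_ofReal_iff (by positivity)] at h
      refine h.trans ?_
      have e5 : ((2 : ℝ) ^ n) ^ 2 = 4 ^ n := by rw [← pow_mul, mul_comm, pow_mul]; norm_num
      rw [div_pow, mul_pow, e5, div_mul_eq_mul_div]
      refine div_le_div_of_nonneg_right (mul_le_mul_of_nonneg_left ?_ (by positivity))
        (by positivity)
      rw [← Real.exp_nat_mul]
      refine Real.exp_le_exp.2 ?_
      have ht' : (t : ℝ) ≤ N := by exact_mod_cast ht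
      have : (4 * (c : ℝ) + 1) * t ≤ (4 * c + 1) * N := by gcongr
      have h0 : 0 ≤ (4 * (c : ℝ) + 1) * N := by positivity
      push_cast
      linarith
    rw [dist_comm, dist_eq_norm, mul_div_cancel_left₀ _ (two_ne_zero)]
    exact (sq_le_sq₀ (norm_nonneg _) (by positivity)).1 h1
  have hlim : ∀ t, ∃ y, Tendsto (fun n => X n t) atTop (𝓝 y) := fun t => by
    obtain ⟨C, hC⟩ := hgeo t
    exact cauchySeq_tendsto_of_complete (cauchySeq_of_le_geometric_two (hC t le_rfl))
  choose Z hZ using hlim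
  have hrate : ∀ N : ℝ≥0, ∃ C : ℝ, ∀ t ≤ N, ∀ n, dist (X n t) (Z t) ≤ C / 2 ^ n := fun N => by
    obtain ⟨C, hC⟩ := hgeo N
    exact ⟨C, fun t ht n => dist_le_of_le_geometric_two_of_tendsto (hC t ht) (hZ t) n⟩
  have hzero : ∀ C : ℝ, Tendsto (fun n : ℕ => C / 2 ^ n) atTop (𝓝 0) := fun C => by
    have := (tendsto_pow_atTop_nhds_zero_of_lt_one (r := (1 / 2 : ℝ)) (by norm_num)
      (by norm_num)).const_mul C
    rw [mul_zero] at this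
    refine this.congr fun n => ?_
    rw [one_div, inv_pow, div_eq_mul_inv]
  have hZc : Continuous Z := by
    have : TendstoLocallyUniformly X Z atTop := by
      rw [Metric.tendstoLocallyUniformly_iff]
      intro ε hε t₀
      obtain ⟨C, hC⟩ := hrate (t₀ + 1)
      refine ⟨Set.Iio (t₀ + 1), Iio_mem_nhds (lt_add_one t₀), ?_⟩
      filter_upwards [(hzero C).eventually_lt_const hε] with n hn t ht
      rw [dist_comm]
      exact (hC t (le_of_lt ht) n).trans_lt hn
    exact this.continuous (Frequently.of_forall fun n => (hX n).continuous)
  have hZa : IsAdaptedCurve 𝓕 Z := ⟨hZc, fun t =>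
    (isClosed_aestronglyMeasurable (𝓕.le t)).mem_of_tendsto (hZ t)
      (Eventually.of_forall fun n => (hX n).adapted t)⟩
  refine ⟨Z, hZa, ?_⟩
  -- The Picard step is Lipschitz, so `X (n + 1) t` converges to `step Z t` as well as to `Z t`.
  have hfix : step Z = Z := by
    ext1 t
    obtain ⟨c, hc⟩ := exists_picardStep_bound (P := P) (𝓕 := 𝓕) hW hT hG hF t
    obtain ⟨C, hC⟩ := hrate t
    have hb : ∀ n, ‖step Z t - X (n + 1) t‖ₑ ^ 2
        ≤ c * (ENNReal.ofReal ((C / 2 ^ n)) ^ 2 * timeMeasure (Set.Icc 0 t)) := by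
      intro n
      have h := hc ξ ξ Z (X n) (step Z) (X (n + 1)) hZc (hX n).continuous (hstep2 Z hZa)
        (hXstep n) t le_rfl
      rw [sub_self, enorm_zero] at h
      simp only [ne_eq, OfNat.ofNat_ne_zero, not_false_eq_true, zero_pow, mul_zero,
        zero_add] at h
      refine h.trans ?_
      gcongr
      rw [← setLIntegral_const]
      refine setLIntegral_mono' measurableSet_Icc fun s hs => pow_le_pow_left' ?_ 2
      rw [← ofReal_norm, ← dist_eq_norm, dist_comm]
      exact ENNReal.ofReal_le_ofReal (hC s (Set.mem_Icc.1 hs).2 n)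
    have h1 : Tendsto (fun n => ‖step Z t - X (n + 1) t‖ₑ ^ 2) atTop (𝓝 0) := by
      refine tendsto_of_tendsto_of_tendsto_of_le_of_le tendsto_const_nhds ?_ (fun _ => zero_le) hb
      have a1 := ENNReal.tendsto_ofReal (hzero C)
      have a2 := ((ENNReal.continuous_pow 2).tendsto _).comp a1
      have a3 := ENNReal.Tendsto.mul_const (b := timeMeasure (Set.Icc 0 t)) a2
        (Or.inr (timeMeasure_Icc_ne_top _ _))
      have a4 := ENNReal.Tendsto.const_mul (a := (c : ℝ≥0∞)) a3 (Or.inr (by simp))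
      simpa using a4
    have h2 : Tendsto (fun n => ‖step Z t - X (n + 1) t‖ₑ ^ 2) atTop
        (𝓝 (‖step Z t - Z t‖ₑ ^ 2)) := by
      have := (((hZ t).comp (tendsto_add_atTop_nat 1)).const_sub (step Z t)).enorm
      exact ((ENNReal.continuous_pow 2).tendsto _).comp this
    have h3 := tendsto_nhds_unique h2 h1
    have h4 : ‖step Z t - Z t‖ₑ = 0 := by simpa using h3
    exact sub_eq_zero.1 (enorm_eq_zero.1 h4)
  have := hstep2 Z hZa
  rwa [hfix] at this

end Picard

/-! ### Bochner integrals of curves in `L²` as pointwise integrals -/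

section Pointwise

variable {S : Type*} {mS : MeasurableSpace S} {ν : Measure S} [SigmaFinite ν]
  {F : Type*} [NormedAddCommGroup F] [NormedSpace ℝ F] [CompleteSpace F]

theorem eLpNorm_one_restrict_le (B : Set S) (x : Lp F 2 ν) :
    eLpNorm x 1 (ν.restrict B) ≤ ‖x‖ₑ * ν B ^ (1 / 2 : ℝ) := by
  refine (eLpNorm_le_eLpNorm_mul_rpow_measure_univ (q := 2) (by norm_num)
    (Lp.aestronglyMeasurable x).restrict).trans ?_
  rw [Measure.restrict_apply_univ, Lp.enorm_def]
  refine mul_le_mul' (eLpNorm_mono_measure _ Measure.restrict_le_self) (le_of_eq ?_)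
  norm_num

theorem integrableOn_Lp_two {B : Set S} (hB : ν B ≠ ∞) (x : Lp F 2 ν) : IntegrableOn x B ν := by
  rw [IntegrableOn, ← memLp_one_iff_integrable]
  refine ⟨(Lp.aestronglyMeasurable x).restrict, (eLpNorm_one_restrict_le B x).trans_lt ?_⟩
  exact ENNReal.mul_lt_top (by simp) (ENNReal.rpow_lt_top_of_nonneg (by norm_num) hB)

/-- Integration over a set of finite measure, as a continuous linear map on `L²`. -/
noncomputable def setIntegralCLM (F : Type*) [NormedAddCommGroup F] [NormedSpace ℝ F] [CompleteSpace F]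
    {B : Set S} (hB : ν B ≠ ∞) : Lp F 2 ν →L[ℝ] F :=
  LinearMap.mkContinuous
    { toFun := fun x => ∫ ω in B, x ω ∂ν
      map_add' := fun x y => by
        rw [← integral_add (integrableOn_Lp_two hB x) (integrableOn_Lp_two hB y)]
        exact integral_congr_ae (ae_restrict_of_ae (Lp.coeFn_add x y))
      map_smul' := fun c x => by
        rw [RingHom.id_apply, ← integral_smul]
        exact integral_congr_ae (ae_restrict_of_ae (Lp.coeFn_smul c x)) }
    (ν B ^ (1 / 2 : ℝ)).toReal fun x => by
      have h1 : ‖∫ ω in B, x ω ∂ν‖ₑ ≤ ‖x‖ₑ * ν B ^ (1 / 2 : ℝ) :=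
        (enorm_integral_le_lintegral_enorm _).trans
          ((eLpNorm_one_eq_lintegral_enorm (f := x)).symm.le.trans (eLpNorm_one_restrict_le B x))
      have h2 := ENNReal.toReal_mono (ENNReal.mul_ne_top (by simp)
        (ENNReal.rpow_ne_top_of_nonneg (by norm_num) hB)) h1
      rw [ENNReal.toReal_mul, mul_comm] at h2
      simpa using h2

theorem setIntegralCLM_apply {B : Set S} (hB : ν B ≠ ∞) (x : Lp F 2 ν) :
    setIntegralCLM F hB x = ∫ ω in B, x ω ∂ν := rfl

theorem integrable_prod_of_curve {h : ℝ≥0 → Lp F 2 ν} (hc : Continuous h) (t : ℝ≥0)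
    {z : ℝ≥0 → S → F} (hz : StronglyMeasurable fun p : ℝ≥0 × S => z p.1 p.2)
    (hzh : ∀ s ≤ t, z s =ᵐ[ν] h s) {B : Set S} (hB : ν B ≠ ∞) :
    Integrable (fun p : ℝ≥0 × S => z p.1 p.2)
      ((timeMeasure.restrict (Set.Icc 0 t)).prod (ν.restrict B)) := by
  have hfin : IsFiniteMeasure (timeMeasure.restrict (Set.Icc 0 t)) :=
    ⟨by rw [Measure.restrict_apply_univ]; exact (timeMeasure_Icc_ne_top 0 t).lt_top⟩
  refine ⟨hz.aestronglyMeasurable, ?_⟩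
  rw [HasFiniteIntegral, lintegral_prod _ hz.enorm.aemeasurable]
  obtain ⟨b, hb⟩ := (isCompact_Icc (a := (0 : ℝ≥0)) (b := t)).exists_bound_of_continuousOn
    hc.continuousOn
  refine lt_of_le_of_lt (b := ∫⁻ _ in Set.Icc 0 t, ENNReal.ofReal b * ν B ^ (1 / 2 : ℝ) ∂timeMeasure)
    ?_ ?_
  · refine setLIntegral_mono' measurableSet_Icc fun s hs => ?_
    have e : ∫⁻ ω in B, ‖z s ω‖ₑ ∂ν = ∫⁻ ω in B, ‖h s ω‖ₑ ∂ν :=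
      lintegral_congr_ae (ae_restrict_of_ae ((hzh s (Set.mem_Icc.1 hs).2).mono fun ω h => by
        simp only [h]))
    rw [e, ← eLpNorm_one_eq_lintegral_enorm]
    refine (eLpNorm_one_restrict_le B (h s)).trans (mul_le_mul' ?_ le_rfl)
    rw [← ofReal_norm]
    exact ENNReal.ofReal_le_ofReal (hb s hs)
  · rw [lintegral_const]
    exact ENNReal.mul_lt_top (ENNReal.mul_lt_top (by simp)
      (ENNReal.rpow_lt_top_of_nonneg (by norm_num) hB)) (measure_lt_top _ _)

/-- Integration over a set of finite measure is a continuous functional on `L²`, so it commutes with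
the Bochner integral; for the pointwise integral the same exchange is Fubini's theorem. Equal
integrals over all such sets force equality almost everywhere. It is applied both on `Ω` and on the
time axis. -/
theorem setIntegral_curve_ae_eq {h : ℝ≥0 → Lp F 2 ν} (hc : Continuous h) (t : ℝ≥0)
    {z : ℝ≥0 → S → F} (hz : StronglyMeasurable fun p : ℝ≥0 × S => z p.1 p.2)
    (hzh : ∀ s ≤ t, z s =ᵐ[ν] h s) :
    (∫ s in Set.Icc 0 t, h s ∂timeMeasure : Lp F 2 ν)
      =ᵐ[ν] fun ω => ∫ s in Set.Icc 0 t, z s ω ∂timeMeasure := by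
  have hint : ∀ B, ν B < ∞ → Integrable (fun p : ℝ≥0 × S => z p.1 p.2)
      ((timeMeasure.restrict (Set.Icc 0 t)).prod (ν.restrict B)) := fun B hB =>
    integrable_prod_of_curve hc t hz hzh hB.ne
  have hm : StronglyMeasurable fun ω => ∫ s in Set.Icc 0 t, z s ω ∂timeMeasure :=
    StronglyMeasurable.integral_prod_left' (μ := timeMeasure.restrict (Set.Icc 0 t)) hz
  refine ae_eq_of_forall_setIntegral_eq_of_sigmaFinite
    (fun B _ hB => integrableOn_Lp_two hB.ne _) (fun B _ hB => (hint B hB).integral_prod_right)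
    fun B hBm hB => ?_
  rw [← setIntegralCLM_apply hB.ne, ← (setIntegralCLM F hB.ne).integral_comp_comm
    (hc.continuousOn.integrableOn_compact isCompact_Icc)]
  have e : ∀ s ∈ Set.Icc 0 t, setIntegralCLM F hB.ne (h s) = ∫ ω in B, z s ω ∂ν := fun s hs =>
    integral_congr_ae (ae_restrict_of_ae (hzh s (Set.mem_Icc.1 hs).2).symm)
  rw [setIntegral_congr_fun measurableSet_Icc e]
  exact integral_integral_swap (hint B hB)

end Pointwise

/-! ### Closed subspaces and integrals; translation of time -/

theorem setIntegral_mem_of_isClosed {F : Type*} [NormedAddCommGroup F] [NormedSpace ℝ F]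
    [CompleteSpace F] {S : Submodule ℝ F} (hS : IsClosed (S : Set F)) {h : ℝ≥0 → F}
    (hc : Continuous h) (t : ℝ≥0) (hmem : ∀ s ≤ t, h s ∈ S) :
    ∫ s in Set.Icc 0 t, h s ∂timeMeasure ∈ S := by
  by_cases h0 : timeMeasure (Set.Icc 0 t) = 0
  · rw [setIntegral_measure_zero _ h0]
    exact zero_mem _
  · have h1 := S.convex.set_average_mem hS h0 (timeMeasure_Icc_ne_top 0 t)
      ((ae_restrict_mem measurableSet_Icc).mono fun s hs => hmem s (Set.mem_Icc.1 hs).2)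
      (hc.continuousOn.integrableOn_compact isCompact_Icc)
    rw [setAverage_eq] at h1
    have h2 : timeMeasure.real (Set.Icc 0 t) ≠ 0 := by
      rw [measureReal_def, ENNReal.toReal_ne_zero]
      exact ⟨h0, timeMeasure_Icc_ne_top 0 t⟩
    have h3 := S.smul_mem (timeMeasure.real (Set.Icc 0 t)) h1
    rwa [smul_inv_smul₀ h2] at h3

theorem map_add_right_timeMeasure (a : ℝ≥0) :
    timeMeasure.map (· + a) = timeMeasure.restrict (Set.Ici a) := by
  have h1 : ∀ f : ℝ≥0 → ℝ≥0∞, Measurable f → ∫⁻ s, f s ∂timeMeasure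
      = ∫⁻ x in Set.Ici (0 : ℝ), f x.toNNReal := fun f hf => by
    have e : timeMeasure.map ((↑) : ℝ≥0 → ℝ) = volume.restrict (Set.Ici (0 : ℝ)) := by
      rw [timeMeasure, measurableEmbedding_coe.map_comap, NNReal.range_coe]
    rw [← e, measurableEmbedding_coe.lintegral_map]
    simp
  refine Measure.ext fun B hB => ?_
  rw [← lintegral_indicator_one hB, ← lintegral_indicator_one hB,
    lintegral_map (measurable_one.indicator hB) (measurable_add_const a),
    ← lintegral_indicator measurableSet_Ici,
    h1 (fun s => B.indicator 1 (s + a)) ((measurable_one.indicator hB).comp (measurable_add_const a)),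
    h1 _ ((measurable_one.indicator hB).indicator measurableSet_Ici),
    ← lintegral_indicator measurableSet_Ici, ← lintegral_indicator measurableSet_Ici,
    ← lintegral_add_right_eq_self _ (-(a : ℝ))]
  refine lintegral_congr fun x => ?_
  by_cases hx : (a : ℝ) ≤ x
  · have h2 : x + -a ∈ Set.Ici (0 : ℝ) := by simpa using hx
    have h3 : x ∈ Set.Ici (0 : ℝ) := a.coe_nonneg.trans hx
    have h4 : x.toNNReal ∈ Set.Ici a := NNReal.le_toNNReal_of_coe_le hx
    rw [Set.indicator_of_mem h2, Set.indicator_of_mem h3, Set.indicator_of_mem h4]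
    congr 1
    apply NNReal.coe_injective
    rw [NNReal.coe_add, Real.coe_toNNReal _ h2, Real.coe_toNNReal _ h3]
    ring
  · have h2 : x + -a ∉ Set.Ici (0 : ℝ) := by simpa using hx
    rw [Set.indicator_of_notMem h2]
    by_cases h3 : x ∈ Set.Ici (0 : ℝ)
    · have h4 : x.toNNReal ∉ Set.Ici a := fun h => hx (by
        have := NNReal.coe_le_coe.2 (Set.mem_Ici.1 h)
        rwa [Real.coe_toNNReal _ h3] at this)
      rw [Set.indicator_of_mem h3, Set.indicator_of_notMem h4]
    · rw [Set.indicator_of_notMem h3]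

theorem setLIntegral_add_right (a : ℝ≥0) {f : ℝ≥0 → ℝ≥0∞} (hf : Measurable f) :
    ∫⁻ s in Set.Ici a, f s ∂timeMeasure = ∫⁻ s, f (s + a) ∂timeMeasure := by
  rw [← map_add_right_timeMeasure, lintegral_map hf (measurable_add_const a)]

theorem lintegral_sub_right (a : ℝ≥0) {f : ℝ≥0 → ℝ≥0∞} (hf : Measurable f) :
    ∫⁻ s in Set.Ici a, f (s - a) ∂timeMeasure = ∫⁻ s, f s ∂timeMeasure := by
  rw [setLIntegral_add_right a (f := fun s => f (s - a))
    (hf.comp (by fun_prop : Measurable fun s : ℝ≥0 => s - a))]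
  simp

/-! ### Progressive processes and versions of curves -/

section Progressive

variable {Ω : Type*} {mΩ : MeasurableSpace Ω} {P : Measure Ω} {𝓕 : Filtration ℝ≥0 mΩ}
  {H : Type*} [NormedAddCommGroup H]

/-- Stop the time variable at `n`. The stopped process is jointly measurable by the progressive
property at time `n`, and at each point the sequence is eventually constant. -/
theorem stronglyMeasurable_of_progressive {x : ℝ≥0 → Ω → H} (hx : IsStronglyProgressive 𝓕 x) :
    StronglyMeasurable fun p : ℝ≥0 × Ω => x p.1 p.2 := by
  have h : ∀ n : ℕ, StronglyMeasurable fun p : ℝ≥0 × Ω => x (min p.1 n) p.2 := fun n => by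
    have h1 : StronglyMeasurable fun p : Set.Iic (n : ℝ≥0) × Ω => x p.1 p.2 :=
      (hx n).mono (sup_le_sup le_rfl (MeasurableSpace.comap_mono (𝓕.le n)))
    exact h1.comp_measurable (g := fun p : ℝ≥0 × Ω =>
      ((⟨min p.1 n, Set.mem_Iic.2 (min_le_right _ _)⟩ : Set.Iic (n : ℝ≥0)), p.2))
      (((measurable_fst.min measurable_const).subtype_mk).prodMk measurable_snd)
  refine stronglyMeasurable_of_tendsto atTop h (tendsto_pi_nhds.2 fun p => ?_)
  obtain ⟨N, hN⟩ := exists_nat_ge p.1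
  refine tendsto_const_nhds.congr' ?_
  filter_upwards [eventually_ge_atTop N] with n hn
  rw [min_eq_left (hN.trans (by exact_mod_cast hn))]

theorem stronglyMeasurable_floor {S : Type*} {mS : MeasurableSpace S} {τ : S → ℕ}
    (hτ : Measurable τ) {g : ℕ → S → H} (hg : ∀ j, StronglyMeasurable (g j)) :
    StronglyMeasurable fun p => g (τ p) p := by
  classical
  have h : ∀ J : ℕ, StronglyMeasurable
      fun p => ∑ j ∈ Finset.range J, (τ ⁻¹' {j}).indicator (g j) p := fun J =>
    Finset.stronglyMeasurable_fun_sum _ fun j _ => (hg j).indicator (hτ (measurableSet_singleton j))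
  refine stronglyMeasurable_of_tendsto atTop h (tendsto_pi_nhds.2 fun p => ?_)
  refine tendsto_const_nhds.congr' ?_
  filter_upwards [eventually_gt_atTop (τ p)] with J hJ
  rw [Finset.sum_eq_single_of_mem (τ p) (Finset.mem_range.2 hJ)]
  · rw [Set.indicator_of_mem (by simp)]
  · intro j _ hj
    rw [Set.indicator_of_notMem (by simpa using hj.symm)]

/-- Square-summable `L²` distances give almost sure convergence. -/
theorem ae_tendsto_of_enorm_le {x : ℕ → Lp H 2 P} {y : Lp H 2 P}
    (h : ∀ᶠ n in atTop, ‖x n - y‖ₑ ^ 2 ≤ (2⁻¹ : ℝ≥0∞) ^ n) :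
    ∀ᵐ ω ∂P, Tendsto (fun n => x n ω) atTop (𝓝 (y ω)) := by
  obtain ⟨N, hN⟩ := eventually_atTop.1 h
  have hmeas : ∀ n, AEMeasurable (fun ω => ‖x (n + N) ω - y ω‖ₑ ^ 2) P := fun n =>
    ((Lp.aestronglyMeasurable _).sub (Lp.aestronglyMeasurable _)).enorm.pow_const 2
  have h1 : ∫⁻ ω, ∑' n, ‖x (n + N) ω - y ω‖ₑ ^ 2 ∂P ≠ ∞ := by
    rw [lintegral_tsum hmeas]
    refine ((ENNReal.tsum_le_tsum (g := fun n => (2⁻¹ : ℝ≥0∞) ^ n) fun n => ?_).trans_lt ?_).ne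
    · refine le_trans (le_of_eq ?_) ((hN (n + N) (by omega)).trans ?_)
      · rw [Lp_enorm_sq]
        exact lintegral_congr_ae ((Lp.coeFn_sub (x (n + N)) y).mono fun ω hω => by
          simp only [hω, Pi.sub_apply])
      · exact pow_le_pow_of_le_one zero_le (by norm_num) (by omega)
    · rw [ENNReal.tsum_geometric]
      norm_num
  have h2 : ∀ᵐ ω ∂P, ∑' n, ‖x (n + N) ω - y ω‖ₑ ^ 2 < ∞ :=
    ae_lt_top' (AEMeasurable.tsum hmeas) h1
  filter_upwards [h2] with ω hω
  have h3 := ENNReal.tendsto_atTop_zero_of_tsum_ne_top hω.ne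
  have h4 := (ENNReal.continuous_rpow_const (y := 1 / 2)).tendsto 0 |>.comp h3
  simp only [Function.comp_def, ← ENNReal.rpow_natCast, ← ENNReal.rpow_mul] at h4
  rw [← tendsto_add_atTop_iff_nat N, tendsto_iff_edist_tendsto_0]
  simp only [edist_eq_enorm_sub]
  simpa using h4

/-- Sample the curve at the last grid point `⌊m s⌋ / m` before `s`, which keeps the process adapted.
On `[0, k]` the mesh is fine enough for a squared error of at most `2⁻ᵏ`, so at each fixed time the
samples converge almost surely. Where they diverge `limUnder` takes some value, which does not
matter. -/
theorem exists_progressive_version [IsProbabilityMeasure P] {H : Type*} [NormedAddCommGroup H]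
    [InnerProductSpace ℝ H] [CompleteSpace H] {X : ℝ≥0 → Lp H 2 P} (hX : IsAdaptedCurve 𝓕 X) :
    ∃ x : ℝ≥0 → Ω → H, IsStronglyProgressive 𝓕 x ∧ ∀ t, x t =ᵐ[P] X t := by
  have hm : ∀ k : ℕ, ∃ m : ℕ, 0 < m ∧ ∀ s ≤ (k : ℝ≥0),
      ‖X ((⌊(m : ℝ≥0) * s⌋₊ : ℝ≥0) / m) - X s‖ₑ ^ 2 ≤ (2⁻¹ : ℝ≥0∞) ^ k := by
    intro k
    have huc := (isCompact_Icc (a := (0 : ℝ≥0)) (b := k)).uniformContinuousOn_of_continuous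
      hX.continuous.continuousOn
    rw [Metric.uniformContinuousOn_iff_le] at huc
    obtain ⟨δ, hδ, h⟩ := huc ((1 / 2) ^ k) (by positivity)
    obtain ⟨m, hm⟩ := exists_nat_gt (1 / δ)
    have hm0 : (0 : ℝ) < m := (by positivity : (0 : ℝ) < 1 / δ).trans hm
    have hm0' : (0 : ℝ≥0) < m := by exact_mod_cast hm0
    refine ⟨m, by exact_mod_cast hm0, fun s hs => ?_⟩
    have h1 : (⌊(m : ℝ≥0) * s⌋₊ : ℝ≥0) / m ≤ s := by
      rw [div_le_iff₀ hm0', mul_comm]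
      exact Nat.floor_le zero_le
    have h2 : s ≤ (⌊(m : ℝ≥0) * s⌋₊ : ℝ≥0) / m + 1 / m := by
      rw [← add_div, le_div_iff₀ hm0', mul_comm]
      exact (Nat.lt_floor_add_one _).le
    have h3 : dist ((⌊(m : ℝ≥0) * s⌋₊ : ℝ≥0) / m) s ≤ δ := by
      rw [NNReal.dist_eq, abs_sub_comm, abs_of_nonneg (by
        have := NNReal.coe_le_coe.2 h1; linarith)]
      have h5 := NNReal.coe_le_coe.2 h2
      have h6 : (1 : ℝ) / m ≤ δ := by
        rw [div_le_iff₀ hm0]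
        rw [div_lt_iff₀ hδ] at hm
        linarith
      push_cast at h5 ⊢
      linarith
    have h4 := h _ (Set.mem_Icc.2 ⟨zero_le, h1.trans hs⟩) s (Set.mem_Icc.2 ⟨zero_le, hs⟩) h3
    rw [← ofReal_norm, ← dist_eq_norm]
    have e2 : (2⁻¹ : ℝ≥0∞) = ENNReal.ofReal (1 / 2) := by
      rw [one_div, ENNReal.ofReal_inv_of_pos (by norm_num)]; norm_num
    rw [e2, ← ENNReal.ofReal_pow dist_nonneg, ← ENNReal.ofReal_pow (by norm_num)]
    refine ENNReal.ofReal_le_ofReal (le_trans ?_ (le_trans h4 le_rfl))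
    refine pow_le_of_le_one dist_nonneg (h4.trans (pow_le_one₀ (by norm_num) (by norm_num)))
      two_ne_zero
  choose m hm0 hm using hm
  let η : ℝ≥0 → Ω → H := fun t => (hX.adapted t).mk (X t)
  have hη : ∀ t, StronglyMeasurable[𝓕 t] (η t) := fun t => (hX.adapted t).stronglyMeasurable_mk
  have hηX : ∀ t, η t =ᵐ[P] X t := fun t => (hX.adapted t).ae_eq_mk.symm
  let π : ℕ → ℝ≥0 → ℝ≥0 := fun k s => (⌊(m k : ℝ≥0) * s⌋₊ : ℝ≥0) / m k
  have hπ : ∀ k s, π k s ≤ s := fun k s => by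
    rw [div_le_iff₀ (by exact_mod_cast hm0 k), mul_comm]
    exact Nat.floor_le zero_le
  refine ⟨fun s ω => limUnder atTop fun k => η (π k s) ω, fun i => ?_, fun t => ?_⟩
  · let : MeasurableSpace Ω := 𝓕 i
    refine StronglyMeasurable.limUnder fun k => ?_
    -- Grid values after time `i` are replaced by zero. They need not be `𝓕 i`-measurable, and they
    -- are never used because `π k s ≤ s ≤ i`.
    let g : ℕ → Set.Iic i × Ω → H := fun j p =>
      if ((j : ℝ≥0) / m k) ≤ i then η ((j : ℝ≥0) / m k) p.2 else 0
    have hg : ∀ j, StronglyMeasurable (g j) := fun j => by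
      by_cases hj : ((j : ℝ≥0) / m k) ≤ i
      · simp only [g, if_pos hj]
        exact ((hη _).mono (𝓕.mono hj)).comp_measurable measurable_snd
      · simp only [g, if_neg hj]
        exact stronglyMeasurable_const
    have h := stronglyMeasurable_floor (τ := fun p : Set.Iic i × Ω => ⌊(m k : ℝ≥0) * p.1⌋₊)
      (Nat.measurable_floor.comp (by fun_prop)) hg
    have e : (fun p : Set.Iic i × Ω => η (π k p.1) p.2)
        = fun p => g ⌊(m k : ℝ≥0) * p.1⌋₊ p := funext fun p => by
      have hle : (⌊(m k : ℝ≥0) * p.1⌋₊ : ℝ≥0) / m k ≤ i :=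
        (hπ k p.1).trans (Set.mem_Iic.1 p.1.2)
      simp only [g, if_pos hle, π]
    rw [e]
    exact h
  · have h := ae_tendsto_of_enorm_le (x := fun k => X (π k t)) (y := X t) (by
      obtain ⟨N, hN⟩ := exists_nat_ge t
      filter_upwards [eventually_ge_atTop N] with k hk
      exact hm k t (hN.trans (by exact_mod_cast hk)))
    have h' : ∀ᵐ ω ∂P, ∀ k, η (π k t) ω = X (π k t) ω := ae_all_iff.2 fun k => hηX _
    filter_upwards [h, h'] with ω h1 h2
    simp only [h2]
    exact h1.limUnder_eq

end Progressive

/-! ### Mild solutions -/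

section Mild

variable {Ω : Type*} {mΩ : MeasurableSpace Ω} {P : Measure Ω} [IsProbabilityMeasure P]
  {𝓕 : Filtration ℝ≥0 mΩ} {W : ℝ≥0 → Ω → ℝ}
  {H : Type*} [NormedAddCommGroup H] [InnerProductSpace ℝ H] [CompleteSpace H]
  {T : ℝ≥0 → H →L[ℝ] H} {G F : H → H} {L : ℝ≥0}

instance (α : ℝ≥0) : IsFiniteMeasure (timeMeasure.restrict (Set.Icc 0 α)) :=
  ⟨by rw [Measure.restrict_apply_univ]; exact (timeMeasure_Icc_ne_top 0 α).lt_top⟩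

instance (α : ℝ≥0) : IsFiniteMeasure (timeProd P α) := by
  unfold timeProd; infer_instance

theorem stronglyMeasurable_volterra (hT : IsC0Semigroup T) (hG : LipschitzWith L G) (t : ℝ≥0)
    {x : ℝ≥0 → Ω → H} (hx : StronglyMeasurable fun p : ℝ≥0 × Ω => x p.1 p.2) :
    StronglyMeasurable fun p : ℝ≥0 × Ω => T (t - p.1) (G (x p.1 p.2)) :=
  hT.continuous_uncurry.comp_stronglyMeasurable
    (((by fun_prop : Continuous fun s : ℝ≥0 => t - s).stronglyMeasurable.comp_measurable
      measurable_fst).prodMk (hG.continuous.comp_stronglyMeasurable hx))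

theorem MemCF.memLp_timeProd {x : ℝ≥0 → Ω → H} (hx : MemCF 𝓕 P x) (t : ℝ≥0) :
    MemLp (fun p : ℝ≥0 × Ω => x p.1 p.2) 2 (timeProd P t) := by
  have hm := (stronglyMeasurable_of_progressive hx.progressive).aestronglyMeasurable
    (μ := timeProd P t)
  refine ⟨hm, ?_⟩
  have h := normL2F_sq hm
  have h2 : ∫⁻ s in Set.Icc 0 t, eLpNorm (x s) 2 P ^ 2 ∂timeMeasure < ∞ := by
    have hc : Continuous fun s => (eLpNorm (x s) 2 P).toNNReal := by
      have := hx.continuous_norm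
      rw [continuous_iff_continuousAt] at this ⊢
      exact fun s => (ENNReal.tendsto_toNNReal (hx.memLp s).2.ne).comp (this s)
    obtain ⟨b, hb⟩ := (isCompact_Icc (a := (0 : ℝ≥0)) (b := t)).bddAbove_image hc.continuousOn
    refine lt_of_le_of_lt (b := ∫⁻ _ in Set.Icc 0 t, (b : ℝ≥0∞) ^ 2 ∂timeMeasure)
      (setLIntegral_mono' measurableSet_Icc fun s hs => pow_le_pow_left' ?_ 2) ?_
    · rw [← ENNReal.coe_toNNReal (hx.memLp s).2.ne]
      exact_mod_cast hb (Set.mem_image_of_mem _ hs)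
    · rw [lintegral_const]
      exact ENNReal.mul_lt_top (by simp) (measure_lt_top _ _)
  rw [← h] at h2
  exact (ENNReal.pow_lt_top_iff.1 h2).resolve_right two_ne_zero

theorem memLp_volterra (hT : IsC0Semigroup T) (hG : LipschitzWith L G) (t : ℝ≥0)
    {x : ℝ≥0 → Ω → H} (hx : MemCF 𝓕 P x) :
    MemLp (fun p : ℝ≥0 × Ω => T (t - p.1) (G (x p.1 p.2))) 2 (timeProd P t) := by
  obtain ⟨M, -, hM⟩ := hT.exists_bound t
  have h1 : MemLp (fun p : ℝ≥0 × Ω => (‖G 0‖ : ℝ) + (L : ℝ) * ‖x p.1 p.2‖) 2 (timeProd P t) :=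
    MemLp.add (f := fun _ => ‖G 0‖) (memLp_const _) ((hx.memLp_timeProd t).norm.const_mul (L : ℝ))
  have h2 : ∀ p : ℝ≥0 × Ω, ‖T (t - p.1) (G (x p.1 p.2))‖
      ≤ (M : ℝ) * ‖(‖G 0‖ : ℝ) + (L : ℝ) * ‖x p.1 p.2‖‖ := fun p => by
    have h3 := hG.dist_le_mul (x p.1 p.2) 0
    rw [dist_eq_norm, dist_zero_right] at h3
    have h4 : ‖G (x p.1 p.2)‖ ≤ ‖G 0‖ + L * ‖x p.1 p.2‖ := by
      have := norm_add_le (G 0) (G (x p.1 p.2) - G 0)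
      rw [add_sub_cancel] at this
      linarith
    rw [Real.norm_of_nonneg (by positivity)]
    exact ((T (t - p.1)).le_of_opNorm_le (hM _ tsub_le_self) _).trans
      (mul_le_mul_of_nonneg_left h4 M.coe_nonneg)
  exact h1.of_le_mul (stronglyMeasurable_volterra hT hG t
    (stronglyMeasurable_of_progressive hx.progressive)).aestronglyMeasurable
    (Eventually.of_forall h2)

theorem enorm_volterra_sub_le (hG : LipschitzWith L G) {K : H →L[ℝ] H} {M : ℝ≥0}
    (hK : ‖K‖ ≤ M) (x y : H) :
    ‖K (G x) - K (G y)‖ₑ ≤ ((M * L : ℝ≥0) : ℝ≥0∞) * ‖x - y‖ₑ := by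
  rw [← map_sub, ← ofReal_norm, ← ofReal_norm, ← ENNReal.ofReal_coe_nnreal,
    ← ENNReal.ofReal_mul (NNReal.coe_nonneg _)]
  refine ENNReal.ofReal_le_ofReal ((K.le_of_opNorm_le hK _).trans ?_)
  rw [NNReal.coe_mul, mul_assoc]
  refine mul_le_mul_of_nonneg_left ?_ M.coe_nonneg
  have := hG.dist_le_mul x y
  rwa [dist_eq_norm, dist_eq_norm] at this

/-- Mild solutions depend Lipschitz continuously on the initial value, in mean square. -/
theorem exists_isMildSolution_bound (hW : IsFBrownianMotion 𝓕 P W) (hT : IsC0Semigroup T)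
    (hG : LipschitzWith L G) (hF : LipschitzWith L F) (N : ℝ≥0) :
    ∃ c : ℝ≥0, ∀ (ξ η : Ω → H) (x y : ℝ≥0 → Ω → H), MemLp ξ 2 P → MemLp η 2 P →
      IsMildSolution 𝓕 P W T G F ξ x → IsMildSolution 𝓕 P W T G F η y → ∀ t ≤ N,
      eLpNorm (x t - y t) 2 P ^ 2 ≤ c * eLpNorm (ξ - η) 2 P ^ 2 := by
  obtain ⟨M, -, hM⟩ := hT.exists_bound N
  let c : ℝ≥0 := 4 * (N + 1) * (M * L) ^ 2
  -- One factor 2 comes from `(a + b)² ≤ 2 (a² + b²)`, the other from Gronwall's lemma.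
  refine ⟨4 * M ^ 2 * (Real.exp ((4 * c + 1) * N)).toNNReal, fun ξ η x y hξ hη hx hy => ?_⟩
  have mx := stronglyMeasurable_of_progressive hx.memCF.progressive
  have my := stronglyMeasurable_of_progressive hy.memCF.progressive
  set φ : ℝ≥0 → ℝ≥0∞ := fun t => eLpNorm (x t - y t) 2 P ^ 2 with hφ
  have hφ' : ∀ t, φ t = ∫⁻ ω, ‖x t ω - y t ω‖ₑ ^ 2 ∂P := fun t => eLpNorm_two_sq _ _
  -- Gronwall's lemma requires a finite a priori bound, which the continuity of the mean square
  -- norms in `MemCF` provides on `[0, N]`.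
  have hB : ∃ B : ℝ≥0∞, B ≠ ∞ ∧ ∀ t ≤ N, φ t ≤ B := by
    have hc : ∀ {z : ℝ≥0 → Ω → H}, MemCF 𝓕 P z → Continuous fun s => (eLpNorm (z s) 2 P).toNNReal :=
      fun {z} hz => by
        have := hz.continuous_norm
        rw [continuous_iff_continuousAt] at this ⊢
        exact fun s => (ENNReal.tendsto_toNNReal (hz.memLp s).2.ne).comp (this s)
    obtain ⟨b, hb⟩ := (isCompact_Icc (a := (0 : ℝ≥0)) (b := N)).bddAbove_image
      ((hc hx.memCF).add (hc hy.memCF)).continuousOn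
    refine ⟨(b : ℝ≥0∞) ^ 2, by simp, fun t ht => pow_le_pow_left' ?_ 2⟩
    refine (eLpNorm_sub_le (hx.memCF.memLp t).1 (hy.memCF.memLp t).1 (by norm_num)).trans ?_
    rw [← ENNReal.coe_toNNReal (hx.memCF.memLp t).2.ne,
      ← ENNReal.coe_toNNReal (hy.memCF.memLp t).2.ne]
    exact_mod_cast hb (Set.mem_image_of_mem _ (Set.mem_Icc.2 ⟨zero_le, ht⟩))
  obtain ⟨B, hB, hφB⟩ := hB
  have key : ∀ t ≤ N, φ t ≤ 2 * (M : ℝ≥0∞) ^ 2 * eLpNorm (ξ - η) 2 P ^ 2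
      + c * ∫⁻ s in Set.Icc 0 t, φ s ∂timeMeasure := by
    intro t ht
    obtain ⟨I, hI, hxt⟩ := hx.eq t
    obtain ⟨J, hJ, hyt⟩ := hy.eq t
    set Q := ∫⁻ s in Set.Icc 0 t, φ s ∂timeMeasure with hQ
    have hQ' : ∫⁻ ω, ∫⁻ s in Set.Icc 0 t, ‖x s ω - y s ω‖ₑ ^ 2 ∂timeMeasure ∂P = Q := by
      rw [lintegral_lintegral_swap]
      · rw [hQ]; simp_rw [hφ']
      · exact (((mx.sub my).comp_measurable measurable_swap).enorm.pow_const 2).aemeasurable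
    have hML : ∀ {K : H → H} (hK : LipschitzWith L K) (s : ℝ≥0) (ω : Ω),
        ‖T (t - s) (K (x s ω)) - T (t - s) (K (y s ω))‖ₑ ^ 2
        ≤ ((M * L : ℝ≥0) : ℝ≥0∞) ^ 2 * ‖x s ω - y s ω‖ₑ ^ 2 := fun hK s ω => by
      rw [← mul_pow]
      exact pow_le_pow_left' (enorm_volterra_sub_le hK (hM _ (tsub_le_self.trans ht)) _ _) 2
    have h1 : ∫⁻ ω, ‖T t (ξ ω) - T t (η ω)‖ₑ ^ 2 ∂P ≤ (M : ℝ≥0∞) ^ 2 * eLpNorm (ξ - η) 2 P ^ 2 := by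
      rw [eLpNorm_two_sq, ← lintegral_const_mul' _ _ (ENNReal.pow_ne_top ENNReal.coe_ne_top)]
      refine lintegral_mono fun ω => ?_
      rw [← mul_pow]
      refine pow_le_pow_left' ?_ 2
      have := enorm_volterra_sub_le (L := 1) LipschitzWith.id (hM t ht) (ξ ω) (η ω)
      simpa using this
    have hint : ∀ {z : ℝ≥0 → Ω → H}, MemCF 𝓕 P z → ∀ᵐ ω ∂P,
        IntegrableOn (fun s => T (t - s) (G (z s ω))) (Set.Icc 0 t) timeMeasure := fun hz => by
      have := (memLp_volterra hT hG t hz).integrable (by norm_num)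
      exact this.prod_left_ae
    have hDm : ∀ {z : ℝ≥0 → Ω → H}, MemCF 𝓕 P z → StronglyMeasurable fun ω =>
        ∫ s in Set.Icc 0 t, T (t - s) (G (z s ω)) ∂timeMeasure := fun hz =>
      StronglyMeasurable.integral_prod_left' (μ := timeMeasure.restrict (Set.Icc 0 t))
        (stronglyMeasurable_volterra hT hG t (stronglyMeasurable_of_progressive hz.progressive))
    have h2 : ∫⁻ ω, ‖(∫ s in Set.Icc 0 t, T (t - s) (G (x s ω)) ∂timeMeasure)
        - ∫ s in Set.Icc 0 t, T (t - s) (G (y s ω)) ∂timeMeasure‖ₑ ^ 2 ∂P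
        ≤ N * (((M * L : ℝ≥0) : ℝ≥0∞) ^ 2 * Q) := by
      rw [← hQ', ← lintegral_const_mul' _ _ (ENNReal.pow_ne_top ENNReal.coe_ne_top),
        ← lintegral_const_mul' _ _ ENNReal.coe_ne_top]
      refine lintegral_mono_ae ?_
      filter_upwards [hint hx.memCF, hint hy.memCF] with ω hxi hyi
      rw [← integral_sub hxi hyi]
      refine (pow_le_pow_left' (enorm_integral_le_lintegral_enorm _) 2).trans ?_
      refine (sq_setLIntegral_le t (hxi.sub hyi).1.enorm).trans ?_
      refine mul_le_mul' (by exact_mod_cast ht) ?_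
      rw [← lintegral_const_mul' _ _ (ENNReal.pow_ne_top ENNReal.coe_ne_top)]
      exact lintegral_mono fun s => hML hG s ω
    have h3 : ∫⁻ ω, ‖I ω - J ω‖ₑ ^ 2 ∂P ≤ ((M * L : ℝ≥0) : ℝ≥0∞) ^ 2 * Q := by
      rw [← eLpNorm_two_sq]
      refine (pow_le_pow_left' (eLpNorm_sub_of_isItoIntegral hW hI hJ) 2).trans ?_
      rw [normL2F_sq (hI.1.1.sub hJ.1.1), hQ,
        ← lintegral_const_mul' _ _ (ENNReal.pow_ne_top ENNReal.coe_ne_top)]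
      refine lintegral_mono fun s => ?_
      rw [hφ', eLpNorm_two_sq, ← lintegral_const_mul' _ _ (ENNReal.pow_ne_top ENNReal.coe_ne_top)]
      exact lintegral_mono fun ω => hML hF s ω
    rw [hφ']
    have h4 : ∀ᵐ ω ∂P, ‖x t ω - y t ω‖ₑ ^ 2 ≤ 2 * (‖T t (ξ ω) - T t (η ω)‖ₑ ^ 2
        + 2 * (‖(∫ s in Set.Icc 0 t, T (t - s) (G (x s ω)) ∂timeMeasure)
        - ∫ s in Set.Icc 0 t, T (t - s) (G (y s ω)) ∂timeMeasure‖ₑ ^ 2 + ‖I ω - J ω‖ₑ ^ 2)) := by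
      filter_upwards [hxt, hyt] with ω e1 e2
      rw [e1, e2, show ∀ a b c a' b' c' : H, a + b + c - (a' + b' + c')
        = (a - a') + ((b - b') + (c - c')) from fun _ _ _ _ _ _ => by abel]
      refine (pow_le_pow_left' (enorm_add_le _ _) 2).trans ((add_sq_le_two_mul _ _).trans ?_)
      exact mul_le_mul_right (add_le_add_right ((pow_le_pow_left' (enorm_add_le _ _) 2).trans
        (add_sq_le_two_mul _ _)) _) _
    refine (lintegral_mono_ae h4).trans ?_
    have m1 : AEMeasurable (fun ω => ‖T t (ξ ω) - T t (η ω)‖ₑ ^ 2) P :=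
      ((((T t).continuous.comp_aestronglyMeasurable hξ.1).sub
        ((T t).continuous.comp_aestronglyMeasurable hη.1)).enorm.pow_const 2)
    have m2 : AEMeasurable (fun ω => ‖(∫ s in Set.Icc 0 t, T (t - s) (G (x s ω)) ∂timeMeasure)
        - ∫ s in Set.Icc 0 t, T (t - s) (G (y s ω)) ∂timeMeasure‖ₑ ^ 2) P :=
      ((hDm hx.memCF).sub (hDm hy.memCF)).enorm.aemeasurable.pow_const 2
    rw [lintegral_const_mul' _ _ (by simp), lintegral_add_left' m1,
      lintegral_const_mul' _ _ (by simp), lintegral_add_left' m2]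
    refine (mul_le_mul_right (add_le_add h1 (mul_le_mul_right (add_le_add h2 h3) _)) _).trans
      (le_of_eq ?_)
    simp only [c]
    push_cast
    ring
  intro t ht
  refine (gronwall_lintegral hB key hφB t ht).trans ?_
  rw [ENNReal.coe_mul, ← ENNReal.ofReal]
  push_cast
  rw [show (2 : ℝ≥0∞) * (2 * (M : ℝ≥0∞) ^ 2 * eLpNorm (ξ - η) 2 P ^ 2)
    * ENNReal.ofReal (Real.exp ((4 * c + 1) * t))
    = 4 * (M : ℝ≥0∞) ^ 2 * ENNReal.ofReal (Real.exp ((4 * c + 1) * t))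
      * eLpNorm (ξ - η) 2 P ^ 2 by ring]
  gcongr

/-- A progressive version of the curve is inserted into the equation. The drift, a Bochner integral
in `L²(Ω, H)`, becomes an integral along paths by `setIntegral_curve_ae_eq`, and membership in the
graph becomes `IsItoIntegral`. -/
theorem exists_isMildSolution_of_curve (hT : IsC0Semigroup T) (hG : LipschitzWith L G) (hF : LipschitzWith L F) {ξ : Ω → H} {ξ' : Lp H 2 P}
    {X : ℝ≥0 → Lp H 2 P}
    (hξ : ξ' =ᵐ[P] ξ) (hX : IsAdaptedCurve 𝓕 X) (hfix : IsPicardStep 𝓕 P W T hG hF ξ' X X) :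
    ∃ x, IsMildSolution 𝓕 P W T G F ξ x ∧ ∀ t, x t =ᵐ[P] X t := by
  obtain ⟨x, hx, hxX⟩ := exists_progressive_version hX
  have mx := stronglyMeasurable_of_progressive hx
  refine ⟨x, ⟨⟨hx, fun t => (Lp.memLp (X t)).ae_eq (hxX t).symm, ?_⟩, fun t => ?_⟩, hxX⟩
  · have e : (fun t => eLpNorm (x t) 2 P) = fun t => ‖X t‖ₑ := funext fun t => by
      rw [eLpNorm_congr_ae (hxX t), Lp.enorm_def]
    rw [e]
    exact hX.continuous.enorm
  · obtain ⟨v, I, hvI, hv, hXt⟩ := hfix t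
    have hcur : ∀ {K : H → H} (hK : LipschitzWith L K) (s : ℝ≥0),
        (fun ω => T (t - s) (K (x s ω)))
          =ᵐ[P] (T (t - s)).compLpL 2 P (superposition hK (X s)) := fun hK s => by
      filter_upwards [hxX s, (T (t - s)).coeFn_compLpL (superposition hK (X s)),
        coeFn_superposition hK (X s)] with ω h1 h2 h3
      rw [h2, h3, h1]
    refine ⟨I, isItoIntegral_of_mem_itoGraph
      (stronglyMeasurable_volterra hT hF t mx).aestronglyMeasurable hvI ?_ EventuallyEq.rfl, ?_⟩
    · filter_upwards [hv] with s hs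
      rw [hs]
      by_cases h : s ∈ Set.Icc 0 t
      · simp only [Set.indicator_of_mem h]
        exact (hcur hF s).symm
      · simp only [Set.indicator_of_notMem h]
        exact Lp.coeFn_zero H 2 P
    · have hD := setIntegral_curve_ae_eq (continuous_volterra_kernel_right hT hG hX.continuous t) t
        (stronglyMeasurable_volterra hT hG t mx) fun s _ => hcur hG s
      have h2 := (T t).coeFn_compLpL (p := 2) (μ := P) ξ'
      have h3 := hxX t
      rw [hXt] at h3
      filter_upwards [h3, Lp.coeFn_add ((T t).compLpL 2 P ξ'
        + ∫ s in Set.Icc 0 t, (T (t - s)).compLpL 2 P (superposition hG (X s)) ∂timeMeasure) I,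
        Lp.coeFn_add ((T t).compLpL 2 P ξ')
        (∫ s in Set.Icc 0 t, (T (t - s)).compLpL 2 P (superposition hG (X s)) ∂timeMeasure),
        h2, hD, hξ] with ω e1 e2 e3 e4 e5 e6
      rw [e1, e2, Pi.add_apply, e3, Pi.add_apply, e4, e5, e6]

/-- A mild solution is a version of a curve in `L²(Ω, H)` that solves the integral equation. -/
theorem exists_curve_of_init (hW : IsFBrownianMotion 𝓕 P W) (hT : IsC0Semigroup T)
    (hG : LipschitzWith L G) (hF : LipschitzWith L F) {ξ : Ω → H} (hξ : MemL2Init 𝓕 P ξ) :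
    ∃ X : ℝ≥0 → Lp H 2 P, IsAdaptedCurve 𝓕 X ∧
      IsPicardStep 𝓕 P W T hG hF (hξ.2.toLp ξ) X X ∧
      (∃ x, IsMildSolution 𝓕 P W T G F ξ x) ∧
      ∀ y, IsMildSolution 𝓕 P W T G F ξ y → ∀ t, y t =ᵐ[P] X t := by
  have hξ' : AEStronglyMeasurable[𝓕 0] (hξ.2.toLp ξ) P :=
    hξ.1.aestronglyMeasurable.congr hξ.2.coeFn_toLp.symm
  obtain ⟨X, hX, hfix⟩ := exists_curve_fixedPoint hW hT hG hF hξ'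
  obtain ⟨x, hx, hxX⟩ := exists_isMildSolution_of_curve hT hG hF hξ.2.coeFn_toLp hX hfix
  refine ⟨X, hX, hfix, ⟨x, hx⟩, fun y hy t => EventuallyEq.trans ?_ (hxX t)⟩
  -- Uniqueness is the Lipschitz bound for two equal initial values.
  obtain ⟨c, hc⟩ := exists_isMildSolution_bound hW hT hG hF t
  have h := hc ξ ξ y x hξ.2 hξ.2 hy hx t le_rfl
  rw [sub_self] at h
  simp only [eLpNorm_zero, ne_eq, OfNat.ofNat_ne_zero, not_false_eq_true, zero_pow, mul_zero,
    nonpos_iff_eq_zero, pow_eq_zero_iff] at h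
  rw [eLpNorm_eq_zero_iff ((hy.memCF.memLp t).1.sub (hx.memCF.memLp t).1) (by norm_num)] at h
  exact (sub_ae_eq_zero _ _).1 h

end Mild

/-! ### Integral inequalities on the time axis -/

theorem lintegral_indicator_sub_le (a u : ℝ≥0) {ψ : ℝ≥0 → ℝ≥0∞} (hψ : Measurable ψ) :
    ∫⁻ t in Set.Icc 0 u, (Set.Ici a).indicator (fun t => ψ (t - a)) t ∂timeMeasure
      ≤ ∫⁻ τ in Set.Icc 0 u, ψ τ ∂timeMeasure := by
  rw [← lintegral_indicator measurableSet_Icc,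
    ← lintegral_indicator (f := ψ) measurableSet_Icc,
    ← lintegral_sub_right a (hψ.indicator measurableSet_Icc),
    ← lintegral_indicator measurableSet_Ici]
  refine lintegral_mono fun t => ?_
  by_cases h1 : t ∈ Set.Icc 0 u
  · rw [Set.indicator_of_mem h1]
    by_cases h2 : t ∈ Set.Ici a
    · rw [Set.indicator_of_mem h2, Set.indicator_of_mem h2, Set.indicator_of_mem
        (Set.mem_Icc.2 ⟨zero_le, tsub_le_self.trans (Set.mem_Icc.1 h1).2⟩)]
    · rw [Set.indicator_of_notMem h2]; exact zero_le
  · rw [Set.indicator_of_notMem h1]; exact zero_le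

/-- Exchange the integrals over the triangle `s ≤ t ≤ u`, substitute `τ = t - s` and enlarge the
triangle to a square. -/
theorem lintegral_volterra_le (u : ℝ≥0) {φ : ℝ≥0 → ℝ≥0 → ℝ≥0∞}
    (hφ : Measurable fun p : ℝ≥0 × ℝ≥0 => φ p.1 p.2) :
    ∫⁻ t in Set.Icc 0 u, ∫⁻ s in Set.Icc 0 t, φ s (t - s) ∂timeMeasure ∂timeMeasure
      ≤ ∫⁻ s in Set.Icc 0 u, ∫⁻ τ in Set.Icc 0 u, φ s τ ∂timeMeasure ∂timeMeasure := by
  have h1 : ∀ t ∈ Set.Icc 0 u, ∫⁻ s in Set.Icc 0 t, φ s (t - s) ∂timeMeasure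
      ≤ ∫⁻ s in Set.Icc 0 u, (Set.Ici s).indicator (fun t => φ s (t - s)) t ∂timeMeasure := by
    intro t ht
    rw [← lintegral_indicator measurableSet_Icc, ← lintegral_indicator measurableSet_Icc]
    refine lintegral_mono fun s => ?_
    by_cases hs : s ∈ Set.Icc 0 t
    · have hst := (Set.mem_Icc.1 hs).2
      rw [Set.indicator_of_mem hs, Set.indicator_of_mem
        (Set.mem_Icc.2 ⟨zero_le, hst.trans (Set.mem_Icc.1 ht).2⟩),
        Set.indicator_of_mem (Set.mem_Ici.2 hst)]
    · rw [Set.indicator_of_notMem hs]; exact zero_le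
  refine (setLIntegral_mono' measurableSet_Icc h1).trans ?_
  rw [lintegral_lintegral_swap]
  · exact lintegral_mono fun s => lintegral_indicator_sub_le s u
      (hφ.comp (by fun_prop : Measurable fun τ : ℝ≥0 => (s, τ)))
  · have hm : Measurable fun p : ℝ≥0 × ℝ≥0 => φ p.2 (p.1 - p.2) :=
      hφ.comp (by fun_prop : Measurable fun p : ℝ≥0 × ℝ≥0 => (p.2, p.1 - p.2))
    have e : (Function.uncurry fun t s => (Set.Ici s).indicator (fun t => φ s (t - s)) t)
        = {p : ℝ≥0 × ℝ≥0 | p.2 ≤ p.1}.indicator fun p => φ p.2 (p.1 - p.2) := by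
      ext ⟨t, s⟩
      simp [Set.indicator_apply]
    rw [e]
    exact (hm.indicator (measurableSet_le measurable_snd measurable_fst)).aemeasurable

/-- Each `r` belongs to the window `[t, t + h]` only for `t` in an interval of length at most `h`.
This is the factor `h` gained by integrating over `t`. -/
theorem lintegral_window_le (u h : ℝ≥0) {φ : ℝ≥0 → ℝ≥0∞} (hφ : Measurable φ) :
    ∫⁻ t in Set.Icc 0 u, ∫⁻ r in Set.Icc t (t + h), φ r ∂timeMeasure ∂timeMeasure
      ≤ h * ∫⁻ r in Set.Icc 0 (u + h), φ r ∂timeMeasure := by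
  have h1 : ∀ t ∈ Set.Icc 0 u, ∫⁻ r in Set.Icc t (t + h), φ r ∂timeMeasure
      ≤ ∫⁻ r in Set.Icc 0 (u + h), (Set.Icc (r - h) r).indicator (fun _ => φ r) t ∂timeMeasure := by
    intro t ht
    rw [← lintegral_indicator measurableSet_Icc, ← lintegral_indicator measurableSet_Icc]
    refine lintegral_mono fun r => ?_
    by_cases hr : r ∈ Set.Icc t (t + h)
    · obtain ⟨h1, h2⟩ := Set.mem_Icc.1 hr
      have h3 : t ∈ Set.Icc (r - h) r := Set.mem_Icc.2 ⟨tsub_le_iff_right.2 h2, h1⟩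
      rw [Set.indicator_of_mem hr, Set.indicator_of_mem (Set.mem_Icc.2
        ⟨zero_le, h2.trans (by gcongr; exact (Set.mem_Icc.1 ht).2)⟩), Set.indicator_of_mem h3]
    · rw [Set.indicator_of_notMem hr]; exact zero_le
  refine (setLIntegral_mono' measurableSet_Icc h1).trans ?_
  rw [lintegral_lintegral_swap]
  · rw [← lintegral_const_mul' _ _ ENNReal.coe_ne_top]
    refine lintegral_mono fun r => ?_
    refine (lintegral_mono' Measure.restrict_le_self le_rfl).trans ?_
    rw [lintegral_indicator measurableSet_Icc, setLIntegral_const, timeMeasure_Icc, mul_comm]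
    refine mul_le_mul_left ?_ _
    rw [← ENNReal.ofReal_coe_nnreal]
    refine ENNReal.ofReal_le_ofReal ?_
    have : (r : ℝ) - h ≤ (r - h : ℝ≥0) := by
      rw [NNReal.coe_sub_def]; exact le_max_left _ _
    linarith
  · have e : (Function.uncurry fun t r => (Set.Icc (r - h) r).indicator (fun _ => φ r) t)
        = {p : ℝ≥0 × ℝ≥0 | p.2 - h ≤ p.1 ∧ p.1 ≤ p.2}.indicator fun p => φ p.2 := by
      ext ⟨t, r⟩
      simp [Set.indicator_apply]
    rw [e]
    refine ((hφ.comp measurable_snd).indicator ?_).aemeasurable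
    have a1 : MeasurableSet {p : ℝ≥0 × ℝ≥0 | p.2 - h ≤ p.1} :=
      measurableSet_le (by fun_prop) measurable_fst
    have a2 : MeasurableSet {p : ℝ≥0 × ℝ≥0 | p.1 ≤ p.2} :=
      measurableSet_le measurable_fst measurable_snd
    exact a1.inter a2

theorem setLIntegral_rpow_neg_half_le (h : ℝ≥0) :
    ∫⁻ τ in Set.Icc 0 h, ENNReal.ofReal ((τ : ℝ) ^ (-(1 / 2) : ℝ)) ∂timeMeasure
      ≤ ENNReal.ofReal (2 * (h : ℝ) ^ (1 / 2 : ℝ)) := by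
  rw [setLIntegral_timeMeasure 0 h fun x => ENNReal.ofReal (x ^ (-(1 / 2) : ℝ)),
    setLIntegral_congr Ioc_ae_eq_Icc.symm, NNReal.coe_zero,
    ← ofReal_integral_eq_lintegral_ofReal]
  · refine ENNReal.ofReal_le_ofReal (le_of_eq ?_)
    rw [← intervalIntegral.integral_of_le h.coe_nonneg, integral_rpow (Or.inl (by norm_num))]
    norm_num
    ring
  · exact (intervalIntegrable_iff_integrableOn_Ioc_of_le h.coe_nonneg).1
      (intervalIntegral.intervalIntegrable_rpow' (by norm_num))
  · exact (ae_restrict_mem measurableSet_Ioc).mono fun x hx => Real.rpow_nonneg hx.1.le _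

theorem setLIntegral_rpow_neg_three_halves_le {τ : ℝ≥0} (hτ : 0 < τ) (u : ℝ≥0) :
    ∫⁻ h in Set.Icc τ u, ENNReal.ofReal ((h : ℝ) ^ (-(3 / 2) : ℝ)) ∂timeMeasure
      ≤ ENNReal.ofReal (2 * (τ : ℝ) ^ (-(1 / 2) : ℝ)) := by
  have hτ' : (0 : ℝ) < τ := hτ
  rw [setLIntegral_timeMeasure τ u fun x => ENNReal.ofReal (x ^ (-(3 / 2) : ℝ)),
    setLIntegral_congr Ioc_ae_eq_Icc.symm]
  refine (lintegral_mono_set Set.Ioc_subset_Ioi_self).trans ?_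
  rw [← ofReal_integral_eq_lintegral_ofReal]
  · refine ENNReal.ofReal_le_ofReal (le_of_eq ?_)
    rw [integral_Ioi_rpow_of_lt (by norm_num) hτ']
    norm_num
    ring
  · exact integrableOn_Ioi_rpow_of_lt (by norm_num) hτ'
  · exact (ae_restrict_mem measurableSet_Ioi).mono fun x hx =>
      Real.rpow_nonneg (hτ'.trans hx).le _

/-- Hardy's inequality. -/
theorem hardy_lintegral (u : ℝ≥0) {q : ℝ≥0 → ℝ≥0∞} (hq : Measurable q) :
    ∫⁻ h in Set.Icc 0 u, ((h : ℝ≥0∞) ^ 2)⁻¹ * (∫⁻ τ in Set.Icc 0 h, q τ ∂timeMeasure) ^ 2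
      ∂timeMeasure ≤ 4 * ∫⁻ τ in Set.Icc 0 u, q τ ^ 2 ∂timeMeasure := by
  have hpos : ∀ᵐ τ ∂timeMeasure, (0 : ℝ≥0) < τ := by
    filter_upwards [Measure.ae_ne timeMeasure (0 : ℝ≥0)] with τ hτ using pos_iff_ne_zero.2 hτ
  let w : ℝ → ℝ≥0 → ℝ≥0∞ := fun e τ => ENNReal.ofReal ((τ : ℝ) ^ e)
  have hw : ∀ e, Measurable (w e) := fun e => by fun_prop
  have hww : ∀ (e e' : ℝ) {τ : ℝ≥0}, 0 < τ → w e τ * w e' τ = w (e + e') τ := fun e e' τ hτ => by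
    have hτ' : (0 : ℝ) < τ := hτ
    simp only [w]
    rw [← ENNReal.ofReal_mul (Real.rpow_nonneg hτ'.le _), ← Real.rpow_add hτ']
  have hw0 : ∀ {τ : ℝ≥0}, 0 < τ → w 0 τ = 1 := fun hτ => by simp [w]
  -- Cauchy–Schwarz after the splitting `q = τ^{-1/4} (τ^{1/4} q)`; the first factor contributes
  -- `∫₀^h τ^{-1/2} dτ = 2 h^{1/2}`.
  have h1 : ∀ h : ℝ≥0, (∫⁻ τ in Set.Icc 0 h, q τ ∂timeMeasure) ^ 2
      ≤ 2 * w (1 / 2) h * ∫⁻ τ in Set.Icc 0 h, w (1 / 2) τ * q τ ^ 2 ∂timeMeasure := by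
    intro h
    have e1 : ∫⁻ τ in Set.Icc 0 h, q τ ∂timeMeasure
        = ∫⁻ τ in Set.Icc 0 h, w (-(1 / 4)) τ * (w (1 / 4) τ * q τ) ∂timeMeasure := by
      refine lintegral_congr_ae (ae_restrict_of_ae (hpos.mono fun τ hτ => ?_))
      simp only
      rw [← mul_assoc, hww _ _ hτ, neg_add_cancel, hw0 hτ, one_mul]
    rw [e1]
    refine (sq_lintegral_mul_le (hw _).aemeasurable ((hw _).mul hq).aemeasurable).trans ?_
    refine mul_le_mul' ?_ (le_of_eq ?_)
    · refine le_trans (le_of_eq ?_) ((setLIntegral_rpow_neg_half_le h).trans (le_of_eq ?_))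
      · refine lintegral_congr_ae (ae_restrict_of_ae (hpos.mono fun τ hτ => ?_))
        simp only
        rw [sq, hww _ _ hτ]
        norm_num [w]
      · rw [ENNReal.ofReal_mul (by norm_num)]
        norm_num [w]
    · refine lintegral_congr_ae (ae_restrict_of_ae (hpos.mono fun τ hτ => ?_))
      simp only [Pi.mul_apply]
      rw [mul_pow, sq (w _ _), hww _ _ hτ]
      norm_num
  have h2 : ∀ h ∈ Set.Icc 0 u, 0 < h →
      ((h : ℝ≥0∞) ^ 2)⁻¹ * (∫⁻ τ in Set.Icc 0 h, q τ ∂timeMeasure) ^ 2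
      ≤ ∫⁻ τ in Set.Icc 0 u, (Set.Icc τ u).indicator
        (fun h => 2 * w (-(3 / 2)) h * (w (1 / 2) τ * q τ ^ 2)) h ∂timeMeasure := by
    intro h hh hh0
    have hh' : (0 : ℝ) < h := hh0
    refine (mul_le_mul_right (h1 h) _).trans ?_
    have e2 : ((h : ℝ≥0∞) ^ 2)⁻¹ = w (-2) h := by
      simp only [w]
      rw [Real.rpow_neg hh'.le, ENNReal.ofReal_inv_of_pos (by positivity), Real.rpow_two,
        ENNReal.ofReal_pow hh'.le, ENNReal.ofReal_coe_nnreal]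
    rw [e2, ← mul_assoc, show w (-2) h * (2 * w (1 / 2) h) = 2 * w (-(3 / 2)) h by
      rw [mul_left_comm, hww _ _ hh0]; norm_num,
      ← lintegral_const_mul _ (by fun_prop : Measurable fun τ => w (1 / 2) τ * q τ ^ 2),
      ← lintegral_indicator measurableSet_Icc, ← lintegral_indicator measurableSet_Icc]
    refine lintegral_mono fun τ => ?_
    by_cases hτ : τ ∈ Set.Icc 0 h
    · have h3 := (Set.mem_Icc.1 hτ).2
      have h4 := (Set.mem_Icc.1 hh).2
      rw [Set.indicator_of_mem hτ, Set.indicator_of_mem (Set.mem_Icc.2 ⟨zero_le, h3.trans h4⟩),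
        Set.indicator_of_mem (Set.mem_Icc.2 ⟨h3, h4⟩)]
    · rw [Set.indicator_of_notMem hτ]; exact zero_le
  refine (lintegral_mono_ae (((ae_restrict_mem measurableSet_Icc).and
    (ae_restrict_of_ae hpos)).mono fun h hh => h2 h hh.1 hh.2)).trans ?_
  -- After the exchange the remaining weight is `2 h⁻² h^{1/2} = 2 h^{-3/2}`. Its integral over `h ≥
  -- τ` is `4 τ^{-1/2}`, which cancels the weight `τ^{1/2}` and leaves the constant 4.
  rw [lintegral_lintegral_swap]
  · rw [← lintegral_const_mul _ (hq.pow_const 2)]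
    refine lintegral_mono_ae (ae_restrict_of_ae (hpos.mono fun τ hτ => ?_))
    refine (lintegral_mono' Measure.restrict_le_self le_rfl).trans ?_
    rw [lintegral_indicator measurableSet_Icc,
      lintegral_mul_const _ (by fun_prop : Measurable fun h => 2 * w (-(3 / 2)) h),
      lintegral_const_mul _ (hw _)]
    refine (mul_le_mul_left (mul_le_mul_right
      (setLIntegral_rpow_neg_three_halves_le hτ u) _) _).trans (le_of_eq ?_)
    rw [ENNReal.ofReal_mul (by norm_num)]
    change 2 * (_ * w (-(1 / 2)) τ) * (w (1 / 2) τ * q τ ^ 2) = _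
    rw [show 2 * (ENNReal.ofReal 2 * w (-(1 / 2)) τ) * (w (1 / 2) τ * q τ ^ 2)
      = 2 * ENNReal.ofReal 2 * (w (-(1 / 2)) τ * w (1 / 2) τ) * q τ ^ 2 by ring, hww _ _ hτ,
      neg_add_cancel, hw0 hτ]
    norm_num
  · have e : (Function.uncurry fun h τ => (Set.Icc τ u).indicator
        (fun h => 2 * w (-(3 / 2)) h * (w (1 / 2) τ * q τ ^ 2)) h)
        = {p : ℝ≥0 × ℝ≥0 | p.2 ≤ p.1 ∧ p.1 ≤ u}.indicator
          fun p => 2 * w (-(3 / 2)) p.1 * (w (1 / 2) p.2 * q p.2 ^ 2) := by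
      ext ⟨h, τ⟩
      simp [Set.indicator_apply]
    rw [e]
    refine (Measurable.indicator (by fun_prop) ?_).aemeasurable
    have a1 : MeasurableSet {p : ℝ≥0 × ℝ≥0 | p.2 ≤ p.1} :=
      measurableSet_le measurable_snd measurable_fst
    have a2 : MeasurableSet {p : ℝ≥0 × ℝ≥0 | p.1 ≤ u} :=
      measurableSet_le measurable_fst measurable_const
    exact a1.inter a2

/-! ### Lifting observability estimates to `L²` -/

section Lift

variable {Ω : Type*} {mΩ : MeasurableSpace Ω} {P : Measure Ω} [SFinite P]
  {H : Type*} [NormedAddCommGroup H] [NormedSpace ℝ H] [CompleteSpace H]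
  {H' : Type*} [NormedAddCommGroup H'] [NormedSpace ℝ H']
  {Y : Type*} [NormedAddCommGroup Y] [NormedSpace ℝ Y] {T : ℝ≥0 → H →L[ℝ] H}

/-- Tonelli's theorem: apply the deterministic estimate to `x ω` for each `ω`. The operator `J` on
the right is kept general so that differences of approximate observations inherit a small bound. -/
theorem setLIntegral_compLpL_le (hT : IsC0Semigroup T) {D : H →L[ℝ] Y} {J : H →L[ℝ] H'}
    {γ : ℝ≥0} {u : ℝ≥0}
    (h : ∀ x, ∫⁻ τ in Set.Icc 0 u, ‖D (T τ x)‖ₑ ^ 2 ∂timeMeasure ≤ γ * ‖J x‖ₑ ^ 2) (x : Lp H 2 P) :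
    ∫⁻ τ in Set.Icc 0 u, ‖D.compLpL 2 P ((T τ).compLpL 2 P x)‖ₑ ^ 2 ∂timeMeasure
      ≤ γ * ‖J.compLpL 2 P x‖ₑ ^ 2 := by
  have e : ∀ τ, ‖D.compLpL 2 P ((T τ).compLpL 2 P x)‖ₑ ^ 2 = ∫⁻ ω, ‖D (T τ (x ω))‖ₑ ^ 2 ∂P := by
    intro τ
    rw [Lp_enorm_sq]
    refine lintegral_congr_ae ?_
    filter_upwards [D.coeFn_compLpL ((T τ).compLpL 2 P x), (T τ).coeFn_compLpL x] with ω h1 h2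
    rw [h1, h2]
  simp_rw [e]
  rw [lintegral_lintegral_swap, Lp_enorm_sq, ← lintegral_const_mul' _ _ ENNReal.coe_ne_top]
  · refine lintegral_mono_ae ?_
    filter_upwards [J.coeFn_compLpL x] with ω h1
    rw [h1]
    exact h (x ω)
  · have : StronglyMeasurable fun p : ℝ≥0 × Ω => D (T p.1 (x p.2)) :=
      (D.continuous.comp hT.continuous_uncurry).comp_stronglyMeasurable
        (stronglyMeasurable_id.comp_measurable measurable_fst |>.prodMk
          ((Lp.stronglyMeasurable x).comp_measurable measurable_snd))
    exact (this.enorm.pow_const 2).aemeasurable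

end Lift

theorem measurable_setLIntegral_Icc {S : Type*} {mS : MeasurableSpace S} {τ : S → ℝ≥0}
    (hτ : Measurable τ) {φ : S → ℝ≥0 → ℝ≥0∞} (hφ : Measurable fun p : S × ℝ≥0 => φ p.1 p.2) :
    Measurable fun x => ∫⁻ s in Set.Icc 0 (τ x), φ x s ∂timeMeasure := by
  have m : MeasurableSet {p : S × ℝ≥0 | p.2 ≤ τ p.1} :=
    measurableSet_le measurable_snd (hτ.comp measurable_fst)
  have h := (hφ.indicator m).lintegral_prod_right' (ν := timeMeasure)
  have e : (fun x => ∫⁻ s in Set.Icc 0 (τ x), φ x s ∂timeMeasure) = fun x =>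
      ∫⁻ s, {p : S × ℝ≥0 | p.2 ≤ τ p.1}.indicator (fun p => φ p.1 p.2) (x, s) ∂timeMeasure := by
    ext x
    rw [← lintegral_indicator measurableSet_Icc]
    refine lintegral_congr fun s => ?_
    simp [Set.indicator_apply]
  rw [e]
  exact h

/-! ### Mean square estimates for the linear mild equation -/

section Linear

variable {Ω : Type*} {mΩ : MeasurableSpace Ω} {P : Measure Ω} [IsProbabilityMeasure P]
  {𝓕 : Filtration ℝ≥0 mΩ} {W : ℝ≥0 → Ω → ℝ}
  {H : Type*} [NormedAddCommGroup H] [InnerProductSpace ℝ H] [CompleteSpace H]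
  {Y : Type*} [NormedAddCommGroup Y] [InnerProductSpace ℝ Y] [CompleteSpace Y]
  {T : ℝ≥0 → H →L[ℝ] H}

/-- The curve `X` satisfies `X(t) = T(t) ξ + ∫₀ᵗ T(t-s) g(s) ds + ∫₀ᵗ T(t-s) f(s) dW(s)`. -/
def IsLinearMild (𝓕 : Filtration ℝ≥0 mΩ) (P : Measure Ω) [IsProbabilityMeasure P]
    (W : ℝ≥0 → Ω → ℝ) (T : ℝ≥0 → H →L[ℝ] H) (ξ : Lp H 2 P) (g f X : ℝ≥0 → Lp H 2 P) : Prop :=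
  ∀ t, ∃ (v : Lp (Lp H 2 P) 2 timeMeasure) (I : Lp H 2 P), (v, I) ∈ itoGraph 𝓕 P W t ∧
    v =ᵐ[timeMeasure] (Set.Icc 0 t).indicator (fun s => (T (t - s)).compLpL 2 P (f s)) ∧
    X t = (T t).compLpL 2 P ξ
      + ∫ s in Set.Icc 0 t, (T (t - s)).compLpL 2 P (g s) ∂timeMeasure + I

theorem continuous_compLpL_kernel (hT : IsC0Semigroup T) {g : ℝ≥0 → Lp H 2 P}
    (hg : Continuous g) :
    Continuous fun p : ℝ≥0 × ℝ≥0 => (T (p.1 - p.2)).compLpL 2 P (g p.2) :=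
  hT.compLpL.continuous_uncurry.comp
    ((continuous_fst.sub continuous_snd).prodMk (hg.comp continuous_snd))

theorem continuous_compLpL_kernel_right (hT : IsC0Semigroup T) {g : ℝ≥0 → Lp H 2 P}
    (hg : Continuous g) (t : ℝ≥0) : Continuous fun s => (T (t - s)).compLpL 2 P (g s) :=
  (continuous_compLpL_kernel hT hg).comp (by fun_prop : Continuous fun s : ℝ≥0 => (t, s))

theorem IsLinearMild.sub (hT : IsC0Semigroup T) {ξ ξ' : Lp H 2 P} {g g' f f' X X' : ℝ≥0 → Lp H 2 P}
    (hg : Continuous g) (hg' : Continuous g') (h : IsLinearMild 𝓕 P W T ξ g f X)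
    (h' : IsLinearMild 𝓕 P W T ξ' g' f' X') :
    IsLinearMild 𝓕 P W T (ξ - ξ') (g - g') (f - f') (X - X') := by
  intro t
  obtain ⟨v, I, hvI, hv, hX⟩ := h t
  obtain ⟨v', I', hvI', hv', hX'⟩ := h' t
  refine ⟨v - v', I - I', sub_mem hvI hvI', ?_, ?_⟩
  · filter_upwards [hv, hv', Lp.coeFn_sub v v'] with s h1 h2 h3
    rw [h3, Pi.sub_apply, h1, h2]
    by_cases hs : s ∈ Set.Icc 0 t
    · simp only [Set.indicator_of_mem hs, Pi.sub_apply, map_sub]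
    · simp only [Set.indicator_of_notMem hs, sub_zero]
  · have e : ∀ s, (T (t - s)).compLpL 2 P ((g - g') s)
        = (T (t - s)).compLpL 2 P (g s) - (T (t - s)).compLpL 2 P (g' s) := fun s => by
      rw [Pi.sub_apply, map_sub]
    simp_rw [e]
    rw [integral_sub ((continuous_compLpL_kernel_right hT hg t).continuousOn.integrableOn_compact
      isCompact_Icc) ((continuous_compLpL_kernel_right hT hg' t).continuousOn.integrableOn_compact
      isCompact_Icc), Pi.sub_apply, hX, hX', map_sub]
    abel

/-- A bounded `D` passes through the drift integral and through the Itô graph. Itô's isometry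
evaluates the noise term exactly, while Cauchy–Schwarz in time treats the drift and costs the factor
`t`. -/
theorem IsLinearMild.enorm_observe_sq_le (hW : IsFBrownianMotion 𝓕 P W) (hT : IsC0Semigroup T)
    {ξ : Lp H 2 P} {g f X : ℝ≥0 → Lp H 2 P} (hg : Continuous g)
    (h : IsLinearMild 𝓕 P W T ξ g f X) (D : H →L[ℝ] Y) (t : ℝ≥0) :
    ‖D.compLpL 2 P (X t)‖ₑ ^ 2 ≤ 4 * (‖D.compLpL 2 P ((T t).compLpL 2 P ξ)‖ₑ ^ 2
      + (t * ∫⁻ s in Set.Icc 0 t, ‖D.compLpL 2 P ((T (t - s)).compLpL 2 P (g s))‖ₑ ^ 2 ∂timeMeasure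
      + ∫⁻ s in Set.Icc 0 t, ‖D.compLpL 2 P ((T (t - s)).compLpL 2 P (f s))‖ₑ ^ 2 ∂timeMeasure)) := by
  obtain ⟨v, I, hvI, hv, hX⟩ := h t
  have hc := continuous_compLpL_kernel_right hT hg t
  have h1 : ‖∫ s in Set.Icc 0 t, D.compLpL 2 P ((T (t - s)).compLpL 2 P (g s)) ∂timeMeasure‖ₑ ^ 2
      ≤ t * ∫⁻ s in Set.Icc 0 t, ‖D.compLpL 2 P ((T (t - s)).compLpL 2 P (g s))‖ₑ ^ 2
        ∂timeMeasure :=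
    (pow_le_pow_left' (enorm_integral_le_lintegral_enorm _) 2).trans
      (sq_setLIntegral_le t ((D.compLpL 2 P).continuous.comp hc).enorm.measurable.aemeasurable)
  have h2 : ‖D.compLpL 2 P I‖ₑ ^ 2
      = ∫⁻ s in Set.Icc 0 t, ‖D.compLpL 2 P ((T (t - s)).compLpL 2 P (f s))‖ₑ ^ 2 ∂timeMeasure := by
    rw [← ofReal_norm, ← norm_eq_of_mem_itoGraph hW (map_mem_itoGraph D hvI), ofReal_norm,
      Lp_enorm_sq, ← lintegral_indicator measurableSet_Icc]
    refine lintegral_congr_ae ?_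
    filter_upwards [hv, (D.compLpL 2 P).coeFn_compLpL v] with s e1 e2
    rw [e2, e1]
    by_cases hs : s ∈ Set.Icc 0 t
    · simp only [Set.indicator_of_mem hs]
    · simp only [Set.indicator_of_notMem hs, map_zero]
      simp
  have e : D.compLpL 2 P (X t) = D.compLpL 2 P ((T t).compLpL 2 P ξ)
      + (∫ s in Set.Icc 0 t, D.compLpL 2 P ((T (t - s)).compLpL 2 P (g s)) ∂timeMeasure
        + D.compLpL 2 P I) := by
    rw [hX, map_add, map_add, add_assoc, (D.compLpL 2 P).integral_comp_comm
      (hc.continuousOn.integrableOn_compact isCompact_Icc)]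
  rw [e]
  refine (pow_le_pow_left' (enorm_add_le _ _) 2).trans ((add_sq_le_two_mul _ _).trans ?_)
  refine (mul_le_mul_right (add_le_add_right ((pow_le_pow_left' (enorm_add_le _ _) 2).trans
    (add_sq_le_two_mul _ _)) _) _).trans ?_
  rw [h2]
  refine (mul_le_mul_right (add_le_add_right (mul_le_mul_right (add_le_add_left h1 _) _) _)
    _).trans ?_
  generalize ‖D.compLpL 2 P ((T t).compLpL 2 P ξ)‖ₑ ^ 2 = a
  generalize (t : ℝ≥0∞) * _ = b
  generalize ∫⁻ s in Set.Icc 0 t, ‖D.compLpL 2 P ((T (t - s)).compLpL 2 P (f s))‖ₑ ^ 2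
    ∂timeMeasure = c
  calc 2 * (a + 2 * (b + c)) ≤ 2 * (a + 2 * (b + c)) + 2 * a := le_self_add
    _ = _ := by ring

theorem measurable_enorm_observe (hT : IsC0Semigroup T) (D : H →L[ℝ] Y) {k : ℝ≥0 → Lp H 2 P}
    (hk : Continuous k) : Measurable fun p : ℝ≥0 × ℝ≥0 =>
      ‖D.compLpL 2 P ((T p.2).compLpL 2 P (k p.1))‖ₑ := by
  have : Continuous fun p : ℝ≥0 × ℝ≥0 => D.compLpL 2 P ((T p.2).compLpL 2 P (k p.1)) :=
    (D.compLpL 2 P).continuous.comp (hT.compLpL.continuous_uncurry.comp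
      (continuous_snd.prodMk (hk.comp continuous_fst)))
  exact this.enorm.measurable

theorem measurable_enorm_observe_sub (hT : IsC0Semigroup T) (D : H →L[ℝ] Y)
    {k : ℝ≥0 → Lp H 2 P} (hk : Continuous k) : Measurable fun p : ℝ≥0 × ℝ≥0 =>
      ‖D.compLpL 2 P ((T (p.1 - p.2)).compLpL 2 P (k p.2))‖ₑ := by
  have : Continuous fun p : ℝ≥0 × ℝ≥0 => D.compLpL 2 P ((T (p.1 - p.2)).compLpL 2 P (k p.2)) :=
    (D.compLpL 2 P).continuous.comp (continuous_compLpL_kernel hT hk)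
  exact this.enorm.measurable

/-- The observation of a solution of the linear equation is square integrable in time. -/
theorem IsLinearMild.lintegral_observe_sq_le (hW : IsFBrownianMotion 𝓕 P W)
    (hT : IsC0Semigroup T) {ξ : Lp H 2 P} {g f X : ℝ≥0 → Lp H 2 P} (hg : Continuous g)
    (hf : Continuous f) (h : IsLinearMild 𝓕 P W T ξ g f X) {H' : Type*}
    [NormedAddCommGroup H'] [NormedSpace ℝ H'] {D : H →L[ℝ] Y} {J : H →L[ℝ] H'} {γ u : ℝ≥0}
    (hD : ∀ x, ∫⁻ τ in Set.Icc 0 u, ‖D (T τ x)‖ₑ ^ 2 ∂timeMeasure ≤ γ * ‖J x‖ₑ ^ 2) :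
    ∫⁻ t in Set.Icc 0 u, ‖D.compLpL 2 P (X t)‖ₑ ^ 2 ∂timeMeasure
      ≤ 4 * γ * (‖J.compLpL 2 P ξ‖ₑ ^ 2
        + (u * ∫⁻ s in Set.Icc 0 u, ‖J.compLpL 2 P (g s)‖ₑ ^ 2 ∂timeMeasure
        + ∫⁻ s in Set.Icc 0 u, ‖J.compLpL 2 P (f s)‖ₑ ^ 2 ∂timeMeasure)) := by
  have hlift := setLIntegral_compLpL_le (P := P) hT hD
  -- After the exchange of integrals each fixed `s` contributes a free orbit started at `k s`, to
  -- which the observation estimate applies.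
  have hvol : ∀ {k : ℝ≥0 → Lp H 2 P}, Continuous k → ∫⁻ t in Set.Icc 0 u, ∫⁻ s in Set.Icc 0 t,
      ‖D.compLpL 2 P ((T (t - s)).compLpL 2 P (k s))‖ₑ ^ 2 ∂timeMeasure ∂timeMeasure
      ≤ γ * ∫⁻ s in Set.Icc 0 u, ‖J.compLpL 2 P (k s)‖ₑ ^ 2 ∂timeMeasure := fun {k} hk => by
    refine (lintegral_volterra_le u
      (φ := fun s τ => ‖D.compLpL 2 P ((T τ).compLpL 2 P (k s))‖ₑ ^ 2)
      ((measurable_enorm_observe hT D hk).pow_const 2)).trans ?_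
    rw [← lintegral_const_mul' _ _ ENNReal.coe_ne_top]
    exact lintegral_mono fun s => hlift (k s)
  have hmeas : ∀ {k : ℝ≥0 → Lp H 2 P}, Continuous k → Measurable fun t => ∫⁻ s in Set.Icc 0 t,
      ‖D.compLpL 2 P ((T (t - s)).compLpL 2 P (k s))‖ₑ ^ 2 ∂timeMeasure := fun {k} hk => by
    exact measurable_setLIntegral_Icc
      (φ := fun t s => ‖D.compLpL 2 P ((T (t - s)).compLpL 2 P (k s))‖ₑ ^ 2) measurable_id
      ((measurable_enorm_observe_sub hT D hk).pow_const 2)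
  have hξ : Measurable fun t => ‖D.compLpL 2 P ((T t).compLpL 2 P ξ)‖ₑ ^ 2 :=
    ((D.compLpL 2 P).continuous.comp
      (hT.compLpL.continuous_apply ξ)).enorm.measurable.pow_const 2
  refine (setLIntegral_mono' (g := fun t => 4 * (‖D.compLpL 2 P ((T t).compLpL 2 P ξ)‖ₑ ^ 2
      + (u * ∫⁻ s in Set.Icc 0 t, ‖D.compLpL 2 P ((T (t - s)).compLpL 2 P (g s))‖ₑ ^ 2 ∂timeMeasure
      + ∫⁻ s in Set.Icc 0 t, ‖D.compLpL 2 P ((T (t - s)).compLpL 2 P (f s))‖ₑ ^ 2 ∂timeMeasure)))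
    measurableSet_Icc fun t ht =>
    (h.enorm_observe_sq_le hW hT hg D t).trans (mul_le_mul_right (add_le_add_right
      (add_le_add_left (mul_le_mul_left (by exact_mod_cast (Set.mem_Icc.1 ht).2) _) _) _) _)).trans ?_
  rw [lintegral_const_mul' _ _ (by simp), lintegral_add_left hξ,
    lintegral_add_left ((hmeas hg).const_mul _), lintegral_const_mul' _ _ ENNReal.coe_ne_top]
  refine (mul_le_mul_right (add_le_add (hlift ξ) (add_le_add (mul_le_mul_right (hvol hg) _)
    (hvol hf))) _).trans (le_of_eq ?_)
  ring

end Linear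

/-! ### Time averages of observed increments -/

section Increments

variable {Ω : Type*} {mΩ : MeasurableSpace Ω} {P : Measure Ω} [IsProbabilityMeasure P]
  {𝓕 : Filtration ℝ≥0 mΩ} {W : ℝ≥0 → Ω → ℝ}
  {H : Type*} [NormedAddCommGroup H] [InnerProductSpace ℝ H] [CompleteSpace H]
  {Y : Type*} [NormedAddCommGroup Y] [InnerProductSpace ℝ Y] [CompleteSpace Y]
  {T : ℝ≥0 → H →L[ℝ] H}

/-- The integrand `1_{(t, t+τ]}(r) D T(t+τ-r) k(r)` of the observed increments. -/
noncomputable def incrementKernel (D : H →L[ℝ] Y) (T : ℝ≥0 → H →L[ℝ] H) (k : ℝ≥0 → Lp H 2 P)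
    (t τ r : ℝ≥0) : Lp Y 2 P :=
  (Set.Ioc t (t + τ)).indicator
    (fun r => D.compLpL 2 P ((T (t + τ - r)).compLpL 2 P (k r))) r

theorem stronglyMeasurable_incrementKernel (hT : IsC0Semigroup T) (D : H →L[ℝ] Y)
    {k : ℝ≥0 → Lp H 2 P} (hk : Continuous k) (t : ℝ≥0) :
    StronglyMeasurable fun p : ℝ≥0 × ℝ≥0 => incrementKernel D T k t p.1 p.2 := by
  have hs : Continuous fun p : ℝ≥0 × ℝ≥0 => (t + p.1, p.2) := by fun_prop
  have hc : Continuous fun p : ℝ≥0 × ℝ≥0 =>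
      D.compLpL 2 P ((T (t + p.1 - p.2)).compLpL 2 P (k p.2)) := by
    have h1 := (continuous_compLpL_kernel hT hk).comp hs
    exact (D.compLpL 2 P).continuous.comp h1
  have m1 : MeasurableSet {p : ℝ≥0 × ℝ≥0 | t < p.2} :=
    measurableSet_lt measurable_const measurable_snd
  have m2 : MeasurableSet {p : ℝ≥0 × ℝ≥0 | p.2 ≤ t + p.1} :=
    measurableSet_le measurable_snd (by fun_prop)
  have e : (fun p : ℝ≥0 × ℝ≥0 => incrementKernel D T k t p.1 p.2)
      = ({p : ℝ≥0 × ℝ≥0 | t < p.2} ∩ {p : ℝ≥0 × ℝ≥0 | p.2 ≤ t + p.1}).indicator fun p =>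
        D.compLpL 2 P ((T (t + p.1 - p.2)).compLpL 2 P (k p.2)) := by
    ext1 p
    simp [incrementKernel, Set.indicator_apply]
  rw [e]
  exact hc.stronglyMeasurable.indicator (m1.inter m2)

/-- For fixed `r` the kernel is supported on `τ ≥ r - t`; there the substitution `σ = t + τ - r`
turns it into a free orbit started at `k r`. -/
theorem lintegral_incrementKernel_le (hT : IsC0Semigroup T) (D : H →L[ℝ] Y)
    (k : ℝ≥0 → Lp H 2 P) (t h r : ℝ≥0) :
    ∫⁻ τ in Set.Icc 0 h, ‖incrementKernel D T k t τ r‖ₑ ∂timeMeasure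
      ≤ (Set.Icc t (t + h)).indicator (fun r => ∫⁻ σ in Set.Icc 0 h,
        ‖D.compLpL 2 P ((T σ).compLpL 2 P (k r))‖ₑ ∂timeMeasure) r := by
  by_cases hr : r ∈ Set.Ioc t (t + h)
  · rw [Set.indicator_of_mem (Set.Ioc_subset_Icc_self hr)]
    have hm : Measurable fun σ => ‖D.compLpL 2 P ((T σ).compLpL 2 P (k r))‖ₑ :=
      ((D.compLpL 2 P).continuous.comp (hT.compLpL.continuous_apply (k r))).enorm.measurable
    refine le_trans ?_ (lintegral_indicator_sub_le (r - t) h hm)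
    refine lintegral_mono fun τ => ?_
    obtain ⟨a, rfl⟩ := exists_add_of_le hr.1.le
    simp only [incrementKernel, add_tsub_cancel_left]
    by_cases ha : a ≤ τ
    · have h1 : t + a ∈ Set.Ioc t (t + τ) := ⟨hr.1, by gcongr⟩
      rw [Set.indicator_of_mem h1, Set.indicator_of_mem (Set.mem_Ici.2 ha),
        add_tsub_add_eq_tsub_left]
    · have h1 : t + a ∉ Set.Ioc t (t + τ) := fun h => ha (le_of_add_le_add_left h.2)
      rw [Set.indicator_of_notMem h1, enorm_zero]
      exact zero_le
  · refine le_trans (le_of_eq ?_) zero_le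
    refine (setLIntegral_congr_fun measurableSet_Icc (g := fun _ => 0) fun τ hτ => ?_).trans (by simp)
    have h1 : r ∉ Set.Ioc t (t + τ) := fun h => hr ⟨h.1, h.2.trans (by
      gcongr; exact (Set.mem_Icc.1 hτ).2)⟩
    simp only [incrementKernel, Set.indicator_of_notMem h1, enorm_zero]

/-- For the closed subspace given by the Itô graph this says that the integral of an averaged
integrand is the average of the integrals, which is the form of stochastic Fubini needed here. -/
theorem setIntegral_prod_mem_of_isClosed {A B : Type*} [NormedAddCommGroup A] [NormedSpace ℝ A]
    [CompleteSpace A] [NormedAddCommGroup B] [NormedSpace ℝ B] [CompleteSpace B]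
    {S : Submodule ℝ (A × B)} (hS : IsClosed (S : Set (A × B))) {v : ℝ≥0 → A} {I : ℝ≥0 → B}
    (hv : Continuous v) (hI : Continuous I) {h : ℝ≥0} (hmem : ∀ τ ≤ h, (v τ, I τ) ∈ S) :
    (∫ τ in Set.Icc 0 h, v τ ∂timeMeasure, ∫ τ in Set.Icc 0 h, I τ ∂timeMeasure) ∈ S := by
  have hc : Continuous fun τ => (v τ, I τ) := hv.prodMk hI
  have h1 := setIntegral_mem_of_isClosed hS hc h hmem
  have hi : Integrable (fun τ => (v τ, I τ)) (timeMeasure.restrict (Set.Icc 0 h)) :=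
    hc.continuousOn.integrableOn_compact isCompact_Icc
  have e : ∫ τ in Set.Icc 0 h, (v τ, I τ) ∂timeMeasure
      = (∫ τ in Set.Icc 0 h, v τ ∂timeMeasure, ∫ τ in Set.Icc 0 h, I τ ∂timeMeasure) :=
    Prod.ext (fst_integral hi) (snd_integral hi)
  rwa [e] at h1

theorem norm_setIntegral_eq_of_mem_itoGraph (hW : IsFBrownianMotion 𝓕 P W)
    {v : ℝ≥0 → Lp (Lp H 2 P) 2 timeMeasure} {I : ℝ≥0 → Lp H 2 P} (hv : Continuous v)
    (hI : Continuous I) {t h : ℝ≥0} (hmem : ∀ τ ≤ h, (v τ, I τ) ∈ itoGraph 𝓕 P W t) :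
    ‖∫ τ in Set.Icc 0 h, v τ ∂timeMeasure‖ = ‖∫ τ in Set.Icc 0 h, I τ ∂timeMeasure‖ := by
  have h1 : (∫ τ in Set.Icc 0 h, v τ ∂timeMeasure, ∫ τ in Set.Icc 0 h, I τ ∂timeMeasure)
      ∈ itoGraph 𝓕 P W t := by
    refine setIntegral_prod_mem_of_isClosed ?_ hv hI hmem
    exact isClosed_itoGraph t
  have h2 := norm_eq_of_mem_itoGraph hW h1
  exact h2

/-- In `X(t + τ) - T(τ) X(t)` the initial value and everything before `t` cancel. Averaging over `τ`
precedes Itô's isometry, so the bound contains the square of a time integral of free outputs and not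
the value of an output at one instant. This keeps it uniform over approximations of `C`. -/
theorem IsLinearMild.enorm_setIntegral_increment_sq_le (hW : IsFBrownianMotion 𝓕 P W)
    (hT : IsC0Semigroup T) {ξ : Lp H 2 P} {g f X : ℝ≥0 → Lp H 2 P} (hg : Continuous g)
    (hf : Continuous f) (hX : Continuous X) (hmild : IsLinearMild 𝓕 P W T ξ g f X)
    (D : H →L[ℝ] Y) (t h : ℝ≥0) :
    ‖∫ τ in Set.Icc 0 h, D.compLpL 2 P (X (t + τ) - (T τ).compLpL 2 P (X t)) ∂timeMeasure‖ₑ ^ 2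
      ≤ 2 * (h * (∫⁻ r in Set.Icc t (t + h), (∫⁻ σ in Set.Icc 0 h,
          ‖D.compLpL 2 P ((T σ).compLpL 2 P (g r))‖ₑ ∂timeMeasure) ^ 2 ∂timeMeasure)
        + ∫⁻ r in Set.Icc t (t + h), (∫⁻ σ in Set.Icc 0 h,
          ‖D.compLpL 2 P ((T σ).compLpL 2 P (f r))‖ₑ ∂timeMeasure) ^ 2 ∂timeMeasure) := by
  choose v I hvI hv hXeq using hmild
  set B : ℝ≥0 → Lp H 2 P := fun t =>
    ∫ s in Set.Icc 0 t, (T (t - s)).compLpL 2 P (g s) ∂timeMeasure with hB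
  have hBc : Continuous B := continuous_setIntegral_volterra
    (h := fun t s => (T (t - s)).compLpL 2 P (g s)) (continuous_compLpL_kernel hT hg)
  have hIc : Continuous I := by
    have e : I = fun t => X t - (T t).compLpL 2 P ξ - B t := funext fun t => by
      rw [hXeq t]; abel
    rw [e]
    exact (hX.sub (hT.compLpL.continuous_apply ξ)).sub hBc
  -- The noise term is continuous because the other terms of the equation are; the isometry
  -- transfers its continuity back to the integrands.
  have hvc : Continuous v := by
    rw [Metric.continuous_iff] at hIc ⊢
    intro b ε hε
    obtain ⟨δ, hδ, hd⟩ := hIc b ε hε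
    refine ⟨δ, hδ, fun a ha => ?_⟩
    have := norm_eq_of_mem_itoGraph hW (sub_mem (itoGraph_mono (le_max_left a b) (hvI a))
      (itoGraph_mono (le_max_right a b) (hvI b)))
    simp only [Prod.fst_sub, Prod.snd_sub] at this
    rw [dist_eq_norm, this, ← dist_eq_norm]
    exact hd a ha
  have hshift : Continuous fun τ : ℝ≥0 => t + τ := by fun_prop
  set w : ℝ≥0 → Lp (Lp H 2 P) 2 timeMeasure := fun τ =>
    v (t + τ) - ((T τ).compLpL 2 P).compLpL 2 timeMeasure (v t) with hw
  set J : ℝ≥0 → Lp H 2 P := fun τ => I (t + τ) - (T τ).compLpL 2 P (I t) with hJ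
  have hwc : Continuous w :=
    (hvc.comp hshift).sub (hT.compLpL.compLpL.continuous_apply (v t))
  have hJc : Continuous J := (hIc.comp hshift).sub (hT.compLpL.continuous_apply (I t))
  have hmem : ∀ τ ≤ h, ((D.compLpL 2 P).compLpL 2 timeMeasure (w τ), D.compLpL 2 P (J τ))
      ∈ itoGraph 𝓕 P W (t + h) := fun τ hτ => by
    have h1 : (v (t + τ), I (t + τ)) ∈ itoGraph 𝓕 P W (t + h) :=
      itoGraph_mono (add_le_add_right hτ t) (hvI (t + τ))
    have h2 := itoGraph_mono (le_self_add : t ≤ t + h) (map_mem_itoGraph (T τ) (hvI t))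
    have h3 := map_mem_itoGraph D (sub_mem h1 h2)
    exact h3
  have hDw : Continuous fun τ => (D.compLpL 2 P).compLpL 2 timeMeasure (w τ) :=
    ((D.compLpL 2 P).compLpL 2 timeMeasure).continuous.comp hwc
  have hDJ : Continuous fun τ => D.compLpL 2 P (J τ) := (D.compLpL 2 P).continuous.comp hJc
  set V := ∫ τ in Set.Icc 0 h, (D.compLpL 2 P).compLpL 2 timeMeasure (w τ) ∂timeMeasure with hV
  set N := ∫ τ in Set.Icc 0 h, D.compLpL 2 P (J τ) ∂timeMeasure with hN
  have hVN : ‖V‖ = ‖N‖ :=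
    norm_setIntegral_eq_of_mem_itoGraph hW hDw hDJ hmem
  -- Evaluate the averaged integrand at a time `r`. For `r ≤ t` the two kernels cancel by the
  -- semigroup law, and for `r > t` only the first one is left.
  have hVeq : V =ᵐ[timeMeasure] fun r => ∫ τ in Set.Icc 0 h, incrementKernel D T f t τ r
      ∂timeMeasure := by
    refine setIntegral_curve_ae_eq hDw h (stronglyMeasurable_incrementKernel hT D hf t)
      fun τ _ => ?_
    filter_upwards [(D.compLpL 2 P).coeFn_compLpL (w τ), Lp.coeFn_sub (v (t + τ))
      (((T τ).compLpL 2 P).compLpL 2 timeMeasure (v t)), ((T τ).compLpL 2 P).coeFn_compLpL (v t),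
      hv t, hv (t + τ)] with r e1 e2 e3 e4 e5
    rw [e1, hw, e2, Pi.sub_apply, e3, e4, e5]
    by_cases h1 : r ≤ t
    · have h2 : r ∉ Set.Ioc t (t + τ) := fun h => absurd h.1 (not_lt.2 h1)
      have h3 : r ∈ Set.Icc 0 t := Set.mem_Icc.2 ⟨zero_le, h1⟩
      have h4 : r ∈ Set.Icc 0 (t + τ) := Set.mem_Icc.2 ⟨zero_le, h1.trans (by simp)⟩
      rw [incrementKernel, Set.indicator_of_notMem h2, Set.indicator_of_mem h3,
        Set.indicator_of_mem h4, ← hT.compLpL.add_apply, add_comm t τ, add_tsub_assoc_of_le h1,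
        sub_self, map_zero]
    · have h3 : r ∉ Set.Icc 0 t := fun h => h1 (Set.mem_Icc.1 h).2
      rw [Set.indicator_of_notMem h3, map_zero, sub_zero, incrementKernel]
      by_cases h2 : r ≤ t + τ
      · rw [Set.indicator_of_mem (Set.mem_Icc.2 ⟨zero_le, h2⟩),
          Set.indicator_of_mem (show r ∈ Set.Ioc t (t + τ) from ⟨not_le.1 h1, h2⟩)]
      · rw [Set.indicator_of_notMem fun h => h2 (Set.mem_Icc.1 h).2,
          Set.indicator_of_notMem fun h => h2 (Set.mem_Ioc.1 h).2, map_zero]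
  have hNle : ‖N‖ₑ ^ 2 ≤ ∫⁻ r in Set.Icc t (t + h), (∫⁻ σ in Set.Icc 0 h,
      ‖D.compLpL 2 P ((T σ).compLpL 2 P (f r))‖ₑ ∂timeMeasure) ^ 2 ∂timeMeasure := by
    rw [← ofReal_norm, ← hVN, ofReal_norm, Lp_enorm_sq, ← lintegral_indicator measurableSet_Icc]
    refine lintegral_mono_ae ?_
    filter_upwards [hVeq] with r hr
    rw [hr]
    refine (pow_le_pow_left' ((enorm_integral_le_lintegral_enorm _).trans
      (lintegral_incrementKernel_le hT D f t h r)) 2).trans (le_of_eq ?_)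
    by_cases h1 : r ∈ Set.Icc t (t + h)
    · simp only [Set.indicator_of_mem h1]
    · simp only [Set.indicator_of_notMem h1]; simp
  have hDg : ∀ a, Continuous fun r => D.compLpL 2 P ((T (a - r)).compLpL 2 P (g r)) := fun a =>
    (D.compLpL 2 P).continuous.comp (continuous_compLpL_kernel_right hT hg a)
  have hdrift : ∀ τ, D.compLpL 2 P (B (t + τ) - (T τ).compLpL 2 P (B t))
      = ∫ r, incrementKernel D T g t τ r ∂timeMeasure := by
    intro τ
    have i1 : ∀ a b : ℝ≥0, IntegrableOn (fun r => (T (a - r)).compLpL 2 P (g r)) (Set.Icc 0 b)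
        timeMeasure := fun a b =>
      (continuous_compLpL_kernel_right hT hg a).continuousOn.integrableOn_compact isCompact_Icc
    have h1 : (T τ).compLpL 2 P (B t)
        = ∫ r in Set.Icc 0 t, (T (t + τ - r)).compLpL 2 P (g r) ∂timeMeasure := by
      rw [hB, ← ((T τ).compLpL 2 P).integral_comp_comm (i1 t t)]
      refine setIntegral_congr_fun measurableSet_Icc fun r hr => ?_
      rw [← hT.compLpL.add_apply, add_comm t τ, add_tsub_assoc_of_le (Set.mem_Icc.1 hr).2]
    have h2 : Set.Icc 0 (t + τ) = Set.Icc 0 t ∪ Set.Ioc t (t + τ) :=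
      (Set.Icc_union_Ioc_eq_Icc zero_le (by simp)).symm
    have h3 : B (t + τ) = (∫ r in Set.Icc 0 t, (T (t + τ - r)).compLpL 2 P (g r) ∂timeMeasure)
        + ∫ r in Set.Ioc t (t + τ), (T (t + τ - r)).compLpL 2 P (g r) ∂timeMeasure := by
      change ∫ r in Set.Icc 0 (t + τ), (T (t + τ - r)).compLpL 2 P (g r) ∂timeMeasure = _
      rw [h2, setIntegral_union _ measurableSet_Ioc (i1 _ _)
        ((i1 (t + τ) (t + τ)).mono_set fun r hr => Set.mem_Icc.2 ⟨zero_le, hr.2⟩)]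
      exact Set.disjoint_left.2 fun r h1 h2 => absurd (Set.mem_Icc.1 h1).2 (not_le.2 h2.1)
    rw [h1, h3, add_sub_cancel_left, ← (D.compLpL 2 P).integral_comp_comm
      ((i1 (t + τ) (t + τ)).mono_set fun r hr => Set.mem_Icc.2 ⟨zero_le, hr.2⟩),
      ← integral_indicator measurableSet_Ioc]
    rfl
  set M := ∫ τ in Set.Icc 0 h, D.compLpL 2 P (B (t + τ) - (T τ).compLpL 2 P (B t)) ∂timeMeasure
    with hM
  have hMle : ‖M‖ₑ ^ 2 ≤ h * ∫⁻ r in Set.Icc t (t + h), (∫⁻ σ in Set.Icc 0 h,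
      ‖D.compLpL 2 P ((T σ).compLpL 2 P (g r))‖ₑ ∂timeMeasure) ^ 2 ∂timeMeasure := by
    have h1 : ‖M‖ₑ ≤ ∫⁻ r in Set.Icc t (t + h), (∫⁻ σ in Set.Icc 0 h,
        ‖D.compLpL 2 P ((T σ).compLpL 2 P (g r))‖ₑ ∂timeMeasure) ∂timeMeasure := by
      rw [hM]
      refine (enorm_integral_le_lintegral_enorm _).trans ?_
      simp_rw [hdrift]
      refine (lintegral_mono fun τ => enorm_integral_le_lintegral_enorm _).trans ?_
      rw [lintegral_lintegral_swap
        (stronglyMeasurable_incrementKernel hT D hg t).enorm.aemeasurable,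
        ← lintegral_indicator measurableSet_Icc]
      exact lintegral_mono fun r => lintegral_incrementKernel_le hT D g t h r
    refine (pow_le_pow_left' h1 2).trans ?_
    have hm : Measurable fun r => ∫⁻ σ in Set.Icc 0 h,
        ‖D.compLpL 2 P ((T σ).compLpL 2 P (g r))‖ₑ ∂timeMeasure :=
      measurable_setLIntegral_Icc
        (φ := fun r σ => ‖D.compLpL 2 P ((T σ).compLpL 2 P (g r))‖ₑ) measurable_const
        (measurable_enorm_observe hT D hg)
    have h2 := sq_lintegral_mul_le (μ := timeMeasure.restrict (Set.Icc t (t + h)))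
      (f := fun _ => 1) aemeasurable_const hm.aemeasurable
    simpa [timeMeasure_Icc] using h2
  have hsum : ∫ τ in Set.Icc 0 h, D.compLpL 2 P (X (t + τ) - (T τ).compLpL 2 P (X t)) ∂timeMeasure
      = M + N := by
    have c1 : Continuous fun τ => D.compLpL 2 P (B (t + τ) - (T τ).compLpL 2 P (B t)) :=
      (D.compLpL 2 P).continuous.comp
        ((hBc.comp hshift).sub (hT.compLpL.continuous_apply (B t)))
    rw [hM, hN, ← integral_add (c1.continuousOn.integrableOn_compact isCompact_Icc)
      (hDJ.continuousOn.integrableOn_compact isCompact_Icc)]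
    refine setIntegral_congr_fun measurableSet_Icc fun τ _ => ?_
    rw [← map_add, hXeq (t + τ), hXeq t, hJ]
    congr 1
    simp only [map_add]
    rw [add_comm t τ, hT.compLpL.add_apply]
    simp only [hB]
    abel
  rw [hsum]
  exact (pow_le_pow_left' (enorm_add_le _ _) 2).trans ((add_sq_le_two_mul _ _).trans
    (mul_le_mul_right (add_le_add hMle hNle) _))

end Increments

/-! ### Square functions of averaged increments -/

section SquareFunction

variable {Ω : Type*} {mΩ : MeasurableSpace Ω} {P : Measure Ω} [IsProbabilityMeasure P]
  {𝓕 : Filtration ℝ≥0 mΩ} {W : ℝ≥0 → Ω → ℝ}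
  {H : Type*} [NormedAddCommGroup H] [InnerProductSpace ℝ H] [CompleteSpace H]
  {Y : Type*} [NormedAddCommGroup Y] [InnerProductSpace ℝ Y] [CompleteSpace Y]
  {T : ℝ≥0 → H →L[ℝ] H}

/-- For fixed `r` apply Hardy's inequality to `q σ = ‖D T(σ) k(r)‖`, then the observation estimate
on `[0, 1]`. -/
theorem lintegral_hardy_observe_le (hT : IsC0Semigroup T) {D : H →L[ℝ] Y} {γ : ℝ≥0}
    (hD : ∀ x, ∫⁻ τ in Set.Icc 0 1, ‖D (T τ x)‖ₑ ^ 2 ∂timeMeasure ≤ γ * ‖x‖ₑ ^ 2)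
    {k : ℝ≥0 → Lp H 2 P} (hk : Continuous k) (v : ℝ≥0) :
    ∫⁻ h in Set.Icc 0 1, ((h : ℝ≥0∞) ^ 2)⁻¹ * ∫⁻ r in Set.Icc 0 v, (∫⁻ σ in Set.Icc 0 h,
      ‖D.compLpL 2 P ((T σ).compLpL 2 P (k r))‖ₑ ∂timeMeasure) ^ 2 ∂timeMeasure ∂timeMeasure
      ≤ 4 * γ * ∫⁻ r in Set.Icc 0 v, ‖k r‖ₑ ^ 2 ∂timeMeasure := by
  have hlift := setLIntegral_compLpL_le (P := P) hT (J := ContinuousLinearMap.id ℝ H) hD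
  have hm : Measurable fun p : ℝ≥0 × ℝ≥0 => ∫⁻ σ in Set.Icc 0 p.1,
      ‖D.compLpL 2 P ((T σ).compLpL 2 P (k p.2))‖ₑ ∂timeMeasure := by
    refine measurable_setLIntegral_Icc
      (φ := fun (p : ℝ≥0 × ℝ≥0) σ => ‖D.compLpL 2 P ((T σ).compLpL 2 P (k p.2))‖ₑ)
      measurable_fst ?_
    have hs : Measurable fun p : (ℝ≥0 × ℝ≥0) × ℝ≥0 => (p.1.2, p.2) := by fun_prop
    have h1 := (measurable_enorm_observe hT D hk).comp hs
    exact h1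
  have h1 : ∀ h : ℝ≥0, ((h : ℝ≥0∞) ^ 2)⁻¹ * ∫⁻ r in Set.Icc 0 v, (∫⁻ σ in Set.Icc 0 h,
      ‖D.compLpL 2 P ((T σ).compLpL 2 P (k r))‖ₑ ∂timeMeasure) ^ 2 ∂timeMeasure
      = ∫⁻ r in Set.Icc 0 v, ((h : ℝ≥0∞) ^ 2)⁻¹ * (∫⁻ σ in Set.Icc 0 h,
      ‖D.compLpL 2 P ((T σ).compLpL 2 P (k r))‖ₑ ∂timeMeasure) ^ 2 ∂timeMeasure := fun h => by
    rw [lintegral_const_mul]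
    have hs : Measurable fun r : ℝ≥0 => (h, r) := by fun_prop
    have h2 := (hm.comp hs).pow_const 2
    exact h2
  simp_rw [h1]
  rw [lintegral_lintegral_swap]
  · rw [← lintegral_const_mul' _ _ (ENNReal.mul_ne_top (by simp) ENNReal.coe_ne_top)]
    refine lintegral_mono fun r => ?_
    have h3 : Measurable fun σ => ‖D.compLpL 2 P ((T σ).compLpL 2 P (k r))‖ₑ :=
      ((D.compLpL 2 P).continuous.comp (hT.compLpL.continuous_apply (k r))).enorm.measurable
    refine (hardy_lintegral 1 h3).trans ?_
    rw [mul_assoc]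
    refine mul_le_mul_right ((hlift (k r)).trans (le_of_eq ?_)) _
    congr 3
    apply Lp.ext
    filter_upwards [(ContinuousLinearMap.id ℝ H).coeFn_compLpL (p := 2) (μ := P) (k r)] with ω h
    rw [h]; rfl
  · have h2 : Measurable fun p : ℝ≥0 × ℝ≥0 => ((p.1 : ℝ≥0∞) ^ 2)⁻¹ := by fun_prop
    exact (h2.mul (hm.pow_const 2)).aemeasurable

/-- Integration over `t` turns the windows into a factor `h`, so the weight `h⁻³` becomes the Hardy
weight `h⁻²`. The drift has one more factor `h`, bounded by 1. The constant depends on `D` only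
through `γ`, which permits the passage to the unbounded `C`. -/
theorem IsLinearMild.lintegral_average_increment_le (hW : IsFBrownianMotion 𝓕 P W)
    (hT : IsC0Semigroup T) {ξ : Lp H 2 P} {g f X : ℝ≥0 → Lp H 2 P} (hg : Continuous g)
    (hf : Continuous f) (hX : Continuous X) (hmild : IsLinearMild 𝓕 P W T ξ g f X)
    {D : H →L[ℝ] Y} {γ : ℝ≥0}
    (hD : ∀ x, ∫⁻ τ in Set.Icc 0 1, ‖D (T τ x)‖ₑ ^ 2 ∂timeMeasure ≤ γ * ‖x‖ₑ ^ 2) (u : ℝ≥0) :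
    ∫⁻ h in Set.Icc 0 1, ((h : ℝ≥0∞) ^ 3)⁻¹ * ∫⁻ t in Set.Icc 0 u,
      ‖∫ τ in Set.Icc 0 h, D.compLpL 2 P (X (t + τ) - (T τ).compLpL 2 P (X t)) ∂timeMeasure‖ₑ ^ 2
        ∂timeMeasure ∂timeMeasure
      ≤ 8 * γ * (∫⁻ r in Set.Icc 0 (u + 1), ‖g r‖ₑ ^ 2 ∂timeMeasure
        + ∫⁻ r in Set.Icc 0 (u + 1), ‖f r‖ₑ ^ 2 ∂timeMeasure) := by
  let Q : (ℝ≥0 → Lp H 2 P) → ℝ≥0 → ℝ≥0 → ℝ≥0∞ := fun k h r => (∫⁻ σ in Set.Icc 0 h,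
      ‖D.compLpL 2 P ((T σ).compLpL 2 P (k r))‖ₑ ∂timeMeasure) ^ 2
  have hQm : ∀ {k : ℝ≥0 → Lp H 2 P}, Continuous k → ∀ h, Measurable (Q k h) := fun {k} hk h =>
    (measurable_setLIntegral_Icc
      (φ := fun r σ => ‖D.compLpL 2 P ((T σ).compLpL 2 P (k r))‖ₑ) measurable_const
      (measurable_enorm_observe hT D hk)).pow_const 2
  have hwin : ∀ {k : ℝ≥0 → Lp H 2 P}, Continuous k → ∀ h ≤ 1,
      ∫⁻ t in Set.Icc 0 u, ∫⁻ r in Set.Icc t (t + h), Q k h r ∂timeMeasure ∂timeMeasure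
      ≤ h * ∫⁻ r in Set.Icc 0 (u + 1), Q k h r ∂timeMeasure := fun {k} hk h hh =>
    (lintegral_window_le u h (hQm hk h)).trans (mul_le_mul_right
      (lintegral_mono_set (Set.Icc_subset_Icc_right (by gcongr))) _)
  -- Only an inequality holds, because at `h = 0` the left side is `∞ * 0 = 0`.
  have hinv : ∀ h : ℝ≥0, ((h : ℝ≥0∞) ^ 3)⁻¹ * h ≤ ((h : ℝ≥0∞) ^ 2)⁻¹ := fun h => by
    rcases eq_or_ne h 0 with rfl | h0
    · simp
    · have h0' : (h : ℝ≥0∞) ≠ 0 := by simpa using h0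
      rw [pow_succ, ENNReal.mul_inv (Or.inr ENNReal.coe_ne_top) (Or.inr h0'), mul_assoc,
        ENNReal.inv_mul_cancel h0' ENNReal.coe_ne_top, mul_one]
  have hmeasW : ∀ {k : ℝ≥0 → Lp H 2 P}, Continuous k → ∀ h, Measurable fun t =>
      ∫⁻ r in Set.Icc t (t + h), Q k h r ∂timeMeasure := fun {k} hk h => by
    have m1 : MeasurableSet {p : ℝ≥0 × ℝ≥0 | p.1 ≤ p.2} :=
      measurableSet_le measurable_fst measurable_snd
    have m2 : MeasurableSet {p : ℝ≥0 × ℝ≥0 | p.2 ≤ p.1 + h} :=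
      measurableSet_le measurable_snd (by fun_prop)
    have h1 := (((hQm hk h).comp measurable_snd).indicator (m1.inter m2)).lintegral_prod_right'
      (ν := timeMeasure)
    have e : (fun t => ∫⁻ r in Set.Icc t (t + h), Q k h r ∂timeMeasure) = fun t => ∫⁻ r,
        ({p : ℝ≥0 × ℝ≥0 | p.1 ≤ p.2} ∩ {p : ℝ≥0 × ℝ≥0 | p.2 ≤ p.1 + h}).indicator
          (Q k h ∘ Prod.snd) (t, r) ∂timeMeasure := by
      ext t
      rw [← lintegral_indicator measurableSet_Icc]
      refine lintegral_congr fun r => ?_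
      simp [Set.indicator_apply]
    rw [e]
    exact h1
  have key : ∀ h ∈ Set.Icc (0 : ℝ≥0) 1, ((h : ℝ≥0∞) ^ 3)⁻¹ * ∫⁻ t in Set.Icc 0 u,
      ‖∫ τ in Set.Icc 0 h, D.compLpL 2 P (X (t + τ) - (T τ).compLpL 2 P (X t)) ∂timeMeasure‖ₑ ^ 2
        ∂timeMeasure
      ≤ 2 * (((h : ℝ≥0∞) ^ 2)⁻¹ * ∫⁻ r in Set.Icc 0 (u + 1), Q g h r ∂timeMeasure
        + ((h : ℝ≥0∞) ^ 2)⁻¹ * ∫⁻ r in Set.Icc 0 (u + 1), Q f h r ∂timeMeasure) := by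
    intro h hh
    have h1 : (h : ℝ≥0∞) ≤ 1 := by exact_mod_cast (Set.mem_Icc.1 hh).2
    refine (mul_le_mul_right (lintegral_mono fun t =>
      hmild.enorm_setIntegral_increment_sq_le hW hT hg hf hX D t h) _).trans ?_
    change _ * ∫⁻ t in Set.Icc 0 u, 2 * (h * (∫⁻ r in Set.Icc t (t + h), Q g h r ∂timeMeasure)
      + ∫⁻ r in Set.Icc t (t + h), Q f h r ∂timeMeasure) ∂timeMeasure ≤ _
    rw [lintegral_const_mul' _ _ (by simp), lintegral_add_left ((hmeasW hg h).const_mul _),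
      lintegral_const_mul' _ _ ENNReal.coe_ne_top]
    refine (mul_le_mul_right (mul_le_mul_right (add_le_add
      ((mul_le_mul' h1 (hwin hg h (Set.mem_Icc.1 hh).2)).trans (one_mul _).le)
      (hwin hf h (Set.mem_Icc.1 hh).2)) _) _).trans ?_
    rw [← mul_add, ← mul_add]
    generalize (∫⁻ r in Set.Icc 0 (u + 1), Q g h r ∂timeMeasure)
      + ∫⁻ r in Set.Icc 0 (u + 1), Q f h r ∂timeMeasure = A
    calc ((h : ℝ≥0∞) ^ 3)⁻¹ * (2 * (h * A)) = 2 * ((((h : ℝ≥0∞) ^ 3)⁻¹ * h) * A) := by ring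
      _ ≤ _ := mul_le_mul_right (mul_le_mul_left (hinv h) _) _
  refine (setLIntegral_mono' measurableSet_Icc key).trans ?_
  have hQint : ∀ {k : ℝ≥0 → Lp H 2 P}, Continuous k → Measurable fun h : ℝ≥0 =>
      ((h : ℝ≥0∞) ^ 2)⁻¹ * ∫⁻ r in Set.Icc 0 (u + 1), Q k h r ∂timeMeasure := fun {k} hk => by
    have hs : Measurable fun p : (ℝ≥0 × ℝ≥0) × ℝ≥0 => (p.1.2, p.2) := by fun_prop
    have h1 := (measurable_enorm_observe hT D hk).comp hs
    have h2 := (measurable_setLIntegral_Icc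
      (φ := fun (p : ℝ≥0 × ℝ≥0) σ => ‖D.compLpL 2 P ((T σ).compLpL 2 P (k p.2))‖ₑ)
      measurable_fst h1).pow_const 2
    have h3 := measurable_setLIntegral_Icc (τ := fun _ : ℝ≥0 => u + 1) (φ := Q k)
      measurable_const h2
    exact (by fun_prop : Measurable fun h : ℝ≥0 => ((h : ℝ≥0∞) ^ 2)⁻¹).mul h3
  rw [lintegral_const_mul' _ _ (by simp), lintegral_add_left (hQint hg)]
  refine (mul_le_mul_right (add_le_add (lintegral_hardy_observe_le hT hD hg (u + 1))
    (lintegral_hardy_observe_le hT hD hf (u + 1))) _).trans (le_of_eq ?_)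
  ring

end SquareFunction

/-! ### The observation of a mild solution as a limit in mean square -/

theorem stronglyMeasurable_setIntegral_Icc {S : Type*} {mS : MeasurableSpace S} {F : Type*}
    [NormedAddCommGroup F] [NormedSpace ℝ F] {τ : S → ℝ≥0}
    (hτ : Measurable τ) {φ : S → ℝ≥0 → F} (hφ : StronglyMeasurable fun p : S × ℝ≥0 => φ p.1 p.2) :
    StronglyMeasurable fun x => ∫ s in Set.Icc 0 (τ x), φ x s ∂timeMeasure := by
  have m : MeasurableSet {p : S × ℝ≥0 | p.2 ≤ τ p.1} :=
    measurableSet_le measurable_snd (hτ.comp measurable_fst)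
  have h := (hφ.indicator m).integral_prod_right' (ν := timeMeasure)
  have e : (fun x => ∫ s in Set.Icc 0 (τ x), φ x s ∂timeMeasure) = fun x =>
      ∫ s, {p : S × ℝ≥0 | p.2 ≤ τ p.1}.indicator (fun p => φ p.1 p.2) (x, s) ∂timeMeasure := by
    ext x
    rw [← integral_indicator measurableSet_Icc]
    refine integral_congr_ae (Eventually.of_forall fun s => ?_)
    simp [Set.indicator_apply]
  rw [e]
  exact h

/-- The sum of the functions has finite integral, so it is finite almost everywhere and its terms
tend to zero there. -/
theorem ae_tendsto_zero_of_lintegral_le {S : Type*} {mS : MeasurableSpace S} {μ : Measure S}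
    {G : ℕ → S → ℝ≥0∞} (hG : ∀ k, AEMeasurable (G k) μ)
    (h : ∀ k, ∫⁻ ω, G k ω ∂μ ≤ (2⁻¹ : ℝ≥0∞) ^ k) :
    ∀ᵐ ω ∂μ, Tendsto (fun k => G k ω) atTop (𝓝 0) := by
  have h1 : ∫⁻ ω, ∑' k, G k ω ∂μ ≠ ∞ := by
    rw [lintegral_tsum hG]
    refine ((ENNReal.tsum_le_tsum h).trans_lt ?_).ne
    rw [ENNReal.tsum_geometric]
    norm_num
  filter_upwards [ae_lt_top' (AEMeasurable.tsum hG) h1] with ω hω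
  exact ENNReal.tendsto_atTop_zero_of_tsum_ne_top hω.ne

/-- `K n` are bounded operators that approximate an admissible observation operator for `T`, with
`J n → 1` the corresponding smoothing operators, and `Ψ h x` is the time integral over `[0, h]` of
the output with initial state `x`. -/
structure IsObservationApprox {H Y : Type*} [NormedAddCommGroup H] [NormedSpace ℝ H]
    [NormedAddCommGroup Y] [NormedSpace ℝ Y] (T : ℝ≥0 → H →L[ℝ] H) (K : ℕ → H →L[ℝ] Y)
    (J : ℕ → H →L[ℝ] H) (Ψ : ℝ≥0 → H → Y) : Prop where
  sub_le : ∀ u : ℝ≥0, ∃ γ : ℝ≥0, ∀ n m x,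
    ∫⁻ τ in Set.Icc 0 u, ‖(K n - K m) (T τ x)‖ₑ ^ 2 ∂timeMeasure ≤ γ * ‖(J n - J m) x‖ₑ ^ 2
  le : ∀ u : ℝ≥0, ∃ γ : ℝ≥0, ∀ n x,
    ∫⁻ τ in Set.Icc 0 u, ‖K n (T τ x)‖ₑ ^ 2 ∂timeMeasure ≤ γ * ‖x‖ₑ ^ 2
  bound : ∃ M : ℝ≥0, ∀ n, ‖J n‖ ≤ M
  tendsto : ∀ x, Tendsto (fun n => J n x) atTop (𝓝 x)
  average : ∀ h ≤ 1, ∀ x, Tendsto (fun n => ∫ τ in Set.Icc 0 h, K n (T τ x) ∂timeMeasure)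
    atTop (𝓝 (Ψ h x))

section Observation

variable {Ω : Type*} {mΩ : MeasurableSpace Ω} {P : Measure Ω} [IsProbabilityMeasure P]
  {𝓕 : Filtration ℝ≥0 mΩ} {W : ℝ≥0 → Ω → ℝ}
  {H : Type*} [NormedAddCommGroup H] [InnerProductSpace ℝ H] [CompleteSpace H]
  {Y : Type*} [NormedAddCommGroup Y] [InnerProductSpace ℝ Y] [CompleteSpace Y]
  {T : ℝ≥0 → H →L[ℝ] H} {K : ℕ → H →L[ℝ] Y} {J : ℕ → H →L[ℝ] H} {Ψ : ℝ≥0 → H → Y}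

theorem IsObservationApprox.tendsto_lift (hK : IsObservationApprox T K J Ψ) (x : Lp H 2 P) :
    Tendsto (fun n => ‖(J n).compLpL 2 P x - x‖ₑ ^ 2) atTop (𝓝 0) := by
  obtain ⟨M, hM⟩ := hK.bound
  have h := tendsto_compLpL (P := P) (K₀ := ContinuousLinearMap.id ℝ H)
    (Eventually.of_forall hM) hK.tendsto x
  have e : (ContinuousLinearMap.id ℝ H).compLpL 2 P x = x := by
    apply Lp.ext
    filter_upwards [(ContinuousLinearMap.id ℝ H).coeFn_compLpL (p := 2) (μ := P) x] with ω h
    rw [h]; rfl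
  rw [e] at h
  have h1 := (h.sub_const x).enorm
  rw [sub_self, enorm_zero] at h1
  have h2 := (ENNReal.continuous_pow 2).tendsto 0 |>.comp h1
  simpa [Function.comp_def] using h2

theorem IsObservationApprox.tendsto_lintegral_lift (hK : IsObservationApprox T K J Ψ)
    {k : ℝ≥0 → Lp H 2 P} (hk : Continuous k) (u : ℝ≥0) :
    Tendsto (fun n => ∫⁻ s in Set.Icc 0 u, ‖(J n).compLpL 2 P (k s) - k s‖ₑ ^ 2 ∂timeMeasure)
      atTop (𝓝 0) := by
  obtain ⟨M, hM⟩ := hK.bound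
  obtain ⟨B, hB⟩ := (isCompact_Icc (a := (0 : ℝ≥0)) (b := u)).exists_bound_of_continuousOn
    hk.continuousOn
  have h := tendsto_lintegral_of_dominated_convergence (μ := timeMeasure.restrict (Set.Icc 0 u))
    (F := fun n s => ‖(J n).compLpL 2 P (k s) - k s‖ₑ ^ 2) (f := fun _ => 0)
    (fun _ => ENNReal.ofReal (M * B + B) ^ 2)
    (fun n => ((((J n).compLpL 2 P).continuous.comp hk).sub hk).enorm.measurable.pow_const 2)
    (fun n => by
      filter_upwards [ae_restrict_mem measurableSet_Icc] with s hs
      refine pow_le_pow_left' ?_ 2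
      rw [← ofReal_norm]
      refine ENNReal.ofReal_le_ofReal ((norm_sub_le _ _).trans (add_le_add ?_ (hB s hs)))
      exact (norm_compLpL_le' _ (hM n) _).trans (mul_le_mul_of_nonneg_left (hB s hs) M.coe_nonneg))
    (by
      rw [lintegral_const]
      exact ENNReal.mul_ne_top (by simp) (measure_ne_top _ _))
    (Eventually.of_forall fun s => hK.tendsto_lift (k s))
  simpa using h

/-- The observation by `K n - K m` is bounded through `J n - J m`, and both `J n` and `J m` are
close to the identity. Strong convergence for the initial value and dominated convergence along the
coefficient curves make the errors vanish. -/
theorem IsObservationApprox.exists_cauchy_bound (hK : IsObservationApprox T K J Ψ)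
    (hW : IsFBrownianMotion 𝓕 P W) (hT : IsC0Semigroup T) {ξ : Lp H 2 P}
    {g f X : ℝ≥0 → Lp H 2 P} (hg : Continuous g) (hf : Continuous f)
    (hmild : IsLinearMild 𝓕 P W T ξ g f X) (u : ℝ≥0) :
    ∃ e : ℕ → ℝ≥0∞, Tendsto e atTop (𝓝 0) ∧ ∀ n m,
      ∫⁻ t in Set.Icc 0 u, ‖(K n - K m).compLpL 2 P (X t)‖ₑ ^ 2 ∂timeMeasure ≤ e n + e m := by
  obtain ⟨γ, hγ⟩ := hK.sub_le u
  let d : ℕ → Lp H 2 P → ℝ≥0∞ := fun n x => ‖(J n).compLpL 2 P x - x‖ₑ ^ 2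
  have hd : ∀ n m x, ‖(J n - J m).compLpL 2 P x‖ₑ ^ 2 ≤ 2 * (d n x + d m x) := fun n m x => by
    rw [compLpL_sub, ← sub_sub_sub_cancel_right _ _ x, sub_eq_add_neg]
    refine (pow_le_pow_left' (enorm_add_le _ _) 2).trans ((add_sq_le_two_mul _ _).trans ?_)
    rw [enorm_neg]
  have hdm : ∀ {k : ℝ≥0 → Lp H 2 P}, Continuous k → ∀ n, Measurable fun s => d n (k s) :=
    fun {k} hk n =>
      ((((J n).compLpL 2 P).continuous.comp hk).sub hk).enorm.measurable.pow_const 2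
  have hint : ∀ {k : ℝ≥0 → Lp H 2 P}, Continuous k → ∀ n m,
      ∫⁻ s in Set.Icc 0 u, ‖(J n - J m).compLpL 2 P (k s)‖ₑ ^ 2 ∂timeMeasure
      ≤ 2 * (∫⁻ s in Set.Icc 0 u, d n (k s) ∂timeMeasure
        + ∫⁻ s in Set.Icc 0 u, d m (k s) ∂timeMeasure) := fun {k} hk n m => by
    refine (lintegral_mono fun s => hd n m (k s)).trans (le_of_eq ?_)
    rw [lintegral_const_mul' _ _ (by simp), lintegral_add_left (hdm hk n)]
  refine ⟨fun n => 8 * γ * (d n ξ + (u * ∫⁻ s in Set.Icc 0 u, d n (g s) ∂timeMeasure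
    + ∫⁻ s in Set.Icc 0 u, d n (f s) ∂timeMeasure)), ?_, fun n m => ?_⟩
  · have h1 := hK.tendsto_lift ξ
    have h2 := ENNReal.Tendsto.const_mul (a := (u : ℝ≥0∞)) (hK.tendsto_lintegral_lift hg u)
      (Or.inr ENNReal.coe_ne_top)
    have h3 := hK.tendsto_lintegral_lift hf u
    have h4 := ENNReal.Tendsto.const_mul (a := 8 * (γ : ℝ≥0∞)) (h1.add (h2.add h3))
      (Or.inr (ENNReal.mul_ne_top (by simp) ENNReal.coe_ne_top))
    simpa using h4
  · refine (hmild.lintegral_observe_sq_le hW hT hg hf (hγ n m)).trans ?_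
    refine (mul_le_mul_right (add_le_add (hd n m ξ) (add_le_add
      (mul_le_mul_right (hint hg n m) _) (hint hf n m))) _).trans (le_of_eq ?_)
    ring

theorem lintegral_timeProd_eq {x : ℝ≥0 → Ω → H} {X : ℝ≥0 → Lp H 2 P}
    (hx : StronglyMeasurable fun p : ℝ≥0 × Ω => x p.1 p.2) (hxX : ∀ t, x t =ᵐ[P] X t)
    (D : H →L[ℝ] Y) (u : ℝ≥0) :
    ∫⁻ p, ‖D (x p.1 p.2)‖ₑ ^ 2 ∂(timeProd P u)
      = ∫⁻ t in Set.Icc 0 u, ‖D.compLpL 2 P (X t)‖ₑ ^ 2 ∂timeMeasure := by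
  rw [timeProd, lintegral_prod _
    ((D.continuous.comp_stronglyMeasurable hx).enorm.pow_const 2).aemeasurable]
  refine lintegral_congr fun t => ?_
  rw [Lp_enorm_sq]
  refine lintegral_congr_ae ?_
  filter_upwards [hxX t, D.coeFn_compLpL (X t)] with ω h1 h2
  rw [h2, h1]

theorem memLp_timeProd_of_curve {x : ℝ≥0 → Ω → H} {X : ℝ≥0 → Lp H 2 P} (hX : Continuous X)
    (hx : StronglyMeasurable fun p : ℝ≥0 × Ω => x p.1 p.2) (hxX : ∀ t, x t =ᵐ[P] X t) (u : ℝ≥0) :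
    MemLp (fun p : ℝ≥0 × Ω => x p.1 p.2) 2 (timeProd P u) := by
  refine ⟨hx.aestronglyMeasurable, ?_⟩
  have h1 : eLpNorm (fun p : ℝ≥0 × Ω => x p.1 p.2) 2 (timeProd P u) ^ 2 < ∞ := by
    have := lintegral_timeProd_eq hx hxX (ContinuousLinearMap.id ℝ H) u
    rw [eLpNorm_two_sq]
    refine lt_of_eq_of_lt this ?_
    obtain ⟨B, hB⟩ := (isCompact_Icc (a := (0 : ℝ≥0)) (b := u)).exists_bound_of_continuousOn
      (((ContinuousLinearMap.id ℝ H).compLpL 2 P).continuous.comp hX).continuousOn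
    refine lt_of_le_of_lt (b := ∫⁻ _ in Set.Icc 0 u, ENNReal.ofReal B ^ 2 ∂timeMeasure)
      (setLIntegral_mono' measurableSet_Icc fun s hs => pow_le_pow_left' ?_ 2) ?_
    · rw [← ofReal_norm]
      exact ENNReal.ofReal_le_ofReal (hB s hs)
    · rw [lintegral_const]
      exact ENNReal.mul_lt_top (by simp) (measure_lt_top _ _)
  exact (ENNReal.pow_lt_top_iff.1 h1).resolve_right two_ne_zero

/-- The output `y` of a mild solution, and a subsequence along which the approximate outputs
converge to it in `L²(0, u)` almost surely. -/
theorem IsObservationApprox.exists_output (hK : IsObservationApprox T K J Ψ)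
    (hW : IsFBrownianMotion 𝓕 P W) (hT : IsC0Semigroup T) {ξ : Lp H 2 P}
    {g f X : ℝ≥0 → Lp H 2 P} (hg : Continuous g) (hf : Continuous f) (hX : Continuous X)
    (hmild : IsLinearMild 𝓕 P W T ξ g f X) {x : ℝ≥0 → Ω → H}
    (hx : StronglyMeasurable fun p : ℝ≥0 × Ω => x p.1 p.2) (hxX : ∀ t, x t =ᵐ[P] X t) (u : ℝ≥0) :
    ∃ y : ℝ≥0 → Ω → Y, StronglyMeasurable (fun p : ℝ≥0 × Ω => y p.1 p.2) ∧
      MemLp (fun p : ℝ≥0 × Ω => y p.1 p.2) 2 (timeProd P u) ∧ ∃ φ : ℕ → ℕ, Tendsto φ atTop atTop ∧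
      ∀ᵐ ω ∂P, Tendsto (fun k => ∫⁻ t in Set.Icc 0 u, ‖K (φ k) (x t ω) - y t ω‖ₑ ^ 2 ∂timeMeasure)
        atTop (𝓝 0) := by
  obtain ⟨e, he, hcau⟩ := hK.exists_cauchy_bound hW hT hg hf hmild u
  have hxL := memLp_timeProd_of_curve hX hx hxX u
  let Z : ℕ → Lp Y 2 (timeProd P u) := fun n => ((K n).comp_memLp' hxL).toLp _
  have hZ : ∀ n, Z n =ᵐ[timeProd P u] fun p => K n (x p.1 p.2) := fun n => MemLp.coeFn_toLp _
  have hdist : ∀ n m, edist (Z n) (Z m) ^ 2 ≤ e n + e m := fun n m => by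
    refine le_trans (le_of_eq ?_) (hcau n m)
    rw [edist_eq_enorm_sub, Lp_enorm_sq, ← lintegral_timeProd_eq hx hxX]
    refine lintegral_congr_ae ?_
    filter_upwards [Lp.coeFn_sub (Z n) (Z m), hZ n, hZ m] with p h1 h2 h3
    rw [h1, Pi.sub_apply, h2, h3]; rfl
  have hcs : CauchySeq Z := by
    rw [EMetric.cauchySeq_iff]
    intro ε hε
    have hpos : 0 < ε ^ 2 / 2 := by
      refine ENNReal.div_pos (pow_ne_zero 2 hε.ne') (by simp)
    obtain ⟨N, hN⟩ := eventually_atTop.1 (he.eventually (gt_mem_nhds hpos))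
    refine ⟨N, fun n hn m hm => ?_⟩
    have h1 : edist (Z n) (Z m) ^ 2 < ε ^ 2 :=
      (hdist n m).trans_lt ((ENNReal.add_lt_add (hN n hn) (hN m hm)).trans_eq
        (ENNReal.add_halves _))
    exact (ENNReal.pow_right_strictMono two_ne_zero).lt_iff_lt.1 h1
  obtain ⟨z, hz⟩ := cauchySeq_tendsto_of_complete hcs
  have hz2 : Tendsto (fun n => ‖Z n - z‖ₑ ^ 2) atTop (𝓝 0) := by
    have h1 := (hz.sub_const z).enorm
    rw [sub_self, enorm_zero] at h1
    have h2 := (ENNReal.continuous_pow 2).tendsto 0 |>.comp h1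
    simpa [Function.comp_def] using h2
  -- The errors along the subsequence are summable, which upgrades mean square convergence to
  -- convergence in `L²(0, u)` along almost every path.
  have hφ : ∀ k : ℕ, ∃ n, k ≤ n ∧ ‖Z n - z‖ₑ ^ 2 ≤ (2⁻¹ : ℝ≥0∞) ^ k := fun k => by
    have hpos : (0 : ℝ≥0∞) < (2⁻¹ : ℝ≥0∞) ^ k :=
      ENNReal.pow_pos (ENNReal.inv_pos.2 (by simp)) k
    obtain ⟨n, h1, h2⟩ := ((eventually_ge_atTop k).and
      (hz2.eventually (gt_mem_nhds hpos))).exists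
    exact ⟨n, h1, h2.le⟩
  choose φ hφk hφ using hφ
  have hym : StronglyMeasurable fun p : ℝ≥0 × Ω => z (p.1, p.2) := Lp.stronglyMeasurable z
  have hxK : ∀ n, StronglyMeasurable fun p : ℝ≥0 × Ω => K n (x p.1 p.2) - z (p.1, p.2) := fun n =>
    ((K n).continuous.comp_stronglyMeasurable hx).sub hym
  refine ⟨fun t ω => z (t, ω), hym, Lp.memLp z, φ, tendsto_atTop_mono hφk tendsto_id, ?_⟩
  refine ae_tendsto_zero_of_lintegral_le (fun k => ?_) fun k => le_trans (le_of_eq ?_) (hφ k)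
  · have h1 := ((hxK (φ k)).enorm.pow_const 2).comp measurable_swap
    have h2 := h1.lintegral_prod_right' (ν := timeMeasure.restrict (Set.Icc 0 u))
    exact h2.aemeasurable
  · have h1 := ((hxK (φ k)).enorm.pow_const 2).aemeasurable
      (μ := (timeMeasure.restrict (Set.Icc 0 u)).prod P)
    rw [lintegral_lintegral_swap]
    · refine (lintegral_prod _ h1).symm.trans ?_
      rw [Lp_enorm_sq]
      refine lintegral_congr_ae (μ := timeProd P u) ?_
      filter_upwards [Lp.coeFn_sub (Z (φ k)) z, hZ (φ k)] with p h1 h2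
      rw [h1, Pi.sub_apply, h2]
    · exact (((hxK (φ k)).enorm.pow_const 2).comp measurable_swap).aemeasurable

end Observation

/-! ### Pathwise square function of the averaged output -/

theorem setLIntegral_shift_le {φ : ℝ≥0 → ℝ≥0∞} (hφ : Measurable φ) {t h u v : ℝ≥0} (ht : t ≤ u)
    (hh : h ≤ v) :
    ∫⁻ τ in Set.Icc 0 h, φ (t + τ) ∂timeMeasure ≤ ∫⁻ s in Set.Icc 0 (u + v), φ s ∂timeMeasure := by
  have e : ∫⁻ s in Set.Ici t, (Set.Icc 0 (u + v)).indicator φ s ∂timeMeasure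
      = ∫⁻ τ, (Set.Icc 0 (u + v)).indicator φ (τ + t) ∂timeMeasure :=
    setLIntegral_add_right t (hφ.indicator measurableSet_Icc)
  rw [← lintegral_indicator (f := φ) measurableSet_Icc]
  refine le_trans ?_ (e.symm.le.trans (lintegral_mono' Measure.restrict_le_self le_rfl))
  rw [← lintegral_indicator measurableSet_Icc]
  refine lintegral_mono fun τ => ?_
  by_cases hτ : τ ∈ Set.Icc 0 h
  · rw [Set.indicator_of_mem hτ, add_comm t τ, Set.indicator_of_mem]
    refine Set.mem_Icc.2 ⟨zero_le, ?_⟩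
    rw [add_comm]
    exact add_le_add ht ((Set.mem_Icc.1 hτ).2.trans hh)
  · rw [Set.indicator_of_notMem hτ]; exact zero_le

theorem integrableOn_shift {F : Type*} [NormedAddCommGroup F] {y : ℝ≥0 → F}
    (hy : StronglyMeasurable y) {t h u v : ℝ≥0} (ht : t ≤ u) (hh : h ≤ v)
    (hi : IntegrableOn y (Set.Icc 0 (u + v)) timeMeasure) :
    IntegrableOn (fun τ => y (t + τ)) (Set.Icc 0 h) timeMeasure := by
  have hm : Measurable fun τ : ℝ≥0 => t + τ := by fun_prop
  exact ⟨(hy.comp_measurable hm).aestronglyMeasurable,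
    (setLIntegral_shift_le hy.enorm ht hh).trans_lt hi.2⟩

section SquareFunction

variable {Ω : Type*} {mΩ : MeasurableSpace Ω} {P : Measure Ω} [IsProbabilityMeasure P]
  {𝓕 : Filtration ℝ≥0 mΩ} {W : ℝ≥0 → Ω → ℝ}
  {H : Type*} [NormedAddCommGroup H] [InnerProductSpace ℝ H] [CompleteSpace H]
  {Y : Type*} [NormedAddCommGroup Y] [InnerProductSpace ℝ Y] [CompleteSpace Y]
  {T : ℝ≥0 → H →L[ℝ] H} {K : ℕ → H →L[ℝ] Y} {J : ℕ → H →L[ℝ] H} {Ψ : ℝ≥0 → H → Y}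

/-- The averaged observation over `[t, t + h]` of the deviation of `x` from the free evolution. -/
noncomputable def averagedIncrement (D : H →L[ℝ] Y) (T : ℝ≥0 → H →L[ℝ] H) (x : ℝ≥0 → Ω → H)
    (t h : ℝ≥0) (ω : Ω) : Y :=
  ∫ τ in Set.Icc 0 h, D (x (t + τ) ω - T τ (x t ω)) ∂timeMeasure

theorem stronglyMeasurable_averagedIncrement (hT : IsC0Semigroup T) (D : H →L[ℝ] Y)
    {x : ℝ≥0 → Ω → H} (hx : StronglyMeasurable fun p : ℝ≥0 × Ω => x p.1 p.2) :
    StronglyMeasurable fun p : (ℝ≥0 × Ω) × ℝ≥0 => averagedIncrement D T x p.1.1 p.2 p.1.2 := by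
  have m1 : Measurable fun q : ((ℝ≥0 × Ω) × ℝ≥0) × ℝ≥0 => (q.1.1.1 + q.2, q.1.1.2) := by fun_prop
  have m2 : Measurable fun q : ((ℝ≥0 × Ω) × ℝ≥0) × ℝ≥0 => (q.1.1.1, q.1.1.2) := by fun_prop
  have m3 : StronglyMeasurable fun q : ((ℝ≥0 × Ω) × ℝ≥0) × ℝ≥0 => q.2 :=
    stronglyMeasurable_id.comp_measurable measurable_snd
  have h1 := hx.comp_measurable m1
  have h2 := hx.comp_measurable m2
  have h3 : StronglyMeasurable fun q : ((ℝ≥0 × Ω) × ℝ≥0) × ℝ≥0 => T q.2 (x q.1.1.1 q.1.1.2) :=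
    hT.continuous_uncurry.comp_stronglyMeasurable (m3.prodMk h2)
  have h4 := D.continuous.comp_stronglyMeasurable (h1.sub h3)
  exact stronglyMeasurable_setIntegral_Icc (τ := fun p : (ℝ≥0 × Ω) × ℝ≥0 => p.2)
    (φ := fun p τ => D (x (p.1.1 + τ) p.1.2 - T τ (x p.1.1 p.1.2))) measurable_snd h4

theorem lintegral_averagedIncrement_eq (hT : IsC0Semigroup T) (D : H →L[ℝ] Y)
    {X : ℝ≥0 → Lp H 2 P} (hX : Continuous X) {x : ℝ≥0 → Ω → H}
    (hx : StronglyMeasurable fun p : ℝ≥0 × Ω => x p.1 p.2) (hxX : ∀ t, x t =ᵐ[P] X t) (t h : ℝ≥0) :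
    ∫⁻ ω, ‖averagedIncrement D T x t h ω‖ₑ ^ 2 ∂P
      = ‖∫ τ in Set.Icc 0 h, D.compLpL 2 P (X (t + τ) - (T τ).compLpL 2 P (X t))
        ∂timeMeasure‖ₑ ^ 2 := by
  have hs : Continuous fun τ : ℝ≥0 => t + τ := by fun_prop
  have hc : Continuous fun τ => D.compLpL 2 P (X (t + τ) - (T τ).compLpL 2 P (X t)) :=
    (D.compLpL 2 P).continuous.comp ((hX.comp hs).sub (hT.compLpL.continuous_apply (X t)))
  have m1 : Measurable fun p : ℝ≥0 × Ω => (t + p.1, p.2) := by fun_prop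
  have m2 : Measurable fun p : ℝ≥0 × Ω => (t, p.2) := by fun_prop
  have m3 : StronglyMeasurable fun p : ℝ≥0 × Ω => p.1 :=
    stronglyMeasurable_id.comp_measurable measurable_fst
  have h3 : StronglyMeasurable fun p : ℝ≥0 × Ω => T p.1 (x t p.2) :=
    hT.continuous_uncurry.comp_stronglyMeasurable (m3.prodMk (hx.comp_measurable m2))
  have h4 := D.continuous.comp_stronglyMeasurable ((hx.comp_measurable m1).sub h3)
  have key := setIntegral_curve_ae_eq hc h
    (z := fun τ ω => D (x (t + τ) ω - T τ (x t ω))) h4 fun τ _ => by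
      filter_upwards [D.coeFn_compLpL (X (t + τ) - (T τ).compLpL 2 P (X t)),
        Lp.coeFn_sub (X (t + τ)) ((T τ).compLpL 2 P (X t)), (T τ).coeFn_compLpL (X t), hxX t,
        hxX (t + τ)] with ω e1 e2 e3 e4 e5
      rw [e1, e2, Pi.sub_apply, e3, e4, e5]
  rw [Lp_enorm_sq]
  refine lintegral_congr_ae (key.mono fun ω hω => ?_)
  simp only
  rw [hω]
  rfl

/-- The square function estimate is uniform over the operators `K n`, so by Fatou's lemma the lower
limit has a finite integral over `[0, u] × Ω`. -/
theorem IsObservationApprox.ae_lintegral_lt_top (hK : IsObservationApprox T K J Ψ)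
    (hW : IsFBrownianMotion 𝓕 P W) (hT : IsC0Semigroup T) {ξ : Lp H 2 P}
    {g f X : ℝ≥0 → Lp H 2 P} (hg : Continuous g) (hf : Continuous f) (hX : Continuous X)
    (hmild : IsLinearMild 𝓕 P W T ξ g f X) {x : ℝ≥0 → Ω → H}
    (hx : StronglyMeasurable fun p : ℝ≥0 × Ω => x p.1 p.2) (hxX : ∀ t, x t =ᵐ[P] X t) (u : ℝ≥0)
    (φ : ℕ → ℕ) :
    ∀ᵐ ω ∂P, ∀ᵐ t ∂timeMeasure.restrict (Set.Icc 0 u),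
      liminf (fun k => ∫⁻ h in Set.Icc 0 1, ((h : ℝ≥0∞) ^ 3)⁻¹
        * ‖averagedIncrement (K (φ k)) T x t h ω‖ₑ ^ 2 ∂timeMeasure) atTop < ∞ := by
  obtain ⟨γ, hγ⟩ := hK.le 1
  let a : ℕ → ℝ≥0 × Ω → ℝ≥0 → ℝ≥0∞ := fun k p h =>
    ((h : ℝ≥0∞) ^ 3)⁻¹ * ‖averagedIncrement (K (φ k)) T x p.1 h p.2‖ₑ ^ 2
  have ha : ∀ k, Measurable fun q : (ℝ≥0 × Ω) × ℝ≥0 => a k q.1 q.2 := fun k => by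
    have h1 : Measurable fun q : (ℝ≥0 × Ω) × ℝ≥0 => ((q.2 : ℝ≥0∞) ^ 3)⁻¹ := by fun_prop
    exact h1.mul ((stronglyMeasurable_averagedIncrement hT (K (φ k)) hx).enorm.pow_const 2)
  let I : ℕ → ℝ≥0 × Ω → ℝ≥0∞ := fun k p => ∫⁻ h in Set.Icc 0 1, a k p h ∂timeMeasure
  have hI : ∀ k, Measurable (I k) := fun k => (ha k).lintegral_prod_right'
  set C : ℝ≥0∞ := 8 * γ * (∫⁻ r in Set.Icc 0 (u + 1), ‖g r‖ₑ ^ 2 ∂timeMeasure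
        + ∫⁻ r in Set.Icc 0 (u + 1), ‖f r‖ₑ ^ 2 ∂timeMeasure) with hC
  have hCtop : C < ∞ := by
    have h1 : ∀ {k : ℝ≥0 → Lp H 2 P}, Continuous k →
        ∫⁻ r in Set.Icc 0 (u + 1), ‖k r‖ₑ ^ 2 ∂timeMeasure < ∞ := fun {k} hk => by
      obtain ⟨B, hB⟩ := (isCompact_Icc (a := (0 : ℝ≥0)) (b := u + 1)).exists_bound_of_continuousOn
        hk.continuousOn
      refine lt_of_le_of_lt (b := ∫⁻ _ in Set.Icc 0 (u + 1), ENNReal.ofReal B ^ 2 ∂timeMeasure)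
        (setLIntegral_mono' measurableSet_Icc fun s hs => pow_le_pow_left' ?_ 2) ?_
      · rw [← ofReal_norm]
        exact ENNReal.ofReal_le_ofReal (hB s hs)
      · rw [lintegral_const]
        exact ENNReal.mul_lt_top (by simp) (measure_lt_top _ _)
    exact ENNReal.mul_lt_top (ENNReal.mul_lt_top (by simp) (by simp))
      (ENNReal.add_lt_top.2 ⟨h1 hg, h1 hf⟩)
  have hIle : ∀ k, ∫⁻ p, I k p ∂(timeProd P u) ≤ C := fun k => by
    refine le_trans (le_of_eq ?_) (hmild.lintegral_average_increment_le hW hT hg hf hX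
      (D := K (φ k)) (hγ (φ k)) u)
    simp only [I]
    rw [lintegral_lintegral_swap (ha k).aemeasurable]
    refine lintegral_congr fun h => ?_
    have hs : Measurable fun p : ℝ≥0 × Ω => (p, h) := by fun_prop
    have h1 : Measurable fun p : ℝ≥0 × Ω =>
        ‖averagedIncrement (K (φ k)) T x p.1 h p.2‖ₑ ^ 2 :=
      ((stronglyMeasurable_averagedIncrement hT (K (φ k)) hx).comp_measurable hs).enorm.pow_const 2
    simp only [a]
    rw [lintegral_const_mul _ h1, timeProd, lintegral_prod _ h1.aemeasurable]
    congr 1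
    exact lintegral_congr fun t => lintegral_averagedIncrement_eq hT _ hX hx hxX t h
  have hlim : ∫⁻ p, liminf (fun k => I k p) atTop ∂(timeProd P u) < ∞ := by
    refine (lintegral_liminf_le hI).trans_lt (lt_of_le_of_lt ?_ hCtop)
    exact liminf_le_of_frequently_le' (Frequently.of_forall hIle)
  have hm : Measurable fun p => liminf (fun k => I k p) atTop := Measurable.liminf hI
  have h1 := ae_lt_top hm hlim.ne
  have h2 := Measure.ae_ae_of_ae_prod h1
  have hset : MeasurableSet {p : ℝ≥0 × Ω | liminf (fun k => I k p) atTop < ∞} :=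
    measurableSet_lt hm measurable_const
  -- Joint measurability allows the exchange of "for almost every `t`" and "almost surely".
  exact (Measure.ae_ae_comm (p := fun t ω => liminf (fun k => I k (t, ω)) atTop < ∞) hset).1 h2

/-- Almost surely, the output `y` satisfies, for almost every `t`, a square integral condition that
compares its averages over `[t, t + h]` with the free output `Ψ h x(t)`. -/
theorem IsObservationApprox.exists_output_average (hK : IsObservationApprox T K J Ψ)
    (hW : IsFBrownianMotion 𝓕 P W) (hT : IsC0Semigroup T) {ξ : Lp H 2 P}
    {g f X : ℝ≥0 → Lp H 2 P} (hg : Continuous g) (hf : Continuous f) (hX : Continuous X)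
    (hmild : IsLinearMild 𝓕 P W T ξ g f X) {x : ℝ≥0 → Ω → H}
    (hx : StronglyMeasurable fun p : ℝ≥0 × Ω => x p.1 p.2) (hxX : ∀ t, x t =ᵐ[P] X t) (u : ℝ≥0) :
    ∀ᵐ ω ∂P, ∃ y : ℝ≥0 → Y, StronglyMeasurable y ∧
      IntegrableOn y (Set.Icc 0 (u + 1)) timeMeasure ∧
      ∀ᵐ t ∂timeMeasure.restrict (Set.Icc 0 u), ∫⁻ h in Set.Icc 0 1, ((h : ℝ≥0∞) ^ 3)⁻¹
        * ‖(∫ τ in Set.Icc 0 h, y (t + τ) ∂timeMeasure) - Ψ h (x t ω)‖ₑ ^ 2 ∂timeMeasure < ∞ := by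
  obtain ⟨y, hy, hy2, φ, hφ, hlim⟩ := hK.exists_output hW hT hg hf hX hmild hx hxX (u + 1)
  have hxL := memLp_timeProd_of_curve hX hx hxX (u + 1)
  have hxi : ∀ᵐ ω ∂P, IntegrableOn (fun t => x t ω) (Set.Icc 0 (u + 1)) timeMeasure :=
    (hxL.integrable (by norm_num)).prod_left_ae
  have hyi : ∀ᵐ ω ∂P, IntegrableOn (fun t => y t ω) (Set.Icc 0 (u + 1)) timeMeasure :=
    (hy2.integrable (by norm_num)).prod_left_ae
  filter_upwards [hlim, hxi, hyi,
    hK.ae_lintegral_lt_top hW hT hg hf hX hmild hx hxX u φ] with ω h1 h2 h3 h4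
  have hyω : StronglyMeasurable fun t => y t ω :=
    hy.comp_measurable (by fun_prop : Measurable fun t : ℝ≥0 => (t, ω))
  have hxω : StronglyMeasurable fun t => x t ω :=
    hx.comp_measurable (by fun_prop : Measurable fun t : ℝ≥0 => (t, ω))
  refine ⟨fun t => y t ω, hyω, h3, ?_⟩
  filter_upwards [h4, ae_restrict_mem measurableSet_Icc] with t ht htu
  have htu' := (Set.mem_Icc.1 htu).2
  -- For fixed `h` the increment splits. The averages of `K (φ k) x` converge to those of `y`, since
  -- convergence in `L²` on a bounded interval implies convergence in `L¹`; the free averages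
  -- converge to `Ψ`.
  have hconv : ∀ h ≤ 1, Tendsto (fun k => averagedIncrement (K (φ k)) T x t h ω) atTop
      (𝓝 ((∫ τ in Set.Icc 0 h, y (t + τ) ω ∂timeMeasure) - Ψ h (x t ω))) := by
    intro h hh
    have hxs := integrableOn_shift hxω htu' hh h2
    have hTx : ∀ n, IntegrableOn (fun τ => K n (T τ (x t ω))) (Set.Icc 0 h) timeMeasure := fun n =>
      ((K n).continuous.comp (hT.continuous_apply _)).continuousOn.integrableOn_compact
        isCompact_Icc
    have e : ∀ k, averagedIncrement (K (φ k)) T x t h ω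
        = (∫ τ in Set.Icc 0 h, K (φ k) (x (t + τ) ω) ∂timeMeasure)
          - ∫ τ in Set.Icc 0 h, K (φ k) (T τ (x t ω)) ∂timeMeasure := fun k => by
      rw [averagedIncrement, ← integral_sub ((K (φ k)).integrable_comp hxs) (hTx _)]
      simp only [map_sub]
    simp_rw [e]
    refine Tendsto.sub ?_ ((hK.average h hh (x t ω)).comp hφ)
    refine tendsto_integral_of_L1 _ (integrableOn_shift hyω htu' hh h3).1
      (Eventually.of_forall fun k => (K (φ k)).integrable_comp hxs) ?_
    have hm : ∀ k, Measurable fun s => ‖K (φ k) (x s ω) - y s ω‖ₑ := fun k =>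
      (((K (φ k)).continuous.comp_stronglyMeasurable hxω).sub hyω).enorm
    have hsq : Tendsto (fun k => (∫⁻ τ in Set.Icc 0 h, ‖K (φ k) (x (t + τ) ω) - y (t + τ) ω‖ₑ
        ∂timeMeasure) ^ 2) atTop (𝓝 0) := by
      have hb := ENNReal.Tendsto.const_mul (a := ((u + 1 : ℝ≥0) : ℝ≥0∞)) h1
        (Or.inr ENNReal.coe_ne_top)
      rw [mul_zero] at hb
      refine tendsto_of_tendsto_of_tendsto_of_le_of_le tendsto_const_nhds hb (fun _ => zero_le)
        fun k => ?_
      exact (pow_le_pow_left' (setLIntegral_shift_le (hm k) htu' hh) 2).trans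
        (sq_setLIntegral_le (u + 1) (hm k).aemeasurable)
    have h5 := (ENNReal.continuous_rpow_const (y := 1 / 2)).tendsto 0 |>.comp hsq
    simp only [Function.comp_def, ← ENNReal.rpow_natCast, ← ENNReal.rpow_mul] at h5
    simpa using h5
  have hpos : ∀ᵐ h ∂timeMeasure, (h : ℝ≥0) ≠ 0 := Measure.ae_ne timeMeasure (0 : ℝ≥0)
  -- Fatou's lemma in `h` puts the limit under the integral. The point `h = 0`, where the weight is
  -- infinite, is excluded as a null set.
  have hfat : ∫⁻ h in Set.Icc 0 1, ((h : ℝ≥0∞) ^ 3)⁻¹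
      * ‖(∫ τ in Set.Icc 0 h, y (t + τ) ω ∂timeMeasure) - Ψ h (x t ω)‖ₑ ^ 2 ∂timeMeasure
      ≤ ∫⁻ h in Set.Icc 0 1, liminf (fun k => ((h : ℝ≥0∞) ^ 3)⁻¹
        * ‖averagedIncrement (K (φ k)) T x t h ω‖ₑ ^ 2) atTop ∂timeMeasure := by
    refine lintegral_mono_ae ?_
    filter_upwards [ae_restrict_mem measurableSet_Icc, ae_restrict_of_ae hpos] with h hh h0
    have h6 := (hconv h (Set.mem_Icc.1 hh).2).enorm
    have h7 := ((ENNReal.continuous_pow 2).tendsto _).comp h6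
    have h8 := ENNReal.Tendsto.const_mul (a := ((h : ℝ≥0∞) ^ 3)⁻¹) h7
      (Or.inr (ENNReal.inv_ne_top.2 (pow_ne_zero 3 (by simpa using h0))))
    exact h8.liminf_eq.symm.le
  refine hfat.trans_lt ((lintegral_liminf_le fun k => ?_).trans_lt ht)
  have hs : Measurable fun h : ℝ≥0 => ((t, ω), h) := by fun_prop
  have m1 : Measurable fun h : ℝ≥0 => ((h : ℝ≥0∞) ^ 3)⁻¹ := by fun_prop
  exact m1.mul (((stronglyMeasurable_averagedIncrement hT (K (φ k)) hx).comp_measurable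
    hs).enorm.pow_const 2)

end SquareFunction

/-! ### Laplace-type averages -/

theorem setIntegral_exp_kernel (r : ℝ) :
    ∫ h in Set.Icc (0 : ℝ≥0) 1, r * Real.exp (-(r * h)) ∂timeMeasure = 1 - Real.exp (-r) := by
  rw [setIntegral_timeMeasure 0 1 fun x => r * Real.exp (-(r * x)), integral_Icc_eq_integral_Ioc,
    NNReal.coe_zero, NNReal.coe_one, ← intervalIntegral.integral_of_le zero_le_one]
  have hd : ∀ x ∈ Set.uIcc (0 : ℝ) 1, HasDerivAt (fun x => -Real.exp (-(r * x)))
      (r * Real.exp (-(r * x))) x := fun x _ => by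
    have h1 := (((hasDerivAt_id x).const_mul r).neg.exp).neg
    simp only [id_eq, mul_one, mul_neg, neg_neg] at h1
    rw [mul_comm r]
    exact h1
  rw [intervalIntegral.integral_eq_sub_of_hasDerivAt hd
    (Continuous.intervalIntegrable (by fun_prop) _ _)]
  simp
  ring

theorem setIntegral_gamma_kernel (r : ℝ) :
    ∫ h in Set.Icc (0 : ℝ≥0) 1, r ^ 2 * Real.exp (-(r * h)) * h ∂timeMeasure
      = 1 - (1 + r) * Real.exp (-r) := by
  rw [setIntegral_timeMeasure 0 1 fun x => r ^ 2 * Real.exp (-(r * x)) * x,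
    integral_Icc_eq_integral_Ioc,
    NNReal.coe_zero, NNReal.coe_one, ← intervalIntegral.integral_of_le zero_le_one]
  have hd : ∀ x ∈ Set.uIcc (0 : ℝ) 1, HasDerivAt (fun x => -((1 + r * x) * Real.exp (-(r * x))))
      (r ^ 2 * Real.exp (-(r * x)) * x) x := fun x _ => by
    have h1 := ((hasDerivAt_id x).const_mul r).neg.exp
    have h2 := (((hasDerivAt_id x).const_mul r).const_add 1).mul h1
    refine h2.neg.congr_deriv ?_
    simp only [id_eq, Pi.neg_apply]
    ring
  rw [intervalIntegral.integral_eq_sub_of_hasDerivAt hd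
    (Continuous.intervalIntegrable (by fun_prop) _ _)]
  simp
  ring

theorem cube_mul_exp_neg_le {x : ℝ} (hx : 0 ≤ x) : x ^ 3 * Real.exp (-x) ≤ 6 := by
  have h1 := Real.pow_div_factorial_le_exp x hx 3
  rw [Real.exp_neg, ← div_eq_mul_inv, div_le_iff₀ (Real.exp_pos x)]
  have : ((Nat.factorial 3 : ℕ) : ℝ) = 6 := by norm_num [Nat.factorial]
  rw [this] at h1
  linarith

theorem tendsto_cube_mul_exp_neg :
    Tendsto (fun x : ℝ => x ^ 3 * Real.exp (-x)) atTop (𝓝 0) :=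
  Real.tendsto_pow_mul_exp_neg_atTop_nhds_zero 3

section Abel

variable {Y : Type*} [NormedAddCommGroup Y] [NormedSpace ℝ Y] [CompleteSpace Y]

/-- The Laplace averages of a function with finite square function at `0` tend to zero. -/
theorem tendsto_laplace_of_square {d : ℝ≥0 → Y} (hd : ContinuousOn d (Set.Icc 0 1))
    (hsq : ∫⁻ h in Set.Icc 0 1, ((h : ℝ≥0∞) ^ 3)⁻¹ * ‖d h‖ₑ ^ 2 ∂timeMeasure < ∞) :
    Tendsto (fun r : ℝ => ∫ h in Set.Icc (0 : ℝ≥0) 1, (r ^ 2 * Real.exp (-(r * h))) • d h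
      ∂timeMeasure) atTop (𝓝 0) := by
  have hdm : AEMeasurable (fun h => ‖d h‖ₑ) (timeMeasure.restrict (Set.Icc 0 1)) :=
    (hd.aestronglyMeasurable measurableSet_Icc).enorm
  let k : ℝ → ℝ≥0 → ℝ≥0∞ := fun r h =>
    ENNReal.ofReal ((r * h) ^ 3 * Real.exp (-(r * h))) * (((h : ℝ≥0∞) ^ 3)⁻¹ * ‖d h‖ₑ ^ 2)
  have hpos : ∀ᵐ h ∂timeMeasure.restrict (Set.Icc (0 : ℝ≥0) 1), (h : ℝ≥0) ≠ 0 :=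
    ae_restrict_of_ae (Measure.ae_ne timeMeasure (0 : ℝ≥0))
  -- The factor `(r h)³ e^{-rh}` is at most 6 and tends to 0 for each `h > 0`, so the finite square
  -- function dominates.
  have hk : Tendsto (fun r => ∫⁻ h in Set.Icc 0 1, k r h ∂timeMeasure) atTop (𝓝 0) := by
    have m0 : AEMeasurable (fun h : ℝ≥0 => ((h : ℝ≥0∞) ^ 3)⁻¹ * ‖d h‖ₑ ^ 2)
        (timeMeasure.restrict (Set.Icc 0 1)) :=
      (by fun_prop : Measurable fun h : ℝ≥0 => ((h : ℝ≥0∞) ^ 3)⁻¹).aemeasurable.mul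
        (hdm.pow_const 2)
    have h := tendsto_lintegral_filter_of_dominated_convergence' (l := atTop)
      (μ := timeMeasure.restrict (Set.Icc 0 1)) (F := k) (f := fun _ => 0)
      (fun h => 6 * (((h : ℝ≥0∞) ^ 3)⁻¹ * ‖d h‖ₑ ^ 2))
      (Eventually.of_forall fun r => (by fun_prop : Measurable fun h : ℝ≥0 =>
        ENNReal.ofReal ((r * h) ^ 3 * Real.exp (-(r * h)))).aemeasurable.mul m0)
      (by
        filter_upwards [eventually_ge_atTop 0] with r hr
        refine Eventually.of_forall fun h => mul_le_mul_left ?_ _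
        rw [show (6 : ℝ≥0∞) = ENNReal.ofReal 6 by norm_num]
        exact ENNReal.ofReal_le_ofReal (cube_mul_exp_neg_le (by positivity)))
      (by
        rw [lintegral_const_mul'' _ m0]
        exact ENNReal.mul_ne_top (by simp) hsq.ne)
      (by
        filter_upwards [hpos, ae_lt_top' m0 hsq.ne] with h h0 hfin
        have h0' : (0 : ℝ) < h := by
          have := pos_iff_ne_zero.2 h0
          exact this
        have h1 := tendsto_cube_mul_exp_neg.comp (tendsto_id.atTop_mul_const h0')
        have h2 := ENNReal.tendsto_ofReal h1
        have h3 := ENNReal.Tendsto.mul_const (b := ((h : ℝ≥0∞) ^ 3)⁻¹ * ‖d h‖ₑ ^ 2) h2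
          (Or.inr hfin.ne)
        simpa using h3)
    simpa using h
  -- Cauchy–Schwarz for `r² e^{-rh} = (r e^{-rh})^{1/2} (r³ e^{-rh})^{1/2}`. The first kernel has
  -- mass at most 1, and the second is `(r h)³ e^{-rh}` times the weight `h⁻³`.
  have hb : ∀ r : ℝ, 0 ≤ r → ‖∫ h in Set.Icc (0 : ℝ≥0) 1, (r ^ 2 * Real.exp (-(r * h))) • d h
      ∂timeMeasure‖ₑ ^ 2 ≤ ∫⁻ h in Set.Icc 0 1, k r h ∂timeMeasure := by
    intro r hr
    let p : ℝ≥0 → ℝ≥0∞ := fun h => ENNReal.ofReal (Real.sqrt (r * Real.exp (-(r * h))))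
    let q : ℝ≥0 → ℝ≥0∞ := fun h =>
      ENNReal.ofReal (Real.sqrt (r ^ 3 * Real.exp (-(r * h)))) * ‖d h‖ₑ
    have e1 : ∀ h : ℝ≥0, ‖(r ^ 2 * Real.exp (-(r * h))) • d h‖ₑ = p h * q h := fun h => by
      have h1 : Real.sqrt (r * Real.exp (-(r * h))) * Real.sqrt (r ^ 3 * Real.exp (-(r * h)))
          = r ^ 2 * Real.exp (-(r * h)) := by
        rw [← Real.sqrt_mul (by positivity),
          show r * Real.exp (-(r * h)) * (r ^ 3 * Real.exp (-(r * h)))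
            = (r ^ 2 * Real.exp (-(r * h))) ^ 2 by ring, Real.sqrt_sq (by positivity)]
      rw [enorm_smul, Real.enorm_eq_ofReal (by positivity), ← h1,
        ENNReal.ofReal_mul (Real.sqrt_nonneg _), mul_assoc]
    have hp : ∫⁻ h in Set.Icc 0 1, p h ^ 2 ∂timeMeasure ≤ 1 := by
      have e2 : ∀ h : ℝ≥0, p h ^ 2 = ENNReal.ofReal (r * Real.exp (-(r * h))) := fun h => by
        simp only [p]
        rw [← ENNReal.ofReal_pow (Real.sqrt_nonneg _), Real.sq_sqrt (by positivity)]
      simp_rw [e2]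
      rw [← ofReal_integral_eq_lintegral_ofReal, setIntegral_exp_kernel]
      · rw [← ENNReal.ofReal_one]
        refine ENNReal.ofReal_le_ofReal ?_
        have := Real.exp_pos (-r)
        linarith
      · exact (by fun_prop : Continuous fun h : ℝ≥0 =>
          r * Real.exp (-(r * h))).continuousOn.integrableOn_compact isCompact_Icc
      · exact Eventually.of_forall fun h => by positivity
    refine (pow_le_pow_left' (enorm_integral_le_lintegral_enorm _) 2).trans ?_
    simp_rw [e1]
    refine (sq_lintegral_mul_le (by fun_prop) ((by fun_prop : Measurable fun h : ℝ≥0 =>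
      ENNReal.ofReal (Real.sqrt (r ^ 3 * Real.exp (-(r * h))))).aemeasurable.mul hdm)).trans ?_
    refine (mul_le_mul_left hp _).trans (le_of_eq ?_)
    rw [one_mul]
    refine lintegral_congr_ae ?_
    filter_upwards [hpos] with h h0
    have h0' : (h : ℝ≥0∞) ≠ 0 := by simpa using h0
    simp only [Pi.mul_apply, k]
    rw [mul_pow, ← ENNReal.ofReal_pow (Real.sqrt_nonneg _), Real.sq_sqrt (by positivity),
      mul_pow r, show r ^ 3 * (h : ℝ) ^ 3 * Real.exp (-(r * h))
        = r ^ 3 * Real.exp (-(r * h)) * (h : ℝ) ^ 3 by ring,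
      ENNReal.ofReal_mul (p := r ^ 3 * Real.exp (-(r * h))) (by positivity),
      ENNReal.ofReal_pow h.coe_nonneg,
      ENNReal.ofReal_coe_nnreal, mul_assoc (ENNReal.ofReal (r ^ 3 * _)),
      ← mul_assoc ((h : ℝ≥0∞) ^ 3),
      ENNReal.mul_inv_cancel (pow_ne_zero 3 h0') (ENNReal.pow_ne_top ENNReal.coe_ne_top), one_mul]
  rw [tendsto_iff_edist_tendsto_0]
  have h2 : Tendsto (fun r : ℝ => ‖∫ h in Set.Icc (0 : ℝ≥0) 1,
      (r ^ 2 * Real.exp (-(r * h))) • d h ∂timeMeasure‖ₑ ^ 2) atTop (𝓝 0) :=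
    tendsto_of_tendsto_of_tendsto_of_le_of_le' tendsto_const_nhds hk
      (Eventually.of_forall fun _ => zero_le)
      ((eventually_ge_atTop 0).mono hb)
  have h5 := (ENNReal.continuous_rpow_const (y := 1 / 2)).tendsto 0 |>.comp h2
  simp only [Function.comp_def, ← ENNReal.rpow_natCast, ← ENNReal.rpow_mul] at h5
  simpa using h5

/-- Abel means of a function that is differentiable at `0`. -/
theorem tendsto_laplace_of_deriv {e : ℝ≥0 → Y} (he : ContinuousOn e (Set.Icc 0 1)) {v : Y}
    (hv : ∀ ε > 0, ∃ δ > 0, ∀ h ≤ δ, ‖e h - (h : ℝ) • v‖ ≤ ε * h) :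
    Tendsto (fun r : ℝ => ∫ h in Set.Icc (0 : ℝ≥0) 1, (r ^ 2 * Real.exp (-(r * h))) • e h
      ∂timeMeasure) atTop (𝓝 v) := by
  have hc : ∀ r : ℝ, Continuous fun h : ℝ≥0 => r ^ 2 * Real.exp (-(r * h)) := fun r => by fun_prop
  have hlin : Continuous fun h : ℝ≥0 => (h : ℝ) • v := by fun_prop
  have hd : ContinuousOn (fun h : ℝ≥0 => e h - (h : ℝ) • v) (Set.Icc 0 1) :=
    he.sub hlin.continuousOn
  have hexp : ∀ δ : ℝ, 0 < δ → ∀ n : ℕ, Tendsto (fun r : ℝ => r ^ n * Real.exp (-(r * δ))) atTop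
      (𝓝 0) := fun δ hδ n => by
    have h1 := (Real.tendsto_pow_mul_exp_neg_atTop_nhds_zero n).comp
      (tendsto_id.atTop_mul_const hδ)
    have h2 := h1.const_mul ((δ ^ n)⁻¹)
    rw [mul_zero] at h2
    refine h2.congr fun r => ?_
    simp only [Function.comp_apply, id_eq]
    rw [mul_pow]
    field_simp
  have h1 : Tendsto (fun r : ℝ => ∫ h in Set.Icc (0 : ℝ≥0) 1,
      (r ^ 2 * Real.exp (-(r * h))) • (e h - (h : ℝ) • v) ∂timeMeasure) atTop (𝓝 0) := by
    obtain ⟨B, hB⟩ := (isCompact_Icc (a := (0 : ℝ≥0)) (b := 1)).exists_bound_of_continuousOn hd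
    have hB0 : 0 ≤ B := (norm_nonneg _).trans (hB 0 (by simp))
    rw [Metric.tendsto_nhds]
    intro ε hε
    -- For `h ≤ δ` the error is at most `ε h / 2`, and the kernel `r² e^{-rh} h` has mass at most 1.
    -- Beyond `δ` the kernel is at most `r² e^{-rδ}`, which tends to 0, while the error is bounded.
    obtain ⟨δ, hδ, hdel⟩ := hv (ε / 2) (by positivity)
    have hδ' : (0 : ℝ) < δ := hδ
    have h3 := (hexp δ hδ' 2).mul_const B
    rw [zero_mul] at h3
    filter_upwards [h3.eventually_lt_const (by positivity : (0 : ℝ) < ε / 2),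
      eventually_ge_atTop 0] with r hr hr0
    rw [dist_zero_right]
    have hbd : ∀ h ∈ Set.Icc (0 : ℝ≥0) 1, ‖(r ^ 2 * Real.exp (-(r * h))) • (e h - (h : ℝ) • v)‖
        ≤ ε / 2 * (r ^ 2 * Real.exp (-(r * h)) * h) + r ^ 2 * Real.exp (-(r * δ)) * B := by
      intro h hh
      rw [norm_smul, Real.norm_of_nonneg (by positivity)]
      by_cases hle : h ≤ δ
      · have h4 := mul_le_mul_of_nonneg_left (hdel h hle)
          (by positivity : 0 ≤ r ^ 2 * Real.exp (-(r * h)))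
        have h5 : 0 ≤ r ^ 2 * Real.exp (-(r * δ)) * B := by positivity
        linarith
      · have h4 : Real.exp (-(r * h)) ≤ Real.exp (-(r * δ)) := by
          refine Real.exp_le_exp.2 (neg_le_neg (mul_le_mul_of_nonneg_left ?_ hr0))
          exact_mod_cast (not_le.1 hle).le
        have h5 : r ^ 2 * Real.exp (-(r * h)) * ‖e h - (h : ℝ) • v‖
            ≤ r ^ 2 * Real.exp (-(r * δ)) * B :=
          mul_le_mul (mul_le_mul_of_nonneg_left h4 (by positivity)) (hB h hh) (norm_nonneg _)
            (by positivity)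
        have h6 : 0 ≤ ε / 2 * (r ^ 2 * Real.exp (-(r * h)) * h) := by positivity
        linarith
    have hi1 : IntegrableOn (fun h : ℝ≥0 => ε / 2 * (r ^ 2 * Real.exp (-(r * h)) * h))
        (Set.Icc 0 1) timeMeasure :=
      (by fun_prop : Continuous fun h : ℝ≥0 =>
        ε / 2 * (r ^ 2 * Real.exp (-(r * h)) * h)).continuousOn.integrableOn_compact isCompact_Icc
    have hi2 : IntegrableOn (fun _ : ℝ≥0 => r ^ 2 * Real.exp (-(r * δ)) * B)
        (Set.Icc 0 1) timeMeasure := continuousOn_const.integrableOn_compact isCompact_Icc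
    have hone : timeMeasure.real (Set.Icc (0 : ℝ≥0) 1) = 1 := by
      rw [measureReal_def, timeMeasure_Icc]; simp
    refine (norm_integral_le_of_norm_le (hi1.add hi2)
      ((ae_restrict_mem measurableSet_Icc).mono hbd)).trans_lt ?_
    simp only [Pi.add_apply]
    rw [integral_add hi1 hi2, integral_const_mul, setIntegral_gamma_kernel, setIntegral_const,
      hone, one_smul]
    have h7 : 0 ≤ (1 + r) * Real.exp (-r) := by positivity
    nlinarith
  have h2 : Tendsto (fun r : ℝ => (1 - (1 + r) * Real.exp (-r)) • v) atTop (𝓝 v) := by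
    have h3 := (hexp 1 one_pos 0).add (hexp 1 one_pos 1)
    have h4 : Tendsto (fun r : ℝ => 1 - (1 + r) * Real.exp (-r)) atTop (𝓝 1) := by
      have h5 := h3.const_sub 1
      simp only [add_zero, sub_zero] at h5
      refine h5.congr fun r => ?_
      rw [mul_one]; ring
    simpa using h4.smul_const v
  have h3 := h1.add h2
  rw [zero_add] at h3
  refine h3.congr fun r => ?_
  rw [← setIntegral_gamma_kernel, ← integral_smul_const, ← integral_add]
  · refine integral_congr_ae (Eventually.of_forall fun h => ?_)
    simp only
    rw [smul_sub, mul_smul _ (h : ℝ), sub_add_cancel]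
  · exact ((hc r).continuousOn.smul hd).integrableOn_compact isCompact_Icc
  · exact (by fun_prop : Continuous fun h : ℝ≥0 =>
      (r ^ 2 * Real.exp (-(r * h)) * h) • v).continuousOn.integrableOn_compact isCompact_Icc

/-- The averages of `e` converge to its derivative at `0`, and those of `e - d` vanish by the square
function. Thus `d` has the same limit although it need not be differentiable at `0` itself. -/
theorem tendsto_laplace {e d : ℝ≥0 → Y} (he : ContinuousOn e (Set.Icc 0 1))
    (hd : ContinuousOn d (Set.Icc 0 1)) {v : Y}
    (hv : ∀ ε > 0, ∃ δ > 0, ∀ h ≤ δ, ‖e h - (h : ℝ) • v‖ ≤ ε * h)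
    (hsq : ∫⁻ h in Set.Icc 0 1, ((h : ℝ≥0∞) ^ 3)⁻¹ * ‖e h - d h‖ₑ ^ 2 ∂timeMeasure < ∞) :
    Tendsto (fun r : ℝ => ∫ h in Set.Icc (0 : ℝ≥0) 1, (r ^ 2 * Real.exp (-(r * h))) • d h
      ∂timeMeasure) atTop (𝓝 v) := by
  have hc : ∀ r : ℝ, Continuous fun h : ℝ≥0 => r ^ 2 * Real.exp (-(r * h)) := fun r => by fun_prop
  have hed : ContinuousOn (fun h => e h - d h) (Set.Icc 0 1) := he.sub hd
  have h1 := (tendsto_laplace_of_deriv he hv).sub (tendsto_laplace_of_square hed hsq)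
  rw [sub_zero] at h1
  refine h1.congr fun r => ?_
  have i1 : IntegrableOn (fun h : ℝ≥0 => (r ^ 2 * Real.exp (-(r * h))) • e h) (Set.Icc 0 1)
      timeMeasure := ((hc r).continuousOn.smul he).integrableOn_compact isCompact_Icc
  have i2 : IntegrableOn (fun h : ℝ≥0 => (r ^ 2 * Real.exp (-(r * h))) • (e h - d h))
      (Set.Icc 0 1) timeMeasure := ((hc r).continuousOn.smul hed).integrableOn_compact isCompact_Icc
  rw [← integral_sub i1 i2]
  refine integral_congr_ae (Eventually.of_forall fun h => ?_)
  simp only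
  rw [← smul_sub, sub_sub_cancel]

end Abel

/-! ### The output along almost every path -/

section Paths

variable {Y : Type*} [NormedAddCommGroup Y] [NormedSpace ℝ Y] [CompleteSpace Y]

/-- The running averages of an integrable function are primitives of a function on the line that
has a derivative almost everywhere. -/
theorem exists_primitive {y : ℝ≥0 → Y} {u : ℝ≥0}
    (hy : IntegrableOn y (Set.Icc 0 (u + 1)) timeMeasure) :
    ∃ F : ℝ → Y, Continuous F ∧ (∀ᵐ x ∂volume, ∃ v, HasDerivAt F v x) ∧
      ∀ t ≤ u, ∀ h : ℝ≥0, h ≤ 1 → ∫ τ in Set.Icc 0 h, y (t + τ) ∂timeMeasure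
        = F (t + h) - F t := by
  -- Extension by zero to the whole line makes `y` integrable on `ℝ`, where the Lebesgue
  -- differentiation theorem is available.
  let z : ℝ → Y := (Set.Icc (0 : ℝ) (u + 1)).indicator fun s => y s.toNNReal
  have hz : Integrable z := by
    rw [integrable_indicator_iff measurableSet_Icc]
    have h1 := map_coe_timeMeasure_restrict 0 (u + 1)
    rw [NNReal.coe_zero, NNReal.coe_add, NNReal.coe_one] at h1
    rw [IntegrableOn, ← h1, measurableEmbedding_coe.integrable_map_iff]
    refine Integrable.congr hy (Eventually.of_forall fun s => ?_)
    simp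
  refine ⟨fun x => ∫ s in (0 : ℝ)..x, z s,
    intervalIntegral.continuous_primitive (fun a b => hz.intervalIntegrable) 0, ?_, ?_⟩
  · filter_upwards [LocallyIntegrable.ae_hasDerivAt_integral hz.locallyIntegrable] with x hx
    exact ⟨z x, hx 0⟩
  · intro t ht h hh
    have e1 : ∫ τ in Set.Icc 0 h, y (t + τ) ∂timeMeasure
        = ∫ τ in Set.Icc 0 h, (fun r : ℝ => z (t + r)) τ ∂timeMeasure := by
      refine setIntegral_congr_fun measurableSet_Icc fun τ hτ => ?_
      have h1 : (t : ℝ) + τ ∈ Set.Icc (0 : ℝ) (u + 1) := by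
        have := (Set.mem_Icc.1 hτ).2.trans hh
        exact Set.mem_Icc.2 ⟨by positivity, by exact_mod_cast add_le_add ht this⟩
      simp only [z]
      rw [Set.indicator_of_mem h1, ← NNReal.coe_add, Real.toNNReal_coe]
    rw [e1, setIntegral_timeMeasure 0 h fun r : ℝ => z (t + r), integral_Icc_eq_integral_Ioc,
      NNReal.coe_zero, ← intervalIntegral.integral_of_le h.coe_nonneg,
      intervalIntegral.integral_comp_add_left, add_zero,
      intervalIntegral.integral_interval_sub_left hz.intervalIntegrable hz.intervalIntegrable]

theorem ae_timeMeasure_of_ae {p : ℝ → Prop} (hp : ∀ᵐ x ∂volume, p x) (u : ℝ≥0) :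
    ∀ᵐ t : ℝ≥0 ∂timeMeasure.restrict (Set.Icc 0 u), p (t : ℝ) := by
  have h := ae_restrict_of_ae (s := Set.Icc ((0 : ℝ≥0) : ℝ) (u : ℝ)) hp
  rw [← map_coe_timeMeasure_restrict] at h
  exact ae_of_ae_map measurableEmbedding_coe.measurable.aemeasurable h

theorem exists_deriv_bound {F : ℝ → Y} {v : Y} {x : ℝ} (hF : HasDerivAt F v x) :
    ∀ ε > 0, ∃ δ > 0, ∀ h : ℝ≥0, h ≤ δ → ‖F (x + h) - F x - (h : ℝ) • v‖ ≤ ε * h := by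
  intro ε hε
  have h1 := hF.isLittleO.def hε
  obtain ⟨δ, hδ, h2⟩ := Metric.eventually_nhds_iff.1 h1
  refine ⟨(δ / 2).toNNReal, Real.toNNReal_pos.2 (by positivity), fun h hh => ?_⟩
  have h3 : (h : ℝ) ≤ δ / 2 := by
    rw [← Real.coe_toNNReal (δ / 2) (by positivity)]
    exact_mod_cast hh
  have h4 := h2 (y := x + h) (by
    rw [Real.dist_eq, add_sub_cancel_left, abs_of_nonneg h.coe_nonneg]
    linarith)
  rw [add_sub_cancel_left, Real.norm_of_nonneg h.coe_nonneg] at h4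
  exact h4

end Paths

section Observation

variable {Ω : Type*} {mΩ : MeasurableSpace Ω} {P : Measure Ω} [IsProbabilityMeasure P]
  {𝓕 : Filtration ℝ≥0 mΩ} {W : ℝ≥0 → Ω → ℝ}
  {H : Type*} [NormedAddCommGroup H] [InnerProductSpace ℝ H] [CompleteSpace H]
  {Y : Type*} [NormedAddCommGroup Y] [InnerProductSpace ℝ Y] [CompleteSpace Y]
  {T : ℝ≥0 → H →L[ℝ] H} {K : ℕ → H →L[ℝ] Y} {J : ℕ → H →L[ℝ] H} {Ψ : ℝ≥0 → H → Y}

/-- Almost surely, the Laplace averages of the free outputs converge at almost every time. -/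
theorem IsObservationApprox.ae_tendsto_laplace (hK : IsObservationApprox T K J Ψ)
    (hΨ : ∀ x, ContinuousOn (fun h => Ψ h x) (Set.Icc 0 1))
    (hW : IsFBrownianMotion 𝓕 P W) (hT : IsC0Semigroup T) {ξ : Lp H 2 P}
    {g f X : ℝ≥0 → Lp H 2 P} (hg : Continuous g) (hf : Continuous f) (hX : Continuous X)
    (hmild : IsLinearMild 𝓕 P W T ξ g f X) {x : ℝ≥0 → Ω → H}
    (hx : StronglyMeasurable fun p : ℝ≥0 × Ω => x p.1 p.2) (hxX : ∀ t, x t =ᵐ[P] X t) (u : ℝ≥0) :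
    ∀ᵐ ω ∂P, ∀ᵐ t ∂timeMeasure.restrict (Set.Icc 0 u), ∃ v,
      Tendsto (fun r : ℝ => ∫ h in Set.Icc (0 : ℝ≥0) 1,
        (r ^ 2 * Real.exp (-(r * h))) • Ψ h (x t ω) ∂timeMeasure) atTop (𝓝 v) := by
  filter_upwards [hK.exists_output_average hW hT hg hf hX hmild hx hxX u] with ω hω
  obtain ⟨y, -, hy, hsq⟩ := hω
  -- `F` is a primitive of the output along this path. Where it is differentiable, its derivative
  -- `v` is the limit sought, with `F (t + h) - F t` as the differentiable comparison function for
  -- `Ψ h (x t ω)`.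
  obtain ⟨F, hFc, hFd, hF⟩ := exists_primitive hy
  filter_upwards [hsq, ae_timeMeasure_of_ae hFd u, ae_restrict_mem measurableSet_Icc]
    with t h1 ⟨v, hv⟩ ht
  have htu := (Set.mem_Icc.1 ht).2
  refine ⟨v, ?_⟩
  have hc : Continuous fun h : ℝ≥0 => F (t + h) - F t := by fun_prop
  refine tendsto_laplace (e := fun h : ℝ≥0 => F (t + h) - F t) hc.continuousOn (hΨ (x t ω))
    (exists_deriv_bound hv) ?_
  refine lt_of_eq_of_lt (setLIntegral_congr_fun measurableSet_Icc fun h hh => ?_) h1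
  rw [hF t htu h (Set.mem_Icc.1 hh).2]

end Observation

/-! ### The generator and the resolvent -/

theorem coe_smul_eq_real_smul {𝕜 : Type*} [RCLike 𝕜] {H : Type*} [NormedAddCommGroup H]
    [NormedSpace 𝕜 H] [NormedSpace ℝ H] [IsScalarTower ℝ 𝕜 H] (r : ℝ) (x : H) : (r : 𝕜) • x = r • x := by
  rw [← one_smul 𝕜 x, smul_smul, ← smul_assoc, mul_one, RCLike.real_smul_eq_coe_mul, mul_one]

section Generator

variable {𝕜 : Type*} [RCLike 𝕜]
  {H : Type*} [NormedAddCommGroup H] [NormedSpace 𝕜 H] [NormedSpace ℝ H] [IsScalarTower ℝ 𝕜 H]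
  [CompleteSpace H] {T : ℝ≥0 → H →L[𝕜] H} {A : H →ₗ.[𝕜] H}

/-- The incomplete Laplace transform `∫₀^h e^{-rτ} T(τ) x dτ` of an orbit. -/
noncomputable def expIntegral (T : ℝ≥0 → H →L[𝕜] H) (r : ℝ) (h : ℝ≥0) (x : H) : H :=
  ∫ τ in Set.Icc 0 h, Real.exp (-(r * τ)) • T τ x ∂timeMeasure

/-- The primitive of the orbit `s ↦ e^{-rs} T(s) x`. -/
noncomputable def expPrimitive (T : ℝ≥0 → H →L[𝕜] H) (r : ℝ) (x : H) (s : ℝ) : H :=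
  ∫ τ in (0 : ℝ)..s, Real.exp (-(r * τ)) • T τ.toNNReal x

theorem continuous_exp_smul (hT : IsC0Semigroup T) (r : ℝ) (x : H) :
    Continuous fun τ : ℝ => Real.exp (-(r * τ)) • T τ.toNNReal x := by
  have h1 : Continuous fun τ : ℝ => T τ.toNNReal x :=
    (hT.continuous_apply x).comp continuous_real_toNNReal
  exact (by fun_prop : Continuous fun τ : ℝ => Real.exp (-(r * τ))).smul h1

theorem continuous_exp_smul_nnreal (hT : IsC0Semigroup T) (r : ℝ) (x : H) :
    Continuous fun τ : ℝ≥0 => Real.exp (-(r * τ)) • T τ x := by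
  have h1 := hT.continuous_apply x
  fun_prop

theorem hasDerivAt_expPrimitive (hT : IsC0Semigroup T) (r : ℝ) (x : H) (s : ℝ) :
    HasDerivAt (expPrimitive T r x) (Real.exp (-(r * s)) • T s.toNNReal x) s :=
  ((continuous_exp_smul hT r x).integral_hasStrictDerivAt 0 s).hasDerivAt

theorem expIntegral_eq_expPrimitive (r : ℝ) (h : ℝ≥0) (x : H) :
    expIntegral T r h x = expPrimitive T r x h := by
  rw [expPrimitive, intervalIntegral.integral_of_le h.coe_nonneg, ← integral_Icc_eq_integral_Ioc,
    ← NNReal.coe_zero, ← setIntegral_timeMeasure 0 h, expIntegral]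
  simp only [Real.toNNReal_coe]

theorem continuous_expIntegral (hT : IsC0Semigroup T) (r : ℝ) (x : H) :
    Continuous fun h : ℝ≥0 => expIntegral T r h x := by
  have h1 : Continuous (expPrimitive T r x) := continuous_iff_continuousAt.2 fun s =>
    (hasDerivAt_expPrimitive hT r x s).continuousAt
  simp_rw [expIntegral_eq_expPrimitive]
  fun_prop

theorem apply_expIntegral (hT : IsC0Semigroup T) (r : ℝ) (h s : ℝ≥0) (x : H) :
    T s (expIntegral T r h x)
      = Real.exp (r * s) • (expPrimitive T r x (s + h) - expPrimitive T r x s) := by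
  have hi : IntegrableOn (fun τ : ℝ≥0 => Real.exp (-(r * τ)) • T τ x) (Set.Icc 0 h) timeMeasure :=
    (continuous_exp_smul_nnreal hT r x).continuousOn.integrableOn_compact isCompact_Icc
  have hii : ∀ a b, IntervalIntegrable (fun τ : ℝ => Real.exp (-(r * τ)) • T τ.toNNReal x)
      volume a b := fun a b => (continuous_exp_smul hT r x).intervalIntegrable a b
  rw [expPrimitive, expPrimitive, intervalIntegral.integral_interval_sub_left (hii _ _) (hii _ _),
    ← intervalIntegral.integral_smul]
  have e := intervalIntegral.integral_comp_add_left (a := 0) (b := h)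
    (fun τ : ℝ => Real.exp (r * s) • Real.exp (-(r * τ)) • T τ.toNNReal x) s
  rw [add_zero] at e
  rw [← e, expIntegral, ← (T s).integral_comp_comm hi, intervalIntegral.integral_of_le h.coe_nonneg,
    ← integral_Icc_eq_integral_Ioc, ← NNReal.coe_zero, ← setIntegral_timeMeasure 0 h]
  refine integral_congr_ae (Eventually.of_forall fun τ => ?_)
  simp only
  rw [← NNReal.coe_add, Real.toNNReal_coe, hT.add_apply, smul_smul, ← Real.exp_add,
    ← coe_smul_eq_real_smul (𝕜 := 𝕜), map_smul, coe_smul_eq_real_smul]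
  congr 2
  push_cast
  ring

/-- Applying `T s` shifts the integral: it becomes `e^{rs}` times a difference of values of the
primitive. The product rule at `s = 0` gives the generator. For `r = 0` this is the relation `A ∫₀^h
T(τ) x dτ = T(h) x - x`. -/
theorem expIntegral_mem_graph (hT : IsC0Semigroup T) (hA : IsGenerator T A) (r : ℝ) (h : ℝ≥0)
    (x : H) : (expIntegral T r h x,
      Real.exp (-(r * h)) • T h x - x + r • expIntegral T r h x) ∈ A.graph := by
  rw [hA]
  have h1 : HasDerivAt (fun s : ℝ => Real.exp (r * s))  r 0 := by
    simpa using ((hasDerivAt_id (0 : ℝ)).const_mul r).exp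
  have h2 : HasDerivAt (fun s : ℝ => expPrimitive T r x (s + h) - expPrimitive T r x s)
      (Real.exp (-(r * h)) • T h x - x) 0 := by
    have a := hasDerivAt_expPrimitive hT r x (0 + h)
    have b := hasDerivAt_expPrimitive hT r x 0
    have c := (a.comp_add_const (0 : ℝ) (h : ℝ)).sub b
    refine HasDerivAt.congr_deriv (f := fun s : ℝ => _ - _) c ?_
    simp [hT.zero_apply]
  have h3 := h1.smul h2
  have h4 := h3.hasDerivWithinAt (s := Set.Ioi 0)
  rw [hasDerivWithinAt_iff_tendsto_slope' (by simp)] at h4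
  have h5 : Tendsto ((↑) : ℝ≥0 → ℝ) (𝓝[>] 0) (𝓝[>] 0) := by
    refine tendsto_nhdsWithin_iff.2 ⟨?_, ?_⟩
    · exact (NNReal.continuous_coe.tendsto 0).mono_left nhdsWithin_le_nhds
    · filter_upwards [self_mem_nhdsWithin] with s hs
      exact hs
  have h6 := h4.comp h5
  have e0 : expPrimitive T r x 0 = 0 := by simp [expPrimitive]
  have e1 : expIntegral T r h x = expPrimitive T r x h := expIntegral_eq_expPrimitive r h x
  have e2 : Real.exp (-(r * h)) • T h x - x + r • expIntegral T r h x
      = Real.exp (r * 0) • (Real.exp (-(r * h)) • T h x - x)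
        + r • (expPrimitive T r x (0 + h) - expPrimitive T r x 0) := by
    rw [e0, e1]; simp
  rw [e2]
  refine h6.congr fun s => ?_
  simp only [Function.comp_apply, slope, vsub_eq_sub, sub_zero, Pi.smul_apply']
  rw [apply_expIntegral hT, e1]
  rw [zero_add, e0, sub_zero, mul_zero, Real.exp_zero, one_smul,
    ← RCLike.ofReal_inv, coe_smul_eq_real_smul]

end Generator

/-! ### Construction of the resolvent from a truncated Laplace transform -/

section Generator

variable {𝕜 : Type*} [RCLike 𝕜]
  {H : Type*} [NormedAddCommGroup H] [NormedSpace 𝕜 H] [NormedSpace ℝ H] [IsScalarTower ℝ 𝕜 H]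
  [CompleteSpace H] {T : ℝ≥0 → H →L[𝕜] H} {A : H →ₗ.[𝕜] H}

theorem norm_expIntegral_le {M : ℝ} {h : ℝ≥0} (hM : ∀ t ≤ h, ‖T t‖ ≤ M)
    (r : ℝ) (x : H) : ‖expIntegral T r h x‖
      ≤ (∫ τ in Set.Icc 0 h, Real.exp (-(r * τ)) ∂timeMeasure) * (M * ‖x‖) := by
  have hc : Continuous fun τ : ℝ≥0 => Real.exp (-(r * τ)) := by fun_prop
  rw [← integral_mul_const]
  refine norm_integral_le_of_norm_le
    ((hc.mul continuous_const).continuousOn.integrableOn_compact isCompact_Icc) ?_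
  filter_upwards [ae_restrict_mem measurableSet_Icc] with τ hτ
  rw [norm_smul, Real.norm_of_nonneg (Real.exp_pos _).le]
  exact mul_le_mul_of_nonneg_left (((T τ).le_opNorm x).trans
    (mul_le_mul_of_nonneg_right (hM τ (Set.mem_Icc.1 hτ).2) (norm_nonneg x))) (Real.exp_pos _).le

theorem integrableOn_exp_smul (hT : IsC0Semigroup T) (r : ℝ) (h : ℝ≥0) (x : H) :
    IntegrableOn (fun τ : ℝ≥0 => Real.exp (-(r * τ)) • T τ x) (Set.Icc 0 h) timeMeasure :=
  (continuous_exp_smul_nnreal hT r x).continuousOn.integrableOn_compact isCompact_Icc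

/-- The incomplete Laplace transform as a bounded operator. -/
theorem exists_expIntegral_clm (hT : IsC0Semigroup T) (r : ℝ) (h : ℝ≥0) :
    ∃ I : H →L[𝕜] H, ∀ x, I x = expIntegral T r h x := by
  obtain ⟨M, -, hM⟩ := hT.exists_bound h
  have : SMulCommClass ℝ 𝕜 H := IsScalarTower.to_smulCommClass
  refine ⟨LinearMap.mkContinuous
    { toFun := expIntegral T r h
      map_add' := fun x y => ?_
      map_smul' := fun c x => ?_ }
    ((∫ τ in Set.Icc 0 h, Real.exp (-(r * τ)) ∂timeMeasure) * M) fun x => ?_, fun x => rfl⟩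
  · rw [expIntegral, expIntegral, expIntegral,
      ← integral_add (integrableOn_exp_smul hT r h x) (integrableOn_exp_smul hT r h y)]
    simp only [map_add, smul_add]
  · rw [expIntegral, expIntegral, RingHom.id_apply, ← integral_smul]
    refine integral_congr_ae (Eventually.of_forall fun τ => ?_)
    simp only
    rw [map_smul, smul_comm]
  · rw [mul_assoc]
    exact norm_expIntegral_le hM r x

theorem apply_expIntegral_comm (hT : IsC0Semigroup T) {D : H →L[𝕜] H}
    (hD : ∀ t x, D (T t x) = T t (D x)) (r : ℝ) (h : ℝ≥0) (x : H) :
    D (expIntegral T r h x) = expIntegral T r h (D x) := by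
  rw [expIntegral, ← D.integral_comp_comm (integrableOn_exp_smul hT r h x), expIntegral]
  refine integral_congr_ae (Eventually.of_forall fun τ => ?_)
  simp only
  rw [← coe_smul_eq_real_smul (𝕜 := 𝕜), map_smul, hD, coe_smul_eq_real_smul]

/-- Integration by parts for the incomplete Laplace transform. -/
theorem expIntegral_eq_add (hT : IsC0Semigroup T) (r : ℝ) (x : H) :
    expIntegral T r 1 x = Real.exp (-r) • expIntegral T 0 1 x
      + ∫ h in Set.Icc (0 : ℝ≥0) 1, (r * Real.exp (-(r * h))) • expIntegral T 0 h x
        ∂timeMeasure := by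
  have hF : Continuous (expPrimitive T 0 x) := continuous_iff_continuousAt.2 fun s =>
    (hasDerivAt_expPrimitive hT 0 x s).continuousAt
  have hd : ∀ s ∈ Set.uIcc (0 : ℝ) 1, HasDerivAt (fun s => -(Real.exp (-(r * s))
      • expPrimitive T 0 x s)) ((r * Real.exp (-(r * s))) • expPrimitive T 0 x s
        - Real.exp (-(r * s)) • T s.toNNReal x) s := fun s _ => by
    have h1 := (((hasDerivAt_id s).const_mul r).neg.exp).smul (hasDerivAt_expPrimitive hT 0 x s)
    refine h1.neg.congr_deriv ?_
    simp only [id_eq, Pi.neg_apply, zero_mul, neg_zero, Real.exp_zero, one_smul, mul_one]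
    rw [mul_neg, neg_smul, mul_comm r (Real.exp _)]
    abel
  have c1 : Continuous fun s => (r * Real.exp (-(r * s))) • expPrimitive T 0 x s := by fun_prop
  have c2 := continuous_exp_smul hT r x
  have h1 := intervalIntegral.integral_eq_sub_of_hasDerivAt hd
    ((c1.sub c2).intervalIntegrable _ _)
  rw [intervalIntegral.integral_sub (c1.intervalIntegrable _ _) (c2.intervalIntegrable _ _)] at h1
  have e0 : expPrimitive T 0 x 0 = 0 := by simp [expPrimitive]
  rw [e0, smul_zero, neg_zero, sub_zero, mul_one] at h1
  have e1 : ∫ h in Set.Icc (0 : ℝ≥0) 1, (r * Real.exp (-(r * h))) • expIntegral T 0 h x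
        ∂timeMeasure = ∫ s in (0 : ℝ)..1, (r * Real.exp (-(r * s))) • expPrimitive T 0 x s := by
    rw [intervalIntegral.integral_of_le zero_le_one, ← integral_Icc_eq_integral_Ioc,
      ← NNReal.coe_zero, ← NNReal.coe_one, ← setIntegral_timeMeasure 0 1]
    simp only [expIntegral_eq_expPrimitive]
  rw [e1, expIntegral_eq_expPrimitive, expIntegral_eq_expPrimitive, NNReal.coe_one]
  have h2 := sub_eq_iff_eq_add.1 h1
  rw [h2, expPrimitive]
  abel

/-- A bounded operator that commutes with the semigroup commutes with its generator. -/
theorem mem_graph_of_comm (hA : IsGenerator T A) {D : H →L[𝕜] H}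
    (hD : ∀ t x, D (T t x) = T t (D x)) {x y : H} (h : (x, y) ∈ A.graph) :
    (D x, D y) ∈ A.graph := by
  rw [hA] at h ⊢
  refine ((D.continuous.tendsto y).comp h).congr fun t => ?_
  simp only [Function.comp_apply]
  rw [map_smul, map_sub, hD]

/-- `R r` is the resolvent of `A` at the real number `r`, for every `r ≥ l`. -/
structure IsResolventFamily (T : ℝ≥0 → H →L[𝕜] H) (A : H →ₗ.[𝕜] H) (R : ℝ → H →L[𝕜] H)
    (l M : ℝ) : Prop where
  pos : 0 < l
  graph : ∀ r ≥ l, ∀ x, (R r x, r • R r x - x) ∈ A.graph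
  left_inv : ∀ r ≥ l, ∀ x y, (x, y) ∈ A.graph → R r (r • x - y) = x
  comm : ∀ r ≥ l, ∀ t x, R r (T t x) = T t (R r x)
  bound : ∀ r ≥ l, ‖R r‖ ≤ M / r
  decomp : ∀ r ≥ l, ∀ x, R r x = expIntegral T r 1 x + Real.exp (-r) • R r (T 1 x)

/-- With `I` the Laplace transform over `[0, 1]`, the resolvent is `I (1 - e^{-r} T(1))⁻¹`. For `r ≥
2M` one has `2M ≤ r + 1 ≤ e^r`, hence `‖e^{-r} T(1)‖ ≤ 1/2`, and the Neumann series provides the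
inverse. No integral over an infinite interval is involved. -/
theorem exists_isResolventFamily (hT : IsC0Semigroup T) (hA : IsGenerator T A) :
    ∃ (R : ℝ → H →L[𝕜] H) (l M : ℝ), IsResolventFamily T A R l M := by
  obtain ⟨M, hM1, hM⟩ := hT.exists_bound 1
  have hM1' : (1 : ℝ) ≤ M := by exact_mod_cast hM1
  have key : ∀ r : ℝ, ∃ R : H →L[𝕜] H, 2 * (M : ℝ) ≤ r →
      (∀ x, (R x, r • R x - x) ∈ A.graph) ∧ (∀ x y, (x, y) ∈ A.graph → R (r • x - y) = x) ∧
      (∀ t x, R (T t x) = T t (R x)) ∧ ‖R‖ ≤ 2 * M / r ∧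
      (∀ x, R x = expIntegral T r 1 x + Real.exp (-r) • R (T 1 x)) := by
    intro r
    by_cases hr : 2 * (M : ℝ) ≤ r
    swap
    · exact ⟨0, fun h => absurd h hr⟩
    have hr0 : 0 < r := by linarith
    have hexp : Real.exp (-r) * M ≤ 1 / 2 := by
      have h1 := Real.add_one_le_exp r
      rw [Real.exp_neg, inv_mul_le_iff₀ (Real.exp_pos r)]
      linarith
    obtain ⟨I, hI⟩ := exists_expIntegral_clm hT r 1
    let S : H →L[𝕜] H := ((Real.exp (-r) : ℝ) : 𝕜) • T 1
    have hSx : ∀ x, S x = Real.exp (-r) • T 1 x := fun x =>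
      coe_smul_eq_real_smul (𝕜 := 𝕜) _ _
    have hS : ‖S‖ < 1 := by
      rw [norm_smul, RCLike.norm_ofReal, abs_of_pos (Real.exp_pos _)]
      have := mul_le_mul_of_nonneg_left (hM 1 le_rfl) (Real.exp_pos (-r)).le
      linarith
    obtain ⟨Q, hQ⟩ := isUnit_one_sub_of_norm_lt_one hS
    have hQx : ∀ x, (Q : H →L[𝕜] H) x = x - Real.exp (-r) • T 1 x := fun x => by
      rw [hQ, ← hSx]; rfl
    have hIT : ∀ t x, I (T t x) = T t (I x) := fun t x => by
      rw [hI, hI]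
      exact (apply_expIntegral_comm hT (fun s x => hT.comm_apply t s x) r 1 x).symm
    have hQT : ∀ t, Commute (T t) (Q : H →L[𝕜] H) := fun t => by
      rw [hQ]
      refine (Commute.one_right _).sub_right (Commute.smul_right ?_ _)
      ext x
      exact hT.comm_apply t 1 x
    have hIQ : Commute I (Q : H →L[𝕜] H) := by
      rw [hQ]
      refine (Commute.one_right _).sub_right (Commute.smul_right ?_ _)
      ext x
      exact hIT 1 x
    have hinv : ∀ x, (Q : H →L[𝕜] H) ((↑Q⁻¹ : H →L[𝕜] H) x) = x := fun x =>
      DFunLike.congr_fun Q.mul_inv x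
    have hinv' : ∀ x, (↑Q⁻¹ : H →L[𝕜] H) ((Q : H →L[𝕜] H) x) = x := fun x =>
      DFunLike.congr_fun Q.inv_mul x
    have hRI : ∀ x, (I * (↑Q⁻¹ : H →L[𝕜] H)) x = I ((↑Q⁻¹ : H →L[𝕜] H) x) := fun x => rfl
    have hdec : ∀ x, (I * (↑Q⁻¹ : H →L[𝕜] H)) x
        = expIntegral T r 1 x + Real.exp (-r) • (I * (↑Q⁻¹ : H →L[𝕜] H)) (T 1 x) := fun x => by
      have h1 : (I * (↑Q⁻¹ : H →L[𝕜] H)) ((Q : H →L[𝕜] H) x) = I x := by rw [hRI, hinv']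
      rw [hQx, map_sub, ← coe_smul_eq_real_smul (𝕜 := 𝕜), map_smul, hI,
        coe_smul_eq_real_smul] at h1
      rw [← h1, sub_add_cancel]
    refine ⟨I * (↑Q⁻¹ : H →L[𝕜] H), fun _ => ⟨fun x => ?_, fun x y hxy => ?_, fun t x => ?_, ?_,
      hdec⟩⟩
    · have h1 := expIntegral_mem_graph hT hA r 1 ((↑Q⁻¹ : H →L[𝕜] H) x)
      have h2 : Real.exp (-(r * (1 : ℝ≥0))) • T 1 ((↑Q⁻¹ : H →L[𝕜] H) x)
          - (↑Q⁻¹ : H →L[𝕜] H) x = -x := by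
        have h3 := hQx ((↑Q⁻¹ : H →L[𝕜] H) x)
        rw [hinv] at h3
        rw [NNReal.coe_one, mul_one, ← neg_sub, ← h3]
      rw [h2, ← hI, ← hRI, neg_add_eq_sub] at h1
      exact h1
    -- `I` commutes with `A`, and `A I x` is also known explicitly. Since the graph is
    -- single-valued, comparison yields `I (r x - y) = Q x`.
    · have h1 := mem_graph_of_comm hA hIT hxy
      have h2 := expIntegral_mem_graph hT hA r 1 x
      rw [← hI] at h2
      have h3 := A.mem_graph_snd_inj h1 h2 rfl
      have h4 : I (r • x - y) = (Q : H →L[𝕜] H) x := by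
        rw [map_sub, h3, ← coe_smul_eq_real_smul (𝕜 := 𝕜) r x, map_smul, coe_smul_eq_real_smul,
          hQx, NNReal.coe_one, mul_one]
        abel
      rw [hIQ.units_inv_right.eq]
      change (↑Q⁻¹ : H →L[𝕜] H) (I (r • x - y)) = x
      rw [h4, hinv']
    · have h1 := DFunLike.congr_fun (hQT t).units_inv_right.eq x
      change T t ((↑Q⁻¹ : H →L[𝕜] H) x) = (↑Q⁻¹ : H →L[𝕜] H) (T t x) at h1
      rw [hRI, hRI, ← h1, hIT]
    -- The decomposition of the resolvent bounds its norm by `M / r` plus half of itself, whence the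
    -- constant `2M`.
    · have h1 : ‖I * (↑Q⁻¹ : H →L[𝕜] H)‖ ≤ M / r + ‖I * (↑Q⁻¹ : H →L[𝕜] H)‖ / 2 := by
        refine ContinuousLinearMap.opNorm_le_bound _ (by positivity) fun x => ?_
        conv_lhs => rw [hdec]
        refine (norm_add_le _ _).trans ?_
        have h2 := norm_expIntegral_le hM r x
        have h3 : (∫ τ in Set.Icc (0 : ℝ≥0) 1, Real.exp (-(r * τ)) ∂timeMeasure) ≤ 1 / r := by
          have h4 := setIntegral_exp_kernel r
          rw [integral_const_mul] at h4
          rw [le_div_iff₀ hr0, mul_comm, h4]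
          have := Real.exp_pos (-r)
          linarith
        have h5 : ‖Real.exp (-r) • (I * (↑Q⁻¹ : H →L[𝕜] H)) (T 1 x)‖
            ≤ Real.exp (-r) * (‖I * (↑Q⁻¹ : H →L[𝕜] H)‖ * (M * ‖x‖)) := by
          rw [norm_smul, Real.norm_of_nonneg (Real.exp_pos _).le]
          refine mul_le_mul_of_nonneg_left (((I * (↑Q⁻¹ : H →L[𝕜] H)).le_opNorm _).trans
            (mul_le_mul_of_nonneg_left (((T 1).le_opNorm x).trans
              (mul_le_mul_of_nonneg_right (hM 1 le_rfl) (norm_nonneg x))) (norm_nonneg _)))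
            (Real.exp_pos _).le
        have h6 : (∫ τ in Set.Icc (0 : ℝ≥0) 1, Real.exp (-(r * τ)) ∂timeMeasure) * (M * ‖x‖)
            ≤ 1 / r * (M * ‖x‖) := mul_le_mul_of_nonneg_right h3 (by positivity)
        have h7 := mul_le_mul_of_nonneg_right hexp
          (by positivity : 0 ≤ ‖I * (↑Q⁻¹ : H →L[𝕜] H)‖ * ‖x‖)
        have h8 : 1 / r * (M * ‖x‖) = M / r * ‖x‖ := by ring
        linarith
      have h9 : 2 * (M : ℝ) / r = 2 * (M / r) := by ring
      linarith
  choose R hR using key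
  exact ⟨R, 2 * M, 2 * M, ⟨by linarith, fun r hr => (hR r hr).1, fun r hr => (hR r hr).2.1,
    fun r hr => (hR r hr).2.2.1, fun r hr => (hR r hr).2.2.2.1, fun r hr => (hR r hr).2.2.2.2⟩⟩

end Generator

/-! ### The resolvent identity and strong convergence of `r R(r, A)` -/

section Resolvent

variable {𝕜 : Type*} [RCLike 𝕜]
  {H : Type*} [NormedAddCommGroup H] [NormedSpace 𝕜 H] [NormedSpace ℝ H] [IsScalarTower ℝ 𝕜 H]
  [CompleteSpace H] {T : ℝ≥0 → H →L[𝕜] H} {A : H →ₗ.[𝕜] H} {R : ℝ → H →L[𝕜] H} {l M : ℝ}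

/-- Both inverse properties show that `r - A` is bijective from its domain onto `H`, so
`resolventMap` is the genuine inverse and not its placeholder. -/
theorem IsResolventFamily.coe_resolventMap (hR : IsResolventFamily T A R l M) {r : ℝ} (hr : l ≤ r)
    (x : H) : (resolventMap A (r : 𝕜) x : H) = R r x := by
  have hgr : ∀ z : A.domain, ((z : H), A z) ∈ A.graph := fun z => A.mem_graph z
  have happ : ∀ z : A.domain, ((r : 𝕜) • A.domain.subtype - A.toFun) z = r • (z : H) - A z :=
    fun z => by
      rw [LinearMap.sub_apply, LinearMap.smul_apply, Submodule.subtype_apply,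
        coe_smul_eq_real_smul]
      rfl
  have hR' : ∀ x, ∃ z : A.domain, (z : H) = R r x ∧ A z = r • R r x - x := fun x =>
    A.mem_graph_iff.1 (hR.graph r hr x)
  have hbij : Function.Bijective ((r : 𝕜) • A.domain.subtype - A.toFun) := by
    refine ⟨fun z z' h => ?_, fun x => ?_⟩
    · rw [happ, happ] at h
      apply Subtype.ext
      rw [← hR.left_inv r hr _ _ (hgr z), h, hR.left_inv r hr _ _ (hgr z')]
    · obtain ⟨z, h1, h2⟩ := hR' x
      exact ⟨z, by rw [happ, h1, h2, sub_sub_cancel]⟩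
  obtain ⟨z, h1, h2⟩ := hR' x
  have e : resolventMap A (r : 𝕜) x = z := by
    rw [resolventMap, dif_pos hbij]
    change (LinearEquiv.ofBijective _ hbij).symm x = z
    rw [LinearEquiv.symm_apply_eq, LinearEquiv.ofBijective_apply, happ, h1, h2, sub_sub_cancel]
  rw [e, h1]

theorem IsResolventFamily.norm_apply_le (hR : IsResolventFamily T A R l M) {r : ℝ} (hr : l ≤ r)
    (x : H) : r * ‖R r x‖ ≤ M * ‖x‖ := by
  have hr0 := hR.pos.trans_le hr
  have h1 := ((R r).le_opNorm x).trans (mul_le_mul_of_nonneg_right (hR.bound r hr) (norm_nonneg x))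
  calc r * ‖R r x‖ ≤ r * (M / r * ‖x‖) := mul_le_mul_of_nonneg_left h1 hr0.le
    _ = M * ‖x‖ := by field_simp

theorem IsResolventFamily.nonneg (hR : IsResolventFamily T A R l M) : 0 ≤ M := by
  have h1 := (norm_nonneg _).trans (hR.bound l le_rfl)
  have h2 := mul_nonneg h1 hR.pos.le
  rwa [div_mul_cancel₀ _ hR.pos.ne'] at h2

theorem IsResolventFamily.identity (hR : IsResolventFamily T A R l M) {r s : ℝ} (hr : l ≤ r)
    (hs : l ≤ s) (x : H) : R r x - R s x = (s - r) • R r (R s x) := by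
  have h1 := hR.left_inv r hr _ _ (hR.graph s hs x)
  have h2 : r • R s x - (s • R s x - x) = x - ((s - r : ℝ) : 𝕜) • R s x := by
    rw [coe_smul_eq_real_smul, sub_smul]; abel
  rw [h2, map_sub, map_smul, coe_smul_eq_real_smul] at h1
  rw [sub_eq_iff_eq_add] at h1
  rw [h1]; abel

/-- The resolvent identity and the uniform bound `M / l` give a Lipschitz estimate in `r`.
Continuity later reduces the limit `r → ∞` to rational parameters. -/
theorem IsResolventFamily.continuousOn (hR : IsResolventFamily T A R l M) (x : H) :
    ContinuousOn (fun r => R r x) (Set.Ici l) := by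
  have h0 := hR.pos
  have hb : ∀ r ≥ l, ∀ y, ‖R r y‖ ≤ M / l * ‖y‖ := fun r hr y => by
    have h1 := hR.norm_apply_le hr y
    have h2 : l * ‖R r y‖ ≤ r * ‖R r y‖ := mul_le_mul_of_nonneg_right hr (norm_nonneg _)
    rw [div_mul_eq_mul_div, le_div_iff₀ h0]
    linarith
  have hM := hR.nonneg
  refine LipschitzOnWith.continuousOn (K := (M / l * (M / l * ‖x‖)).toNNReal)
    (LipschitzOnWith.of_dist_le_mul fun r hr s hs => ?_)
  rw [dist_eq_norm, hR.identity hr hs, norm_smul, Real.coe_toNNReal _ (by positivity),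
    Real.dist_eq, Real.norm_eq_abs, abs_sub_comm, mul_comm]
  refine mul_le_mul_of_nonneg_right ((hb r hr _).trans ?_) (abs_nonneg _)
  exact mul_le_mul_of_nonneg_left (hb s hs x) (by positivity)

theorem tendsto_mul_exp_neg : Tendsto (fun r : ℝ => r * Real.exp (-r)) atTop (𝓝 0) := by
  simpa using Real.tendsto_pow_mul_exp_neg_atTop_nhds_zero 1

theorem tendsto_exp_neg : Tendsto (fun r : ℝ => Real.exp (-r)) atTop (𝓝 0) := by
  simpa using Real.tendsto_pow_mul_exp_neg_atTop_nhds_zero 0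

theorem tendsto_smul_expIntegral (hT : IsC0Semigroup T) (x : H) :
    Tendsto (fun r : ℝ => r • expIntegral T r 1 x) atTop (𝓝 x) := by
  have h1 : Tendsto (fun r : ℝ => ∫ h in Set.Icc (0 : ℝ≥0) 1,
      (r ^ 2 * Real.exp (-(r * h))) • expIntegral T 0 h x ∂timeMeasure) atTop (𝓝 x) := by
    refine tendsto_laplace_of_deriv (continuous_expIntegral hT 0 x).continuousOn ?_
    have h2 := exists_deriv_bound (hasDerivAt_expPrimitive hT 0 x 0)
    have e0 : expPrimitive T 0 x 0 = 0 := by simp [expPrimitive]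
    have e1 : Real.exp (-(0 * 0)) • T (0 : ℝ).toNNReal x = x := by simp [hT.zero_apply]
    rw [e1] at h2
    simpa only [zero_add, e0, sub_zero, ← expIntegral_eq_expPrimitive] using h2
  have h3 := (tendsto_mul_exp_neg.smul_const (expIntegral T 0 1 x)).add h1
  rw [zero_smul, zero_add] at h3
  refine h3.congr fun r => ?_
  rw [expIntegral_eq_add hT r x, smul_add, smul_smul, ← integral_smul]
  congr 1
  refine integral_congr_ae (Eventually.of_forall fun h => ?_)
  simp only
  rw [smul_smul]
  congr 1
  ring

/-- The truncated transform is an Abel mean of a primitive of the orbit, whose derivative at `0` is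
`x`. The rest of the resolvent carries the factor `e^{-r}`. -/
theorem IsResolventFamily.tendsto_smul (hR : IsResolventFamily T A R l M) (hT : IsC0Semigroup T)
    (x : H) : Tendsto (fun r : ℝ => r • R r x) atTop (𝓝 x) := by
  have h1 : Tendsto (fun r : ℝ => Real.exp (-r) • (r • R r (T 1 x))) atTop (𝓝 0) := by
    have h2 := tendsto_exp_neg.mul_const (M * ‖T 1 x‖)
    rw [zero_mul] at h2
    refine squeeze_zero_norm' ?_ h2
    filter_upwards [eventually_ge_atTop l] with r hr
    have hr0 := hR.pos.trans_le hr
    rw [norm_smul, norm_smul, Real.norm_of_nonneg (Real.exp_pos _).le, Real.norm_of_nonneg hr0.le]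
    exact mul_le_mul_of_nonneg_left (hR.norm_apply_le hr _) (Real.exp_pos _).le
  have h3 := (tendsto_smul_expIntegral hT x).add h1
  rw [add_zero] at h3
  refine h3.congr' ?_
  filter_upwards [eventually_ge_atTop l] with r hr
  conv_rhs => rw [hR.decomp r hr, smul_add]
  rw [smul_comm r]

end Resolvent

/-! ### Bounded approximations of the observation operator -/

section Observer

variable {𝕜 : Type*} [RCLike 𝕜]
  {H : Type*} [NormedAddCommGroup H] [NormedSpace 𝕜 H] [NormedSpace ℝ H] [IsScalarTower ℝ 𝕜 H]
  [CompleteSpace H]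
  {Y : Type*} [NormedAddCommGroup Y] [NormedSpace 𝕜 Y] [NormedSpace ℝ Y] [IsScalarTower ℝ 𝕜 Y]
  [CompleteSpace Y]
  {T : ℝ≥0 → H →L[𝕜] H} {A : H →ₗ.[𝕜] H} {R : ℝ → H →L[𝕜] H} {l M : ℝ}
  {C : A.domain →ₗ[𝕜] Y} {B : H →L[𝕜] Y}

theorem valueAt_of_mem {N : H →ₗ.[𝕜] Y} {x : H} (h : x ∈ N.domain) : valueAt N x = N ⟨x, h⟩ :=
  dif_pos h

theorem clm_map_real_smul {H' : Type*} [NormedAddCommGroup H'] [NormedSpace 𝕜 H']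
    [NormedSpace ℝ H'] [IsScalarTower ℝ 𝕜 H'] (D : H →L[𝕜] H') (r : ℝ) (x : H) :
    D (r • x) = r • D x := by
  rw [← coe_smul_eq_real_smul (𝕜 := 𝕜), map_smul, coe_smul_eq_real_smul]

/-- `B` represents the observation operator `C` as `C x = B (l - A) x`. -/
def IsObservationFactor (A : H →ₗ.[𝕜] H) (C : A.domain →ₗ[𝕜] Y) (l : ℝ) (B : H →L[𝕜] Y) : Prop :=
  ∀ x y, (x, y) ∈ A.graph → valueAt (LinearPMap.mk A.domain C) x = B (l • x - y)

/-- Take `B = C R(l, A)`. It is bounded because `R(l, A)` maps `H` into `D(A)` boundedly for the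
graph norm. -/
theorem IsResolventFamily.exists_observationFactor (hR : IsResolventFamily T A R l M)
    (hC : IsGraphBounded A C) : ∃ B : H →L[𝕜] Y, IsObservationFactor A C l B := by
  obtain ⟨K, hK⟩ := hC
  have hl := hR.pos
  have hmem : ∀ x, R l x ∈ A.domain := fun x =>
    LinearPMap.mem_domain_of_mem_graph (hR.graph l le_rfl x)
  have hval : ∀ x, A ⟨R l x, hmem x⟩ = l • R l x - x := fun x =>
    A.mem_graph_snd_inj (A.mem_graph ⟨R l x, hmem x⟩) (hR.graph l le_rfl x) rfl
  let B₀ : H →ₗ[𝕜] Y := C.comp ((R l : H →ₗ[𝕜] H).codRestrict A.domain hmem)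
  have hB₀ : ∀ x, B₀ x = C ⟨R l x, hmem x⟩ := fun x => rfl
  refine ⟨B₀.mkContinuous (|K| * (M / l + (M + 1))) fun x => ?_, fun x y hxy => ?_⟩
  · rw [hB₀]
    refine (hK _).trans ?_
    rw [hval]
    have h1 := hR.norm_apply_le le_rfl x
    have h2 : ‖R l x‖ ≤ M / l * ‖x‖ := by
      rw [div_mul_eq_mul_div, le_div_iff₀ hl]; linarith
    have h3 : ‖l • R l x - x‖ ≤ M * ‖x‖ + ‖x‖ := by
      refine (norm_sub_le _ _).trans ?_
      rw [norm_smul, Real.norm_of_nonneg hl.le]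
      linarith
    refine (mul_le_mul_of_nonneg_right (le_abs_self K)
      (add_nonneg (norm_nonneg _) (norm_nonneg _))).trans ?_
    rw [mul_assoc]
    refine mul_le_mul_of_nonneg_left ?_ (abs_nonneg K)
    simp only
    linarith
  · have h1 := hR.left_inv l le_rfl x y hxy
    rw [LinearMap.mkContinuous_apply, hB₀,
      valueAt_of_mem (N := LinearPMap.mk A.domain C)
        (LinearPMap.mem_domain_of_mem_graph hxy : x ∈ A.domain)]
    change C _ = C _
    congr 1
    exact Subtype.ext h1.symm

/-- The bounded operator `C r R(r, A)`. -/
noncomputable def observer (B : H →L[𝕜] Y) (R : ℝ → H →L[𝕜] H) (l r : ℝ) : H →L[𝕜] Y :=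
  (r : 𝕜) • B.comp (ContinuousLinearMap.id 𝕜 H + ((l - r : ℝ) : 𝕜) • R r)

/-- The time integral over `[0, h]` of the free output. -/
noncomputable def freeOutput (T : ℝ≥0 → H →L[𝕜] H) (B : H →L[𝕜] Y) (l : ℝ) (h : ℝ≥0) (x : H) : Y :=
  B (l • expIntegral T 0 h x - (T h x - x))

theorem observer_apply (r : ℝ) (x : H) :
    observer B R l r x = r • B (x + (l - r) • R r x) := by
  change (r : 𝕜) • B (x + ((l - r : ℝ) : 𝕜) • R r x) = _
  rw [coe_smul_eq_real_smul, coe_smul_eq_real_smul]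

theorem IsResolventFamily.graph_smul (hR : IsResolventFamily T A R l M) {r : ℝ} (hr : l ≤ r)
    (x : H) : (r • R r x, r • (r • R r x - x)) ∈ A.graph := by
  have h1 := A.graph.smul_mem (r : 𝕜) (hR.graph r hr x)
  rw [Prod.smul_mk, coe_smul_eq_real_smul, coe_smul_eq_real_smul] at h1
  exact h1

/-- Since `(l - A) R(r, A) = 1 + (l - r) R(r, A)`, factoring `C` through `l - A` leads to the
formula that defines `observer`. -/
theorem IsObservationFactor.valueAt_smul (hB : IsObservationFactor A C l B)
    (hR : IsResolventFamily T A R l M) {r : ℝ} (hr : l ≤ r) (x : H) :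
    valueAt (LinearPMap.mk A.domain C) (r • R r x) = observer B R l r x := by
  rw [hB _ _ (hR.graph_smul hr x), observer_apply, ← clm_map_real_smul B]
  congr 1
  module

theorem IsObservationFactor.yosidaApprox_eq (hB : IsObservationFactor A C l B)
    (hR : IsResolventFamily T A R l M) {r : ℝ} (hr : l ≤ r) (x : H) :
    yosidaApprox A C r x = observer B R l r x := by
  have e : (((r : 𝕜) • resolventMap A (r : 𝕜) x : A.domain) : H) = r • R r x := by
    rw [Submodule.coe_smul, hR.coe_resolventMap hr, coe_smul_eq_real_smul]
  rw [← hB.valueAt_smul hR hr, ← e,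
    valueAt_of_mem (N := LinearPMap.mk A.domain C) ((r : 𝕜) • resolventMap A (r : 𝕜) x).2]
  rfl

theorem IsResolventFamily.norm_observer_le (hR : IsResolventFamily T A R l M) {r : ℝ}
    (hr : l ≤ r) (x : H) : ‖observer B R l r x‖ ≤ r * (‖B‖ * ((1 + M) * ‖x‖)) := by
  have hr0 := hR.pos.trans_le hr
  rw [observer_apply, norm_smul, Real.norm_of_nonneg hr0.le]
  refine mul_le_mul_of_nonneg_left ((B.le_opNorm _).trans
    (mul_le_mul_of_nonneg_left ?_ (norm_nonneg B))) hr0.le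
  refine (norm_add_le _ _).trans ?_
  rw [norm_smul, Real.norm_eq_abs, abs_sub_comm, abs_of_nonneg (sub_nonneg.2 hr)]
  have h1 := hR.norm_apply_le hr x
  have h2 : (r - l) * ‖R r x‖ ≤ r * ‖R r x‖ :=
    mul_le_mul_of_nonneg_right (by linarith [hR.pos]) (norm_nonneg _)
  linarith

theorem IsResolventFamily.continuousOn_observer (hR : IsResolventFamily T A R l M) (x : H) :
    ContinuousOn (fun r => observer B R l r x) (Set.Ici l) := by
  simp_rw [observer_apply]
  refine continuousOn_id.smul (B.continuous.comp_continuousOn (continuousOn_const.add ?_))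
  exact (continuousOn_const.sub continuousOn_id).smul (hR.continuousOn x)

theorem continuous_freeOutput (hT : IsC0Semigroup T) (x : H) :
    Continuous fun h => freeOutput T B l h x := by
  have h1 := continuous_expIntegral hT 0 x
  have h2 := hT.continuous_apply x
  exact B.continuous.comp ((h1.const_smul l).sub (h2.sub continuous_const))

theorem continuous_freeOutput_right (hT : IsC0Semigroup T) (h : ℝ≥0) :
    Continuous fun x => freeOutput T B l h x := by
  obtain ⟨I, hI⟩ := exists_expIntegral_clm hT 0 h
  simp_rw [freeOutput, ← hI]
  have h1 := I.continuous
  have h2 := (T h).continuous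
  exact B.continuous.comp ((h1.const_smul l).sub (h2.sub continuous_id))

/-- The bounded `B` comes out of the integral, and integration by parts evaluates the transform of
the primitive of the orbit. -/
theorem laplace_freeOutput (hT : IsC0Semigroup T) (r : ℝ) (x : H) :
    ∫ h in Set.Icc (0 : ℝ≥0) 1, (r ^ 2 * Real.exp (-(r * h))) • freeOutput T B l h x ∂timeMeasure
      = r • B (l • (expIntegral T r 1 x - Real.exp (-r) • expIntegral T 0 1 x)
          - (r • expIntegral T r 1 x - (1 - Real.exp (-r)) • x)) := by
  have c0 : Continuous fun h : ℝ≥0 => Real.exp (-(r * h)) := by fun_prop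
  have c1 : Continuous fun h : ℝ≥0 => (r * Real.exp (-(r * h))) • expIntegral T 0 h x :=
    (c0.const_mul r).smul (continuous_expIntegral hT 0 x)
  have c2 := continuous_exp_smul_nnreal hT r x
  have c3 : Continuous fun h : ℝ≥0 => (r * Real.exp (-(r * h))) • x :=
    (c0.const_mul r).smul continuous_const
  have int : ∀ {c : ℝ≥0 → H}, Continuous c → IntegrableOn c (Set.Icc 0 1) timeMeasure :=
    fun hc => hc.continuousOn.integrableOn_compact isCompact_Icc
  have i1 : IntegrableOn (fun h : ℝ≥0 => l • (r * Real.exp (-(r * h))) • expIntegral T 0 h x)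
      (Set.Icc 0 1) timeMeasure := int (c1.const_smul l)
  have i2 : IntegrableOn (fun h : ℝ≥0 => r • Real.exp (-(r * h)) • T h x)
      (Set.Icc 0 1) timeMeasure := int (c2.const_smul r)
  have i3 := int c3
  have i23 : IntegrableOn (fun h : ℝ≥0 => r • Real.exp (-(r * h)) • T h x
      - (r * Real.exp (-(r * h))) • x) (Set.Icc 0 1) timeMeasure := i2.sub i3
  have i4 : IntegrableOn (fun h : ℝ≥0 => l • (r * Real.exp (-(r * h))) • expIntegral T 0 h x
      - (r • Real.exp (-(r * h)) • T h x - (r * Real.exp (-(r * h))) • x)) (Set.Icc 0 1)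
      timeMeasure := i1.sub i23
  have e1 : ∫ h in Set.Icc (0 : ℝ≥0) 1, (l • (r * Real.exp (-(r * h))) • expIntegral T 0 h x
      - (r • Real.exp (-(r * h)) • T h x - (r * Real.exp (-(r * h))) • x)) ∂timeMeasure
      = l • (expIntegral T r 1 x - Real.exp (-r) • expIntegral T 0 1 x)
          - (r • expIntegral T r 1 x - (1 - Real.exp (-r)) • x) := by
    rw [integral_sub i1 i23, integral_sub i2 i3, integral_smul, integral_smul,
      integral_smul_const, setIntegral_exp_kernel]
    congr 2
    rw [expIntegral_eq_add hT r x, add_sub_cancel_left]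
  rw [← e1, ← B.integral_comp_comm i4, ← integral_smul]
  refine integral_congr_ae (Eventually.of_forall fun h => ?_)
  simp only [freeOutput]
  rw [← clm_map_real_smul B, ← clm_map_real_smul B]
  congr 1
  module

/-- The two expressions differ only by the truncation to `[0, 1]`. All remaining terms carry
`e^{-r}`, while the operators involved grow at most linearly in `r`. Hence the Yosida limit exists
exactly when the Laplace averages of the free output converge. -/
theorem IsResolventFamily.tendsto_observer_sub (hR : IsResolventFamily T A R l M)
    (hT : IsC0Semigroup T) (x : H) :
    Tendsto (fun r : ℝ => observer B R l r x - ∫ h in Set.Icc (0 : ℝ≥0) 1,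
      (r ^ 2 * Real.exp (-(r * h))) • freeOutput T B l h x ∂timeMeasure) atTop (𝓝 0) := by
  have key : ∀ r ≥ l, observer B R l r x - (∫ h in Set.Icc (0 : ℝ≥0) 1,
      (r ^ 2 * Real.exp (-(r * h))) • freeOutput T B l h x ∂timeMeasure)
      = Real.exp (-r) • observer B R l r (T 1 x)
        + (r * Real.exp (-r)) • freeOutput T B l 1 x := by
    intro r hr
    rw [laplace_freeOutput hT, observer_apply, observer_apply, freeOutput]
    simp only [← clm_map_real_smul B]
    rw [← map_sub, ← map_add]
    congr 1
    rw [hR.decomp r hr x]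
    module
  have h1 := tendsto_mul_exp_neg.mul_const (‖B‖ * ((1 + M) * ‖T 1 x‖))
  have h2 := tendsto_mul_exp_neg.smul_const (freeOutput T B l 1 x)
  rw [zero_mul] at h1
  rw [zero_smul] at h2
  have h3 : Tendsto (fun r : ℝ => Real.exp (-r) • observer B R l r (T 1 x)) atTop (𝓝 0) := by
    refine squeeze_zero_norm' ?_ h1
    filter_upwards [eventually_ge_atTop l] with r hr
    rw [norm_smul, Real.norm_of_nonneg (Real.exp_pos _).le, mul_comm r, mul_assoc]
    exact mul_le_mul_of_nonneg_left (hR.norm_observer_le hr _) (Real.exp_pos _).le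
  have h4 := h3.add h2
  rw [zero_add] at h4
  refine h4.congr' ?_
  filter_upwards [eventually_ge_atTop l] with r hr
  rw [key r hr]

/-- This ties the formula for `freeOutput` to the output: `r R(r, A) x` lies in the domain, and `C`
of the integrated orbit is `B (l - A)` of it, where `A ∫₀^h T(τ) z dτ = T(h) z - z`. The right side
of this relation makes sense for every `z`. -/
theorem IsResolventFamily.setIntegral_observer (hR : IsResolventFamily T A R l M)
    (hA : IsGenerator T A) (hT : IsC0Semigroup T) {r : ℝ} (hr : l ≤ r) (h : ℝ≥0) (x : H) :
    ∫ τ in Set.Icc 0 h, observer B R l r (T τ x) ∂timeMeasure = freeOutput T B l h (r • R r x) := by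
  have hi := integrableOn_exp_smul hT 0 h x
  have e1 : ∫ τ in Set.Icc 0 h, observer B R l r (T τ x) ∂timeMeasure
      = observer B R l r (expIntegral T 0 h x) := by
    rw [expIntegral, ← (observer B R l r).integral_comp_comm hi]
    simp
  have hc : ∀ t y, R r (T t y) = T t (R r y) := fun t y => hR.comm r hr t y
  have e2 := apply_expIntegral_comm hT hc 0 h x
  have h1 := hR.left_inv r hr _ _ (expIntegral_mem_graph hT hA 0 h x)
  simp only [zero_mul, neg_zero, Real.exp_zero, one_smul, zero_smul, add_zero] at h1
  have e3 : r • R r (expIntegral T 0 h x) = expIntegral T 0 h x + (T h (R r x) - R r x) := by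
    rw [map_sub, map_sub, clm_map_real_smul, hc] at h1
    rw [sub_eq_iff_eq_add] at h1
    exact h1
  have e4 : expIntegral T 0 h (r • R r x) = r • expIntegral T 0 h (R r x) := by
    obtain ⟨I, hI⟩ := exists_expIntegral_clm hT 0 h
    rw [← hI, ← hI, clm_map_real_smul]
  have e5 : T h (R r x) = r • R r (expIntegral T 0 h x) - expIntegral T 0 h x + R r x := by
    rw [e3]; abel
  rw [e1, observer_apply, freeOutput, ← clm_map_real_smul B, e4, clm_map_real_smul (T h), e5, e2]
  congr 1
  module

theorem yosidaExtension_of_tendsto {x : H} {y : Y}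
    (h : Tendsto (fun r : ℝ => yosidaApprox A C r x) atTop (𝓝 y)) :
    x ∈ (yosidaExtension A C).domain ∧ valueAt (yosidaExtension A C) x = y := by
  have hx : x ∈ (yosidaExtension A C).domain := ⟨y, h⟩
  refine ⟨hx, ?_⟩
  rw [valueAt_of_mem hx]
  exact tendsto_nhds_unique hx.choose_spec h

theorem tendsto_valueAt_yosidaExtension {x : H} (hx : x ∈ (yosidaExtension A C).domain) :
    Tendsto (fun r : ℝ => yosidaApprox A C r x) atTop (𝓝 (valueAt (yosidaExtension A C) x)) := by
  obtain ⟨y, h⟩ := hx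
  rwa [(yosidaExtension_of_tendsto h).2]

/-- For `x ∈ D(A)` the resolvent commutes with `l - A`, so the approximations are `B (r R(r, A) (l -
A) x)` and converge to `B (l - A) x = C x`. -/
theorem IsObservationFactor.le_yosidaExtension (hB : IsObservationFactor A C l B)
    (hR : IsResolventFamily T A R l M) (hA : IsGenerator T A) (hT : IsC0Semigroup T) :
    LinearPMap.mk A.domain C ≤ yosidaExtension A C := by
  have key : ∀ x : A.domain, Tendsto (fun r : ℝ => yosidaApprox A C r (x : H)) atTop
      (𝓝 (C x)) := by
    intro x
    have hx := A.mem_graph x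
    have h1 := (B.continuous.tendsto _).comp (hR.tendsto_smul hT (l • (x : H) - A x))
    have h2 : C x = B (l • (x : H) - A x) := by
      rw [← hB _ _ hx, valueAt_of_mem (N := LinearPMap.mk A.domain C) x.2]
      rfl
    rw [h2]
    refine h1.congr' ?_
    filter_upwards [eventually_ge_atTop l] with r hr
    have hc : ∀ t y, R r (T t y) = T t (R r y) := fun t y => hR.comm r hr t y
    have hg := A.graph.smul_mem (r : 𝕜) (mem_graph_of_comm hA hc hx)
    rw [Prod.smul_mk, coe_smul_eq_real_smul, coe_smul_eq_real_smul] at hg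
    rw [hB.yosidaApprox_eq hR hr, ← hB.valueAt_smul hR hr, hB _ _ hg]
    simp only [Function.comp_apply]
    rw [map_sub, clm_map_real_smul (R r), smul_sub, smul_comm r l]
  refine ⟨fun x hx => ⟨_, key ⟨x, hx⟩⟩, fun x y hxy => ?_⟩
  have h1 := (yosidaExtension_of_tendsto (key x)).2
  have hy : (x : H) ∈ (yosidaExtension A C).domain := ⟨_, key x⟩
  rw [valueAt_of_mem hy] at h1
  have h2 : y = ⟨(x : H), hy⟩ := Subtype.ext hxy.symm
  rw [h2, h1]
  rfl

end Observer

/-! ### Square integral bounds for the free output -/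

theorem setLIntegral_Icc_add {φ : ℝ≥0 → ℝ≥0∞} (hφ : Measurable φ) (a b : ℝ≥0) :
    ∫⁻ t in Set.Icc a (a + b), φ t ∂timeMeasure = ∫⁻ t in Set.Icc 0 b, φ (t + a) ∂timeMeasure := by
  have h1 := setLIntegral_add_right a (f := (Set.Iic (a + b)).indicator φ)
    (hφ.indicator measurableSet_Iic)
  rw [setLIntegral_indicator measurableSet_Iic, Set.inter_comm, Set.Ici_inter_Iic] at h1
  rw [h1, ← lintegral_indicator measurableSet_Icc]
  refine lintegral_congr fun t => ?_
  have h2 : t + a ∈ Set.Iic (a + b) ↔ t ∈ Set.Icc 0 b := by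
    rw [Set.mem_Iic, Set.mem_Icc, add_comm t a, add_le_add_iff_left]
    simp
  by_cases h : t ∈ Set.Icc 0 b
  · rw [Set.indicator_of_mem h, Set.indicator_of_mem (h2.2 h)]
  · rw [Set.indicator_of_notMem h, Set.indicator_of_notMem (mt h2.1 h)]

section Observer

variable {𝕜 : Type*} [RCLike 𝕜]
  {H : Type*} [NormedAddCommGroup H] [NormedSpace 𝕜 H] [NormedSpace ℝ H] [IsScalarTower ℝ 𝕜 H]
  [CompleteSpace H]
  {Y : Type*} [NormedAddCommGroup Y] [NormedSpace 𝕜 Y] [NormedSpace ℝ Y] [IsScalarTower ℝ 𝕜 Y]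
  [CompleteSpace Y]
  {T : ℝ≥0 → H →L[𝕜] H} {A : H →ₗ.[𝕜] H} {R : ℝ → H →L[𝕜] H} {l M : ℝ}
  {C : A.domain →ₗ[𝕜] Y} {B : H →L[𝕜] Y}

theorem IsC0Semigroup.restrictScalars (hT : IsC0Semigroup T) :
    IsC0Semigroup fun t => (T t).restrictScalars ℝ where
  map_zero := by
    ext x
    exact hT.zero_apply x
  map_add s t := by
    ext x
    exact hT.add_apply s t x
  tendsto_zero := hT.tendsto_zero

theorem IsGenerator.apply_mem_graph (hA : IsGenerator T A) (hT : IsC0Semigroup T) (t : ℝ≥0)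
    {x y : H} (h : (x, y) ∈ A.graph) : (T t x, T t y) ∈ A.graph :=
  mem_graph_of_comm hA (fun s x => hT.comm_apply t s x) h

theorem IsObservationFactor.continuous_output (hB : IsObservationFactor A C l B)
    (hA : IsGenerator T A) (hT : IsC0Semigroup T) {x : H} (hx : x ∈ A.domain) :
    Continuous fun t => valueAt (LinearPMap.mk A.domain C) (T t x) := by
  have hg := A.mem_graph ⟨x, hx⟩
  have e : (fun t => valueAt (LinearPMap.mk A.domain C) (T t x))
      = fun t => B (l • T t x - T t (A ⟨x, hx⟩)) := by
    ext t
    exact hB _ _ (hA.apply_mem_graph hT t hg)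
  rw [e]
  exact B.continuous.comp
    (((hT.continuous_apply x).const_smul l).sub (hT.continuous_apply (A ⟨x, hx⟩)))

/-- Admissibility on one time interval implies admissibility on all of them. -/
theorem IsAdmissible.exists_bound (hadm : IsAdmissible T A C) (hB : IsObservationFactor A C l B)
    (hA : IsGenerator T A) (hT : IsC0Semigroup T) (u : ℝ≥0) :
    ∃ γ : ℝ≥0, ∀ x ∈ A.domain, ∫⁻ t in Set.Icc 0 u,
      ‖valueAt (LinearPMap.mk A.domain C) (T t x)‖ₑ ^ 2 ∂timeMeasure ≤ γ * ‖x‖ₑ ^ 2 := by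
  obtain ⟨α, hα, γ₀, -, hγ₀⟩ := hadm
  have step : ∀ n : ℕ, ∃ γ : ℝ≥0, ∀ x ∈ A.domain, ∫⁻ t in Set.Icc 0 (n * α),
      ‖valueAt (LinearPMap.mk A.domain C) (T t x)‖ₑ ^ 2 ∂timeMeasure ≤ γ * ‖x‖ₑ ^ 2 := by
    intro n
    induction n with
    | zero =>
      refine ⟨0, fun x _ => ?_⟩
      simp
    | succ n ih =>
      obtain ⟨γ, hγ⟩ := ih
      -- The additional block of length `α` is an orbit restarted at `T (n α) x`, which lies in the
      -- domain again.
      refine ⟨γ + γ₀ ^ 2 * ‖T (n * α)‖₊ ^ 2, fun x hx => ?_⟩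
      have hTx : T (n * α) x ∈ A.domain := LinearPMap.mem_domain_of_mem_graph
        (hA.apply_mem_graph hT (n * α) (A.mem_graph ⟨x, hx⟩))
      have hm : Measurable fun t => ‖valueAt (LinearPMap.mk A.domain C) (T t x)‖ₑ ^ 2 :=
        (hB.continuous_output hA hT hx).enorm.measurable.pow_const 2
      have hsub : Set.Icc 0 (((n + 1 : ℕ) : ℝ≥0) * α)
          ⊆ Set.Icc 0 (n * α) ∪ Set.Icc (n * α) (n * α + α) := fun t ht => by
        rcases le_total t (n * α) with h | h
        · exact Or.inl (Set.mem_Icc.2 ⟨zero_le, h⟩)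
        · refine Or.inr (Set.mem_Icc.2 ⟨h, (Set.mem_Icc.1 ht).2.trans (le_of_eq ?_)⟩)
          push_cast; ring
      refine (lintegral_mono_set hsub).trans ((lintegral_union_le _ _ _).trans ?_)
      rw [ENNReal.coe_add, add_mul]
      refine add_le_add (hγ x hx) ?_
      rw [setLIntegral_Icc_add hm]
      simp_rw [hT.add_apply]
      refine (hγ₀ _ hTx).trans ?_
      have h2 : ‖T (n * α) x‖ₑ ≤ ‖T (n * α)‖ₑ * ‖x‖ₑ := (T (n * α)).le_opENorm x
      push_cast
      rw [mul_assoc]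
      refine mul_le_mul_right ?_ _
      rw [← enorm_eq_nnnorm, ← mul_pow]
      exact pow_le_pow_left' h2 2
  obtain ⟨n, hn⟩ := exists_nat_ge (u / α)
  obtain ⟨γ, hγ⟩ := step n
  refine ⟨γ, fun x hx => (lintegral_mono_set (Set.Icc_subset_Icc_right ?_)).trans (hγ x hx)⟩
  exact (div_le_iff₀ hα).1 hn

theorem IsResolventFamily.smul_mem_domain (hR : IsResolventFamily T A R l M) {r : ℝ} (hr : l ≤ r)
    (x : H) : r • R r x ∈ A.domain :=
  LinearPMap.mem_domain_of_mem_graph (hR.graph_smul hr x)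

theorem IsObservationFactor.observer_semigroup (hB : IsObservationFactor A C l B)
    (hR : IsResolventFamily T A R l M) {r : ℝ} (hr : l ≤ r) (t : ℝ≥0) (x : H) :
    observer B R l r (T t x) = valueAt (LinearPMap.mk A.domain C) (T t (r • R r x)) := by
  rw [← hB.valueAt_smul hR hr, hR.comm r hr, clm_map_real_smul (T t)]

theorem valueAt_sub {N : H →ₗ.[𝕜] Y} {x y : H} (hx : x ∈ N.domain) (hy : y ∈ N.domain) :
    valueAt N (x - y) = valueAt N x - valueAt N y := by
  rw [valueAt_of_mem hx, valueAt_of_mem hy, valueAt_of_mem (N.domain.sub_mem hx hy), ← N.map_sub]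
  rfl

/-- The operators `C r R(r, A)` approximate `C`. -/
theorem IsObservationFactor.isObservationApprox (hB : IsObservationFactor A C l B)
    (hR : IsResolventFamily T A R l M) (hadm : IsAdmissible T A C) (hA : IsGenerator T A)
    (hT : IsC0Semigroup T) :
    IsObservationApprox (fun t => (T t).restrictScalars ℝ)
      (fun n : ℕ => (observer B R l (l + n)).restrictScalars ℝ)
      (fun n : ℕ => (((l + n : ℝ) : 𝕜) • R (l + n)).restrictScalars ℝ)
      (freeOutput T B l) := by
  have hln : ∀ n : ℕ, l ≤ l + n := fun n => by simp
  have hlim : Tendsto (fun n : ℕ => l + (n : ℝ)) atTop atTop :=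
    tendsto_atTop_add_const_left _ _ tendsto_natCast_atTop_atTop
  have hJ : ∀ (n : ℕ) x, ((((l + n : ℝ) : 𝕜) • R (l + n)).restrictScalars ℝ) x
      = (l + n : ℝ) • R (l + n) x := fun n x => coe_smul_eq_real_smul _ _
  have hK : ∀ (n : ℕ) τ x, ((observer B R l (l + n)).restrictScalars ℝ) ((T τ).restrictScalars ℝ x)
      = valueAt (LinearPMap.mk A.domain C) (T τ ((l + n : ℝ) • R (l + n) x)) := fun n τ x =>
    hB.observer_semigroup hR (hln n) τ x
  have hM := hR.nonneg
  have hJb : ∀ (n : ℕ) x, ‖(l + n : ℝ) • R (l + n) x‖ ≤ M * ‖x‖ := fun n x => by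
    rw [norm_smul, Real.norm_of_nonneg (hR.pos.trans_le (hln n)).le]
    exact hR.norm_apply_le (hln n) x
  refine ⟨fun u => ?_, fun u => ?_, ⟨M.toNNReal, fun n => ?_⟩, fun x => ?_, fun h _ x => ?_⟩
  · obtain ⟨γ, hγ⟩ := hadm.exists_bound hB hA hT u
    refine ⟨γ, fun n m x => ?_⟩
    have hmem := A.domain.sub_mem (hR.smul_mem_domain (hln n) x) (hR.smul_mem_domain (hln m) x)
    refine le_of_eq_of_le (lintegral_congr fun τ => ?_) ((hγ _ hmem).trans (le_of_eq ?_))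
    · have h1 : ∀ k : ℕ, T τ ((l + k : ℝ) • R (l + k) x) ∈ (LinearPMap.mk A.domain C).domain :=
        fun k => (LinearPMap.mem_domain_of_mem_graph
          (hA.apply_mem_graph hT τ (hR.graph_smul (hln k) x)) : _ ∈ A.domain)
      rw [sub_apply, hK, hK, ← valueAt_sub (h1 n) (h1 m), map_sub]
    · rw [sub_apply, hJ, hJ]
  · obtain ⟨γ, hγ⟩ := hadm.exists_bound hB hA hT u
    refine ⟨γ * M.toNNReal ^ 2, fun n x => ?_⟩
    refine le_of_eq_of_le (lintegral_congr fun τ => by rw [hK])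
      ((hγ _ (hR.smul_mem_domain (hln n) x)).trans ?_)
    rw [ENNReal.coe_mul, ENNReal.coe_pow, mul_assoc, ← mul_pow]
    refine mul_le_mul_right (pow_le_pow_left' ?_ 2) _
    change _ ≤ ENNReal.ofReal M * _
    rw [← ofReal_norm, ← ofReal_norm, ← ENNReal.ofReal_mul hM]
    exact ENNReal.ofReal_le_ofReal (hJb n x)
  · rw [Real.coe_toNNReal _ hM]
    refine ContinuousLinearMap.opNorm_le_bound _ hM fun x => ?_
    rw [hJ]
    exact hJb n x
  · simp_rw [hJ]
    exact (hR.tendsto_smul hT x).comp hlim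
  · have h1 := (continuous_freeOutput_right (B := B) (l := l) hT h).tendsto x
    refine (h1.comp ((hR.tendsto_smul hT x).comp hlim)).congr fun n => ?_
    simp only [Function.comp_apply]
    rw [← hR.setIntegral_observer hA hT (hln n)]
    rfl

end Observer

/-! ### Lipschitz bounds for observed mild solutions -/

section RealBound

variable {Ω : Type*} {mΩ : MeasurableSpace Ω} {P : Measure Ω} [IsProbabilityMeasure P]
  {𝓕 : Filtration ℝ≥0 mΩ} {W : ℝ≥0 → Ω → ℝ}
  {H : Type*} [NormedAddCommGroup H] [InnerProductSpace ℝ H] [CompleteSpace H]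
  {Y : Type*} [NormedAddCommGroup Y] [InnerProductSpace ℝ Y] [CompleteSpace Y]
  {T : ℝ≥0 → H →L[ℝ] H} {G F : H → H} {L : ℝ≥0}

theorem enorm_compLpL_id_le (x : Lp H 2 P) :
    ‖(ContinuousLinearMap.id ℝ H).compLpL 2 P x‖ₑ ≤ ‖x‖ₑ := by
  have h := norm_compLpL_le' (ContinuousLinearMap.id ℝ H) ContinuousLinearMap.norm_id_le x
  rw [one_mul] at h
  exact enorm_le_iff_norm_le.2 h

/-- The difference of two mild solutions solves a linear equation whose coefficients are differences
of the nonlinear terms, hence Lipschitz in the difference of the solutions. The constant is chosen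
before `D`, so it is common to all approximations of `C`. -/
theorem exists_lintegral_observe_bound (hW : IsFBrownianMotion 𝓕 P W) (hT : IsC0Semigroup T)
    (hG : LipschitzWith L G) (hF : LipschitzWith L F) (α γ : ℝ≥0) :
    ∃ c : ℝ≥0, ∀ D : H →L[ℝ] Y,
      (∀ x, ∫⁻ τ in Set.Icc 0 α, ‖D (T τ x)‖ₑ ^ 2 ∂timeMeasure ≤ γ * ‖x‖ₑ ^ 2) →
      ∀ ξ η : Ω → H, MemL2Init 𝓕 P ξ → MemL2Init 𝓕 P η → ∀ x y,
      IsMildSolution 𝓕 P W T G F ξ x → IsMildSolution 𝓕 P W T G F η y →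
      ∫⁻ p, ‖D (x p.1 p.2 - y p.1 p.2)‖ₑ ^ 2 ∂timeProd P α ≤ c * eLpNorm (ξ - η) 2 P ^ 2 := by
  obtain ⟨c, hc⟩ := exists_isMildSolution_bound hW hT hG hF α
  -- Inside the bracket, 1 stands for the initial values, `α * (α * (L² c))` for the drift, with its
  -- Cauchy–Schwarz factor `α`, and `α * (L² c)` for the noise.
  refine ⟨4 * γ * (1 + (α * (α * (L ^ 2 * c)) + α * (L ^ 2 * c))),
    fun D hD ξ η hξ hη x y hx hy => ?_⟩
  obtain ⟨X, hX, hXs, -, hXv⟩ := exists_curve_of_init hW hT hG hF hξ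
  obtain ⟨Z, hZ, hZs, -, hZv⟩ := exists_curve_of_init hW hT hG hF hη
  have hxX := hXv x hx
  have hyZ := hZv y hy
  have hSG := lipschitzWith_superposition (P := P) hG
  have hSF := lipschitzWith_superposition (P := P) hF
  have hXl : IsLinearMild 𝓕 P W T (hξ.2.toLp ξ) (fun s => superposition hG (X s))
    (fun s => superposition hF (X s)) X := hXs
  have hZl : IsLinearMild 𝓕 P W T (hη.2.toLp η) (fun s => superposition hG (Z s))
    (fun s => superposition hF (Z s)) Z := hZs
  have g1 := hSG.continuous.comp hX.continuous
  have g2 := hSG.continuous.comp hZ.continuous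
  have f1 := hSF.continuous.comp hX.continuous
  have f2 := hSF.continuous.comp hZ.continuous
  have hd := hXl.sub hT g1 g2 hZl
  have hxm := (stronglyMeasurable_of_progressive hx.memCF.progressive).sub
    (stronglyMeasurable_of_progressive hy.memCF.progressive)
  have hver : ∀ t, (fun ω => x t ω - y t ω) =ᵐ[P] (X - Z) t := fun t => by
    filter_upwards [hxX t, hyZ t, Lp.coeFn_sub (X t) (Z t)] with ω h1 h2 h3
    rw [Pi.sub_apply X Z, h3, Pi.sub_apply, h1, h2]
  have h1 := hd.lintegral_observe_sq_le hW hT (g1.sub g2) (f1.sub f2) (D := D)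
    (J := ContinuousLinearMap.id ℝ H) (γ := γ) (u := α) hD
  rw [lintegral_timeProd_eq (x := fun t ω => x t ω - y t ω) hxm hver D α]
  refine h1.trans ?_
  have hξη : ‖hξ.2.toLp ξ - hη.2.toLp η‖ₑ ^ 2 = eLpNorm (ξ - η) 2 P ^ 2 := by
    rw [← MemLp.toLp_sub, Lp.enorm_toLp]
  have hdt : ∀ t ≤ α, ‖X t - Z t‖ₑ ^ 2 ≤ c * eLpNorm (ξ - η) 2 P ^ 2 := fun t ht => by
    refine le_of_eq_of_le ?_ (hc ξ η x y hξ.2 hη.2 hx hy t ht)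
    rw [Lp_enorm_sq, eLpNorm_two_sq]
    refine lintegral_congr_ae ?_
    filter_upwards [hver t] with ω h
    rw [Pi.sub_apply X Z] at h
    rw [← h, Pi.sub_apply]
  have hint : ∀ {N : H → H} (hN : LipschitzWith L N),
      ∫⁻ s in Set.Icc 0 α, ‖(ContinuousLinearMap.id ℝ H).compLpL 2 P
        (superposition hN (X s) - superposition hN (Z s))‖ₑ ^ 2 ∂timeMeasure
      ≤ α * (L ^ 2 * c) * eLpNorm (ξ - η) 2 P ^ 2 := by
    intro N hN
    have hSN := lipschitzWith_superposition (P := P) hN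
    have hb : ∀ s ∈ Set.Icc 0 α, ‖(ContinuousLinearMap.id ℝ H).compLpL 2 P
        (superposition hN (X s) - superposition hN (Z s))‖ₑ ^ 2
        ≤ L ^ 2 * (c * eLpNorm (ξ - η) 2 P ^ 2) := fun s hs => by
      have h2 := hSN (X s) (Z s)
      rw [edist_eq_enorm_sub, edist_eq_enorm_sub] at h2
      refine (pow_le_pow_left' ((enorm_compLpL_id_le _).trans h2) 2).trans ?_
      rw [mul_pow]
      exact mul_le_mul_right (hdt s (Set.mem_Icc.1 hs).2) _
    refine (setLIntegral_mono' measurableSet_Icc hb).trans (le_of_eq ?_)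
    rw [setLIntegral_const, timeMeasure_Icc, NNReal.coe_zero, sub_zero, ENNReal.ofReal_coe_nnreal]
    ring
  have hg := hint hG
  have hf := hint hF
  have h0 := (pow_le_pow_left' (enorm_compLpL_id_le (hξ.2.toLp ξ - hη.2.toLp η)) 2).trans_eq hξη
  push_cast
  rw [mul_assoc (4 * (γ : ℝ≥0∞))]
  refine mul_le_mul_right ?_ _
  rw [add_mul, one_mul, add_mul, mul_assoc (α : ℝ≥0∞)]
  exact add_le_add h0 (add_le_add (mul_le_mul_right hg _) hf)

end RealBound

/-! ### Measurability of the Yosida extension along processes -/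

/-- If a real `r` violates the limit by `ε`, then by continuity an open set of parameters near `r`
violates it by `ε / 2`, and this set contains a rational. Limits over a countable index set are what
measurability arguments need. -/
theorem tendsto_atTop_iff_rat {Y : Type*} [PseudoMetricSpace Y] {k : ℝ → Y} (hk : Continuous k)
    (y : Y) : Tendsto k atTop (𝓝 y) ↔ Tendsto (fun q : ℚ => k q) atTop (𝓝 y) := by
  refine ⟨fun h => h.comp (tendsto_ratCast_atTop_iff.2 tendsto_id), fun h => ?_⟩
  rw [Metric.tendsto_atTop] at h ⊢
  intro ε hε
  obtain ⟨N, hN⟩ := h (ε / 2) (half_pos hε)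
  refine ⟨N + 1, fun r hr => ?_⟩
  by_contra hcon
  have ho : IsOpen ({s | ε / 2 < dist (k s) y} ∩ Set.Ioi (N : ℝ)) :=
    (isOpen_lt continuous_const (hk.dist continuous_const)).inter isOpen_Ioi
  have hne : ({s | ε / 2 < dist (k s) y} ∩ Set.Ioi (N : ℝ)).Nonempty :=
    ⟨r, (half_lt_self hε).trans_le (not_lt.1 hcon), Set.mem_Ioi.2 (by linarith)⟩
  obtain ⟨q, hq1, hq2⟩ := Rat.denseRange_cast.exists_mem_open ho hne
  have h1 : N ≤ q := by exact_mod_cast (Set.mem_Ioi.1 hq2).le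
  exact lt_asymm hq1 (hN q h1)

section Yosida

variable {𝕜 : Type*} [RCLike 𝕜]
  {H : Type*} [NormedAddCommGroup H] [NormedSpace 𝕜 H] [NormedSpace ℝ H] [IsScalarTower ℝ 𝕜 H]
  [CompleteSpace H]
  {Y : Type*} [NormedAddCommGroup Y] [NormedSpace 𝕜 Y] [NormedSpace ℝ Y] [IsScalarTower ℝ 𝕜 Y]
  [CompleteSpace Y]
  {T : ℝ≥0 → H →L[𝕜] H} {A : H →ₗ.[𝕜] H} {R : ℝ → H →L[𝕜] H} {l M : ℝ}
  {C : A.domain →ₗ[𝕜] Y} {B : H →L[𝕜] Y}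

theorem IsObservationFactor.tendsto_yosida_iff (hB : IsObservationFactor A C l B)
    (hR : IsResolventFamily T A R l M) (x : H) (y : Y) :
    Tendsto (fun r : ℝ => yosidaApprox A C r x) atTop (𝓝 y)
      ↔ Tendsto (fun q : ℚ => observer B R l (max l q) x) atTop (𝓝 y) := by
  have hc : Continuous fun r : ℝ => observer B R l (max l r) x :=
    (hR.continuousOn_observer x).comp_continuous (by fun_prop) fun r => le_max_left l r
  rw [← tendsto_atTop_iff_rat hc]
  refine tendsto_congr' ?_
  filter_upwards [eventually_ge_atTop l] with r hr
  rw [max_eq_right hr, hB.yosidaApprox_eq hR hr]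

variable {S : Type*} {mS : MeasurableSpace S}

/-- Membership is the existence of a limit of countably many strongly measurable functions.
Replacing `q` by `max l q` keeps the parameter in the range of the resolvent family without
affecting the limit. -/
theorem IsObservationFactor.measurableSet_domain (hB : IsObservationFactor A C l B)
    (hR : IsResolventFamily T A R l M) {X : S → H} (hX : StronglyMeasurable X) :
    MeasurableSet {p | X p ∈ (yosidaExtension A C).domain} := by
  have h1 : ∀ q : ℚ, StronglyMeasurable fun p => observer B R l (max l q) (X p) := fun q =>
    (observer B R l (max l q)).continuous.comp_stronglyMeasurable hX
  have h2 := StronglyMeasurable.measurableSet_exists_tendsto (l := atTop) h1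
  have e : {p | X p ∈ (yosidaExtension A C).domain}
      = {p | ∃ y, Tendsto (fun q : ℚ => observer B R l (max l q) (X p)) atTop (𝓝 y)} := by
    ext p
    exact exists_congr fun y => hB.tendsto_yosida_iff hR (X p) y
  rw [e]
  exact h2

theorem IsObservationFactor.stronglyMeasurable_valueAt (hB : IsObservationFactor A C l B)
    (hR : IsResolventFamily T A R l M) {X : S → H} (hX : StronglyMeasurable X) :
    StronglyMeasurable fun p => valueAt (yosidaExtension A C) (X p) := by
  have hD := hB.measurableSet_domain (C := C) hR hX
  refine stronglyMeasurable_of_tendsto (atTop : Filter ℚ)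
    (f := fun q : ℚ => {p | X p ∈ (yosidaExtension A C).domain}.indicator
      fun p => observer B R l (max l q) (X p))
    (fun q => ((observer B R l (max l q)).continuous.comp_stronglyMeasurable hX).indicator hD) ?_
  rw [tendsto_pi_nhds]
  intro p
  by_cases hp : X p ∈ (yosidaExtension A C).domain
  · have h1 := (hB.tendsto_yosida_iff hR (X p) _).1 (tendsto_valueAt_yosidaExtension hp)
    refine h1.congr fun q => ?_
    rw [Set.indicator_of_mem (s := {p | X p ∈ (yosidaExtension A C).domain}) hp]
  · have h1 : valueAt (yosidaExtension A C) (X p) = 0 := dif_neg hp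
    rw [h1]
    refine tendsto_const_nhds.congr fun q => ?_
    rw [Set.indicator_of_notMem (s := {p | X p ∈ (yosidaExtension A C).domain}) hp]

end Yosida

/-! ### Mild solutions stay in the domain of the Yosida extension -/

section System

variable {Ω : Type*} {mΩ : MeasurableSpace Ω} {P : Measure Ω} [IsProbabilityMeasure P]
  {𝓕 : Filtration ℝ≥0 mΩ} {W : ℝ≥0 → Ω → ℝ}
  {𝕜 : Type*} [RCLike 𝕜]
  {H : Type*} [NormedAddCommGroup H] [InnerProductSpace 𝕜 H] [CompleteSpace H]
  [InnerProductSpace ℝ H] [IsScalarTower ℝ 𝕜 H]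
  {Y : Type*} [NormedAddCommGroup Y] [InnerProductSpace 𝕜 Y] [CompleteSpace Y]
  [InnerProductSpace ℝ Y] [IsScalarTower ℝ 𝕜 Y]
  {T : ℝ≥0 → H →L[𝕜] H} {A : H →ₗ.[𝕜] H} {R : ℝ → H →L[𝕜] H} {l M : ℝ}
  {C : A.domain →ₗ[𝕜] Y} {B : H →L[𝕜] Y} {G F : H → H} {L : ℝ≥0}

theorem IsMildSolution.restrictScalars {ξ : Ω → H} {X : ℝ≥0 → Ω → H}
    (h : IsMildSolution 𝓕 P W T G F ξ X) :
    IsMildSolution 𝓕 P W (fun t => (T t).restrictScalars ℝ) G F ξ X :=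
  ⟨h.memCF, h.eq⟩

theorem IsMildSolution.of_restrictScalars {ξ : Ω → H} {X : ℝ≥0 → Ω → H}
    (h : IsMildSolution 𝓕 P W (fun t => (T t).restrictScalars ℝ) G F ξ X) :
    IsMildSolution 𝓕 P W T G F ξ X :=
  ⟨h.memCF, h.eq⟩

theorem ae_timeMeasure_of_forall_restrict {p : ℝ≥0 → Prop}
    (h : ∀ n : ℕ, ∀ᵐ t ∂timeMeasure.restrict (Set.Icc 0 (n : ℝ≥0)), p t) :
    ∀ᵐ t ∂timeMeasure, p t := by
  have h1 := (ae_restrict_iUnion_iff (μ := timeMeasure) (fun n : ℕ => Set.Icc 0 (n : ℝ≥0)) p).2 h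
  have h2 : ⋃ n : ℕ, Set.Icc 0 (n : ℝ≥0) = Set.univ := Set.eq_univ_of_forall fun x => by
    obtain ⟨n, hn⟩ := exists_nat_ge x
    exact Set.mem_iUnion.2 ⟨n, Set.mem_Icc.2 ⟨zero_le, hn⟩⟩
  rwa [h2, Measure.restrict_univ] at h1

/-- The Laplace averages of the free output from `X t ω` converge for almost every `t`, almost
surely, and they differ from the Yosida approximations by a null term. -/
theorem IsObservationFactor.ae_mem_domain_restrict (hB : IsObservationFactor A C l B)
    (hR : IsResolventFamily T A R l M) (hadm : IsAdmissible T A C) (hA : IsGenerator T A)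
    (hT : IsC0Semigroup T) (hW : IsFBrownianMotion 𝓕 P W) (hG : LipschitzWith L G)
    (hF : LipschitzWith L F) {ξ : Ω → H} (hξ : MemL2Init 𝓕 P ξ) {X : ℝ≥0 → Ω → H}
    (hX : IsMildSolution 𝓕 P W T G F ξ X) (u : ℝ≥0) :
    ∀ᵐ t ∂timeMeasure.restrict (Set.Icc 0 u), ∀ᵐ ω ∂P, X t ω ∈ (yosidaExtension A C).domain := by
  have hTr := hT.restrictScalars
  obtain ⟨Z, hZ, hZs, -, hZv⟩ := exists_curve_of_init hW hTr hG hF hξ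
  have hXm := stronglyMeasurable_of_progressive hX.memCF.progressive
  have hSG := (lipschitzWith_superposition (P := P) hG).continuous.comp hZ.continuous
  have hSF := (lipschitzWith_superposition (P := P) hF).continuous.comp hZ.continuous
  have hK := hB.isObservationApprox hR hadm hA hT
  have hZl : IsLinearMild 𝓕 P W (fun t => (T t).restrictScalars ℝ) (hξ.2.toLp ξ)
    (fun s => superposition hG (Z s)) (fun s => superposition hF (Z s)) Z := hZs
  have h1 := hK.ae_tendsto_laplace (fun x => (continuous_freeOutput hT x).continuousOn) hW hTr
    hSG hSF hZ.continuous hZl hXm (hZv X hX.restrictScalars) u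
  -- The result along paths reads "almost surely, for almost every `t`"; measurability of the domain
  -- along `X` lets the quantifiers be exchanged.
  refine (Measure.ae_ae_comm (p := fun t ω => X t ω ∈ (yosidaExtension A C).domain)
    (hB.measurableSet_domain hR hXm)).2 ?_
  filter_upwards [h1] with ω h2
  filter_upwards [h2] with t ⟨v, hv⟩
  have h3 := (hR.tendsto_observer_sub (B := B) hT (X t ω)).add hv
  rw [zero_add] at h3
  refine ⟨v, h3.congr' ?_⟩
  filter_upwards [eventually_ge_atTop l] with r hr
  rw [sub_add_cancel, hB.yosidaApprox_eq hR hr]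

theorem IsObservationFactor.ae_timeProd_mem_domain (hB : IsObservationFactor A C l B)
    (hR : IsResolventFamily T A R l M) (hadm : IsAdmissible T A C) (hA : IsGenerator T A)
    (hT : IsC0Semigroup T) (hW : IsFBrownianMotion 𝓕 P W) (hG : LipschitzWith L G)
    (hF : LipschitzWith L F) {ξ : Ω → H} (hξ : MemL2Init 𝓕 P ξ) {X : ℝ≥0 → Ω → H}
    (hX : IsMildSolution 𝓕 P W T G F ξ X) (u : ℝ≥0) :
    ∀ᵐ p ∂timeProd P u, X p.1 p.2 ∈ (yosidaExtension A C).domain :=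
  (Measure.ae_prod_iff_ae_ae (hB.measurableSet_domain hR
    (stronglyMeasurable_of_progressive hX.memCF.progressive))).2
    (hB.ae_mem_domain_restrict hR hadm hA hT hW hG hF hξ hX u)

/-- Lipschitz dependence of the output on the initial state, in mean square. -/
theorem IsObservationFactor.exists_lintegral_output_bound (hB : IsObservationFactor A C l B)
    (hR : IsResolventFamily T A R l M) (hadm : IsAdmissible T A C) (hA : IsGenerator T A)
    (hT : IsC0Semigroup T) (hW : IsFBrownianMotion 𝓕 P W) (hG : LipschitzWith L G)
    (hF : LipschitzWith L F) (α : ℝ≥0) :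
    ∃ c : ℝ≥0, ∀ ξ η : Ω → H, MemL2Init 𝓕 P ξ → MemL2Init 𝓕 P η → ∀ x y,
      IsMildSolution 𝓕 P W T G F ξ x → IsMildSolution 𝓕 P W T G F η y →
      ∫⁻ p, ‖valueAt (yosidaExtension A C) (x p.1 p.2)
        - valueAt (yosidaExtension A C) (y p.1 p.2)‖ₑ ^ 2 ∂timeProd P α
        ≤ c * eLpNorm (ξ - η) 2 P ^ 2 := by
  have hTr := hT.restrictScalars
  obtain ⟨γ, hγ⟩ := (hB.isObservationApprox hR hadm hA hT).le α
  obtain ⟨c, hc⟩ := exists_lintegral_observe_bound (Y := Y) hW hTr hG hF α γ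
  refine ⟨c, fun ξ η hξ hη x y hx hy => ?_⟩
  have hxm := stronglyMeasurable_of_progressive hx.memCF.progressive
  have hym := stronglyMeasurable_of_progressive hy.memCF.progressive
  let K : ℕ → H →L[ℝ] Y := fun n => (observer B R l (l + n)).restrictScalars ℝ
  have hb : ∀ n, ∫⁻ p, ‖K n (x p.1 p.2 - y p.1 p.2)‖ₑ ^ 2 ∂timeProd P α
      ≤ c * eLpNorm (ξ - η) 2 P ^ 2 := fun n =>
    hc (K n) (hγ n) ξ η hξ hη x y hx.restrictScalars hy.restrictScalars
  have hm : ∀ n, Measurable fun p : ℝ≥0 × Ω => ‖K n (x p.1 p.2 - y p.1 p.2)‖ₑ ^ 2 := fun n =>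
    ((K n).continuous.comp_stronglyMeasurable (hxm.sub hym)).enorm.pow_const 2
  have hlim : Tendsto (fun n : ℕ => l + (n : ℝ)) atTop atTop :=
    tendsto_atTop_add_const_left _ _ tendsto_natCast_atTop_atTop
  -- Fatou's lemma: the bound is the same for all `K n`, and almost everywhere the observed
  -- differences converge to the difference of the outputs.
  refine le_trans (le_of_eq ?_) ((lintegral_liminf_le (u := atTop) hm).trans
    (liminf_le_of_frequently_le' (Frequently.of_forall hb)))
  refine lintegral_congr_ae ?_
  filter_upwards [hB.ae_timeProd_mem_domain hR hadm hA hT hW hG hF hξ hx α,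
    hB.ae_timeProd_mem_domain hR hadm hA hT hW hG hF hη hy α] with p h1 h2
  have t1 := (tendsto_valueAt_yosidaExtension h1).comp hlim
  have t2 := (tendsto_valueAt_yosidaExtension h2).comp hlim
  have t3 : Tendsto (fun n => ‖K n (x p.1 p.2 - y p.1 p.2)‖ₑ ^ 2) atTop
      (𝓝 (‖valueAt (yosidaExtension A C) (x p.1 p.2)
        - valueAt (yosidaExtension A C) (y p.1 p.2)‖ₑ ^ 2)) := by
    refine ((ENNReal.continuous_pow 2).tendsto _).comp ((t1.sub t2).enorm.congr fun n => ?_)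
    have hn : l ≤ l + n := by simp
    simp only [Function.comp_apply, K]
    rw [hB.yosidaApprox_eq hR hn, hB.yosidaApprox_eq hR hn, map_sub]
    rfl
  exact t3.liminf_eq.symm

end System

/-! ### Existence, output estimate and well-posedness of the system -/

section System

variable {Ω : Type*} {mΩ : MeasurableSpace Ω} {P : Measure Ω} [IsProbabilityMeasure P]
  {𝓕 : Filtration ℝ≥0 mΩ} {W : ℝ≥0 → Ω → ℝ}
  {𝕜 : Type*} [RCLike 𝕜]
  {H : Type*} [NormedAddCommGroup H] [InnerProductSpace 𝕜 H] [CompleteSpace H]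
  [InnerProductSpace ℝ H] [IsScalarTower ℝ 𝕜 H]
  {Y : Type*} [NormedAddCommGroup Y] [InnerProductSpace 𝕜 Y] [CompleteSpace Y]
  [InnerProductSpace ℝ Y] [IsScalarTower ℝ 𝕜 Y]
  {T : ℝ≥0 → H →L[𝕜] H} {A : H →ₗ.[𝕜] H} {R : ℝ → H →L[𝕜] H} {l M : ℝ}
  {C : A.domain →ₗ[𝕜] Y} {B : H →L[𝕜] Y} {G F : H → H} {L : ℝ≥0}

theorem exists_isMildSolution_unique (hT : IsC0Semigroup T) (hW : IsFBrownianMotion 𝓕 P W)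
    (hG : LipschitzWith L G) (hF : LipschitzWith L F) {ξ : Ω → H} (hξ : MemL2Init 𝓕 P ξ) :
    ∃ X, IsMildSolution 𝓕 P W T G F ξ X ∧
      ∀ X', IsMildSolution 𝓕 P W T G F ξ X' → ∀ t, X' t =ᵐ[P] X t := by
  obtain ⟨Z, -, -, ⟨X, hX⟩, hZ⟩ := exists_curve_of_init hW hT.restrictScalars hG hF hξ
  exact ⟨X, hX.of_restrictScalars, fun X' hX' t =>
    (hZ X' hX'.restrictScalars t).trans (hZ X hX t).symm⟩

theorem IsObservationFactor.isStronglyProgressive_valueAt (hB : IsObservationFactor A C l B)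
    (hR : IsResolventFamily T A R l M) {X : ℝ≥0 → Ω → H} (hX : IsStronglyProgressive 𝓕 X) :
    IsStronglyProgressive 𝓕 fun t ω => valueAt (yosidaExtension A C) (X t ω) := fun i =>
  hB.stronglyMeasurable_valueAt hR (hX i)

/-- The outputs of mild solutions in mean square. -/
theorem IsObservationFactor.exists_output_lipschitz (hB : IsObservationFactor A C l B)
    (hR : IsResolventFamily T A R l M) (hadm : IsAdmissible T A C) (hA : IsGenerator T A)
    (hT : IsC0Semigroup T) (hW : IsFBrownianMotion 𝓕 P W) (hG : LipschitzWith L G)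
    (hF : LipschitzWith L F) (α : ℝ≥0) :
    ∃ δ : ℝ≥0, 0 < δ ∧ ∀ ξ₁ ξ₂ : Ω → H, MemL2Init 𝓕 P ξ₁ → MemL2Init 𝓕 P ξ₂ →
      ∀ X₁ X₂, IsMildSolution 𝓕 P W T G F ξ₁ X₁ → IsMildSolution 𝓕 P W T G F ξ₂ X₂ →
        MemL2F 𝓕 P α (fun t ω => valueAt (yosidaExtension A C) (X₁ t ω) -
            valueAt (yosidaExtension A C) (X₂ t ω)) ∧
        normL2F P α (fun t ω => valueAt (yosidaExtension A C) (X₁ t ω) -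
            valueAt (yosidaExtension A C) (X₂ t ω))
          ≤ (δ : ℝ≥0∞) * eLpNorm (fun ω => ξ₁ ω - ξ₂ ω) 2 P := by
  obtain ⟨c, hc⟩ := hB.exists_lintegral_output_bound hR hadm hA hT hW hG hF α
  refine ⟨c + 1, by positivity, fun ξ₁ ξ₂ h₁ h₂ X₁ X₂ hX₁ hX₂ => ?_⟩
  have hprog := (hB.isStronglyProgressive_valueAt hR hX₁.memCF.progressive).sub
    (hB.isStronglyProgressive_valueAt hR hX₂.memCF.progressive)
  have hbound : normL2F P α (fun t ω => valueAt (yosidaExtension A C) (X₁ t ω) -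
      valueAt (yosidaExtension A C) (X₂ t ω))
      ≤ ((c + 1 : ℝ≥0) : ℝ≥0∞) * eLpNorm (ξ₁ - ξ₂) 2 P := by
    rw [← sq_le_sq_ennreal, mul_pow, normL2F, eLpNorm_two_sq]
    refine (hc ξ₁ ξ₂ h₁ h₂ X₁ X₂ hX₁ hX₂).trans (mul_le_mul_left ?_ _)
    -- The bound at hand is for squares; `c + 1` is positive and `c ≤ (c + 1)²`, which avoids a
    -- square root.
    have h1 : c ≤ (c + 1) ^ 2 := (le_add_of_nonneg_right zero_le_one).trans
      (le_self_pow₀ (le_add_of_nonneg_left zero_le) two_ne_zero)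
    exact_mod_cast h1
  have hm := (hB.stronglyMeasurable_valueAt (C := C) hR
    (stronglyMeasurable_of_progressive hX₁.memCF.progressive)).sub
    (hB.stronglyMeasurable_valueAt (C := C) hR
      (stronglyMeasurable_of_progressive hX₂.memCF.progressive))
  refine ⟨⟨hprog, hm.aestronglyMeasurable, hbound.trans_lt ?_⟩, hbound⟩
  exact ENNReal.mul_lt_top ENNReal.coe_lt_top (h₁.2.sub h₂.2).2

/-- The extension is the Yosida extension itself. Almost everywhere both solutions lie in its
domain, so its value at the difference is the difference of its values and the output estimate
applies. -/
theorem IsObservationFactor.isWellPosed (hB : IsObservationFactor A C l B)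
    (hR : IsResolventFamily T A R l M) (hadm : IsAdmissible T A C) (hA : IsGenerator T A)
    (hT : IsC0Semigroup T) (hW : IsFBrownianMotion 𝓕 P W) (hG : LipschitzWith L G)
    (hF : LipschitzWith L F) : IsWellPosed 𝓕 P W T A C G F := by
  refine ⟨yosidaExtension A C, hB.le_yosidaExtension hR hA hT, fun ξ hξ X hX =>
    ae_timeMeasure_of_forall_restrict fun n =>
      hB.ae_mem_domain_restrict hR hadm hA hT hW hG hF hξ hX n, fun α _ => ?_⟩
  obtain ⟨δ, hδ, hb⟩ := hB.exists_output_lipschitz hR hadm hA hT hW hG hF (P := P) α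
  refine ⟨δ, hδ, fun ξ₁ ξ₂ h₁ h₂ X₁ X₂ hX₁ hX₂ => ?_⟩
  obtain ⟨⟨-, hmem⟩, hle⟩ := hb ξ₁ ξ₂ h₁ h₂ X₁ X₂ hX₁ hX₂
  have hae : (fun p : ℝ≥0 × Ω => valueAt (yosidaExtension A C) (X₁ p.1 p.2)
      - valueAt (yosidaExtension A C) (X₂ p.1 p.2)) =ᵐ[timeProd P α]
      fun p => valueAt (yosidaExtension A C) (X₁ p.1 p.2 - X₂ p.1 p.2) := by
    filter_upwards [hB.ae_timeProd_mem_domain hR hadm hA hT hW hG hF h₁ hX₁ α,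
      hB.ae_timeProd_mem_domain hR hadm hA hT hW hG hF h₂ hX₂ α] with p m1 m2
    rw [valueAt_sub m1 m2]
  refine ⟨⟨hB.isStronglyProgressive_valueAt hR
    (hX₁.memCF.progressive.sub hX₂.memCF.progressive), hmem.ae_eq hae⟩, ?_⟩
  rw [← mul_pow, sq_le_sq_ennreal]
  refine le_of_eq_of_le ?_ hle
  exact (eLpNorm_congr_ae hae).symm

end System

theorem exists_lipschitzWith {H : Type*} [NormedAddCommGroup H] {G F : H → H} {L : ℝ}
    (h : ∀ x y, ‖G x - G y‖ + ‖F x - F y‖ ≤ L * ‖x - y‖) :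
    LipschitzWith L.toNNReal G ∧ LipschitzWith L.toNNReal F := by
  have h1 : ∀ x y : H, L * ‖x - y‖ ≤ L.toNNReal * ‖x - y‖ := fun x y =>
    mul_le_mul_of_nonneg_right (Real.le_coe_toNNReal L) (norm_nonneg _)
  refine ⟨LipschitzWith.of_dist_le_mul fun x y => ?_, LipschitzWith.of_dist_le_mul fun x y => ?_⟩
  all_goals
    rw [dist_eq_norm, dist_eq_norm]
    have h2 := h x y
    have h3 := h1 x y
    have h4 := norm_nonneg (G x - G y)
    have h5 := norm_nonneg (F x - F y)
    linarith

theorem isScalarTower_rclikeToReal (𝕜 Y : Type*) [RCLike 𝕜] [NormedAddCommGroup Y]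
    [InnerProductSpace 𝕜 Y] :
    letI := InnerProductSpace.rclikeToReal 𝕜 Y
    IsScalarTower ℝ 𝕜 Y := by
  letI := InnerProductSpace.rclikeToReal 𝕜 Y
  refine ⟨fun r c y => ?_⟩
  change (r • c) • y = (r : 𝕜) • c • y
  rw [smul_smul, RCLike.real_smul_eq_coe_mul]

end StochSys

theorem theorem5p2 {Ω : Type*} {mΩ : MeasurableSpace Ω} (P : Measure Ω) [IsProbabilityMeasure P]
    (𝓕 : Filtration ℝ≥0 mΩ) (W : ℝ≥0 → Ω → ℝ) (hW : StochSys.IsFBrownianMotion 𝓕 P W)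
    {𝕜 : Type*} [RCLike 𝕜]
    {H : Type*} [NormedAddCommGroup H] [InnerProductSpace 𝕜 H] [CompleteSpace H]
    [InnerProductSpace ℝ H] [IsScalarTower ℝ 𝕜 H]
    {Y : Type*} [NormedAddCommGroup Y] [InnerProductSpace 𝕜 Y] [CompleteSpace Y]
    (T : ℝ≥0 → H →L[𝕜] H) (hT : StochSys.IsC0Semigroup T)
    (A : H →ₗ.[𝕜] H) (hA : StochSys.IsGenerator T A)
    (C : A.domain →ₗ[𝕜] Y) (hC : StochSys.IsGraphBounded A C)
    (hadm : StochSys.IsAdmissible T A C)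
    (G F : H → H) (L : ℝ) (hGF : ∀ x y, ‖G x - G y‖ + ‖F x - F y‖ ≤ L * ‖x - y‖) :
    -- existence and uniqueness of the mild solution `X(·; ξ)`
    (∀ ξ : Ω → H, StochSys.MemL2Init 𝓕 P ξ →
      ∃ X, StochSys.IsMildSolution 𝓕 P W T G F ξ X ∧
        ∀ X', StochSys.IsMildSolution 𝓕 P W T G F ξ X' → ∀ t, X' t =ᵐ[P] X t) ∧
    -- `X(t; ξ) ∈ D(C_Λ)` for a.e. `t > 0`, almost surely
    (∀ ξ : Ω → H, StochSys.MemL2Init 𝓕 P ξ →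
      ∀ X, StochSys.IsMildSolution 𝓕 P W T G F ξ X →
        ∀ᵐ t ∂StochSys.timeMeasure, ∀ᵐ ω ∂P, X t ω ∈ (StochSys.yosidaExtension A C).domain) ∧
    -- Lipschitz dependence of the output on the initial state
    (∀ α : ℝ≥0, 0 < α → ∃ δ : ℝ≥0, 0 < δ ∧
      ∀ ξ₁ ξ₂ : Ω → H, StochSys.MemL2Init 𝓕 P ξ₁ → StochSys.MemL2Init 𝓕 P ξ₂ →
      ∀ X₁ X₂, StochSys.IsMildSolution 𝓕 P W T G F ξ₁ X₁ →
        StochSys.IsMildSolution 𝓕 P W T G F ξ₂ X₂ →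
        StochSys.MemL2F 𝓕 P α (fun t ω =>
          StochSys.valueAt (StochSys.yosidaExtension A C) (X₁ t ω) -
            StochSys.valueAt (StochSys.yosidaExtension A C) (X₂ t ω)) ∧
        StochSys.normL2F P α (fun t ω =>
          StochSys.valueAt (StochSys.yosidaExtension A C) (X₁ t ω) -
            StochSys.valueAt (StochSys.yosidaExtension A C) (X₂ t ω))
          ≤ (δ : ℝ≥0∞) * eLpNorm (fun ω => ξ₁ ω - ξ₂ ω) 2 P) ∧
    -- in particular, the system is well-posed
    StochSys.IsWellPosed 𝓕 P W T A C G F := by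
  -- The `L²` estimates use real scalars and a real inner product. On `Y` this structure is obtained
  -- from `𝕜` by restriction of scalars.
  letI := InnerProductSpace.rclikeToReal 𝕜 Y
  have := StochSys.isScalarTower_rclikeToReal 𝕜 Y
  obtain ⟨hG, hF⟩ := StochSys.exists_lipschitzWith hGF
  obtain ⟨R, l, M, hR⟩ := StochSys.exists_isResolventFamily hT hA
  obtain ⟨B, hB⟩ := hR.exists_observationFactor hC
  exact ⟨fun ξ hξ => StochSys.exists_isMildSolution_unique hT hW hG hF hξ,
    fun ξ hξ X hX => StochSys.ae_timeMeasure_of_forall_restrict fun n =>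
      hB.ae_mem_domain_restrict hR hadm hA hT hW hG hF hξ hX n,
    fun α _ => hB.exists_output_lipschitz hR hadm hA hT hW hG hF α,
    hB.isWellPosed hR hadm hA hT hW hG hF⟩
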